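/- **Conventions.** Rings are commutative and unital. $W_n(A)$ is the ring of $2$-typical Witt vectors of length $n$, with restriction $R$, Frobenius $F$, Verschiebung $V$ and multiplicative representative $[a]_n=(a,0,\dots,0)$. A *$2$-typical Witt complex* over $A$ consists of $\mathbb Z$-graded rings $E_n^*$ ($n\in\mathbb Z$, $E_n^*=0$ for $n\le 0$) with $xy=(-1)^{|x||y|}yx$; graded ring maps $R,F:E_n^*\to E_{n-1}^*$; ring maps $\lambda:W_n(A)\to E_n^0$; graded additive maps $V:E_n^*\to E_{n+1}^*$; and additive maps $d:E_n^*\to E_n^{*+1}$. All of these commute with $R$; $\lambda F=F\lambda$, $\lambda V=V\lambda$, $V(x)y=V(xF(y))$, $FV=2$, $d(xy)=d(x)y+(-1)^{|x|}xd(y)$, and, with $\iota$ denoting multiplication by $d\lambda[-1]_n/\lambda[-1]_n$, $FdV=d+\iota$, $dd=d\iota=\iota d$, $Fd\lambda[a]_n=\lambda[a]_{n-1}\,d\lambda[a]_{n-1}$ for all $a\in A$. Maps of Witt complexes are the maps of pro-graded rings that commute with $\lambda,d,F,V$. This is the category $\mathcal W_A$; its initial object is the de Rham–Witt complex $W_\bullet\Omega^*_A$.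 **Definition of $P$.** Let $A$ be a $\mathbb Z_{(2)}$-algebra and $E\in\mathcal W_A$; odd integers are then invertible in $E_n$. $P(E)_n^q$ is the group of finite formal sums of elements of four types: (1) $a[X]^j$, $a\in E_n^q$, $j\ge0$; (2) $b[X]^{k-1}d[X]$, $b\in E_n^{q-1}$, $k\ge1$; (3) $V^r(c[X]^l)$, $r>0$, $l\geq 1$ odd, $c\in E_{n-r}^q$; (4) $dV^s(e[X]^m)$, $s>0$, $m\geq 1$ odd, $e\in E_{n-s}^{q-1}$. Each element is additive in its coefficient, and the formal sums are the direct sum over all types and exponents. Below $|a|$ is the degree of $a$, and write $\delta=d+\iota$. The product is graded commutative and given by - $a[X]^j\cdot a'[X]^{j'}=aa'[X]^{j+j'}$, and $a[X]^j\cdot b[X]^{k-1}d[X]=ab[X]^{j+k-1}d[X]$. - $a[X]^j\cdot V^r(c[X]^l)=V^r(F^r(a)c[X]^{2^rj+l})$. - With $M=2^sj+m$: $a[X]^j\cdot dV^s(e[X]^m)=(-1)^{|a|}\frac mM dV^s(F^s(a)e[X]^M)-(-1)^{|a|}V^s\big((F^s(da)e-\frac jM d(F^s(a)e))[X]^M\big)$.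 - $b[X]^{k-1}d[X]\cdot b'[X]^{k'-1}d[X]=\iota(bb')[X]^{k+k'-1}d[X]$. - With $M=2^rk+l$: $b[X]^{k-1}d[X]\cdot V^r(c[X]^l)=-(-1)^{|b|}\frac1M V^r(d(F^r(b)c)[X]^M)+(-1)^{|b|}\frac{2^r}M dV^r(F^r(b)c[X]^M)$. - With $M=2^sk+m$: $b[X]^{k-1}d[X]\cdot dV^s(e[X]^m)=-(-1)^{|b|}\frac1M V^s(F^s(db+k\iota b)\,de[X]^M)+(-1)^{|b|}\frac1M dV^s(F^s(b)\,de[X]^M)$. - $V^r(c[X]^l)\cdot V^{r'}(c'[X]^{l'})$ equals - $2^{r'}V^r(cF^{r-r'}(c')[X]^{2^{r-r'}l'+l})$ if $r>r'$; - $2^rV^{r-v}(V^v(cc')[X]^{2^{-v}(l+l')})$ if $r=r'$ and $v=v_2(l+l')<r$; - $2^rV^r(cc')[X]^{2^{-r}(l+l')}$ if $r=r'$ and $v_2(l+l')\ge r$. - $V^r(c[X]^l)\cdot dV^s(e[X]^m)$ equals - if $r<s$, with $t=s-r$, $M=2^tl+m$: $(-1)^{|c|}\frac{2^rm}M dV^s(F^t(c)e[X]^M)-(-1)^{|c|}V^s\big((F^t(\delta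 c)e-\frac lM d(F^t(c)e))[X]^M\big)$; - if $r=s$, $v=v_2(l+m)<r$, $l+m=2^vN$: $V^{r-v}(V^v(c\,\delta e)[X]^N)+(-1)^{|c|}\frac{2^{r-v}m}N dV^{r-v}(V^v(ce)[X]^N)-(-1)^{|c|}\frac mN V^{r-v}(dV^v(ce)[X]^N)$; - if $r=s$, $v_2(l+m)\ge r$, $l+m=2^rN$: $V^r(c\,\delta e)[X]^N+(-1)^{|e|}mV^r(ce)[X]^{N-1}d[X]$; - if $r>s$, with $t=r-s$, $M=2^tm+l$: $V^r(cF^t(\delta e)[X]^M)+(-1)^{|c|}\frac{2^rm}M dV^r(cF^t(e)[X]^M)-(-1)^{|c|}\frac mM V^r(d(cF^t(e))[X]^M)$. - $dV^s(e[X]^m)\cdot dV^{s'}(e'[X]^{m'})$ equals - if $s<s'$, with $t=s'-s$, $M=2^tm+m'$: $-(-1)^{|e|}dV^{s'}\big((F^t(\delta e)e'-\frac mM d(F^t(e)e'))[X]^M\big)+V^{s'}\big(\iota(F^t(de)e'+F^t(e)de')[X]^M\big)$; - if $s=s'$, $v=v_2(m+m')<s$, $m+m'=2^vN$: $V^{s-v}\big(\iota(V^v(e\,de')+dV^v(ee'))[X]^N\big)+dV^{s-v}\big((V^v(e\,\delta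 e')-(-1)^{|e|}\frac{m'}N dV^v(ee'))[X]^N\big)$; - if $s=s'$, $v_2(m+m')\ge s$, $m+m'=2^sN$: $\big(\iota V^s(e\,de')+dV^s(e\,\delta e')\big)[X]^N+\big(\iota V^s(ee')+(-1)^{|e'|}m'dV^s(ee')-(-1)^{|e|+|e'|}N V^s(e\,de')\big)[X]^{N-1}d[X]$. The operators: $R$ and $\iota$ act on the coefficients; $\lambda(w[X]^j)=\lambda(w)[X]^j$ and $\lambda(V^r(w[X]^l))=V^r(\lambda(w)[X]^l)$ for Witt vectors $w$ over $A$; - $V(a[X]^j)$ is $V^1(a[X]^j)$ for $j$ odd and $V(a)[X]^{j/2}$ for $j$ even; $V(b[X]^{k-1}d[X])$ is $-(-1)^{|b|}\frac1kV((db)[X]^k)+(-1)^{|b|}\frac2k dV(b[X]^k)$ for $k$ odd and $V(b)[X]^{k/2-1}d[X]$ for $k$ even; $V(V^r(c[X]^l))=V^{r+1}(c[X]^l)$; $V(dV^s(e[X]^m))=2dV^{s+1}(e[X]^m)$. - $F(a[X]^j)=F(a)[X]^{2j}$; $F(b[X]^{k-1}d[X])=F(b)[X]^{2k-1}d[X]$;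 $F(V^r(c[X]^l))=2V^{r-1}(c[X]^l)$; $F(dV^s(e[X]^m))=dV^{s-1}(e[X]^m)+V^{s-1}(\iota(e)[X]^m)$, where $V^0(y)=y$ and $dV^0(e[X]^m)=d(e[X]^m)$. - $d(a[X]^j)=d(a)[X]^j+(-1)^{|a|}ja[X]^{j-1}d[X]$; $d(b[X]^{k-1}d[X])=(db+k\iota b)[X]^{k-1}d[X]$; $d(V^r(c[X]^l))=dV^r(c[X]^l)$; $d(dV^s(e[X]^m))=dV^s(\iota(e)[X]^m)$. On a morphism $\theta$, $P(\theta)$ applies $\theta$ to all coefficients. **Theorem.** Let $A$ be a $\mathbb Z_{(2)}$-algebra. With these formulas $P$ is a well-defined functor $\mathcal W_A\to\mathcal W_{A[X]}$: each $P(E)$ is a Witt complex over $A[X]$ and each $P(\theta)$ is a map of Witt complexes. $P$ is left adjoint to the forgetful functor $U:\mathcal W_{A[X]}\to\mathcal W_A$ (restriction of $\lambda$ along $W_\bullet(A)\to W_\bullet(A[X])$), with unit $E\to U(P(E))$, $a\mapsto a[X]^0$. In particular $P$ carries an initial object of $\mathcal W_A$ to an initial object of $\mathcal W_{A[X]}$,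 that is, $P(W_\bullet\Omega^*_A)\cong W_\bullet\Omega^*_{A[X]}$. -/

import Mathlib

open CategoryTheory Polynomial DirectSum

universe u v

/-! ## Truncated 2-typical Witt vectors -/

instance isPrime_span_two : (Ideal.span {(2 : ℤ)}).IsPrime :=
  (Ideal.span_singleton_prime (by norm_num)).2 Int.prime_two

/-- The ring `ℤ_(2)` of rational numbers with odd denominator. -/
abbrev ZLocTwo : Type := Localization.AtPrime (Ideal.span {(2 : ℤ)})

/-- `W_n(A)`, the ring of 2-typical Witt vectors of length `n`. -/
abbrev WittLen (n : ℕ) (A : Type u) : Type u := TruncatedWittVector 2 n A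

namespace WittLen

variable {A : Type u} [CommRing A] {B : Type u} [CommRing B]

/-- The projection `W(A) → W_n(A)`. -/
noncomputable def proj (n : ℕ) : WittVector 2 A →+* WittLen n A := WittVector.truncate n

theorem proj_out {n : ℕ} (x : WittLen n A) :
    proj n (TruncatedWittVector.out x) = x := TruncatedWittVector.truncateFun_out x

theorem proj_surjective (n : ℕ) : Function.Surjective (proj (A := A) n) :=
  WittVector.truncate_surjective 2 n A

theorem proj_eq_iff {n : ℕ} (x y : WittVector 2 A) :
    proj n x = proj n y ↔ ∀ i < n, (x - y).coeff i = 0 := by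
  rw [← sub_eq_zero, ← map_sub]
  exact WittVector.mem_ker_truncate n (x - y)

/-- The restriction `R : W_{n+1}(A) → W_n(A)`. -/
noncomputable def R {n : ℕ} : WittLen (n + 1) A →+* WittLen n A :=
  TruncatedWittVector.truncate (Nat.le_succ n)

theorem R_proj {n : ℕ} (x : WittVector 2 A) : R (proj (n + 1) x) = proj n x :=
  TruncatedWittVector.truncate_wittVector_truncate (Nat.le_succ n) x

/-- The Frobenius `F : W_{n+1}(A) → W_n(A)`, induced by the Frobenius of `W(A)`
(see `F_proj`). -/
noncomputable def F {n : ℕ} (x : WittLen (n + 1) A) : WittLen n A :=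
  proj n (WittVector.frobenius (TruncatedWittVector.out x))

/-- The Verschiebung `V : W_n(A) → W_{n+1}(A)`, `(a_0, …, a_{n-1}) ↦ (0, a_0, …, a_{n-1})`,
induced by the Verschiebung of `W(A)` (see `V_proj`). -/
noncomputable def V {n : ℕ} (x : WittLen n A) : WittLen (n + 1) A :=
  proj (n + 1) (WittVector.verschiebung (TruncatedWittVector.out x))

theorem F_proj {n : ℕ} (x : WittVector 2 A) :
    F (proj (n + 1) x) = proj n (WittVector.frobenius x) := by
  have h : proj (n + 1) (TruncatedWittVector.out (proj (n + 1) x)) = proj (n + 1) x :=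
    proj_out _
  rw [proj_eq_iff] at h
  unfold F
  rw [← sub_eq_zero, ← map_sub, ← map_sub]
  set z := TruncatedWittVector.out (proj (n + 1) x) - x
  have hz := WittVector.eq_iterate_verschiebung (x := z) (n := n + 1) h
  rw [hz, Function.iterate_succ_apply', WittVector.frobenius_verschiebung, map_mul]
  have h0 : proj n (WittVector.verschiebung^[n] (WittVector.shift z (n + 1))) = 0 := by
    refine (WittVector.mem_ker_truncate (p := 2) n _).2 fun i hi => ?_
    exact WittVector.iterate_verschiebung_coeff_eq_zero _ hi
  rw [h0, zero_mul]

theorem V_proj {n : ℕ} (x : WittVector 2 A) :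
    V (proj n x) = proj (n + 1) (WittVector.verschiebung x) := by
  have h : proj n (TruncatedWittVector.out (proj n x)) = proj n x := proj_out _
  rw [proj_eq_iff] at h
  unfold V
  rw [proj_eq_iff, ← map_sub]
  intro i hi
  cases i with
  | zero => exact WittVector.verschiebung_coeff_zero _
  | succ i =>
    rw [WittVector.verschiebung_coeff_succ]
    exact h i (by omega)

/-- The multiplicative representative `[a]_n = (a, 0, …, 0)`. -/
noncomputable def teich (n : ℕ) (a : A) : WittLen n A := proj n (WittVector.teichmuller 2 a)

/-- The map `W_n(A) → W_n(B)` induced by a ring homomorphism `A → B`. -/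
noncomputable def map (φ : A →+* B) {n : ℕ} : WittLen n A →+* WittLen n B :=
  (proj (A := A) n).liftOfRightInverse TruncatedWittVector.out proj_out
    ⟨(proj n).comp (WittVector.map φ), fun x hx => by
      have hx' := (WittVector.mem_ker_truncate n x).1 hx
      refine (WittVector.mem_ker_truncate n (WittVector.map φ x)).2 fun i hi => ?_
      rw [WittVector.map_coeff, hx' i hi, map_zero]⟩

theorem map_proj (φ : A →+* B) {n : ℕ} (x : WittVector 2 A) :
    map φ (proj n x) = proj n (WittVector.map φ x) :=
  (proj (A := A) n).liftOfRightInverse_comp_apply _ _ _ x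

theorem map_teich (φ : A →+* B) {n : ℕ} (a : A) : map φ (teich n a) = teich n (φ a) := by
  rw [teich, map_proj, WittVector.map_teichmuller, teich]

theorem map_R (φ : A →+* B) {n : ℕ} (x : WittLen (n + 1) A) : map φ (R x) = R (map φ x) := by
  obtain ⟨w, rfl⟩ := proj_surjective _ x
  rw [R_proj, map_proj, map_proj, R_proj]

theorem map_F (φ : A →+* B) {n : ℕ} (x : WittLen (n + 1) A) : map φ (F x) = F (map φ x) := by
  obtain ⟨w, rfl⟩ := proj_surjective _ x
  rw [F_proj, map_proj, map_proj, F_proj,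
    (WittVector.frobenius_isPoly 2).map φ w]

theorem map_V (φ : A →+* B) {n : ℕ} (x : WittLen n A) : map φ (V x) = V (map φ x) := by
  obtain ⟨w, rfl⟩ := proj_surjective _ x
  rw [V_proj, map_proj, map_proj, V_proj, WittVector.map_verschiebung]

end WittLen

/-! ## 2-typical Witt complexes -/

/-- The data underlying a 2-typical Witt complex over `A`.  `carrier n` is the total ring
`⨁_q E_n^q` of level `n`, and `deg n q` is its subgroup `E_n^q`.  Levels are indexed by `ℕ`;
those `≤ 0` are zero. -/
structure PreWittComplex (A : Type u) [CommRing A] where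
  carrier : ℕ → Type v
  [ring : ∀ n, Ring (carrier n)]
  deg : ∀ n, ℤ → AddSubgroup (carrier n)
  R : ∀ {n}, carrier (n + 1) →+* carrier n
  lam : ∀ {n}, WittLen n A →+* carrier n
  F : ∀ {n}, carrier (n + 1) →+* carrier n
  V : ∀ {n}, carrier n →+ carrier (n + 1)
  d : ∀ {n}, carrier n →+ carrier n

attribute [instance] PreWittComplex.ring

namespace PreWittComplex

variable {A : Type u} [CommRing A] (E : PreWittComplex.{u, v} A)

/-- The element `dλ[-1]_n / λ[-1]_n`. -/
noncomputable def eta (n : ℕ) : E.carrier n :=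
  Ring.inverse (E.lam (WittLen.teich n (-1))) * E.d (E.lam (WittLen.teich n (-1)))

/-- The operator `ι`, multiplication by `dλ[-1]_n / λ[-1]_n`. -/
noncomputable def iota {n : ℕ} (x : E.carrier n) : E.carrier n := E.eta n * x

/-- `F^r : E_n → E_i`, where `i + r = n`. -/
def Fpow : ∀ (r : ℕ) {i n : ℕ}, i + r = n → (E.carrier n →+* E.carrier i)
  | 0, _, _, rfl => RingHom.id _
  | r + 1, _, _, rfl => (Fpow r rfl).comp E.F

/-- `V^r : E_i → E_n`, where `i + r = n`. -/
def Vpow : ∀ (r : ℕ) {i n : ℕ}, i + r = n → (E.carrier i →+ E.carrier n)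
  | 0, _, _, rfl => AddMonoidHom.id _
  | r + 1, _, _, rfl => E.V.comp (Vpow r rfl)

/-- The scalar `a / b` in level `n`; it is only used for odd `b`, which is invertible in `E_n`
when `A` is a `ℤ_(2)`-algebra. -/
noncomputable def frac {n : ℕ} (a b : ℕ) : E.carrier n :=
  (a : E.carrier n) * Ring.inverse (b : E.carrier n)

end PreWittComplex

/-- A 2-typical Witt complex over `A`. -/
structure WittComplex (A : Type u) [CommRing A] extends PreWittComplex.{u, v} A where
  /-- Levels `≤ 0` vanish. -/
  level_zero : Subsingleton (carrier 0)
  /-- Each level is a graded-commutative graded ring. -/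
  isInternal : ∀ n, DirectSum.IsInternal (deg n)
  one_mem : ∀ n, (1 : carrier n) ∈ deg n 0
  mul_mem : ∀ {n p q} {x y : carrier n}, x ∈ deg n p → y ∈ deg n q → x * y ∈ deg n (p + q)
  mul_comm : ∀ {n p q} {x y : carrier n}, x ∈ deg n p → y ∈ deg n q →
    x * y = (p * q).negOnePow • (y * x)
  R_mem : ∀ {n q} {x : carrier (n + 1)}, x ∈ deg (n + 1) q → R x ∈ deg n q
  /-- `λ` is a strict map of pro-rings into degree `0`. -/
  lam_mem : ∀ {n} (w : WittLen n A), lam w ∈ deg n 0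
  R_lam : ∀ {n} (w : WittLen (n + 1) A), R (lam w) = lam (WittLen.R w)
  /-- `F` is a strict map of pro-graded rings compatible with `λ`. -/
  F_mem : ∀ {n q} {x : carrier (n + 1)}, x ∈ deg (n + 1) q → F x ∈ deg n q
  R_F : ∀ {n} (x : carrier (n + 1 + 1)), R (F x) = F (R x)
  lam_F : ∀ {n} (w : WittLen (n + 1) A), lam (WittLen.F w) = F (lam w)
  /-- `V` is a strict map of pro-graded modules compatible with `λ`, and `FV = 2`. -/
  V_mem : ∀ {n q} {x : carrier n}, x ∈ deg n q → V x ∈ deg (n + 1) q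
  R_V : ∀ {n} (x : carrier (n + 1)), R (V x) = V (R x)
  lam_V : ∀ {n} (w : WittLen n A), lam (WittLen.V w) = V (lam w)
  V_mul : ∀ {n} (x : carrier n) (y : carrier (n + 1)), V x * y = V (x * F y)
  F_V : ∀ {n} (x : carrier n), F (V x) = 2 * x
  /-- `d` is a strict map of pro-graded groups of degree one, and a derivation. -/
  d_mem : ∀ {n q} {x : carrier n}, x ∈ deg n q → d x ∈ deg n (q + 1)
  R_d : ∀ {n} (x : carrier (n + 1)), R (d x) = d (R x)
  d_mul : ∀ {n p} {x : carrier n} (y : carrier n), x ∈ deg n p →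
    d (x * y) = d x * y + p.negOnePow • (x * d y)
  /-- The remaining relations. -/
  F_d_V : ∀ {n} (x : carrier n), F (d (V x)) = d x + toPreWittComplex.iota x
  d_d : ∀ {n} (x : carrier n), d (d x) = d (toPreWittComplex.iota x)
  d_iota : ∀ {n} (x : carrier n), d (toPreWittComplex.iota x) = toPreWittComplex.iota (d x)
  F_d_lam : ∀ {n} (a : A),
    F (d (lam (WittLen.teich (n + 1) a))) =
      lam (WittLen.teich n a) * d (lam (WittLen.teich n a))

namespace WittComplex

variable {A : Type u} [CommRing A]

/-- Maps of 2-typical Witt complexes over `A`. -/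
@[ext]
structure Hom (E E' : WittComplex.{u, v} A) where
  toFun : ∀ n, E.carrier n →+* E'.carrier n
  map_deg : ∀ {n q} {x : E.carrier n}, x ∈ E.deg n q → toFun n x ∈ E'.deg n q
  map_R : ∀ {n} (x : E.carrier (n + 1)), toFun n (E.R x) = E'.R (toFun (n + 1) x)
  map_lam : ∀ {n} (w : WittLen n A), toFun n (E.lam w) = E'.lam w
  map_d : ∀ {n} (x : E.carrier n), toFun n (E.d x) = E'.d (toFun n x)
  map_F : ∀ {n} (x : E.carrier (n + 1)), toFun n (E.F x) = E'.F (toFun (n + 1) x)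
  map_V : ∀ {n} (x : E.carrier n), toFun (n + 1) (E.V x) = E'.V (toFun n x)

/-- The category of 2-typical Witt complexes over `A`. -/
instance : Category (WittComplex.{u, v} A) where
  Hom := Hom
  id E :=
    { toFun := fun _ => RingHom.id _
      map_deg := fun h => h
      map_R := fun _ => rfl
      map_lam := fun _ => rfl
      map_d := fun _ => rfl
      map_F := fun _ => rfl
      map_V := fun _ => rfl }
  comp f g :=
    { toFun := fun n => (g.toFun n).comp (f.toFun n)
      map_deg := fun h => g.map_deg (f.map_deg h)
      map_R := fun x => by simp [f.map_R, g.map_R]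
      map_lam := fun x => by simp [f.map_lam, g.map_lam]
      map_d := fun x => by simp [f.map_d, g.map_d]
      map_F := fun x => by simp [f.map_F, g.map_F]
      map_V := fun x => by simp [f.map_V, g.map_V] }

/-- The ring homomorphism in level `n` of a map of Witt complexes. -/
def app {E E' : WittComplex.{u, v} A} (f : E ⟶ E') (n : ℕ) : E.carrier n →+* E'.carrier n :=
  Hom.toFun f n

/-- Restriction of the base ring of a Witt complex along a ring homomorphism `φ : A → B`:
only `λ` changes, to `W_n(A) → W_n(B) → E_n^0`. -/
noncomputable def restrict {B : Type u} [CommRing B] (φ : A →+* B)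
    (E : WittComplex.{u, v} B) : WittComplex.{u, v} A :=
  let pre : PreWittComplex.{u, v} A :=
    { carrier := E.carrier
      deg := E.deg
      R := E.R
      lam := E.lam.comp (WittLen.map φ)
      F := E.F
      V := E.V
      d := E.d }
  have hiota : ∀ {n} (x : E.carrier n), pre.iota x = E.iota x := fun {n} x => by
    have h : pre.lam (WittLen.teich n (-1 : A)) = E.lam (WittLen.teich n (-1 : B)) := by
      change E.lam (WittLen.map φ _) = _
      rw [WittLen.map_teich, map_neg, map_one]
    change Ring.inverse (pre.lam (WittLen.teich n (-1 : A))) *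
      E.d (pre.lam (WittLen.teich n (-1 : A))) * x = _
    rw [h]
    rfl
  { pre with
    level_zero := E.level_zero
    isInternal := E.isInternal
    one_mem := E.one_mem
    mul_mem := E.mul_mem
    mul_comm := E.mul_comm
    R_mem := E.R_mem
    lam_mem := fun w => E.lam_mem _
    R_lam := fun w => by
      change E.R (E.lam (WittLen.map φ w)) = E.lam (WittLen.map φ _)
      rw [E.R_lam, WittLen.map_R]
    F_mem := E.F_mem
    R_F := E.R_F
    lam_F := fun w => by
      change E.lam (WittLen.map φ _) = E.F (E.lam (WittLen.map φ w))
      rw [WittLen.map_F, E.lam_F]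
    V_mem := E.V_mem
    R_V := E.R_V
    lam_V := fun w => by
      change E.lam (WittLen.map φ _) = E.V (E.lam (WittLen.map φ w))
      rw [WittLen.map_V, E.lam_V]
    V_mul := E.V_mul
    F_V := E.F_V
    d_mem := E.d_mem
    R_d := E.R_d
    d_mul := E.d_mul
    F_d_V := fun x => (E.F_d_V x).trans (by rw [hiota])
    d_d := fun x => (E.d_d x).trans (by rw [hiota])
    d_iota := fun x => by rw [hiota, hiota]; exact E.d_iota x
    F_d_lam := fun {n} a => by
      change E.F (E.d (E.lam (WittLen.map φ _))) =
        E.lam (WittLen.map φ _) * E.d (E.lam (WittLen.map φ _))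
      rw [WittLen.map_teich, WittLen.map_teich, E.F_d_lam] }

/-- The forgetful functor from Witt complexes over `A[X]` to Witt complexes over `A`. -/
noncomputable def forgetPoly (A : Type u) [CommRing A] :
    WittComplex.{u, v} A[X] ⥤ WittComplex.{u, v} A where
  obj E := E.restrict C
  map f :=
    { toFun := fun n => app f n
      map_deg := fun h => Hom.map_deg f h
      map_R := fun x => Hom.map_R f x
      map_lam := fun w => Hom.map_lam f (WittLen.map C w)
      map_d := fun x => Hom.map_d f x
      map_F := fun x => Hom.map_F f x
      map_V := fun x => Hom.map_V f x }
  map_id _ := rfl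
  map_comp _ _ := rfl

/-! ## Formal sums of the four types of elements -/

/-- The indices `(i, r, l)` of the elements `V^r(c[X]^l)` and `dV^r(c[X]^l)` of level `n`:
`c` has level `i = n - r`, `r > 0`, and `l` is odd. -/
abbrev HigherIdx (n : ℕ) : Type :=
  {t : ℕ × ℕ × ℕ // t.1 + t.2.1 = n ∧ 0 < t.2.1 ∧ Odd t.2.2}

/-- The group of formal sums of level `n` of the four types of elements:
* type 1: `a[X]^j` with `a ∈ E_n` (coefficient of index `j`);
* type 2: `b[X]^{k-1}d[X]` with `b ∈ E_n`, `k ≥ 1` (coefficient of index `k - 1`);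
* type 3: `V^r(c[X]^l)` with `r > 0`, `l` odd, `c ∈ E_{n-r}`;
* type 4: `dV^s(e[X]^m)` with `s > 0`, `m` odd, `e ∈ E_{n-s}`. -/
abbrev FormalSum (E : WittComplex.{u, v} A) (n : ℕ) : Type v :=
  (ℕ →₀ E.carrier n) × (ℕ →₀ E.carrier n) ×
    (⨁ t : HigherIdx n, E.carrier t.1.1) × (⨁ t : HigherIdx n, E.carrier t.1.1)

namespace FormalSum

variable {E : WittComplex.{u, v} A}

/-- A formal sum is homogeneous of degree `q` if the coefficients of its elements of type 1 and 3
have degree `q`, and those of its elements of type 2 and 4 have degree `q - 1`. -/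
def IsHomogeneous {n : ℕ} (q : ℤ) (x : FormalSum E n) : Prop :=
  (∀ j, x.1 j ∈ E.deg n q) ∧ (∀ j, x.2.1 j ∈ E.deg n (q - 1)) ∧
    (∀ t, x.2.2.1 t ∈ E.deg t.1.1 q) ∧ (∀ t, x.2.2.2 t ∈ E.deg t.1.1 (q - 1))

/-- `a[X]^j`. -/
noncomputable def ty1 {n : ℕ} (j : ℕ) (a : E.carrier n) : FormalSum E n :=
  (Finsupp.single j a, 0, 0, 0)

/-- `b[X]^{k-1}d[X]`, for `k ≥ 1`. -/
noncomputable def ty2 {n : ℕ} (k : ℕ) (b : E.carrier n) : FormalSum E n :=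
  (0, Finsupp.single (k - 1) b, 0, 0)

/-- `V^r(c[X]^l)`, for `r > 0` and `l` odd (and `0` for the other `r`, `l`, never used). -/
noncomputable def ty3 {i n : ℕ} (r l : ℕ) (h : i + r = n) (c : E.carrier i) : FormalSum E n :=
  if hrl : 0 < r ∧ Odd l then
    (0, 0, DirectSum.of (fun t : HigherIdx n => E.carrier t.1.1) ⟨(i, r, l), h, hrl⟩ c, 0)
  else 0

/-- `dV^s(e[X]^m)`, for `s > 0` and `m` odd (and `0` for the other `s`, `m`, never used). -/
noncomputable def ty4 {i n : ℕ} (s m : ℕ) (h : i + s = n) (e : E.carrier i) : FormalSum E n :=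
  if hsm : 0 < s ∧ Odd m then
    (0, 0, 0, DirectSum.of (fun t : HigherIdx n => E.carrier t.1.1) ⟨(i, s, m), h, hsm⟩ e)
  else 0

/-- The map of formal sums that applies `θ` to all coefficients. -/
noncomputable def map {E' : WittComplex.{u, v} A} (θ : E ⟶ E') (n : ℕ) :
    FormalSum E n →+ FormalSum E' n :=
  (Finsupp.mapRange.addMonoidHom (app θ n).toAddMonoidHom).prodMap <|
    (Finsupp.mapRange.addMonoidHom (app θ n).toAddMonoidHom).prodMap <|
      (DirectSum.map fun t : HigherIdx n => (app θ t.1.1).toAddMonoidHom).prodMap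
        (DirectSum.map fun t : HigherIdx n => (app θ t.1.1).toAddMonoidHom)

end FormalSum

/-! ## The formulas that define the functor -/

section Formulas

variable {E : WittComplex.{u, v} A} {Q : WittComplex.{u, v} A[X]}

/-- The element `a[X]^j` of `Q_n`, if `Q_n` is identified with the formal sums. -/
noncomputable def x1 (ε : ∀ n, FormalSum E n ≃+ Q.carrier n) {n : ℕ} (j : ℕ)
    (a : E.carrier n) : Q.carrier n := ε n (FormalSum.ty1 j a)

/-- The element `b[X]^{k-1}d[X]` of `Q_n`. -/
noncomputable def x2 (ε : ∀ n, FormalSum E n ≃+ Q.carrier n) {n : ℕ} (k : ℕ)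
    (b : E.carrier n) : Q.carrier n := ε n (FormalSum.ty2 k b)

/-- The element `V^r(c[X]^l)` of `Q_n`. -/
noncomputable def x3 (ε : ∀ n, FormalSum E n ≃+ Q.carrier n) {i n : ℕ} (r l : ℕ)
    (h : i + r = n) (c : E.carrier i) : Q.carrier n := ε n (FormalSum.ty3 r l h c)

/-- The element `dV^s(e[X]^m)` of `Q_n`. -/
noncomputable def x4 (ε : ∀ n, FormalSum E n ≃+ Q.carrier n) {i n : ℕ} (s m : ℕ)
    (h : i + s = n) (e : E.carrier i) : Q.carrier n := ε n (FormalSum.ty4 s m h e)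

/-- The ten product formulas.  The products in the other order are given by graded
commutativity.  In the formulas with two higher elements the case distinction `v = v_2(l + l')`
is written as `l + l' = 2^v N` with `N` odd. -/
structure ProductFormulas (ε : ∀ n, FormalSum E n ≃+ Q.carrier n) : Prop where
  p11 : ∀ {n} (j j' : ℕ) (a a' : E.carrier n), x1 ε j a * x1 ε j' a' = x1 ε (j + j') (a * a')
  p12 : ∀ {n} (j k : ℕ) (a b : E.carrier n), 0 < k →
    x1 ε j a * x2 ε k b = x2 ε (j + k) (a * b)
  p13 : ∀ {i n} (j r l : ℕ) (h : i + r = n) (a : E.carrier n) (c : E.carrier i), 0 < r → Odd l →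
    x1 ε j a * x3 ε r l h c = x3 ε r (2 ^ r * j + l) h (E.Fpow r h a * c)
  p14 : ∀ {i n} (j s m : ℕ) (h : i + s = n) (p : ℤ) (a : E.carrier n) (e : E.carrier i),
    0 < s → Odd m → a ∈ E.deg n p →
    x1 ε j a * x4 ε s m h e =
      p.negOnePow • x4 ε s (2 ^ s * j + m) h (E.frac m (2 ^ s * j + m) * (E.Fpow s h a * e))
      - p.negOnePow • x3 ε s (2 ^ s * j + m) h
          (E.Fpow s h (E.d a) * e - E.frac j (2 ^ s * j + m) * E.d (E.Fpow s h a * e))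
  p22 : ∀ {n} (k k' : ℕ) (b b' : E.carrier n), 0 < k → 0 < k' →
    x2 ε k b * x2 ε k' b' = x2 ε (k + k') (E.iota (b * b'))
  p23 : ∀ {i n} (k r l : ℕ) (h : i + r = n) (p : ℤ) (b : E.carrier n) (c : E.carrier i),
    0 < k → 0 < r → Odd l → b ∈ E.deg n p →
    x2 ε k b * x3 ε r l h c =
      - p.negOnePow • x3 ε r (2 ^ r * k + l) h
          (E.frac 1 (2 ^ r * k + l) * E.d (E.Fpow r h b * c))
      + p.negOnePow • x4 ε r (2 ^ r * k + l) h
          (E.frac (2 ^ r) (2 ^ r * k + l) * (E.Fpow r h b * c))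
  p24 : ∀ {i n} (k s m : ℕ) (h : i + s = n) (p : ℤ) (b : E.carrier n) (e : E.carrier i),
    0 < k → 0 < s → Odd m → b ∈ E.deg n p →
    x2 ε k b * x4 ε s m h e =
      - p.negOnePow • x3 ε s (2 ^ s * k + m) h
          (E.frac 1 (2 ^ s * k + m) * (E.Fpow s h (E.d b + (k : E.carrier n) * E.iota b) * E.d e))
      + p.negOnePow • x4 ε s (2 ^ s * k + m) h
          (E.frac 1 (2 ^ s * k + m) * (E.Fpow s h b * E.d e))
  /-- `r > r'`, with `r = r' + t`. -/
  p33_gt : ∀ {i i' n} (r' t l l' : ℕ) (h : i + (r' + t) = n) (h' : i' + r' = n)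
    (c : E.carrier i) (c' : E.carrier i'), 0 < r' → 0 < t → Odd l → Odd l' →
    x3 ε (r' + t) l h c * x3 ε r' l' h' c' =
      2 ^ r' * x3 ε (r' + t) (2 ^ t * l' + l) h (c * E.Fpow t (by omega) c')
  /-- `r = r'` and `v = v_2(l + l') < r`, with `r = v + w`. -/
  p33_lt : ∀ {i n} (v w l l' N : ℕ) (h : i + (v + w) = n) (c c' : E.carrier i),
    0 < w → Odd l → Odd l' → Odd N → l + l' = 2 ^ v * N →
    x3 ε (v + w) l h c * x3 ε (v + w) l' h c' =
      2 ^ (v + w) * x3 ε w N (by omega) (E.Vpow v (rfl : i + v = i + v) (c * c'))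
  /-- `r = r'` and `v_2(l + l') ≥ r`. -/
  p33_ge : ∀ {i n} (r l l' N : ℕ) (h : i + r = n) (c c' : E.carrier i),
    0 < r → Odd l → Odd l' → l + l' = 2 ^ r * N →
    x3 ε r l h c * x3 ε r l' h c' = 2 ^ r * x1 ε N (E.Vpow r h (c * c'))
  /-- `r < s`, with `s = r + t`. -/
  p34_lt : ∀ {i i' n} (r t l m : ℕ) (h : i + r = n) (h' : i' + (r + t) = n) (p : ℤ)
    (c : E.carrier i) (e : E.carrier i'), 0 < r → 0 < t → Odd l → Odd m → c ∈ E.deg i p →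
    x3 ε r l h c * x4 ε (r + t) m h' e =
      p.negOnePow • x4 ε (r + t) (2 ^ t * l + m) h'
          (E.frac (2 ^ r * m) (2 ^ t * l + m) * (E.Fpow t (by omega) c * e))
      - p.negOnePow • x3 ε (r + t) (2 ^ t * l + m) h'
          (E.Fpow t (by omega) (E.d c + E.iota c) * e
            - E.frac l (2 ^ t * l + m) * E.d (E.Fpow t (by omega) c * e))
  /-- `r = s` and `v = v_2(l + m) < r`, with `r = v + w`. -/
  p34_eq_lt : ∀ {i n} (v w l m N : ℕ) (h : i + (v + w) = n) (p : ℤ) (c e : E.carrier i),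
    0 < w → Odd l → Odd m → Odd N → l + m = 2 ^ v * N → c ∈ E.deg i p →
    x3 ε (v + w) l h c * x4 ε (v + w) m h e =
      x3 ε w N (by omega) (E.Vpow v (rfl : i + v = i + v) (c * (E.d e + E.iota e)))
      + p.negOnePow • x4 ε w N (by omega)
          (E.frac (2 ^ w * m) N * E.Vpow v (rfl : i + v = i + v) (c * e))
      - p.negOnePow • x3 ε w N (by omega)
          (E.frac m N * E.d (E.Vpow v (rfl : i + v = i + v) (c * e)))
  /-- `r = s` and `v_2(l + m) ≥ r`. -/
  p34_eq_ge : ∀ {i n} (r l m N : ℕ) (h : i + r = n) (q : ℤ) (c e : E.carrier i),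
    0 < r → Odd l → Odd m → l + m = 2 ^ r * N → e ∈ E.deg i q →
    x3 ε r l h c * x4 ε r m h e =
      x1 ε N (E.Vpow r h (c * (E.d e + E.iota e)))
      + q.negOnePow • x2 ε N ((m : E.carrier n) * E.Vpow r h (c * e))
  /-- `r > s`, with `r = s + t`. -/
  p34_gt : ∀ {i i' n} (s t l m : ℕ) (h : i + (s + t) = n) (h' : i' + s = n) (p : ℤ)
    (c : E.carrier i) (e : E.carrier i'), 0 < s → 0 < t → Odd l → Odd m → c ∈ E.deg i p →
    x3 ε (s + t) l h c * x4 ε s m h' e =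
      x3 ε (s + t) (2 ^ t * m + l) h (c * E.Fpow t (by omega) (E.d e + E.iota e))
      + p.negOnePow • x4 ε (s + t) (2 ^ t * m + l) h
          (E.frac (2 ^ (s + t) * m) (2 ^ t * m + l) * (c * E.Fpow t (by omega) e))
      - p.negOnePow • x3 ε (s + t) (2 ^ t * m + l) h
          (E.frac m (2 ^ t * m + l) * E.d (c * E.Fpow t (by omega) e))
  /-- `s < s'`, with `s' = s + t`. -/
  p44_lt : ∀ {i i' n} (s t m m' : ℕ) (h : i + s = n) (h' : i' + (s + t) = n) (p : ℤ)
    (e : E.carrier i) (e' : E.carrier i'), 0 < s → 0 < t → Odd m → Odd m' → e ∈ E.deg i p →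
    x4 ε s m h e * x4 ε (s + t) m' h' e' =
      - p.negOnePow • x4 ε (s + t) (2 ^ t * m + m') h'
          (E.Fpow t (by omega) (E.d e + E.iota e) * e'
            - E.frac m (2 ^ t * m + m') * E.d (E.Fpow t (by omega) e * e'))
      + x3 ε (s + t) (2 ^ t * m + m') h'
          (E.iota (E.Fpow t (by omega) (E.d e) * e' + E.Fpow t (by omega) e * E.d e'))
  /-- `s = s'` and `v = v_2(m + m') < s`, with `s = v + w`. -/
  p44_eq_lt : ∀ {i n} (v w m m' N : ℕ) (h : i + (v + w) = n) (p : ℤ) (e e' : E.carrier i),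
    0 < w → Odd m → Odd m' → Odd N → m + m' = 2 ^ v * N → e ∈ E.deg i p →
    x4 ε (v + w) m h e * x4 ε (v + w) m' h e' =
      x3 ε w N (by omega) (E.iota (E.Vpow v (rfl : i + v = i + v) (e * E.d e')
          + E.d (E.Vpow v (rfl : i + v = i + v) (e * e'))))
      + x4 ε w N (by omega) (E.Vpow v (rfl : i + v = i + v) (e * (E.d e' + E.iota e'))
          - p.negOnePow • (E.frac m' N * E.d (E.Vpow v (rfl : i + v = i + v) (e * e'))))
  /-- `s = s'` and `v_2(m + m') ≥ s`. -/
  p44_eq_ge : ∀ {i n} (s m m' N : ℕ) (h : i + s = n) (p q : ℤ) (e e' : E.carrier i),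
    0 < s → Odd m → Odd m' → m + m' = 2 ^ s * N → e ∈ E.deg i p → e' ∈ E.deg i q →
    x4 ε s m h e * x4 ε s m' h e' =
      x1 ε N (E.iota (E.Vpow s h (e * E.d e')) + E.d (E.Vpow s h (e * (E.d e' + E.iota e'))))
      + x2 ε N (E.iota (E.Vpow s h (e * e'))
          + q.negOnePow • ((m' : E.carrier n) * E.d (E.Vpow s h (e * e')))
          - (p + q).negOnePow • ((N : E.carrier n) * E.Vpow s h (e * E.d e')))

/-- The formulas for `λ`, `R`, `ι`, `V`, `F` and `d`. -/
structure OperatorFormulas (ε : ∀ n, FormalSum E n ≃+ Q.carrier n) : Prop where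
  /-- `λ(w[X]^j) = λ(w)[X]^j`. -/
  lam1 : ∀ {n} (j : ℕ) (w : WittVector 2 A),
    Q.lam (WittLen.proj n (WittVector.map C w * WittVector.teichmuller 2 X ^ j)) =
      x1 ε j (E.lam (WittLen.proj n w))
  /-- `λ(V^r(w[X]^l)) = V^r(λ(w)[X]^l)`. -/
  lam3 : ∀ {i n} (r l : ℕ) (h : i + r = n) (w : WittVector 2 A), 0 < r → Odd l →
    Q.lam (WittLen.proj n (WittVector.verschiebung^[r]
      (WittVector.map C w * WittVector.teichmuller 2 X ^ l))) =
      x3 ε r l h (E.lam (WittLen.proj i w))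
  r1 : ∀ {n} (j : ℕ) (a : E.carrier (n + 1)), Q.R (x1 ε j a) = x1 ε j (E.R a)
  r2 : ∀ {n} (k : ℕ) (b : E.carrier (n + 1)), 0 < k → Q.R (x2 ε k b) = x2 ε k (E.R b)
  r3 : ∀ {i n} (r l : ℕ) (h : i + r = n) (c : E.carrier (i + 1)), 0 < r → Odd l →
    Q.R (x3 ε r l (by omega : i + 1 + r = n + 1) c) = x3 ε r l h (E.R c)
  r4 : ∀ {i n} (s m : ℕ) (h : i + s = n) (e : E.carrier (i + 1)), 0 < s → Odd m →
    Q.R (x4 ε s m (by omega : i + 1 + s = n + 1) e) = x4 ε s m h (E.R e)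
  iota1 : ∀ {n} (j : ℕ) (a : E.carrier n), Q.iota (x1 ε j a) = x1 ε j (E.iota a)
  iota2 : ∀ {n} (k : ℕ) (b : E.carrier n), 0 < k → Q.iota (x2 ε k b) = x2 ε k (E.iota b)
  iota3 : ∀ {i n} (r l : ℕ) (h : i + r = n) (c : E.carrier i), 0 < r → Odd l →
    Q.iota (x3 ε r l h c) = x3 ε r l h (E.iota c)
  iota4 : ∀ {i n} (s m : ℕ) (h : i + s = n) (e : E.carrier i), 0 < s → Odd m →
    Q.iota (x4 ε s m h e) = x4 ε s m h (E.iota e)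
  v1_odd : ∀ {n} (j : ℕ) (a : E.carrier n), Odd j → Q.V (x1 ε j a) = x3 ε 1 j rfl a
  v1_even : ∀ {n} (j : ℕ) (a : E.carrier n), Q.V (x1 ε (2 * j) a) = x1 ε j (E.V a)
  v2_odd : ∀ {n} (k : ℕ) (p : ℤ) (b : E.carrier n), Odd k → b ∈ E.deg n p →
    Q.V (x2 ε k b) = - p.negOnePow • x3 ε 1 k rfl (E.frac 1 k * E.d b)
      + p.negOnePow • x4 ε 1 k rfl (E.frac 2 k * b)
  v2_even : ∀ {n} (k : ℕ) (b : E.carrier n), 0 < k → Q.V (x2 ε (2 * k) b) = x2 ε k (E.V b)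
  v3 : ∀ {i n} (r l : ℕ) (h : i + r = n) (c : E.carrier i), 0 < r → Odd l →
    Q.V (x3 ε r l h c) = x3 ε (r + 1) l (by omega) c
  v4 : ∀ {i n} (s m : ℕ) (h : i + s = n) (e : E.carrier i), 0 < s → Odd m →
    Q.V (x4 ε s m h e) = 2 * x4 ε (s + 1) m (by omega) e
  f1 : ∀ {n} (j : ℕ) (a : E.carrier (n + 1)), Q.F (x1 ε j a) = x1 ε (2 * j) (E.F a)
  f2 : ∀ {n} (k : ℕ) (b : E.carrier (n + 1)), 0 < k → Q.F (x2 ε k b) = x2 ε (2 * k) (E.F b)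
  f3_one : ∀ {n} (l : ℕ) (c : E.carrier n), Odd l → Q.F (x3 ε 1 l rfl c) = 2 * x1 ε l c
  f3 : ∀ {i n} (r l : ℕ) (h : i + r = n) (c : E.carrier i), 0 < r → Odd l →
    Q.F (x3 ε (r + 1) l (by omega : i + (r + 1) = n + 1) c) = 2 * x3 ε r l h c
  f4_one : ∀ {n} (m : ℕ) (p : ℤ) (e : E.carrier n), Odd m → e ∈ E.deg n p →
    Q.F (x4 ε 1 m rfl e) =
      x1 ε m (E.d e) + p.negOnePow • x2 ε m ((m : E.carrier n) * e) + x1 ε m (E.iota e)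
  f4 : ∀ {i n} (s m : ℕ) (h : i + s = n) (e : E.carrier i), 0 < s → Odd m →
    Q.F (x4 ε (s + 1) m (by omega : i + (s + 1) = n + 1) e) =
      x4 ε s m h e + x3 ε s m h (E.iota e)
  d1 : ∀ {n} (j : ℕ) (p : ℤ) (a : E.carrier n), a ∈ E.deg n p →
    Q.d (x1 ε j a) = x1 ε j (E.d a) + p.negOnePow • x2 ε j ((j : E.carrier n) * a)
  d2 : ∀ {n} (k : ℕ) (b : E.carrier n), 0 < k →
    Q.d (x2 ε k b) = x2 ε k (E.d b) + x2 ε k ((k : E.carrier n) * E.iota b)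
  d3 : ∀ {i n} (r l : ℕ) (h : i + r = n) (c : E.carrier i), 0 < r → Odd l →
    Q.d (x3 ε r l h c) = x4 ε r l h c
  d4 : ∀ {i n} (s m : ℕ) (h : i + s = n) (e : E.carrier i), 0 < s → Odd m →
    Q.d (x4 ε s m h e) = x4 ε s m h (E.iota e)

end Formulas

end WittComplex

/-! The operators `R`, `F`, `V`, `d` on formal sums are easy to write down; the difficulty is the
product. A direct check of associativity from ten formulas with case distinctions would be
unmanageable, so the product is not defined by those formulas. They are derived at the end.

Every element of level `n + 1` is a sum `b + V(x) + dV(y)`, where `b` is integral, that is, a sum of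
elements of type 1 and 2, and `x`, `y` have level `n`. In a Witt complex `V(x)z = V(xF(z))`, and the
Leibniz rule gives `dV(y)z = d(V(y)z) - (-1)^|y| V(y)dz`. Hence the product of level `n + 1` is
forced by the product of integral elements and by the product of level `n`. Induction on the level
yields associativity, the Leibniz rule, multiplicativity of `F` and graded commutativity;
`LevelStep` isolates the algebra of one step, and `mulP` and `isGood` carry out the recursion.

The integral elements form an explicit ring of pairs of polynomials over `E_n` in which `d[X]d[X] =
η[X]d[X]`, with `η = dλ[-1]/λ[-1]`. What is needed from `E` follows from the axioms: `2η = 0`, `η² =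
0`, `Vd = 2dV`, `dF = 2Fd`. Odd denominators enter because, for odd `k`, the element
`b[X]^(k-1)d[X]` has to be written as `d(g[X]^k) - (dg)[X]^k` with `g = ±b/k` before `V` can be
applied to it.

For `λ`, every Witt vector over `A[X]` is uniquely `∑ [a_j][X]^j + V(y)`, and this determines `λ` by
recursion on the level. The relation `Fdλ[a] = λ[a]dλ[a]` is clear for monomials. Passing to sums
uses `[a+b] = [a] + [b] + V(x)` with `x = [a][b] + ([a]+[b])V(x) + V(x²)`
(`exists_teichmuller_add`), and an identity for `dV(z²) - V(z dz)` with `z = λ(x)`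
(`d_V_lamAdd_sq`).

A map `θ : E → U(Q)` extends to `P(E)` by sending `a[X]^j` to `θ(a)λ[X]^j`, compatibly with `V` and
`d`. The extension is multiplicative by the same induction on the level, and it is unique because
`E` and `[X]` generate `P(E)` under products, sums, `V` and `d`. This gives the adjunction, hence
the functor and the statement on initial objects.

The product formulas are then computations inside the Witt complex `P(E)`: factors are moved under
`V^r`, and what remains is to evaluate `V^r` on elements of type 1 and 2 (`Vpow_X2_mul`). -/

set_option linter.unusedSimpArgs false

/-! ### Identities between 2-typical Witt vectors. -/

namespace WittVector

theorem ext_of_ghostComponent {σ : Type*} {x y : WittVector 2 (MvPolynomial σ ℤ)}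
    (h : ∀ n, ghostComponent n x = ghostComponent n y) : x = y := by
  -- Over `ℚ` the prime 2 is invertible and the ghost map is bijective; integral polynomials embed
  -- into rational ones.
  refine map_injective (MvPolynomial.map (Int.castRingHom ℚ))
    (MvPolynomial.map_injective _ Int.cast_injective) ?_
  apply (ghostMap.bijective_of_invertible 2 (MvPolynomial σ ℚ)).1
  have key : ∀ z : WittVector 2 (MvPolynomial σ ℤ), ∀ n, ghostComponent n
      (map (MvPolynomial.map (Int.castRingHom ℚ)) z) =
      MvPolynomial.map (Int.castRingHom ℚ) (ghostComponent n z) := by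
    intro z n
    rw [ghostComponent_apply, ghostComponent_apply, MvPolynomial.aeval_def, MvPolynomial.aeval_def,
      MvPolynomial.hom_eval₂]
    congr 1
    ext; simp
  ext1 n
  rw [ghostMap_apply, ghostMap_apply, key, key, h]

theorem two_mul_cancel {σ : Type*} {x y : WittVector 2 (MvPolynomial σ ℤ)}
    (h : 2 * x = 2 * y) : x = y := by
  refine ext_of_ghostComponent fun n => ?_
  have := congrArg (ghostComponent n) h
  rw [map_mul, map_mul, map_ofNat] at this
  exact mul_left_cancel₀ two_ne_zero this

theorem ghostComponent_frobenius_two {R : Type*} [CommRing R] (x : WittVector 2 R) (n : ℕ) :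
    ghostComponent n (frobenius x) = ghostComponent (n + 1) x :=
  ghostComponent_frobenius n x

/-- By functoriality a polynomial ring over `ℤ` suffices, and there both sides have the ghost
components `a ^ (2 ^ (n + 1))`. -/
theorem frobenius_teich {R : Type*} [CommRing R] (a : R) :
    frobenius (teichmuller 2 a) = teichmuller 2 (a ^ 2) := by
  obtain ⟨a, rfl⟩ := MvPolynomial.counit_surjective R a
  have : frobenius (teichmuller 2 a) = teichmuller 2 (a ^ 2) := by
    refine ext_of_ghostComponent fun n => ?_
    rw [ghostComponent_frobenius_two, ghostComponent_teichmuller, ghostComponent_teichmuller,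
      ← pow_mul, pow_succ']
  rw [← map_pow, ← map_teichmuller, ← map_teichmuller, ← this, (frobenius_isPoly 2).map]

theorem exists_verschiebung_eq {R : Type*} [CommRing R] {x : WittVector 2 R}
    (h : x.coeff 0 = 0) : ∃ y, verschiebung y = x := by
  refine ⟨shift x 1, ?_⟩
  have := eq_iterate_verschiebung (x := x) (n := 1) (by intro i hi; obtain rfl : i = 0 := by omega
                                                        exact h)
  exact this.symm

theorem exists_eq_teichmuller_add {R : Type*} [CommRing R] (x : WittVector 2 R) :
    ∃ y, x = teichmuller 2 (x.coeff 0) + verschiebung y := by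
  obtain ⟨y, hy⟩ := exists_verschiebung_eq (x := x - teichmuller 2 (x.coeff 0)) (by
    have := map_sub constantCoeff x (teichmuller 2 (x.coeff 0))
    simpa using this)
  exact ⟨y, by rw [hy]; ring⟩

theorem frobenius_verschiebung_two {R : Type*} [CommRing R] (x : WittVector 2 R) :
    frobenius (verschiebung x) = 2 * x := by
  rw [frobenius_verschiebung, mul_comm]; rfl

theorem verschiebung_mul_verschiebung {R : Type*} [CommRing R] (x y : WittVector 2 R) :
    verschiebung x * verschiebung y = 2 * verschiebung (x * y) := by
  rw [← verschiebung_mul_frobenius, frobenius_verschiebung_two, two_mul, mul_add, map_add, two_mul]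

/-- Applying `F` to the first equation gives `2x = [a+b]² - [a]² - [b]²`. Expanding `[a+b]` and
using `V(x)² = 2V(x²)` makes the right side divisible by 2, and the division is legitimate in the
universal case of two variables over `ℤ`. The second equation is what later controls `dλ(x)`. -/
theorem exists_teichmuller_add {R : Type*} [CommRing R] (a b : R) :
    ∃ x, teichmuller 2 (a + b) = teichmuller 2 a + teichmuller 2 b + verschiebung x ∧
      x = teichmuller 2 a * teichmuller 2 b + (teichmuller 2 a + teichmuller 2 b) * verschiebung x
        + verschiebung (x * x) := by
  let f : MvPolynomial Bool ℤ →+* R := MvPolynomial.eval₂Hom (Int.castRingHom R) (fun i => cond i a b)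
  have ha : a = f (MvPolynomial.X true) := by simp [f]
  have hb : b = f (MvPolynomial.X false) := by simp [f]
  rw [ha, hb]
  generalize (MvPolynomial.X true : MvPolynomial Bool ℤ) = a,
    (MvPolynomial.X false : MvPolynomial Bool ℤ) = b
  obtain ⟨x, hx⟩ := exists_verschiebung_eq
    (x := teichmuller 2 (a + b) - teichmuller 2 a - teichmuller 2 b) (by
      have := map_sub constantCoeff (teichmuller 2 (a + b) - teichmuller 2 a) (teichmuller 2 b)
      rw [map_sub constantCoeff (teichmuller 2 (a + b)) (teichmuller 2 a)] at this
      simpa using this)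
  have h1 : teichmuller 2 (a + b) = teichmuller 2 a + teichmuller 2 b + verschiebung x := by
    rw [hx]; ring
  have h2 : x = teichmuller 2 a * teichmuller 2 b
      + (teichmuller 2 a + teichmuller 2 b) * verschiebung x + verschiebung (x * x) := by
    apply two_mul_cancel
    have h3 := congrArg frobenius hx
    rw [frobenius_verschiebung_two, map_sub, map_sub, frobenius_teich, frobenius_teich,
      frobenius_teich, map_pow, map_pow, map_pow, h1] at h3
    have h4 := verschiebung_mul_verschiebung x x
    linear_combination h3 + h4
  refine ⟨map f x, ?_, ?_⟩
  · rw [← map_add f, ← map_teichmuller, ← map_teichmuller, ← map_teichmuller, h1, map_add, map_add,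
      map_verschiebung]
  · have := congrArg (map f) h2
    simpa only [map_add, map_mul, map_verschiebung, map_teichmuller] using this

/-- In ghost components `(-1)^(2^n) = -1 + 2` for `n ≥ 1`, and both sides are `-1` for `n = 0`. -/
theorem teichmuller_neg_one {R : Type*} [CommRing R] :
    teichmuller 2 (-1 : R) = -1 + verschiebung 1 := by
  let f : MvPolynomial Empty ℤ →+* R := MvPolynomial.eval₂Hom (Int.castRingHom R) Empty.elim
  have h : teichmuller 2 (-1 : MvPolynomial Empty ℤ) = -1 + verschiebung 1 := by
    refine ext_of_ghostComponent fun n => ?_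
    rw [ghostComponent_teichmuller, map_add, map_neg, map_one]
    cases n with
    | zero => rw [ghostComponent_zero_verschiebung]; simp
    | succ n =>
      rw [ghostComponent_verschiebung, map_one, pow_succ', pow_mul]
      norm_num
  have := congrArg (map f) h
  simpa only [map_add, map_neg, map_one, map_verschiebung, map_teichmuller] using this

/-- Successive approximation of an inverse of `M`: if the error is `V^k(z)`, adding `V^k[a z_0]` to
`N`, where `a` inverts `M` in `R`, cancels the leading coefficient of `z`. -/
theorem exists_one_sub_mul {R : Type*} [CommRing R] (M : ℕ) (hM : IsUnit (M : R)) (k : ℕ) :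
    ∃ N z : WittVector 2 R, 1 - M * N = verschiebung^[k] z := by
  obtain ⟨a, ha⟩ := hM.exists_right_inv
  induction k with
  | zero => exact ⟨0, 1, by simp⟩
  | succ k ih =>
    obtain ⟨N, z, hz⟩ := ih
    obtain ⟨y, hy⟩ := exists_verschiebung_eq
      (x := z - (M : WittVector 2 R) * teichmuller 2 (a * z.coeff 0)) (by
        have := map_sub constantCoeff z ((M : WittVector 2 R) * teichmuller 2 (a * z.coeff 0))
        rw [map_mul constantCoeff, map_natCast] at this
        simp only [constantCoeff_apply, teichmuller_coeff_zero] at this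
        rw [this, ← mul_assoc, ha, one_mul, sub_self])
    refine ⟨N + verschiebung^[k] (teichmuller 2 (a * z.coeff 0)), y, ?_⟩
    have hadd : ∀ (k : ℕ) (x y : WittVector 2 R), verschiebung^[k] (x - y)
        = verschiebung^[k] x - verschiebung^[k] y := fun k x y => by
      induction k generalizing x y with
      | zero => rfl
      | succ k ih => rw [Function.iterate_succ_apply, Function.iterate_succ_apply,
          Function.iterate_succ_apply, map_sub, ih]
    have hmul : ∀ (k : ℕ) (y : WittVector 2 R), verschiebung^[k] ((M : WittVector 2 R) * y)
        = (M : WittVector 2 R) * verschiebung^[k] y := fun k y => by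
      induction k generalizing y with
      | zero => rfl
      | succ k ih => rw [Function.iterate_succ_apply, Function.iterate_succ_apply,
          ← nsmul_eq_mul, map_nsmul, nsmul_eq_mul, ih]
    rw [Function.iterate_succ_apply, hy, hadd, hmul, ← hz]
    ring

end WittVector

/-! ### Odd integers as units, signs, and multiplicative representatives of finite length. -/

theorem WittLen.isUnit_natCast {A : Type u} [CommRing A] (n M : ℕ) (hM : IsUnit (M : A)) :
    IsUnit (M : WittLen n A) := by
  obtain ⟨N, z, h⟩ := WittVector.exists_one_sub_mul M hM n
  refine IsUnit.of_mul_eq_one (proj n N) ?_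
  have h0 : proj n (WittVector.verschiebung^[n] z) = 0 := by
    refine (WittVector.mem_ker_truncate (p := 2) n _).2 fun i hi => ?_
    exact WittVector.iterate_verschiebung_coeff_eq_zero _ hi
  rw [← h, map_sub, map_one, map_mul, map_natCast, sub_eq_zero] at h0
  exact h0.symm

theorem isUnit_natCast_of_odd {A : Type u} [CommRing A] [Algebra ZLocTwo A] {M : ℕ} (hM : Odd M) :
    IsUnit (M : A) := by
  have h : IsUnit (algebraMap ℤ ZLocTwo M) :=
    IsLocalization.map_units ZLocTwo (⟨(M : ℤ), by
      intro hmem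
      rw [SetLike.mem_coe, Ideal.mem_span_singleton] at hmem
      obtain ⟨k, hk⟩ := hM
      omega⟩ : (Ideal.span {(2 : ℤ)}).primeCompl)
  have := h.map (algebraMap ZLocTwo A)
  simpa using this

theorem negOnePow_smul_even {G : Type*} [AddCommGroup G] {p : ℤ} (h : Even p) (x : G) :
    p.negOnePow • x = x := by
  rw [Int.negOnePow_even p h, one_smul]

theorem negOnePow_smul_odd {G : Type*} [AddCommGroup G] {p : ℤ} (h : Odd p) (x : G) :
    p.negOnePow • x = -x := by
  rw [Int.negOnePow_odd p h, Units.smul_def]; simp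

theorem map_negOnePow_smul {G H : Type*} [AddCommGroup G] [AddCommGroup H] (f : G →+ H)
    (p : ℤ) (x : G) : f (p.negOnePow • x) = p.negOnePow • f x := by
  rcases Int.even_or_odd p with h | h
  · simp only [negOnePow_smul_even h]
  · simp only [negOnePow_smul_odd h, map_neg]

theorem negOnePow_smul_mem {G : Type*} [AddCommGroup G] (S : AddSubgroup G) (p : ℤ) {x : G}
    (hx : x ∈ S) : p.negOnePow • x ∈ S := by
  rcases Int.even_or_odd p with h | h
  · rwa [negOnePow_smul_even h]
  · rw [negOnePow_smul_odd h]; exact S.neg_mem hx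

theorem WittLen.teich_mul {A : Type u} [CommRing A] {n : ℕ} (a b : A) :
    WittLen.teich n (a * b) = WittLen.teich n a * WittLen.teich n b := by
  rw [teich, map_mul, map_mul]; rfl

theorem WittLen.teich_one {A : Type u} [CommRing A] {n : ℕ} :
    WittLen.teich n (1 : A) = 1 := by
  rw [teich, map_one, map_one]

theorem WittLen.R_teich {A : Type u} [CommRing A] {n : ℕ} (a : A) :
    WittLen.R (WittLen.teich (n + 1) a) = WittLen.teich n a := WittLen.R_proj _

theorem WittLen.F_teich {A : Type u} [CommRing A] {n : ℕ} (a : A) :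
    WittLen.F (WittLen.teich (n + 1) a) = WittLen.teich n a * WittLen.teich n a := by
  rw [teich, F_proj, WittVector.frobenius_teich, ← teich_mul, ← pow_two]; rfl

/-! ### First consequences of the axioms: the sign operator and the element `η`. -/

namespace WittComplex

variable {A : Type u} [CommRing A] (E : WittComplex.{u, v} A) {n : ℕ}

theorem hom_ind {P : E.carrier n → Prop} (hom : ∀ q x, x ∈ E.deg n q → P x)
    (add : ∀ x y, P x → P y → P (x + y)) (x : E.carrier n) : P x := by
  obtain ⟨z, rfl⟩ := (E.isInternal n).2 x
  induction z using DirectSum.induction_on with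
  | zero => rw [map_zero]; exact hom 0 0 (AddSubgroup.zero_mem _)
  | of q y => rw [DirectSum.coeAddMonoidHom_of]; exact hom q _ y.2
  | add y z hy hz => rw [map_add]; exact add _ _ hy hz

/-- The decomposition of a level into its homogeneous parts. -/
noncomputable def gradedEquiv (n : ℕ) : (⨁ q, E.deg n q) ≃+ E.carrier n :=
  AddEquiv.ofBijective _ (E.isInternal n)

/-- The projection of a level to its part of degree `q`. -/
noncomputable def homPart (n : ℕ) (q : ℤ) : E.carrier n →+ E.carrier n :=
  (E.deg n q).subtype.comp ((DFinsupp.evalAddMonoidHom q).comp (E.gradedEquiv n).symm.toAddMonoidHom)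

theorem gradedEquiv_symm_of_mem {q : ℤ} {x : E.carrier n} (hx : x ∈ E.deg n q) :
    (E.gradedEquiv n).symm x = DirectSum.of (fun q => E.deg n q) q ⟨x, hx⟩ := by
  rw [AddEquiv.symm_apply_eq]
  exact (DirectSum.coeAddMonoidHom_of (E.deg n) q ⟨x, hx⟩).symm

theorem homPart_of_mem {q : ℤ} {x : E.carrier n} (hx : x ∈ E.deg n q) : E.homPart n q x = x := by
  change (((E.gradedEquiv n).symm x) q : E.carrier n) = x
  rw [gradedEquiv_symm_of_mem E hx, DirectSum.of_eq_same]

theorem homPart_of_mem_ne {q q' : ℤ} {x : E.carrier n} (hx : x ∈ E.deg n q) (h : q ≠ q') :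
    E.homPart n q' x = 0 := by
  change (((E.gradedEquiv n).symm x) q' : E.carrier n) = 0
  rw [gradedEquiv_symm_of_mem E hx, DirectSum.of_eq_of_ne _ _ _ h.symm]
  rfl

/-- The involution of a level that multiplies elements of degree `q` by `(-1)^q`, as an
additive map. -/
noncomputable def tauAdd (n : ℕ) : E.carrier n →+ E.carrier n :=
  (DirectSum.toAddMonoid fun q : ℤ =>
    (DistribSMul.toAddMonoidHom (E.carrier n) q.negOnePow).comp (E.deg n q).subtype).comp
    (E.gradedEquiv n).symm.toAddMonoidHom

theorem tauAdd_of_mem {q : ℤ} {x : E.carrier n} (hx : x ∈ E.deg n q) :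
    E.tauAdd n x = q.negOnePow • x := by
  change DirectSum.toAddMonoid _ ((E.gradedEquiv n).symm x) = _
  rw [gradedEquiv_symm_of_mem E hx, DirectSum.toAddMonoid_of]
  rfl

theorem tauAdd_mul (x y : E.carrier n) : E.tauAdd n (x * y) = E.tauAdd n x * E.tauAdd n y := by
  induction x using E.hom_ind with
  | add x x' hx hx' => simp only [add_mul, map_add, hx, hx']
  | hom p x hx =>
    induction y using E.hom_ind with
    | add y y' hy hy' => simp only [mul_add, map_add, hy, hy']
    | hom q y hy =>
      rw [E.tauAdd_of_mem (E.mul_mem hx hy), E.tauAdd_of_mem hx, E.tauAdd_of_mem hy,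
        Int.negOnePow_add, smul_mul_smul_comm]

/-- The involution of a level that multiplies elements of degree `q` by `(-1)^q`. -/
noncomputable def tau (n : ℕ) : E.carrier n →+* E.carrier n :=
  { E.tauAdd n with
    map_one' := by
      change E.tauAdd n 1 = 1
      rw [E.tauAdd_of_mem (E.one_mem n), Int.negOnePow_zero, one_smul]
    map_mul' := E.tauAdd_mul }

theorem tau_of_mem {q : ℤ} {x : E.carrier n} (hx : x ∈ E.deg n q) :
    E.tau n x = q.negOnePow • x := E.tauAdd_of_mem hx

theorem tau_mem {q : ℤ} {x : E.carrier n} (hx : x ∈ E.deg n q) : E.tau n x ∈ E.deg n q := by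
  rw [E.tau_of_mem hx]; exact negOnePow_smul_mem _ _ hx

theorem tau_even {q : ℤ} {x : E.carrier n} (h : Even q) (hx : x ∈ E.deg n q) :
    E.tau n x = x := by rw [E.tau_of_mem hx, negOnePow_smul_even h]

theorem tau_odd {q : ℤ} {x : E.carrier n} (h : Odd q) (hx : x ∈ E.deg n q) :
    E.tau n x = -x := by rw [E.tau_of_mem hx, negOnePow_smul_odd h]

@[simp] theorem tau_tau (x : E.carrier n) : E.tau n (E.tau n x) = x := by
  induction x using E.hom_ind with
  | add x x' hx hx' => simp only [map_add, hx, hx']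
  | hom p x hx =>
    rcases Int.even_or_odd p with h | h
    · rw [E.tau_even h hx, E.tau_even h hx]
    · rw [E.tau_odd h hx, map_neg, E.tau_odd h hx, neg_neg]

theorem map_tau {E' : Type*} [AddCommGroup E'] (f : E.carrier n →+ E')
    (t : E' → E') (htadd : ∀ x y, t (x + y) = t x + t y)
    (h : ∀ q x, x ∈ E.deg n q → t (f x) = q.negOnePow • f x) (x : E.carrier n) :
    f (E.tau n x) = t (f x) := by
  induction x using E.hom_ind with
  | add x x' hx hx' => simp only [map_add, hx, hx', htadd]
  | hom p x hx => rw [E.tau_of_mem hx, map_negOnePow_smul, h p x hx]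

theorem tau_R (x : E.carrier (n + 1)) : E.tau n (E.R x) = E.R (E.tau (n + 1) x) :=
  (E.map_tau E.R.toAddMonoidHom (E.tau n) (map_add _)
    (fun _ _ hx => E.tau_of_mem (E.R_mem hx)) x).symm

theorem tau_F (x : E.carrier (n + 1)) : E.tau n (E.F x) = E.F (E.tau (n + 1) x) :=
  (E.map_tau E.F.toAddMonoidHom (E.tau n) (map_add _)
    (fun _ _ hx => E.tau_of_mem (E.F_mem hx)) x).symm

theorem tau_V (x : E.carrier n) : E.tau (n + 1) (E.V x) = E.V (E.tau n x) :=
  (E.map_tau E.V (E.tau (n + 1)) (map_add _)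
    (fun _ _ hx => E.tau_of_mem (E.V_mem hx)) x).symm

theorem tau_d (x : E.carrier n) : E.tau n (E.d x) = -E.d (E.tau n x) := by
  induction x using E.hom_ind with
  | add x x' hx hx' => simp only [map_add, hx, hx', neg_add]
  | hom p x hx =>
    rw [E.tau_of_mem hx, E.tau_of_mem (E.d_mem hx), map_negOnePow_smul, Int.negOnePow_succ,
      Units.neg_smul]

theorem tau_lam (w : WittLen n A) : E.tau n (E.lam w) = E.lam w :=
  E.tau_even (by decide) (E.lam_mem w)

/-- The Leibniz rule for elements that need not be homogeneous. -/
theorem leibniz (x y : E.carrier n) : E.d (x * y) = E.d x * y + E.tau n x * E.d y := by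
  induction x using E.hom_ind with
  | add x x' hx hx' => simp only [map_add, hx, hx', add_mul]; abel
  | hom p x hx => rw [E.d_mul y hx, E.tau_of_mem hx, Units.smul_def, Units.smul_def, smul_mul_assoc]

theorem comm_even {p : ℤ} {x : E.carrier n} (h : Even p) (hx : x ∈ E.deg n p) (y : E.carrier n) :
    x * y = y * x := by
  induction y using E.hom_ind with
  | add x x' hx hx' => simp only [mul_add, add_mul, hx, hx']
  | hom q y hy => rw [E.mul_comm hx hy, negOnePow_smul_even (h.mul_right q)]

/-- With the sign expressed by the operator `tau`, the second factor need not be homogeneous; this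
is how degrees are avoided in most of the later computations. -/
theorem comm_odd {p : ℤ} {x : E.carrier n} (h : Odd p) (hx : x ∈ E.deg n p) (y : E.carrier n) :
    x * y = E.tau n y * x := by
  induction y using E.hom_ind with
  | add x x' hx hx' => simp only [mul_add, add_mul, hx, hx', map_add]
  | hom q y hy =>
    rw [E.mul_comm hx hy]
    rcases Int.even_or_odd q with hq | hq
    · rw [E.tau_even hq hy, negOnePow_smul_even (hq.mul_left p)]
    · rw [E.tau_odd hq hy, negOnePow_smul_odd (h.mul hq), neg_mul]

theorem lam_comm (w : WittLen n A) (y : E.carrier n) : E.lam w * y = y * E.lam w :=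
  E.comm_even (by decide) (E.lam_mem w) y

@[simp] theorem d_one : E.d (1 : E.carrier n) = 0 := by
  have h := E.leibniz (n := n) 1 1
  simpa using h

@[simp] theorem d_natCast_mul (m : ℕ) (x : E.carrier n) :
    E.d ((m : E.carrier n) * x) = m * E.d x := by
  rw [← nsmul_eq_mul, ← nsmul_eq_mul, map_nsmul]

theorem lam_neg_one_sq :
    E.lam (WittLen.teich n (-1)) * E.lam (WittLen.teich n (-1)) = 1 := by
  rw [← map_mul, ← WittLen.teich_mul, neg_mul_neg, one_mul, WittLen.teich_one, map_one]

theorem eta_eq : E.eta n = E.lam (WittLen.teich n (-1)) * E.d (E.lam (WittLen.teich n (-1))) := by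
  have : Ring.inverse (E.lam (WittLen.teich n (-1))) = E.lam (WittLen.teich n (-1)) :=
    Ring.inverse_unit (⟨_, _, E.lam_neg_one_sq, E.lam_neg_one_sq⟩ : (E.carrier n)ˣ)
  rw [PreWittComplex.eta, this]

theorem eta_mem : E.eta n ∈ E.deg n 1 := by
  rw [eta_eq]
  exact E.mul_mem (E.lam_mem _) (E.d_mem (E.lam_mem _))

-- Differentiating `[-1]² = 1` gives `2[-1]d[-1] = 0`.
@[simp] theorem two_eta : 2 * E.eta n = 0 := by
  have h := congrArg E.d (E.lam_neg_one_sq (n := n))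
  rw [leibniz, tau_lam, ← lam_comm, d_one, ← two_mul] at h
  rw [eta_eq, h]

@[simp] theorem eta_add_eta : E.eta n + E.eta n = 0 := by rw [← two_mul, two_eta]

@[simp] theorem neg_eta : -E.eta n = E.eta n := neg_eq_of_add_eq_zero_left E.eta_add_eta

@[simp] theorem tau_eta : E.tau n (E.eta n) = E.eta n := by
  rw [E.tau_odd (by decide) E.eta_mem, neg_eta]

/-- The sign from graded commutativity is absorbed by `-η = η`. -/
theorem eta_comm (x : E.carrier n) : E.eta n * x = x * E.eta n := by
  induction x using E.hom_ind with
  | add x x' hx hx' => simp only [mul_add, add_mul, hx, hx']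
  | hom q y hy =>
    rw [E.mul_comm E.eta_mem hy]
    rcases Int.even_or_odd q with hq | hq
    · rw [negOnePow_smul_even (by simpa using hq)]
    · rw [negOnePow_smul_odd (by simpa using hq), ← mul_neg, neg_eta]

theorem eta_tau (x : E.carrier n) : E.eta n * E.tau n x = E.eta n * x := by
  rw [eta_comm E x, E.comm_odd (by decide) E.eta_mem, tau_tau]

@[simp] theorem R_eta : E.R (E.eta (n + 1)) = E.eta n := by
  rw [eta_eq, map_mul, E.R_d, E.R_lam, WittLen.R_teich, ← eta_eq]

-- Here `F[-1] = [-1]² = 1` and `Fd[-1] = [-1]d[-1]`, so `F` carries `[-1]d[-1]` to `[-1]d[-1]`.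
@[simp] theorem F_eta : E.F (E.eta (n + 1)) = E.eta n := by
  rw [eta_eq, map_mul, E.F_d_lam, ← E.lam_F, WittLen.F_teich, map_mul, lam_neg_one_sq, one_mul,
    ← eta_eq]

theorem mul_V (y : E.carrier (n + 1)) (x : E.carrier n) : y * E.V x = E.V (E.F y * x) := by
  induction y using E.hom_ind with
  | add x x' hx hx' => simp only [map_add, add_mul, hx, hx']
  | hom q y hy =>
    rcases Int.even_or_odd q with hq | hq
    · rw [E.comm_even hq hy, E.V_mul, E.comm_even hq (E.F_mem hy)]
    · rw [E.comm_odd hq hy, E.comm_odd hq (E.F_mem hy), E.tau_V, E.V_mul]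

theorem V_eta_mul (x : E.carrier n) : E.V (E.eta n * x) = E.eta (n + 1) * E.V x := by
  rw [E.mul_V, F_eta]

theorem F_dV (x : E.carrier n) : E.F (E.d (E.V x)) = E.d x + E.eta n * x := E.F_d_V x

theorem d_d' (x : E.carrier n) : E.d (E.d x) = E.eta n * E.d x := (E.d_d x).trans (E.d_iota x)

theorem d_eta_mul (x : E.carrier n) : E.d (E.eta n * x) = E.eta n * E.d x := E.d_iota x

@[simp] theorem d_eta : E.d (E.eta n) = 0 := by
  have := E.d_eta_mul (n := n) 1
  simpa using this

theorem V_F (y : E.carrier (n + 1)) : E.V (E.F y) = E.V 1 * y := by rw [E.V_mul, one_mul]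

theorem V_one_mul_V (x : E.carrier n) : E.V 1 * E.V x = 2 * E.V x := by
  rw [E.V_mul, E.F_V, one_mul, two_mul, two_mul, map_add]

theorem tau_V_one : E.tau (n + 1) (E.V (1 : E.carrier n)) = E.V 1 := by rw [tau_V, map_one]

/-- Apply `V` to `FdV(x) = dx + ηx`: the result is `V(1)dV(x) = V(dx) + V(ηx)`. Differentiating
`V(1)V(x) = 2V(x)` gives `2dV(x) = V(ηx) + V(1)dV(x)`. The two differ by `2V(ηx) = 0`. -/
theorem V_d (x : E.carrier n) : E.V (E.d x) = 2 * E.d (E.V x) := by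
  have h1 : E.V (E.d x) = E.V 1 * E.d (E.V x) - E.V (E.eta n * x) := by
    rw [← V_F, F_dV, map_add, add_sub_cancel_right]
  have h2 := congrArg E.d (E.V_one_mul_V x)
  rw [leibniz, tau_V_one, mul_V, F_dV, d_one, zero_add, mul_one, two_mul, map_add, ← two_mul] at h2
  have h3 : E.V (E.eta n * x) + E.V (E.eta n * x) = 0 := by
    rw [← map_add, ← add_mul, eta_add_eta, zero_mul, map_zero]
  rw [h1, ← h2]
  have h4 : E.V (E.eta n * x) = - E.V (E.eta n * x) := eq_neg_of_add_eq_zero_left h3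
  conv_rhs => rw [h4]
  exact sub_eq_neg_add _ _

/-- Compute `FdV(F(x))` twice: by the axiom it is `dF(x) + ηF(x)`, and by `V(F(x)) = V(1)x` with the
Leibniz rule it is `ηF(x) + 2F(dx)`. -/
theorem d_F (x : E.carrier (n + 1)) : E.d (E.F x) = 2 * E.F (E.d x) := by
  have h := E.F_dV (E.F x)
  rw [V_F, leibniz, map_add, map_mul, F_dV, tau_V_one, map_mul, E.F_V, d_one, zero_add, mul_one,
    mul_one, add_comm] at h
  exact (add_right_cancel h).symm

theorem two_mul_eta_mul (x : E.carrier n) : 2 * (E.eta n * x) = 0 := by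
  rw [← mul_assoc, two_eta, zero_mul]

theorem two_mul_d_d (x : E.carrier n) : 2 * E.d (E.d x) = 0 := by
  rw [d_d', two_mul_eta_mul]

theorem lam_teich_neg_one :
    E.lam (WittLen.teich (n + 1) (-1)) = -1 + E.V (1 : E.carrier n) := by
  rw [WittLen.teich, WittVector.teichmuller_neg_one, map_add, map_neg, map_one, map_add, map_neg,
    map_one, ← WittLen.V_proj, E.lam_V, map_one, map_one]

/-- As `V(1) = [-1] + 1`, its differential is `d[-1] = [-1]η = (-1 + V(1))η`, and `-η = η`. -/
theorem d_V_one : E.d (E.V (1 : E.carrier n)) = E.eta (n + 1) + E.eta (n + 1) * E.V 1 := by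
  have h := E.lam_teich_neg_one (n := n)
  have h2 := congrArg E.d h
  rw [map_add, map_neg, d_one, neg_zero, zero_add] at h2
  have h3 : E.d (E.lam (WittLen.teich (n + 1) (-1))) =
      E.lam (WittLen.teich (n + 1) (-1)) * E.eta (n + 1) := by
    rw [eta_eq, ← mul_assoc, lam_neg_one_sq, one_mul]
  rw [← h2, h3, h, add_mul, neg_one_mul, neg_eta, eta_comm]

end WittComplex

/-! ### Iterates of `V` and `F`, and the vanishing of `η²`. -/

namespace WittComplex

variable {A : Type u} [CommRing A] (E : WittComplex.{u, v} A)

theorem Vpow_succ {r i n : ℕ} (h : i + r = n) (x : E.carrier i) :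
    E.Vpow (r + 1) (by omega : i + (r + 1) = n + 1) x = E.V (E.Vpow r h x) := by
  subst h; rfl

theorem Fpow_succ {r i n : ℕ} (h : i + r = n) (x : E.carrier (n + 1)) :
    E.Fpow (r + 1) (by omega : i + (r + 1) = n + 1) x = E.Fpow r h (E.F x) := by
  subst h; rfl

theorem Vpow_one {n : ℕ} (x : E.carrier n) : E.Vpow 1 rfl x = E.V x := rfl

theorem Vpow_V {r i n : ℕ} (h : i + 1 + r = n) (x : E.carrier i) :
    E.Vpow r h (E.V x) = E.Vpow (r + 1) (by omega) x := by
  induction r generalizing n with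
  | zero => subst h; rfl
  | succ r ih =>
    obtain ⟨m, rfl⟩ : ∃ m, n = m + 1 := ⟨n - 1, by omega⟩
    rw [Vpow_succ E (by omega : i + 1 + r = m), ih, ← Vpow_succ]

theorem Vpow_mul {r i n : ℕ} (h : i + r = n) (x : E.carrier i) (y : E.carrier n) :
    E.Vpow r h x * y = E.Vpow r h (x * E.Fpow r h y) := by
  induction r generalizing n with
  | zero => subst h; rfl
  | succ r ih =>
    obtain ⟨m, rfl⟩ : ∃ m, n = m + 1 := ⟨n - 1, by omega⟩
    have h' : i + r = m := by omega
    rw [Vpow_succ E h', Vpow_succ E h', Fpow_succ E h', E.V_mul, ih]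

theorem mul_Vpow {r i n : ℕ} (h : i + r = n) (x : E.carrier i) (y : E.carrier n) :
    y * E.Vpow r h x = E.Vpow r h (E.Fpow r h y * x) := by
  induction r generalizing n with
  | zero => subst h; rfl
  | succ r ih =>
    obtain ⟨m, rfl⟩ : ∃ m, n = m + 1 := ⟨n - 1, by omega⟩
    have h' : i + r = m := by omega
    rw [Vpow_succ E h', Vpow_succ E h', Fpow_succ E h', E.mul_V, ih]

theorem Vpow_mem {r i n : ℕ} (h : i + r = n) {q : ℤ} {x : E.carrier i} (hx : x ∈ E.deg i q) :
    E.Vpow r h x ∈ E.deg n q := by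
  induction r generalizing n with
  | zero => subst h; exact hx
  | succ r ih =>
    obtain ⟨m, rfl⟩ : ∃ m, n = m + 1 := ⟨n - 1, by omega⟩
    have h' : i + r = m := by omega
    rw [Vpow_succ E h']; exact E.V_mem (ih h')

theorem tau_Vpow {r i n : ℕ} (h : i + r = n) (x : E.carrier i) :
    E.tau n (E.Vpow r h x) = E.Vpow r h (E.tau i x) := by
  induction r generalizing n with
  | zero => subst h; rfl
  | succ r ih =>
    obtain ⟨m, rfl⟩ : ∃ m, n = m + 1 := ⟨n - 1, by omega⟩
    have h' : i + r = m := by omega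
    rw [Vpow_succ E h', Vpow_succ E h', E.tau_V, ih]

theorem tau_Fpow {r i n : ℕ} (h : i + r = n) (x : E.carrier n) :
    E.tau i (E.Fpow r h x) = E.Fpow r h (E.tau n x) := by
  induction r generalizing n with
  | zero => subst h; rfl
  | succ r ih =>
    obtain ⟨m, rfl⟩ : ∃ m, n = m + 1 := ⟨n - 1, by omega⟩
    have h' : i + r = m := by omega
    rw [Fpow_succ E h', Fpow_succ E h', ih, E.tau_F]

theorem R_Vpow {r i n : ℕ} (h : i + r = n) (x : E.carrier (i + 1)) :
    E.R (E.Vpow r (by omega : i + 1 + r = n + 1) x) = E.Vpow r h (E.R x) := by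
  induction r generalizing n with
  | zero => subst h; rfl
  | succ r ih =>
    obtain ⟨m, rfl⟩ : ∃ m, n = m + 1 := ⟨n - 1, by omega⟩
    have h' : i + r = m := by omega
    rw [Vpow_succ E h', ← ih, ← E.R_V, ← E.Vpow_succ]

@[simp] theorem Fpow_eta {r i n : ℕ} (h : i + r = n) : E.Fpow r h (E.eta n) = E.eta i := by
  induction r generalizing n with
  | zero => subst h; rfl
  | succ r ih =>
    obtain ⟨m, rfl⟩ : ∃ m, n = m + 1 := ⟨n - 1, by omega⟩
    have h' : i + r = m := by omega
    rw [Fpow_succ E h', F_eta, ih]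

theorem Vpow_eta_mul {r i n : ℕ} (h : i + r = n) (x : E.carrier i) :
    E.Vpow r h (E.eta i * x) = E.eta n * E.Vpow r h x := by
  rw [mul_Vpow, Fpow_eta]

theorem two_pow_mul_map {G : ℕ → Type*} [∀ n, Ring (G n)] {i n : ℕ} (f : G i →+ G n) (r : ℕ)
    (x : G i) : f (2 ^ r * x) = 2 ^ r * f x := by
  have h : (2 : ℕ) ^ r • x = 2 ^ r * x := by rw [nsmul_eq_mul]; push_cast; rfl
  have h' : (2 : ℕ) ^ r • f x = 2 ^ r * f x := by rw [nsmul_eq_mul]; push_cast; rfl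
  rw [← h, map_nsmul, h']

theorem Vpow_d {r i n : ℕ} (h : i + r = n) (x : E.carrier i) :
    E.Vpow r h (E.d x) = 2 ^ r * E.d (E.Vpow r h x) := by
  induction r generalizing n with
  | zero => subst h; rw [pow_zero, one_mul]; rfl
  | succ r ih =>
    obtain ⟨m, rfl⟩ : ∃ m, n = m + 1 := ⟨n - 1, by omega⟩
    have h' : i + r = m := by omega
    rw [Vpow_succ E h', Vpow_succ E h', ih, two_pow_mul_map, V_d, ← mul_assoc, ← pow_succ]

theorem d_Fpow {r i n : ℕ} (h : i + r = n) (x : E.carrier n) :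
    E.d (E.Fpow r h x) = 2 ^ r * E.Fpow r h (E.d x) := by
  induction r generalizing n with
  | zero => subst h; rw [pow_zero, one_mul]; rfl
  | succ r ih =>
    obtain ⟨m, rfl⟩ : ∃ m, n = m + 1 := ⟨n - 1, by omega⟩
    have h' : i + r = m := by omega
    rw [Fpow_succ E h', Fpow_succ E h', ih, d_F, map_mul, ← mul_assoc, map_ofNat, ← pow_succ]

theorem Fpow_Vpow {r i n : ℕ} (h : i + r = n) (x : E.carrier i) :
    E.Fpow r h (E.Vpow r h x) = 2 ^ r * x := by
  induction r generalizing n with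
  | zero => subst h; rw [pow_zero, one_mul]; rfl
  | succ r ih =>
    obtain ⟨m, rfl⟩ : ∃ m, n = m + 1 := ⟨n - 1, by omega⟩
    have h' : i + r = m := by omega
    rw [Fpow_succ E h', Vpow_succ E h', E.F_V, map_mul, ih, ← mul_assoc, map_ofNat, pow_succ']

/-- Each further application of `FdV = d + ι` adds a term `η` times a positive power of 2, which is
zero. So `η` occurs only once, whatever `r > 0` is. -/
theorem Fpow_d_Vpow {r i n : ℕ} (h : i + r = n) (hr : 0 < r) (x : E.carrier i) :
    E.Fpow r h (E.d (E.Vpow r h x)) = E.d x + E.eta i * x := by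
  obtain ⟨r, rfl⟩ : ∃ s, r = s + 1 := ⟨r - 1, by omega⟩
  induction r generalizing n with
  | zero => subst h; exact E.F_dV x
  | succ r ih =>
    obtain ⟨m, rfl⟩ : ∃ m, n = m + 1 := ⟨n - 1, by omega⟩
    have h' : i + (r + 1) = m := by omega
    have h0 : E.eta i * (2 ^ (r + 1) * x) = 0 := by
      rw [pow_succ', mul_assoc, ← mul_assoc, E.eta_comm, two_eta, zero_mul]
    rw [Fpow_succ E h', Vpow_succ E h', F_dV, map_add, map_mul, Fpow_eta, ih h' (by omega),
      Fpow_Vpow, h0, add_zero]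

theorem Vpow_congr {r r' i n : ℕ} (h : i + r = n) (hr : r = r') (x : E.carrier i) :
    E.Vpow r h x = E.Vpow r' (by omega) x := by subst hr; rfl

theorem Vpow_Vpow {r t i m n : ℕ} (h : i + t = m) (h' : m + r = n) (x : E.carrier i) :
    E.Vpow r h' (E.Vpow t h x) = E.Vpow (r + t) (by omega) x := by
  induction r generalizing n with
  | zero => subst h'; exact E.Vpow_congr h (by omega) x
  | succ r ih =>
    obtain ⟨k, rfl⟩ : ∃ m, n = m + 1 := ⟨n - 1, by omega⟩
    rw [Vpow_succ E (by omega : m + r = k), ih, ← Vpow_succ E (by omega : i + (r + t) = k)]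
    exact E.Vpow_congr _ (by omega) x

theorem d_Vpow_d {r i n : ℕ} (h : i + r = n) (hr : 0 < r) (x : E.carrier i) :
    E.d (E.Vpow r h (E.d x)) = 0 := by
  obtain ⟨r, rfl⟩ : ∃ s, r = s + 1 := ⟨r - 1, by omega⟩
  rw [Vpow_d, two_pow_mul_map, pow_succ, mul_assoc, two_mul_d_d, mul_zero]

/-- From `dV(1) = η + ηV(1)` one gets `η = dV(1) - V(η)`. The operator `dV^(r+1)` kills the exact
term, and the other term has its `η` one level lower. The descent ends at level 0, where everything
vanishes. -/
theorem d_Vpow_eta {i : ℕ} : ∀ {r n : ℕ} (h : i + (r + 1) = n), E.d (E.Vpow (r + 1) h (E.eta i)) = 0 := by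
  induction i with
  | zero =>
    intro r n h
    have := E.level_zero
    rw [Subsingleton.elim (E.eta 0) 0, map_zero, map_zero]
  | succ i ih =>
    intro r n h
    have h1 : E.eta (i + 1) = E.d (E.V (1 : E.carrier i)) - E.V (E.eta i) := by
      rw [d_V_one, ← mul_one (E.eta i), V_eta_mul, add_sub_cancel_right]
    rw [h1, map_sub, map_sub, d_Vpow_d E h (by omega), Vpow_V, ih, sub_zero]

-- `0 = dV(η) = d(ηV(1)) = η(η + ηV(1)) = η² + V(F(η²))`, and the last term vanishes by induction on
-- the level.
@[simp] theorem eta_mul_eta {n : ℕ} : E.eta n * E.eta n = 0 := by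
  induction n with
  | zero => have := E.level_zero; exact Subsingleton.elim _ _
  | succ n ih =>
    have h := E.d_Vpow_eta (i := n) (r := 0) rfl
    have h0 : E.eta (n + 1) * E.eta (n + 1) * E.V (1 : E.carrier n) = 0 := by
      rw [mul_V, map_mul E.F, F_eta, ih, zero_mul, map_zero]
    rwa [Vpow_one, ← mul_one (E.eta n), V_eta_mul, d_eta_mul, d_V_one, mul_add, ← mul_assoc, h0,
      add_zero] at h

end WittComplex

/-! ### Polynomials over noncommutative rings, and twisted products of pairs. -/

/-- The additive map `R[X] → G` with value `f j a` at `aX^j`. -/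
noncomputable def Polynomial.liftAdd {R G : Type*} [Semiring R] [AddCommMonoid G]
    (f : ℕ → R →+ G) : R[X] →+ G where
  toFun p := p.sum fun j a => f j a
  map_zero' := Polynomial.sum_zero_index _
  map_add' p q := Polynomial.sum_add_index p q _ (fun _ => map_zero _) (fun _ _ _ => map_add _ _ _)

@[simp] theorem Polynomial.liftAdd_monomial {R G : Type*} [Semiring R] [AddCommMonoid G]
    (f : ℕ → R →+ G) (j : ℕ) (a : R) : liftAdd f (monomial j a) = f j a :=
  Polynomial.sum_monomial_index a _ (map_zero _)

/-- The additive map `R[X] → S[X]` that applies `f` to the coefficients. -/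
noncomputable def Polynomial.mapAdd {R S : Type*} [Semiring R] [Semiring S]
    (f : R →+ S) : R[X] →+ S[X] :=
  liftAdd fun j => (monomial j).toAddMonoidHom.comp f

@[simp] theorem Polynomial.mapAdd_monomial {R S : Type*} [Semiring R] [Semiring S]
    (f : R →+ S) (j : ℕ) (a : R) : mapAdd f (monomial j a) = monomial j (f a) :=
  liftAdd_monomial _ j a

/-- The pair `(a, b)` stands for `a + b·dX` with the rules `dX·a = t(a)dX` and `dX·dX = w·dX`; later
`w = ηX`. Terms containing `w` are insensitive to `t`, which is why the two bracketings agree. -/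
theorem twisted_mul_assoc {S : Type*} [Ring S] (t : S →+* S) (w : S) (htt : ∀ a, t (t a) = a)
    (hwt : ∀ a, w * t a = w * a) (hc : ∀ a, a * w = w * a) (htw : t w = w)
    (a b a' b' a'' b'' : S) :
    a * a' * b'' + (a * b' + b * t a' + w * (b * t b')) * t a''
        + w * ((a * b' + b * t a' + w * (b * t b')) * t b'') =
      a * (a' * b'' + b' * t a'' + w * (b' * t b'')) + b * t (a' * a'')
        + w * (b * t (a' * b'' + b' * t a'' + w * (b' * t b''))) := by
  have h1 : ∀ x y, x * (w * y) = w * (x * y) := fun x y => by rw [← mul_assoc, hc, mul_assoc]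
  have h2 : ∀ x y, w * (x * t y) = w * (x * y) := fun x y => by rw [← h1, hwt, h1]
  have h3 : ∀ x y z, w * (x * (t y * z)) = w * (x * (y * z)) := fun x y z => by
    have e : t y * z = t (y * t z) := by rw [map_mul, htt]
    rw [e, h2, ← mul_assoc x, h2, mul_assoc x]
  have h4 : ∀ x y z, w * (x * (y * t z)) = w * (x * (y * z)) := fun x y z => by
    rw [← mul_assoc x, h2, mul_assoc]
  simp only [map_add, map_mul, htw, htt, mul_add, add_mul, mul_assoc, h1 a, h1 b, h1 (t _), h2, h3, h4]
  abel

/-- The second component of the Leibniz rule for `a + b·dX`. The map `δ` differentiates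
coefficients, `D` is the derivative in `X`, and the terms `wD(b)` and `eb` come from `dX·dX = w·dX`
and `ddX = e·dX`. -/
theorem twisted_leibniz {S : Type*} [Ring S] (t : S →+* S) (w e : S) (D δ : S →+ S)
    (htt : ∀ a, t (t a) = a) (hwt : ∀ a, w * t a = w * a) (hc : ∀ a, a * w = w * a)
    (het : ∀ a, e * t a = e * a) (hce : ∀ a, a * e = e * a) (hwn : ∀ a, -(w * a) = w * a)
    (hwe : ∀ a, w * (e * a) = 0) (hww : ∀ a, w * (w * a) = 0) (hew : ∀ a, e * (w * a) = 0)
    (hen : ∀ a, -(e * a) = e * a) (htw : t w = w) (hte : t e = e)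
    (hδ : ∀ a b, δ (a * b) = δ a * b + t a * δ b) (hD : ∀ a b, D (a * b) = D a * b + a * D b)
    (hδw : δ w = 0) (hDw : D w = e)
    (hDt : ∀ a, D (t a) = t (D a)) (htδ : ∀ a, t (δ a) = - δ (t a))
    (a b a' b' : S) :
    t (D (a * a')) + δ (a * b' + b * t a' + w * (b * t b')) +
        w * D (a * b' + b * t a' + w * (b * t b')) + e * (a * b' + b * t a' + w * (b * t b')) =
      (δ a * b' + (t (D a) + δ b + w * D b + e * b) * t a'
        + w * ((t (D a) + δ b + w * D b + e * b) * t b')) +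
      (t a * (t (D a') + δ b' + w * D b' + e * b') + -t b * t (δ a')
        + w * (-t b * t (t (D a') + δ b' + w * D b' + e * b'))) := by
  have h1 : ∀ x y, x * (w * y) = w * (x * y) := fun x y => by rw [← mul_assoc, hc, mul_assoc]
  have h1' : ∀ x y, x * (e * y) = e * (x * y) := fun x y => by rw [← mul_assoc, hce, mul_assoc]
  have h2 : ∀ x y, w * (x * t y) = w * (x * y) := fun x y => by rw [← h1, hwt, h1]
  have h3 : ∀ x y, w * (t x * y) = w * (x * y) := fun x y => by
    have e : t x * y = t (x * t y) := by rw [map_mul, htt]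
    rw [e, hwt, h2]
  have h2' : ∀ x y, e * (x * t y) = e * (x * y) := fun x y => by rw [← h1', het, h1']
  have h3' : ∀ x y, e * (t x * y) = e * (x * y) := fun x y => by
    have e : t x * y = t (x * t y) := by rw [map_mul, htt]
    rw [e, het, h2']
  have h4 : ∀ x y, w * (x * δ (t y)) = w * (x * δ y) := fun x y => by
    rw [← h2 x (δ y), htδ, mul_neg, mul_neg, hwn]
  simp only [map_add, map_mul, htw, hte, htt, hδ, hD, hδw, hDw, hDt, htδ, mul_add, add_mul, mul_assoc, zero_mul,
    zero_add,
    neg_mul, mul_neg, neg_neg, hwe, hww, hew, hwn, hen, h1 (t _), h1 b, h1' (t _), h1' b,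
    h2, h3, h2', h3', h4, hwt, het, add_zero, mul_zero]
  abel

/-! ### The ring of integral elements (types 1 and 2) with its differential. -/

namespace WittComplex

variable {A : Type u} [CommRing A] (E : WittComplex.{u, v} A)

theorem isUnit_natCast [Algebra ZLocTwo A] {n M : ℕ} (hM : Odd M) : IsUnit (M : E.carrier n) := by
  have := (WittLen.isUnit_natCast n M (isUnit_natCast_of_odd (A := A) hM)).map E.lam
  rwa [map_natCast] at this

/-- The part of level `n` of the formal sums that consists of elements of type 1 and 2. -/
def IntPart (E : WittComplex.{u, v} A) (n : ℕ) : Type v := (E.carrier n)[X] × (E.carrier n)[X]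

namespace IntPart

variable {E} {n : ℕ}

noncomputable instance : AddCommGroup (IntPart E n) :=
  inferInstanceAs (AddCommGroup ((E.carrier n)[X] × (E.carrier n)[X]))

@[ext] theorem ext {x y : IntPart E n} (h1 : x.1 = y.1) (h2 : x.2 = y.2) : x = y := Prod.ext h1 h2

/-- The involution on the coefficients of a polynomial. -/
noncomputable def tp : (E.carrier n)[X] →+* (E.carrier n)[X] := Polynomial.mapRingHom (E.tau n)

/-- The differential on the coefficients of a polynomial. -/
noncomputable def dp : (E.carrier n)[X] →+ (E.carrier n)[X] := Polynomial.mapAdd E.d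

/-- The element `η[X]`. -/
noncomputable def wp : (E.carrier n)[X] := monomial 1 (E.eta n)

/-- The element `η`. -/
noncomputable def ep : (E.carrier n)[X] := C (E.eta n)

@[simp] theorem tp_monomial (j : ℕ) (a : E.carrier n) :
    tp (monomial j a) = monomial j (E.tau n a) := Polynomial.map_monomial _

@[simp] theorem dp_monomial (j : ℕ) (a : E.carrier n) :
    dp (monomial j a) = monomial j (E.d a) := Polynomial.mapAdd_monomial _ _ _

@[simp] theorem tp_tp (p : (E.carrier n)[X]) : tp (tp p) = p := by
  induction p using Polynomial.induction_on' with
  | add p q hp hq => simp only [map_add, hp, hq]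
  | monomial k a => simp

theorem tp_dp (p : (E.carrier n)[X]) : tp (dp p) = - dp (tp p) := by
  induction p using Polynomial.induction_on' with
  | add p q hp hq => simp only [map_add, hp, hq, neg_add]
  | monomial k a => simp [E.tau_d]

theorem dp_mul (p q : (E.carrier n)[X]) : dp (p * q) = dp p * q + tp p * dp q := by
  induction p using Polynomial.induction_on' with
  | add p p' hp hp' => simp only [map_add, add_mul, hp, hp']; abel
  | monomial k a =>
    induction q using Polynomial.induction_on' with
    | add q q' hq hq' => simp only [map_add, mul_add, hq, hq']; abel
    | monomial l b => simp [monomial_mul_monomial, E.leibniz]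

theorem wp_tp (p : (E.carrier n)[X]) : wp * tp p = wp * p := by
  induction p using Polynomial.induction_on' with
  | add p p' hp hp' => simp only [map_add, mul_add, hp, hp']
  | monomial k a => simp [wp, monomial_mul_monomial, E.eta_tau]

theorem wp_comm (p : (E.carrier n)[X]) : p * wp = wp * p := by
  induction p using Polynomial.induction_on' with
  | add p p' hp hp' => simp only [add_mul, mul_add, hp, hp']
  | monomial k a => simp [wp, monomial_mul_monomial, E.eta_comm, add_comm]

theorem ep_tp (p : (E.carrier n)[X]) : ep * tp p = ep * p := by
  induction p using Polynomial.induction_on' with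
  | add p p' hp hp' => simp only [map_add, mul_add, hp, hp']
  | monomial k a => simp [ep, C_mul_monomial, E.eta_tau]

theorem ep_comm (p : (E.carrier n)[X]) : p * ep = ep * p := by
  induction p using Polynomial.induction_on' with
  | add p p' hp hp' => simp only [add_mul, mul_add, hp, hp']
  | monomial k a => simp [ep, C_mul_monomial, monomial_mul_C, E.eta_comm]

theorem wp_neg (p : (E.carrier n)[X]) : - (wp * p) = wp * p := by
  rw [← neg_mul, wp, ← map_neg, neg_eta]

theorem ep_neg (p : (E.carrier n)[X]) : - (ep * p) = ep * p := by
  rw [← neg_mul, ep, ← map_neg, neg_eta]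

theorem tp_wp : tp (wp : (E.carrier n)[X]) = wp := by simp [wp]

theorem tp_ep : tp (ep : (E.carrier n)[X]) = ep := by
  rw [ep, ← monomial_zero_left, tp_monomial, tau_eta]

theorem wp_wp (p : (E.carrier n)[X]) : wp * (wp * p) = 0 := by
  rw [← mul_assoc, wp, monomial_mul_monomial, eta_mul_eta, map_zero, zero_mul]

theorem wp_ep (p : (E.carrier n)[X]) : wp * (ep * p) = 0 := by
  rw [← mul_assoc, wp, ep, monomial_mul_C, eta_mul_eta, map_zero, zero_mul]

theorem ep_wp (p : (E.carrier n)[X]) : ep * (wp * p) = 0 := by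
  rw [← mul_assoc, wp, ep, C_mul_monomial, eta_mul_eta, map_zero, zero_mul]

theorem ep_ep (p : (E.carrier n)[X]) : ep * (ep * p) = 0 := by
  rw [← mul_assoc, ep, ← C_mul, eta_mul_eta, map_zero, zero_mul]

theorem dp_wp : dp (wp : (E.carrier n)[X]) = 0 := by
  rw [wp, dp_monomial, d_eta, map_zero]

theorem derivative_wp : derivative (wp : (E.carrier n)[X]) = ep := by
  rw [wp, derivative_monomial, ep]; simp

theorem derivative_tp (p : (E.carrier n)[X]) : derivative (tp p) = tp (derivative p) :=
  Polynomial.derivative_map p _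

theorem derivative_dp (p : (E.carrier n)[X]) : derivative (dp p) = dp (derivative p) := by
  induction p using Polynomial.induction_on' with
  | add p q hp hq => simp only [map_add, hp, hq]
  | monomial k a =>
    rw [dp_monomial, derivative_monomial, derivative_monomial, dp_monomial, ← Nat.cast_comm,
      ← Nat.cast_comm, d_natCast_mul]

theorem dp_dp (p : (E.carrier n)[X]) : dp (dp p) = ep * dp p := by
  induction p using Polynomial.induction_on' with
  | add p q hp hq => simp only [map_add, hp, hq, mul_add]
  | monomial k a => simp [ep, C_mul_monomial, d_d']

noncomputable instance : Mul (IntPart E n) where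
  mul x y := (x.1 * y.1, x.1 * y.2 + x.2 * tp y.1 + wp * (x.2 * tp y.2))

noncomputable instance : One (IntPart E n) where
  one := (1, 0)

theorem mul_fst (x y : IntPart E n) : (x * y).1 = x.1 * y.1 := rfl
theorem mul_snd (x y : IntPart E n) :
    (x * y).2 = x.1 * y.2 + x.2 * tp y.1 + wp * (x.2 * tp y.2) := rfl
theorem one_fst : (1 : IntPart E n).1 = 1 := rfl
theorem one_snd : (1 : IntPart E n).2 = 0 := rfl
theorem add_fst (x y : IntPart E n) : (x + y).1 = x.1 + y.1 := rfl
theorem add_snd (x y : IntPart E n) : (x + y).2 = x.2 + y.2 := rfl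
theorem zero_fst : (0 : IntPart E n).1 = 0 := rfl
theorem zero_snd : (0 : IntPart E n).2 = 0 := rfl

noncomputable instance : Ring (IntPart E n) :=
  { (inferInstance : AddCommGroup (IntPart E n)), (inferInstance : Mul (IntPart E n)),
    (inferInstance : One (IntPart E n)) with
    left_distrib := fun x y z => by
      ext1
      · simp only [mul_fst, add_fst, mul_add]
      · simp only [mul_fst, mul_snd, add_fst, add_snd, mul_add, map_add]; abel
    right_distrib := fun x y z => by
      ext1
      · simp only [mul_fst, add_fst, add_mul]
      · simp only [mul_fst, mul_snd, add_fst, add_snd, add_mul, mul_add, map_add]; abel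
    zero_mul := fun x => by
      ext1
      · simp only [mul_fst, zero_fst, zero_mul]
      · simp only [mul_snd, zero_fst, zero_snd, zero_mul, mul_zero, add_zero]
    mul_zero := fun x => by
      ext1
      · simp only [mul_fst, zero_fst, mul_zero]
      · simp only [mul_snd, zero_fst, zero_snd, map_zero, mul_zero, add_zero]
    one_mul := fun x => by
      ext1
      · simp only [mul_fst, one_fst, one_mul]
      · simp only [mul_snd, one_fst, one_snd, one_mul, zero_mul, mul_zero, add_zero]
    mul_one := fun x => by
      ext1
      · simp only [mul_fst, one_fst, mul_one]
      · simp only [mul_snd, one_fst, one_snd, map_zero, map_one, mul_one, mul_zero, add_zero,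
          zero_add]
    mul_assoc := fun x y z => by
      ext1
      · simp only [mul_fst, mul_assoc]
      · exact twisted_mul_assoc tp wp tp_tp wp_tp wp_comm tp_wp _ _ _ _ _ _ }

/-- The element with the given parts of type 1 and 2. -/
def mk (p q : (E.carrier n)[X]) : IntPart E n := (p, q)

theorem mk_fst (p q : (E.carrier n)[X]) : (mk p q).1 = p := rfl
theorem mk_snd (p q : (E.carrier n)[X]) : (mk p q).2 = q := rfl

/-- The involution of `IntPart E n`. -/
noncomputable def tau : IntPart E n →+* IntPart E n where
  toFun x := mk (tp x.1) (- tp x.2)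
  map_zero' := by ext1 <;> simp [zero_fst, zero_snd, mk_fst, mk_snd]
  map_one' := by ext1 <;> simp [one_fst, one_snd, mk_fst, mk_snd]
  map_add' x y := by ext1 <;> simp [add_fst, add_snd, mk_fst, mk_snd, add_comm]
  map_mul' x y := by
    ext1
    · simp [mul_fst, mk_fst]
    · have h : wp * (tp x.2 * y.2) = wp * (x.2 * tp y.2) := by
        rw [← tp_tp y.2, ← map_mul, wp_tp, tp_tp]
      simp only [mul_snd, mk_fst, mk_snd, map_add, map_mul, tp_tp, tp_wp, map_neg, mul_neg, neg_mul,
        neg_neg, neg_add, h, wp_neg]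

theorem tau_fst (x : IntPart E n) : (tau x).1 = tp x.1 := rfl
theorem tau_snd (x : IntPart E n) : (tau x).2 = - tp x.2 := rfl

/-- The differential of `IntPart E n`. -/
noncomputable def d : IntPart E n →+ IntPart E n where
  toFun x := mk (dp x.1) (tp (derivative x.1) + dp x.2 + wp * derivative x.2 + ep * x.2)
  map_zero' := by ext1 <;> simp [zero_fst, zero_snd, mk_fst, mk_snd]
  map_add' x y := by
    ext1
    · simp [add_fst, mk_fst]
    · simp only [add_fst, add_snd, mk_snd, map_add, mul_add]; abel

theorem d_fst (x : IntPart E n) : (d x).1 = dp x.1 := rfl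
theorem d_snd (x : IntPart E n) :
    (d x).2 = tp (derivative x.1) + dp x.2 + wp * derivative x.2 + ep * x.2 := rfl

theorem d_mul (x y : IntPart E n) : d (x * y) = d x * y + tau x * d y := by
  ext1
  · simp only [mul_fst, add_fst, d_fst, tau_fst, dp_mul]
  · exact twisted_leibniz tp wp ep derivative.toAddMonoidHom dp tp_tp wp_tp wp_comm ep_tp ep_comm
      wp_neg wp_ep wp_wp ep_wp ep_neg tp_wp tp_ep dp_mul
      (fun _ _ => derivative_mul) dp_wp derivative_wp derivative_tp tp_dp _ _ _ _

theorem tau_tau (x : IntPart E n) : tau (tau x) = x := by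
  ext1 <;> simp [tau_fst, tau_snd]

theorem tau_d (x : IntPart E n) : tau (d x) = - d (tau x) := by
  ext1
  · simp only [tau_fst, d_fst, tp_dp]; rfl
  · have h : (- d (tau x)).2 = - (d (tau x)).2 := rfl
    simp only [h, tau_fst, tau_snd, d_fst, d_snd, map_add, map_neg, map_mul, tp_tp, tp_dp, tp_wp,
      tp_ep, derivative_tp, wp_tp, ep_tp, mul_neg, wp_neg, ep_neg, neg_add, neg_neg]

/-- `a[X]^j` -/
noncomputable def y1 (j : ℕ) : E.carrier n →+ IntPart E n where
  toFun a := mk (monomial j a) 0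
  map_zero' := by rw [map_zero]; rfl
  map_add' a b := by
    rw [map_add]; ext1
    · rfl
    · exact (add_zero _).symm

/-- `b[X]^j d[X]` -/
noncomputable def y2 (j : ℕ) : E.carrier n →+ IntPart E n where
  toFun b := mk 0 (monomial j b)
  map_zero' := by rw [map_zero]; rfl
  map_add' a b := by
    rw [map_add]; ext1
    · exact (add_zero _).symm
    · rfl

theorem y1_fst (j : ℕ) (a : E.carrier n) : (y1 j a).1 = monomial j a := rfl
theorem y1_snd (j : ℕ) (a : E.carrier n) : (y1 j a).2 = 0 := rfl
theorem y2_fst (j : ℕ) (a : E.carrier n) : (y2 j a).1 = 0 := rfl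
theorem y2_snd (j : ℕ) (a : E.carrier n) : (y2 j a).2 = monomial j a := rfl

theorem ind {P : IntPart E n → Prop} (h1 : ∀ j a, P (y1 j a)) (h2 : ∀ j a, P (y2 j a))
    (hadd : ∀ x y, P x → P y → P (x + y)) (x : IntPart E n) : P x := by
  have e : x = mk x.1 0 + mk 0 x.2 := by
    ext1
    · exact (add_zero _).symm
    · exact (zero_add _).symm
  rw [e]
  refine hadd _ _ ?_ ?_
  · generalize x.1 = p
    induction p using Polynomial.induction_on' with
    | add p q hp hq =>
      have : mk (p + q) 0 = mk p 0 + (mk q 0 : IntPart E n) := by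
        ext1
        · rfl
        · exact (add_zero _).symm
      rw [this]; exact hadd _ _ hp hq
    | monomial j a => exact h1 j a
  · generalize x.2 = p
    induction p using Polynomial.induction_on' with
    | add p q hp hq =>
      have : mk 0 (p + q) = mk 0 p + (mk 0 q : IntPart E n) := by
        ext1
        · exact (add_zero _).symm
        · rfl
      rw [this]; exact hadd _ _ hp hq
    | monomial j a => exact h2 j a

theorem y1_mul_y1 (j k : ℕ) (a b : E.carrier n) : y1 j a * y1 k b = y1 (j + k) (a * b) := by
  ext1 <;> simp [mul_fst, mul_snd, y1_fst, y1_snd, monomial_mul_monomial]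

theorem y1_mul_y2 (j k : ℕ) (a b : E.carrier n) : y1 j a * y2 k b = y2 (j + k) (a * b) := by
  ext1 <;> simp [mul_fst, mul_snd, y1_fst, y1_snd, y2_fst, y2_snd, monomial_mul_monomial]

theorem y2_mul_y1 (j k : ℕ) (a b : E.carrier n) :
    y2 j a * y1 k b = y2 (j + k) (a * E.tau n b) := by
  ext1 <;> simp [mul_fst, mul_snd, y1_fst, y1_snd, y2_fst, y2_snd, monomial_mul_monomial]

/-- The extra 1 in the exponent is the factor `[X]` in `d[X]d[X] = η[X]d[X]`. -/
theorem y2_mul_y2 (j k : ℕ) (a b : E.carrier n) :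
    y2 j a * y2 k b = y2 (j + k + 1) (E.eta n * (a * b)) := by
  ext1
  · simp [mul_fst, y2_fst]
  · simp only [mul_snd, y2_fst, y2_snd, map_zero, zero_mul, mul_zero, zero_add, tp_monomial,
      monomial_mul_monomial, wp]
    rw [E.eta_comm, mul_assoc, ← E.eta_comm, E.eta_tau, E.eta_comm, ← mul_assoc, ← E.eta_comm,
      add_comm]

theorem one_eq : (1 : IntPart E n) = y1 0 1 := by
  ext1
  · simp [one_fst, y1_fst]
  · rfl

theorem tau_y1 (j : ℕ) (a : E.carrier n) : tau (y1 j a) = y1 j (E.tau n a) := by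
  ext1 <;> simp [tau_fst, tau_snd, y1_fst, y1_snd]

theorem tau_y2 (j : ℕ) (a : E.carrier n) : tau (y2 j a) = - y2 j (E.tau n a) := by
  ext1
  · rw [tau_fst, y2_fst, map_zero]; exact neg_zero.symm
  · rw [tau_snd, y2_snd, tp_monomial]; rfl

theorem d_y1 (j : ℕ) (a : E.carrier n) :
    d (y1 j a) = y1 j (E.d a) + y2 (j - 1) ((j : E.carrier n) * E.tau n a) := by
  ext1
  · simp [d_fst, add_fst, y1_fst, y2_fst]
  · rw [d_snd, add_snd, y1_fst, y1_snd, y1_snd, y2_snd, derivative_monomial, tp_monomial, map_mul,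
      map_natCast, Nat.cast_comm]
    simp

/-- In the factor `j + 1`, the summand `j` comes from `d([X]^j)d[X] = jη[X]^j d[X]` and the 1 from
`dd[X] = ηd[X]`. Here the index is the true exponent of `[X]`, one less than the `k` of the
formulas. -/
theorem d_y2 (j : ℕ) (b : E.carrier n) :
    d (y2 j b) = y2 j (E.d b) + y2 j (((j + 1 : ℕ) : E.carrier n) * (E.eta n * b)) := by
  ext1
  · simp [d_fst, add_fst, y2_fst]
  · simp only [d_snd, add_snd, y2_fst, y2_snd, map_zero, zero_add, dp_monomial,
      derivative_monomial, ep, wp, C_mul_monomial, monomial_mul_monomial, add_assoc]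
    congr 1
    rcases j with _ | j
    · simp
    · rw [Nat.add_sub_cancel, add_comm 1 j, ← map_add, ← mul_assoc, ← Nat.cast_comm,
        Nat.cast_add (j + 1) 1, add_mul, Nat.cast_one, one_mul]

end IntPart

end WittComplex

theorem Polynomial.induction_mem {R : Type*} [Ring R] {S : AddSubgroup R} {P : R[X] → Prop}
    (zero : P 0) (mono : ∀ j a, a ∈ S → P (monomial j a)) (add : ∀ p q, P p → P q → P (p + q))
    {p : R[X]} (hp : ∀ j, p.coeff j ∈ S) : P p := by
  rw [p.as_sum_support]
  exact Finset.sum_induction _ P add zero fun j _ => mono j _ (hp j)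

/-! ### Grading, Frobenius and restriction on integral elements. -/

namespace WittComplex

variable {A : Type u} [CommRing A] {E : WittComplex.{u, v} A}

namespace IntPart

variable {n : ℕ}

/-- The additive map with the given values at `a[X]^j` and `b[X]^j d[X]`. -/
noncomputable def lift {G : Type*} [AddCommGroup G] (f g : ℕ → E.carrier n →+ G) :
    IntPart E n →+ G where
  toFun x := Polynomial.liftAdd f x.1 + Polynomial.liftAdd g x.2
  map_zero' := by simp [zero_fst, zero_snd]
  map_add' x y := by simp only [add_fst, add_snd, map_add]; abel

@[simp] theorem lift_y1 {G : Type*} [AddCommGroup G] (f g : ℕ → E.carrier n →+ G) (j : ℕ)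
    (a : E.carrier n) : lift f g (y1 j a) = f j a := by
  change Polynomial.liftAdd f (y1 j a).1 + Polynomial.liftAdd g (y1 j a).2 = _
  rw [y1_fst, y1_snd, liftAdd_monomial, map_zero, add_zero]

@[simp] theorem lift_y2 {G : Type*} [AddCommGroup G] (f g : ℕ → E.carrier n →+ G) (j : ℕ)
    (a : E.carrier n) : lift f g (y2 j a) = g j a := by
  change Polynomial.liftAdd f (y2 j a).1 + Polynomial.liftAdd g (y2 j a).2 = _
  rw [y2_fst, y2_snd, liftAdd_monomial, map_zero, zero_add]

/-- The homogeneous elements of degree `q`. -/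
def deg (n : ℕ) (q : ℤ) : AddSubgroup (IntPart E n) where
  carrier := {x | (∀ j, x.1.coeff j ∈ E.deg n q) ∧ ∀ j, x.2.coeff j ∈ E.deg n (q - 1)}
  zero_mem' := ⟨fun _ => by rw [zero_fst, coeff_zero]; exact AddSubgroup.zero_mem _,
    fun _ => by rw [zero_snd, coeff_zero]; exact AddSubgroup.zero_mem _⟩
  add_mem' hx hy := ⟨fun j => by rw [add_fst, coeff_add]; exact AddSubgroup.add_mem _ (hx.1 j) (hy.1 j),
    fun j => by rw [add_snd, coeff_add]; exact AddSubgroup.add_mem _ (hx.2 j) (hy.2 j)⟩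
  neg_mem' {x} hx := ⟨fun j => by
      have : (-x).1 = -x.1 := rfl
      rw [this, coeff_neg]; exact AddSubgroup.neg_mem _ (hx.1 j),
    fun j => by
      have : (-x).2 = -x.2 := rfl
      rw [this, coeff_neg]; exact AddSubgroup.neg_mem _ (hx.2 j)⟩

theorem mem_deg {q : ℤ} {x : IntPart E n} : x ∈ deg n q ↔
    (∀ j, x.1.coeff j ∈ E.deg n q) ∧ ∀ j, x.2.coeff j ∈ E.deg n (q - 1) := Iff.rfl

theorem y1_mem {q : ℤ} {j : ℕ} {a : E.carrier n} (ha : a ∈ E.deg n q) : y1 j a ∈ deg n q := by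
  refine ⟨fun k => ?_, fun k => ?_⟩
  · rw [y1_fst, coeff_monomial]; split_ifs
    · exact ha
    · exact AddSubgroup.zero_mem _
  · rw [y1_snd, coeff_zero]; exact AddSubgroup.zero_mem _

theorem y2_mem {q : ℤ} {j : ℕ} {b : E.carrier n} (hb : b ∈ E.deg n (q - 1)) :
    y2 j b ∈ deg n q := by
  refine ⟨fun k => ?_, fun k => ?_⟩
  · rw [y2_fst, coeff_zero]; exact AddSubgroup.zero_mem _
  · rw [y2_snd, coeff_monomial]; split_ifs
    · exact hb
    · exact AddSubgroup.zero_mem _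

theorem deg_ind {q : ℤ} {P : IntPart E n → Prop} (h1 : ∀ j a, a ∈ E.deg n q → P (y1 j a))
    (h2 : ∀ j b, b ∈ E.deg n (q - 1) → P (y2 j b)) (hadd : ∀ x y, P x → P y → P (x + y))
    {x : IntPart E n} (hx : x ∈ deg n q) : P x := by
  have h0 : P 0 := by
    rw [← map_zero (y1 0)]; exact h1 0 0 (AddSubgroup.zero_mem _)
  have e : x = mk x.1 0 + mk 0 x.2 := by
    ext1
    · exact (add_zero _).symm
    · exact (zero_add _).symm
  rw [e]
  refine hadd _ _ (Polynomial.induction_mem (P := fun p => P (mk p 0)) h0 h1 (fun p q hp hq => ?_) hx.1)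
    (Polynomial.induction_mem (P := fun p => P (mk 0 p)) h0 h2 (fun p q hp hq => ?_) hx.2)
  · have : mk (p + q) 0 = mk p 0 + (mk q 0 : IntPart E n) := by
      ext1
      · rfl
      · exact (add_zero _).symm
    rw [this]; exact hadd _ _ hp hq
  · have : mk 0 (p + q) = mk 0 p + (mk 0 q : IntPart E n) := by
      ext1
      · exact (add_zero _).symm
      · rfl
    rw [this]; exact hadd _ _ hp hq

theorem lift_mem {G : Type*} [AddCommGroup G] {f g : ℕ → E.carrier n →+ G} {q : ℤ}
    {S : AddSubgroup G} (hf : ∀ j a, a ∈ E.deg n q → f j a ∈ S)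
    (hg : ∀ j a, a ∈ E.deg n (q - 1) → g j a ∈ S) {x : IntPart E n} (hx : x ∈ deg n q) :
    lift f g x ∈ S := by
  refine deg_ind (P := fun x => lift f g x ∈ S) ?_ ?_ ?_ hx
  · intro j a ha; rw [lift_y1]; exact hf j a ha
  · intro j a ha; rw [lift_y2]; exact hg j a ha
  · intro x y hx hy; rw [map_add]; exact S.add_mem hx hy

theorem natCast_mul_mem {q : ℤ} (m : ℕ) {a : E.carrier n} (ha : a ∈ E.deg n q) :
    (m : E.carrier n) * a ∈ E.deg n q := by
  rw [← nsmul_eq_mul]; exact AddSubgroup.nsmul_mem _ ha m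

theorem eta_mul_mem {q : ℤ} {a : E.carrier n} (ha : a ∈ E.deg n (q - 1)) :
    E.eta n * a ∈ E.deg n q := by
  have := E.mul_mem E.eta_mem ha
  rwa [add_sub_cancel] at this

theorem d_mem {q : ℤ} {x : IntPart E n} (hx : x ∈ deg n q) : d x ∈ deg n (q + 1) := by
  refine deg_ind (P := fun x => d x ∈ deg n (q + 1)) ?_ ?_ ?_ hx
  · intro j a ha
    rw [d_y1]
    refine AddSubgroup.add_mem _ (y1_mem (E.d_mem ha)) (y2_mem ?_)
    rw [add_sub_cancel_right]
    exact natCast_mul_mem _ (E.tau_mem ha)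
  · intro j a ha
    have := E.d_mem ha
    rw [sub_add_cancel] at this
    rw [d_y2]
    refine AddSubgroup.add_mem _ (y2_mem ?_) (y2_mem ?_)
    · rwa [add_sub_cancel_right]
    · rw [add_sub_cancel_right]; exact natCast_mul_mem _ (eta_mul_mem ha)
  · intro x y hx hy; rw [map_add]; exact AddSubgroup.add_mem _ hx hy

theorem mul_mem {p q : ℤ} {x y : IntPart E n} (hx : x ∈ deg n p) (hy : y ∈ deg n q) :
    x * y ∈ deg n (p + q) := by
  have c : ∀ {p q r : ℤ} {a b : E.carrier n}, p + q = r → a ∈ E.deg n p → b ∈ E.deg n q →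
      a * b ∈ E.deg n r := fun h ha hb => h ▸ E.mul_mem ha hb
  refine deg_ind (P := fun x => x * y ∈ deg n (p + q)) ?_ ?_ ?_ hx
  · intro j a ha
    refine deg_ind (P := fun y => y1 j a * y ∈ deg n (p + q)) ?_ ?_ ?_ hy
    · intro k b hb; rw [y1_mul_y1]; exact y1_mem (E.mul_mem ha hb)
    · intro k b hb; rw [y1_mul_y2]; exact y2_mem (c (by ring) ha hb)
    · intro x y hx hy; rw [mul_add]; exact AddSubgroup.add_mem _ hx hy
  · intro j a ha
    refine deg_ind (P := fun y => y2 j a * y ∈ deg n (p + q)) ?_ ?_ ?_ hy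
    · intro k b hb; rw [y2_mul_y1]; exact y2_mem (c (by ring) ha (E.tau_mem hb))
    · intro k b hb; rw [y2_mul_y2]
      exact y2_mem (eta_mul_mem (c (by ring) ha hb))
    · intro x y hx hy; rw [mul_add]; exact AddSubgroup.add_mem _ hx hy
  · intro x y hx hy; rw [add_mul]; exact AddSubgroup.add_mem _ hx hy

theorem tau_of_mem {q : ℤ} {x : IntPart E n} (hx : x ∈ deg n q) : tau x = q.negOnePow • x := by
  refine deg_ind (P := fun x => tau x = q.negOnePow • x) ?_ ?_ ?_ hx
  · intro j a ha; rw [tau_y1, E.tau_of_mem ha, map_negOnePow_smul]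
  · intro j a ha
    rw [tau_y2, E.tau_of_mem ha, map_negOnePow_smul, Int.negOnePow_sub, Int.negOnePow_one, mul_neg,
      mul_one, Units.neg_smul, neg_neg]
  · intro x y hx hy; rw [map_add, smul_add, hx, hy]

theorem comm_even {p : ℤ} (h : Even p) {x : IntPart E n} (hx : x ∈ deg n p) (y : IntPart E n) :
    x * y = y * x := by
  have h' : Odd (p - 1) := h.sub_odd odd_one
  refine deg_ind (P := fun x => x * y = y * x) ?_ ?_ ?_ hx
  · intro j a ha
    induction y using ind with
    | h1 k b => rw [y1_mul_y1, y1_mul_y1, E.comm_even h ha, add_comm]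
    | h2 k b => rw [y1_mul_y2, y2_mul_y1, E.tau_even h ha, E.comm_even h ha, add_comm]
    | hadd y y' hy hy' => rw [mul_add, add_mul, hy, hy']
  · intro j a ha
    induction y using ind with
    | h1 k b =>
      rw [y1_mul_y2, y2_mul_y1, E.comm_odd h' ha, E.tau_tau, add_comm]
    | h2 k b =>
      rw [y2_mul_y2, y2_mul_y2, E.comm_odd h' ha, ← E.eta_tau,
        map_mul (E.tau n), E.tau_tau, E.tau_odd h' ha, mul_neg, mul_neg, ← neg_mul, neg_eta, add_comm j]
    | hadd y y' hy hy' => rw [mul_add, add_mul, hy, hy']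
  · intro x x' hx hx'; rw [mul_add, add_mul, hx, hx']

theorem comm_odd {p : ℤ} (h : Odd p) {x : IntPart E n} (hx : x ∈ deg n p) (y : IntPart E n) :
    x * y = tau y * x := by
  have h' : Even (p - 1) := h.sub_odd odd_one
  refine deg_ind (P := fun x => x * y = tau y * x) ?_ ?_ ?_ hx
  · intro j a ha
    induction y using ind with
    | h1 k b => rw [y1_mul_y1, tau_y1, y1_mul_y1, E.comm_odd h ha, add_comm]
    | h2 k b =>
      rw [y1_mul_y2, tau_y2, neg_mul, y2_mul_y1, E.tau_odd h ha, mul_neg, map_neg, neg_neg,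
        E.comm_odd h ha, add_comm]
    | hadd y y' hy hy' => rw [mul_add, map_add, add_mul, hy, hy']
  · intro j a ha
    induction y using ind with
    | h1 k b =>
      rw [tau_y1, y1_mul_y2, y2_mul_y1, E.comm_even h' ha, add_comm]
    | h2 k b =>
      rw [tau_y2, neg_mul, y2_mul_y2, y2_mul_y2, E.comm_even h' ha, ← E.eta_tau,
        map_mul (E.tau n), E.tau_even h' ha, ← map_neg, ← neg_mul, neg_eta, add_comm j]
    | hadd y y' hy hy' => rw [mul_add, map_add, add_mul, hy, hy']
  · intro x x' hx hx'; rw [mul_add, add_mul, hx, hx']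

theorem y2_congr {j k : ℕ} (h : j = k) (a : E.carrier n) : y2 j a = y2 k a := by rw [h]

/-- The Frobenius on elements of type 1 and 2, as an additive map. -/
noncomputable def FAdd : IntPart E (n + 1) →+ IntPart E n :=
  lift (fun j => (y1 (2 * j)).comp E.F.toAddMonoidHom)
    (fun j => (y2 (2 * j + 1)).comp E.F.toAddMonoidHom)

theorem FAdd_y1 (j : ℕ) (a : E.carrier (n + 1)) : FAdd (y1 j a) = y1 (2 * j) (E.F a) := lift_y1 _ _ _ _
theorem FAdd_y2 (j : ℕ) (a : E.carrier (n + 1)) : FAdd (y2 j a) = y2 (2 * j + 1) (E.F a) :=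
  lift_y2 _ _ _ _

theorem FAdd_mul (x y : IntPart E (n + 1)) : FAdd (x * y) = FAdd x * FAdd y := by
  induction x using ind with
  | hadd x x' hx hx' => rw [add_mul, map_add, map_add, add_mul, hx, hx']
  | h1 j a =>
    induction y using ind with
    | hadd y y' hy hy' => rw [mul_add, map_add, map_add, mul_add, hy, hy']
    | h1 k b => rw [y1_mul_y1, FAdd_y1, FAdd_y1, FAdd_y1, y1_mul_y1, map_mul, mul_add]
    | h2 k b => rw [y1_mul_y2, FAdd_y1, FAdd_y2, FAdd_y2, y1_mul_y2, map_mul, mul_add, add_assoc]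
  | h2 j a =>
    induction y using ind with
    | hadd y y' hy hy' => rw [mul_add, map_add, map_add, mul_add, hy, hy']
    | h1 k b =>
      rw [y2_mul_y1, FAdd_y1, FAdd_y2, FAdd_y2, y2_mul_y1, map_mul, E.tau_F]
      exact y2_congr (by ring) _
    | h2 k b =>
      rw [y2_mul_y2, FAdd_y2, FAdd_y2, FAdd_y2, y2_mul_y2, map_mul E.F, map_mul E.F, F_eta]
      exact y2_congr (by ring) _

/-- The Frobenius on elements of type 1 and 2. -/
noncomputable def F : IntPart E (n + 1) →+* IntPart E n :=
  { FAdd with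
    map_one' := by
      change FAdd 1 = 1
      rw [one_eq, FAdd_y1, map_one, mul_zero, one_eq]
    map_mul' := FAdd_mul }

theorem F_y1 (j : ℕ) (a : E.carrier (n + 1)) : F (y1 j a) = y1 (2 * j) (E.F a) := FAdd_y1 _ _
theorem F_y2 (j : ℕ) (a : E.carrier (n + 1)) : F (y2 j a) = y2 (2 * j + 1) (E.F a) := FAdd_y2 _ _

theorem F_mem {q : ℤ} {x : IntPart E (n + 1)} (hx : x ∈ deg (n + 1) q) : F x ∈ deg n q :=
  lift_mem (S := deg n q) (fun _ a ha => y1_mem (a := E.F a) (E.F_mem ha))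
    (fun _ b hb => y2_mem (b := E.F b) (E.F_mem hb)) hx

/-- The restriction on elements of type 1 and 2, as an additive map. -/
noncomputable def RAdd : IntPart E (n + 1) →+ IntPart E n :=
  lift (fun j => (y1 j).comp E.R.toAddMonoidHom) (fun j => (y2 j).comp E.R.toAddMonoidHom)

theorem RAdd_y1 (j : ℕ) (a : E.carrier (n + 1)) : RAdd (y1 j a) = y1 j (E.R a) := lift_y1 _ _ _ _
theorem RAdd_y2 (j : ℕ) (a : E.carrier (n + 1)) : RAdd (y2 j a) = y2 j (E.R a) :=
  lift_y2 _ _ _ _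

theorem RAdd_mul (x y : IntPart E (n + 1)) : RAdd (x * y) = RAdd x * RAdd y := by
  induction x using ind with
  | hadd x x' hx hx' => rw [add_mul, map_add, map_add, add_mul, hx, hx']
  | h1 j a =>
    induction y using ind with
    | hadd y y' hy hy' => rw [mul_add, map_add, map_add, mul_add, hy, hy']
    | h1 k b => rw [y1_mul_y1, RAdd_y1, RAdd_y1, RAdd_y1, y1_mul_y1, map_mul]
    | h2 k b => rw [y1_mul_y2, RAdd_y1, RAdd_y2, RAdd_y2, y1_mul_y2, map_mul]
  | h2 j a =>
    induction y using ind with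
    | hadd y y' hy hy' => rw [mul_add, map_add, map_add, mul_add, hy, hy']
    | h1 k b => rw [y2_mul_y1, RAdd_y1, RAdd_y2, RAdd_y2, y2_mul_y1, map_mul, E.tau_R]
    | h2 k b =>
      rw [y2_mul_y2, RAdd_y2, RAdd_y2, RAdd_y2, y2_mul_y2, map_mul E.R, map_mul E.R, R_eta]

/-- The restriction on elements of type 1 and 2. -/
noncomputable def R : IntPart E (n + 1) →+* IntPart E n :=
  { RAdd with
    map_one' := by
      change RAdd 1 = 1
      rw [one_eq, RAdd_y1, map_one, one_eq]
    map_mul' := RAdd_mul }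

theorem R_y1 (j : ℕ) (a : E.carrier (n + 1)) : R (y1 j a) = y1 j (E.R a) := RAdd_y1 _ _
theorem R_y2 (j : ℕ) (a : E.carrier (n + 1)) : R (y2 j a) = y2 j (E.R a) := RAdd_y2 _ _

theorem R_mem {q : ℤ} {x : IntPart E (n + 1)} (hx : x ∈ deg (n + 1) q) : R x ∈ deg n q :=
  lift_mem (S := deg n q) (fun _ a ha => y1_mem (a := E.R a) (E.R_mem ha))
    (fun _ b hb => y2_mem (b := E.R b) (E.R_mem hb)) hx

theorem R_F (x : IntPart E (n + 1 + 1)) : R (F x) = F (R x) := by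
  induction x using ind with
  | hadd x x' hx hx' => simp only [map_add, hx, hx']
  | h1 j a => rw [F_y1, R_y1, R_y1, F_y1, E.R_F]
  | h2 j a => rw [F_y2, R_y2, R_y2, F_y2, E.R_F]

theorem R_d (x : IntPart E (n + 1)) : R (d x) = d (R x) := by
  induction x using ind with
  | hadd x x' hx hx' => simp only [map_add, hx, hx']
  | h1 j a => rw [d_y1, R_y1, map_add, R_y1, R_y2, d_y1, E.R_d, map_mul, map_natCast, E.tau_R]
  | h2 j a => rw [d_y2, R_y2, map_add, R_y2, R_y2, d_y2, E.R_d, map_mul E.R, map_natCast, map_mul E.R, R_eta]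

theorem tau_F (x : IntPart E (n + 1)) : tau (F x) = F (tau x) := by
  induction x using ind with
  | hadd x x' hx hx' => simp only [map_add, hx, hx']
  | h1 j a => rw [F_y1, tau_y1, tau_y1, F_y1, E.tau_F]
  | h2 j a => rw [F_y2, tau_y2, tau_y2, map_neg, F_y2, E.tau_F]

theorem d_F (x : IntPart E (n + 1)) : d (F x) = F (d x) + F (d x) := by
  induction x using ind with
  | hadd x x' hx hx' => simp only [map_add, hx, hx']; abel
  | h1 j a =>
    rw [F_y1, d_y1, d_y1, map_add F, F_y1, F_y2, E.d_F, two_mul (E.F _), map_add (y1 _),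
      add_add_add_comm, ← map_add (y2 _), map_mul E.F, map_natCast, E.tau_F]
    congr 1
    rcases j with _ | j
    · simp
    · rw [y2_congr (show 2 * (j + 1) - 1 = 2 * (j + 1 - 1) + 1 by omega), Nat.cast_mul, mul_assoc,
        Nat.cast_two, two_mul ((_ : E.carrier n) * _)]
  | h2 j a =>
    have h : ((2 * j + 1 + 1 : ℕ) : E.carrier n) * (E.eta n * E.F a) = 0 := by
      rw [show 2 * j + 1 + 1 = (j + 1) * 2 by ring, Nat.cast_mul, mul_assoc, Nat.cast_two,
        two_mul_eta_mul, mul_zero]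
    have h' : ((j + 1 : ℕ) : E.carrier n) * (E.eta n * E.F a)
        + ((j + 1 : ℕ) : E.carrier n) * (E.eta n * E.F a) = 0 := by
      rw [← mul_add, ← two_mul, two_mul_eta_mul, mul_zero]
    rw [F_y2, d_y2, h, map_zero, add_zero, d_y2, map_add F, F_y2, F_y2, E.d_F, two_mul (E.F _),
      map_add (y2 _), map_mul E.F, map_natCast, map_mul E.F, F_eta, add_add_add_comm,
      ← map_add (y2 _) (((j + 1 : ℕ) : E.carrier n) * (E.eta n * E.F a)), h', map_zero, add_zero]

/-- A second derivative has the even factors `j(j-1)`, and `2η = 0`. -/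
theorem wp_derivative_derivative (p : (E.carrier n)[X]) :
    wp * derivative (derivative p) = 0 := by
  induction p using Polynomial.induction_on' with
  | add p q hp hq => simp only [map_add, mul_add, hp, hq, add_zero]
  | monomial j a =>
    obtain ⟨k, hk⟩ : ∃ k, j * (j - 1) = 2 * k := by
      rcases j with _ | j
      · exact ⟨0, rfl⟩
      · obtain ⟨k, hk⟩ := Nat.even_mul_succ_self j
        refine ⟨k, ?_⟩
        rw [Nat.add_sub_cancel, _root_.mul_comm (j + 1) j, hk, two_mul]
    rw [derivative_monomial, derivative_monomial, wp, monomial_mul_monomial, mul_assoc,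
      ← Nat.cast_mul, hk, Nat.cast_mul, ← Nat.cast_mul, ← Nat.cast_comm, ← mul_assoc,
      ← Nat.cast_comm, Nat.cast_mul, Nat.cast_comm 2, Nat.cast_two, mul_assoc, mul_assoc,
      two_mul_eta_mul, mul_zero, map_zero]

/-- The coefficient differential and the twisted derivative in `X` anticommute, so their cross terms
cancel. The other unwanted terms are multiples of `η` that occur twice, or contain a second
derivative. -/
theorem d_d (x : IntPart E n) : d (d x) = y1 0 (E.eta n) * d x := by
  ext1
  · rw [mul_fst, d_fst, d_fst, dp_dp]; rfl
  · have h1 : ∀ z : (E.carrier n)[X], wp * z + wp * z = 0 := fun z => by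
      nth_rewrite 1 [← wp_neg]; exact neg_add_cancel _
    have h2 : ∀ z : (E.carrier n)[X], ep * z + ep * z = 0 := fun z => by
      nth_rewrite 1 [← ep_neg]; exact neg_add_cancel _
    have h3 : (y1 0 (E.eta n) * d x).2 = ep * (d x).2 := by
      rw [mul_snd, y1_snd, zero_mul, zero_mul, mul_zero, add_zero, add_zero]; rfl
    have h4 : derivative (ep * x.2) = ep * derivative x.2 := by
      rw [derivative_mul, ep, derivative_C, zero_mul, zero_add]
    have h5 : dp (wp * derivative x.2) = wp * dp (derivative x.2) := by
      rw [dp_mul, dp_wp, tp_wp, zero_mul, zero_add]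
    have h6 : dp (ep * x.2) = ep * dp x.2 := by
      rw [dp_mul, tp_ep, ep, ← monomial_zero_left, dp_monomial, d_eta, map_zero, zero_mul, zero_add]
    have h7 : derivative (wp * derivative x.2) = ep * derivative x.2 := by
      rw [derivative_mul, derivative_wp, wp_derivative_derivative, add_zero]
    rw [h3, d_snd, d_fst, d_snd]
    simp only [map_add, h4, h5, h6, h7, mul_add, wp_ep, ep_ep, ep_wp, derivative_dp, tp_dp, dp_dp,
      derivative_tp, wp_tp, wp_derivative_derivative, add_zero, ep_tp]
    have e : ∀ a b w g : (E.carrier n)[X], -a + (a + b + w + b) + (0 + w) + g = (b + b) + (w + w) + g :=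
      fun a b w g => by abel
    rw [e, h1, h2, zero_add, zero_add]

end IntPart

end WittComplex

/-! ### The step from one level to the next, in abstract form. -/

/-- The data and relations from which the multiplication of level `n + 1` of the formal sums is
obtained: `Q` is the ring of level `n`, `S` the group of level `n + 1`, and `B` the ring of elements
of type 1 and 2 of level `n + 1`. -/
structure LevelStep (Q B S M : Type*) [Ring Q] [Ring B] [AddCommGroup S] [AddCommGroup M] where
  tQ : Q →+* Q
  dQ : Q →+ Q
  eQ : Q
  tB : B →+* B
  dB : B →+ B
  FB : B →+* Q
  γ : M →+ Q
  tM : M →+ M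
  iM : M →+ M
  j : B →+ S
  pB : S →+ B
  pv : S →+ M
  pw : S →+ M
  F : S →+ Q
  V : Q →+ S
  d : S →+ S
  t : S →+ S
  tQ_tQ : ∀ x, tQ (tQ x) = x
  dQ_mul : ∀ x y, dQ (x * y) = dQ x * y + tQ x * dQ y
  eQ_comm : ∀ x, eQ * x = x * eQ
  eQ_tQ : ∀ x, eQ * tQ x = eQ * x
  eQ_add : eQ + eQ = 0
  tB_tB : ∀ x, tB (tB x) = x
  dB_mul : ∀ x y, dB (x * y) = dB x * y + tB x * dB y
  tB_dB : ∀ x, tB (dB x) = - dB (tB x)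
  tQ_FB : ∀ b, tQ (FB b) = FB (tB b)
  dQ_FB : ∀ b, dQ (FB b) = FB (dB b) + FB (dB b)
  γ_tM : ∀ c, γ (tM c) = tQ (γ c)
  γ_iM : ∀ c, γ (iM c) = eQ * γ c
  F_j : ∀ b, F (j b) = FB b
  d_j : ∀ b, d (j b) = j (dB b)
  t_j : ∀ b, t (j b) = j (tB b)
  decomp : ∀ s, s = j (pB s) + V (γ (pv s)) + d (V (γ (pw s)))
  pB_j : ∀ b, pB (j b) = b
  pv_j : ∀ b, pv (j b) = 0
  pw_j : ∀ b, pw (j b) = 0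
  pB_V : ∀ c, pB (V (γ c)) = 0
  pv_V : ∀ c, pv (V (γ c)) = c
  pw_V : ∀ c, pw (V (γ c)) = 0
  pB_dV : ∀ c, pB (d (V (γ c))) = 0
  pv_dV : ∀ c, pv (d (V (γ c))) = 0
  pw_dV : ∀ c, pw (d (V (γ c))) = c
  F_V : ∀ x, F (V x) = x + x
  F_dV : ∀ x, F (d (V x)) = dQ x + eQ * x
  V_d : ∀ x, V (dQ x) = d (V x) + d (V x)
  dQ_F : ∀ s, dQ (F s) = F (d s) + F (d s)
  F_dd : ∀ s, F (d (d s)) = eQ * F (d s)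
  d_dV : ∀ x, d (d (V x)) = d (V (eQ * x))
  tQ_eQ : tQ eQ = eQ
  tQ_F : ∀ s, tQ (F s) = F (t s)
  t_V : ∀ x, t (V x) = V (tQ x)
  t_d : ∀ s, t (d s) = - d (t s)
  t_t : ∀ s, t (t s) = s
  split : ∀ x, ∃ x₀ b c e, x = x₀ + γ c + dQ (γ e) ∧ V x₀ = j b ∧
    ∀ b', V (x₀ * FB b') = j (b * b') ∧ V (FB b' * x₀) = j (b' * b)

namespace LevelStep

variable {Q B S M : Type*} [Ring Q] [Ring B] [AddCommGroup S] [AddCommGroup M]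
  (D : LevelStep Q B S M)

/-- The product of level `n + 1`. -/
def mul (s y : S) : S :=
  -- The summands are the products of the three parts of `s` with `y`. For the integral part of `s`
  -- the element `y` is decomposed as well. All products with a `V` or `dV` factor are dictated by
  -- the projection formula and the Leibniz rule.
  D.j (D.pB s * D.pB y) + D.V (D.FB (D.pB s) * D.γ (D.pv y))
    + (D.d (D.V (D.tQ (D.FB (D.pB s)) * D.γ (D.pw y)))
      - D.V (D.FB (D.dB (D.tB (D.pB s))) * D.γ (D.pw y)))
    + D.V (D.γ (D.pv s) * D.F y)
    + (D.d (D.V (D.γ (D.pw s) * D.F y)) - D.V (D.tQ (D.γ (D.pw s)) * D.F (D.d y)))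

theorem add_mul (s s' y : S) : D.mul (s + s') y = D.mul s y + D.mul s' y := by
  simp only [mul, map_add, _root_.add_mul]; abel

theorem mul_add (s y y' : S) : D.mul s (y + y') = D.mul s y + D.mul s y' := by
  simp only [mul, map_add, _root_.mul_add]; abel

theorem zero_mul (y : S) : D.mul 0 y = 0 := by
  simp [mul]

theorem mul_zero (y : S) : D.mul y 0 = 0 := by
  simp [mul]

theorem neg_mul (s y : S) : D.mul (-s) y = - D.mul s y := by
  rw [eq_neg_iff_add_eq_zero, ← add_mul, neg_add_cancel, zero_mul]

theorem mul_neg (s y : S) : D.mul s (-y) = - D.mul s y := by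
  rw [eq_neg_iff_add_eq_zero, ← mul_add, neg_add_cancel, mul_zero]

theorem sub_mul (s s' y : S) : D.mul (s - s') y = D.mul s y - D.mul s' y := by
  rw [sub_eq_add_neg, add_mul, neg_mul, ← sub_eq_add_neg]

theorem mul_sub (s y y' : S) : D.mul s (y - y') = D.mul s y - D.mul s y' := by
  rw [sub_eq_add_neg, mul_add, mul_neg, ← sub_eq_add_neg]

theorem j_mul_j (b b' : B) : D.mul (D.j b) (D.j b') = D.j (b * b') := by
  simp [mul, D.pB_j, D.pv_j, D.pw_j]

theorem j_mul_V (b : B) (c : M) :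
    D.mul (D.j b) (D.V (D.γ c)) = D.V (D.FB b * D.γ c) := by
  simp [mul, D.pB_j, D.pv_j, D.pw_j, D.pB_V, D.pv_V, D.pw_V]

theorem j_mul_dV (b : B) (c : M) :
    D.mul (D.j b) (D.d (D.V (D.γ c))) =
      D.d (D.V (D.tQ (D.FB b) * D.γ c)) - D.V (D.FB (D.dB (D.tB b)) * D.γ c) := by
  simp [mul, D.pB_j, D.pv_j, D.pw_j, D.pB_dV, D.pv_dV, D.pw_dV]

theorem Vγ_mul (c : M) (y : S) : D.mul (D.V (D.γ c)) y = D.V (D.γ c * D.F y) := by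
  simp [mul, D.pB_V, D.pv_V, D.pw_V]

theorem dVγ_mul (c : M) (y : S) : D.mul (D.d (D.V (D.γ c))) y =
    D.d (D.V (D.γ c * D.F y)) - D.V (D.tQ (D.γ c) * D.F (D.d y)) := by
  simp [mul, D.pB_dV, D.pv_dV, D.pw_dV]

theorem eQ_mul_add (x : Q) : D.eQ * x + D.eQ * x = 0 := by
  rw [← _root_.add_mul, D.eQ_add, MulZeroClass.zero_mul]

theorem neg_eQ_mul (x : Q) : -(D.eQ * x) = D.eQ * x :=
  neg_eq_of_add_eq_zero_left (D.eQ_mul_add x)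

theorem ind {P : S → Prop} (hj : ∀ b, P (D.j b)) (hV : ∀ c, P (D.V (D.γ c)))
    (hdV : ∀ c, P (D.d (D.V (D.γ c)))) (hadd : ∀ x y, P x → P y → P (x + y)) (s : S) : P s := by
  rw [D.decomp s]
  exact hadd _ _ (hadd _ _ (hj _) (hV _)) (hdV _)

theorem indQ {P : Q → Prop} (h0 : ∀ x₀ b, D.V x₀ = D.j b →
    (∀ b', D.V (x₀ * D.FB b') = D.j (b * b') ∧ D.V (D.FB b' * x₀) = D.j (b' * b)) → P x₀)
    (hγ : ∀ c, P (D.γ c)) (hd : ∀ c, P (D.dQ (D.γ c)))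
    (hadd : ∀ x y, P x → P y → P (x + y)) (x : Q) : P x := by
  obtain ⟨x₀, b, c, e, h, h1, h2⟩ := D.split x
  rw [h]
  exact hadd _ _ (hadd _ _ (h0 x₀ b h1 h2) (hγ c)) (hd e)

theorem FB_of_V {x₀ : Q} {b : B} (h : D.V x₀ = D.j b) : D.FB b = x₀ + x₀ := by
  rw [← D.F_j, ← h, D.F_V]

theorem V_mul_aux (z y : Q) : D.d (D.V (z * (y + y))) - D.V (D.tQ z * (D.dQ y + D.eQ * y)) =
    D.V ((D.dQ z + D.eQ * z) * y) := by
  have h : D.d (D.V (z * (y + y))) = D.V (D.dQ z * y + D.tQ z * D.dQ y) := by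
    rw [← D.dQ_mul, D.V_d, _root_.mul_add, map_add, map_add]
  have h2 : D.tQ z * (D.eQ * y) = D.eQ * z * y := by
    rw [← mul_assoc, ← D.eQ_comm, D.eQ_tQ]
  have h3 : D.V (D.eQ * z * y) = - D.V (D.eQ * z * y) := by
    rw [← map_neg, mul_assoc, D.neg_eQ_mul]
  rw [h, _root_.mul_add, h2, _root_.add_mul, map_add, map_add, map_add]
  conv_rhs => rw [h3]
  abel

/-- The projection formula. -/
theorem V_mul (x : Q) (y : S) : D.mul (D.V x) y = D.V (x * D.F y) := by
  induction x using D.indQ with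
  | hadd x x' hx hx' => rw [map_add, add_mul, hx, hx', _root_.add_mul, map_add]
  | hγ c => exact D.Vγ_mul c y
  | hd c =>
    -- `Vd = 2dV` reduces this case to twice the product with `dVγ`; the factor 2 matches `dF =
    -- 2Fd`.
    rw [D.V_d, add_mul, D.dVγ_mul]
    have h : D.dQ (D.γ c) * D.F y =
        D.dQ (D.γ c * D.F y) - D.tQ (D.γ c) * D.F (D.d y) - D.tQ (D.γ c) * D.F (D.d y) := by
      rw [D.dQ_mul, D.dQ_F, _root_.mul_add]; abel
    rw [h, map_sub, map_sub, D.V_d]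
    abel
  | h0 x₀ b h h' =>
    -- Since `V x₀` is integral, the left side is a product with an integral element, and `y` has to
    -- be decomposed too.
    rw [h]
    induction y using D.ind with
    | hadd y y' hy hy' => rw [mul_add, map_add, _root_.mul_add, map_add, hy, hy']
    | hj b' => rw [j_mul_j, D.F_j, (h' b').1]
    | hV c =>
      rw [j_mul_V, D.FB_of_V h, D.F_V, _root_.mul_add, _root_.add_mul]
    | hdV c =>
      rw [j_mul_dV, ← D.F_j (D.dB _), ← D.d_j, ← D.t_j, ← h, D.t_V, D.F_dV, D.tQ_FB, ← D.F_j,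
        ← D.t_j, ← h, D.t_V, D.F_V, D.F_dV, _root_.add_mul, ← _root_.mul_add]
      have := D.V_mul_aux (D.tQ x₀) (D.γ c)
      rw [D.tQ_tQ] at this
      rw [sub_eq_iff_eq_add] at this ⊢
      rw [this, _root_.mul_add, _root_.add_mul, map_add, map_add, D.eQ_tQ, ← mul_assoc x₀,
        ← D.eQ_comm]
      abel

theorem V_F_j_mul_d (b : B) (c : M) : D.V (D.FB b * D.dQ (D.γ c)) =
    (D.d (D.V (D.tQ (D.FB b) * D.γ c)) - D.V (D.FB (D.dB (D.tB b)) * D.γ c)) +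
      (D.d (D.V (D.tQ (D.FB b) * D.γ c)) - D.V (D.FB (D.dB (D.tB b)) * D.γ c)) := by
  have h : D.FB b * D.dQ (D.γ c) = D.dQ (D.tQ (D.FB b) * D.γ c)
      - D.FB (D.dB (D.tB b)) * D.γ c - D.FB (D.dB (D.tB b)) * D.γ c := by
    rw [D.dQ_mul, D.tQ_tQ, D.tQ_FB, D.dQ_FB, _root_.add_mul]; abel
  rw [h, map_sub, map_sub, D.V_d]; abel

/-- Graded commutativity of the new product is not yet known, so the projection formula on the other
side needs its own proof. -/
theorem mul_V (y : S) (x : Q) : D.mul y (D.V x) = D.V (D.F y * x) := by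
  induction y using D.ind with
  | hadd y y' hy hy' => rw [add_mul, map_add, _root_.add_mul, map_add, hy, hy']
  | hV c => rw [Vγ_mul, D.F_V, D.F_V, _root_.mul_add, _root_.add_mul]
  | hdV c => rw [dVγ_mul, D.F_V, D.F_dV, D.F_dV, D.V_mul_aux]
  | hj b =>
    rw [D.F_j]
    induction x using D.indQ with
    | hadd x x' hx hx' => rw [map_add, mul_add, hx, hx', _root_.mul_add, map_add]
    | hγ c => exact D.j_mul_V b c
    | hd c => rw [D.V_d, mul_add, j_mul_dV, V_F_j_mul_d]
    | h0 x₀ b' h h' => rw [h, j_mul_j, (h' b).2]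

theorem F_mul (s y : S) : D.F (D.mul s y) = D.F s * D.F y := by
  induction s using D.ind with
  | hadd s s' hs hs' => rw [add_mul, map_add, map_add, _root_.add_mul, hs, hs']
  | hV c => rw [Vγ_mul, D.F_V, D.F_V, _root_.add_mul]
  | hdV c =>
    rw [dVγ_mul, map_sub, D.F_dV, D.F_V, D.F_dV, D.dQ_mul, D.dQ_F, _root_.mul_add, _root_.add_mul,
      mul_assoc]
    abel
  | hj b =>
    induction y using D.ind with
    | hadd y y' hy hy' => rw [mul_add, map_add, map_add, _root_.mul_add, hy, hy']
    | hj b' => rw [j_mul_j, D.F_j, D.F_j, D.F_j, map_mul]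
    | hV c => rw [j_mul_V, D.F_V, D.F_V, D.F_j, _root_.mul_add]
    | hdV c =>
      rw [j_mul_dV, map_sub, D.F_dV, D.F_V, D.F_dV, D.F_j, D.dQ_mul, D.tQ_tQ, D.tQ_FB, D.dQ_FB,
        _root_.mul_add, _root_.add_mul, ← mul_assoc, ← D.tQ_FB, D.eQ_tQ, D.eQ_comm, mul_assoc]
      abel

theorem t_mul (s y : S) : D.t (D.mul s y) = D.mul (D.t s) (D.t y) := by
  induction s using D.ind with
  | hadd s s' hs hs' => rw [add_mul, map_add, map_add, add_mul, hs, hs']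
  | hV c => rw [V_mul, D.t_V, D.t_V, V_mul, map_mul, D.tQ_F]
  | hdV c =>
    rw [dVγ_mul, map_sub, D.t_d, D.t_d, D.t_V, D.t_V, D.t_V, map_mul D.tQ, map_mul D.tQ, D.tQ_F, D.tQ_F,
      D.t_d, D.tQ_tQ, map_neg, _root_.mul_neg, map_neg, ← D.γ_tM, neg_mul, dVγ_mul, D.γ_tM, D.tQ_tQ]
    abel
  | hj b =>
    induction y using D.ind with
    | hadd y y' hy hy' => rw [mul_add, map_add, map_add, mul_add, hy, hy']
    | hj b' => rw [j_mul_j, D.t_j, D.t_j, D.t_j, j_mul_j, map_mul]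
    | hV c => rw [j_mul_V, D.t_V, D.t_V, D.t_j, mul_V, D.F_j, map_mul, D.tQ_FB]
    | hdV c =>
      simp only [j_mul_dV, map_sub, D.t_d, D.t_V, D.t_j, map_mul, D.tQ_FB, ← D.γ_tM, mul_neg,
        D.tB_dB, D.tB_tB, map_neg, _root_.neg_mul]
      abel

theorem FB_dd (b : B) : D.FB (D.dB (D.dB b)) = D.eQ * D.FB (D.dB b) := by
  have := D.F_dd (D.j b)
  rwa [D.d_j, D.d_j, D.F_j, D.F_j] at this

/-- For a factor `V` this is how products with `dV` were defined. The cases in which a second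
differential meets a `dV` use `dd = ιd` and `2ι = 0`. -/
theorem leibniz (s y : S) : D.d (D.mul s y) = D.mul (D.d s) y + D.mul (D.t s) (D.d y) := by
  induction s using D.ind with
  | hadd s s' hs hs' => rw [add_mul, map_add, map_add, map_add, add_mul, add_mul, hs, hs']; abel
  | hV c => rw [Vγ_mul, dVγ_mul, D.t_V, V_mul]; abel
  | hdV c =>
    rw [dVγ_mul, map_sub, D.d_dV, D.d_dV, D.t_d, D.t_V, ← D.γ_tM, neg_mul, dVγ_mul, D.γ_tM, D.tQ_tQ,
      ← D.γ_iM, dVγ_mul, D.γ_iM, D.F_dd, map_mul D.tQ, D.tQ_eQ, D.eQ_tQ]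
    simp only [← mul_assoc, ← D.eQ_comm]
    abel
  | hj b =>
    induction y using D.ind with
    | hadd y y' hy hy' => rw [mul_add, map_add, map_add, mul_add, mul_add, hy, hy']; abel
    | hj b' =>
      rw [j_mul_j, D.d_j, D.d_j, D.d_j, D.t_j, j_mul_j, j_mul_j, D.dB_mul, map_add]
    | hV c =>
      rw [j_mul_V, D.d_j, j_mul_V, D.t_j, j_mul_dV, D.tQ_FB, D.tB_tB]
      abel
    | hdV c =>
      have h1 : D.eQ * D.FB (D.dB (D.tB b)) = D.eQ * D.FB (D.dB b) := by
        rw [← D.eQ_tQ, D.tQ_FB, D.tB_dB, D.tB_tB, map_neg, _root_.mul_neg, D.neg_eQ_mul]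
      have h2 : D.eQ * (D.tQ (D.FB b) * D.γ c) = D.FB b * (D.eQ * D.γ c) := by
        rw [← mul_assoc, D.eQ_tQ, D.eQ_comm, mul_assoc]
      have h3 : D.FB (D.dB (D.tB (D.dB b))) * D.γ c = D.FB (D.dB b) * (D.eQ * D.γ c) := by
        rw [D.tB_dB, map_neg, map_neg, D.FB_dd, h1, _root_.neg_mul, mul_assoc, D.neg_eQ_mul,
          ← mul_assoc, D.eQ_comm, mul_assoc]
      have h4 : D.tQ (D.FB (D.dB b)) = - D.FB (D.dB (D.tB b)) := by
        rw [D.tQ_FB, D.tB_dB, map_neg]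
      have h5 : D.V (D.FB (D.dB b) * (D.eQ * D.γ c)) + D.V (D.FB (D.dB b) * (D.eQ * D.γ c)) = 0 := by
        rw [← map_add, ← _root_.mul_add, D.eQ_mul_add, MulZeroClass.mul_zero, map_zero]
      have h6 := eq_neg_of_add_eq_zero_left h5
      rw [j_mul_dV, map_sub, D.d_dV, D.d_j, j_mul_dV, D.t_j, D.d_dV, ← D.γ_iM, j_mul_dV, D.tB_tB,
        h2, h3, h4, D.γ_iM, D.tQ_FB, D.tB_tB, _root_.neg_mul, map_neg, map_neg]
      conv_rhs => rw [h6]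
      rw [← sub_eq_zero, ← neg_eq_zero, ← h5]
      abel

theorem d_mul_left (v y : S) : D.mul (D.d v) y = D.d (D.mul v y) - D.mul (D.t v) (D.d y) := by
  rw [leibniz, add_sub_cancel_right]

theorem d_mul_right (y v : S) :
    D.mul y (D.d v) = D.d (D.mul (D.t y) v) - D.mul (D.d (D.t y)) v := by
  rw [leibniz, D.t_t, add_sub_cancel_left]

/-- As soon as one of the three factors lies in the image of `V`, the projection formulas move the
others under `V`, and associativity of level `n` applies; likewise in the other two positions. -/
theorem assoc_V_left (x : Q) (y z : S) :
    D.mul (D.mul (D.V x) y) z = D.mul (D.V x) (D.mul y z) := by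
  simp only [V_mul, F_mul, mul_assoc]

theorem assoc_V_mid (x : Q) (y z : S) :
    D.mul (D.mul y (D.V x)) z = D.mul y (D.mul (D.V x) z) := by
  simp only [V_mul, mul_V, F_mul, mul_assoc]

theorem assoc_V_right (x : Q) (y z : S) :
    D.mul (D.mul y z) (D.V x) = D.mul y (D.mul z (D.V x)) := by
  simp only [mul_V, F_mul, mul_assoc]

/-- The Leibniz rule replaces a factor `dV(x)` by factors `V(x)`, for which associativity is known.
Only the case of three integral factors remains. -/
theorem mul_assoc' (s y z : S) : D.mul (D.mul s y) z = D.mul s (D.mul y z) := by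
  induction s using D.ind with
  | hadd s s' hs hs' => simp only [add_mul, hs, hs']
  | hV c => exact D.assoc_V_left _ _ _
  | hdV c =>
    rw [d_mul_left, sub_mul, d_mul_left, D.t_mul, D.t_V, assoc_V_left, assoc_V_left, assoc_V_left,
      D.d_mul_left (D.V (D.γ c)), D.t_V, D.leibniz y, mul_add]
    abel
  | hj b =>
    induction y using D.ind with
    | hadd y y' hy hy' => simp only [add_mul, mul_add, hy, hy']
    | hV c => exact D.assoc_V_mid _ _ _
    | hdV c =>
      have e1 := D.assoc_V_mid (D.γ c) (D.t (D.j b)) z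
      have e2 := D.assoc_V_mid (D.γ c) (D.d (D.t (D.j b))) z
      have e3 := D.assoc_V_mid (D.tQ (D.γ c)) (D.j b) (D.d z)
      rw [d_mul_right, sub_mul, d_mul_left, e1, e2, D.t_mul, D.t_t, D.t_V, e3,
        D.d_mul_left (D.V (D.γ c)), D.t_V, mul_sub, D.d_mul_right (D.j b) (D.mul _ _)]
      abel
    | hj b' =>
      induction z using D.ind with
      | hadd z z' hz hz' => simp only [mul_add, hz, hz']
      | hV c => exact D.assoc_V_right _ _ _
      | hdV c =>
        rw [d_mul_right, D.t_mul, D.assoc_V_right, D.leibniz (D.t (D.j b)) (D.t (D.j b')), add_mul,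
          D.assoc_V_right, D.assoc_V_right, D.d_mul_right (D.j b'), mul_sub,
          D.d_mul_right (D.j b) (D.mul _ _), D.t_t]
        abel
      | hj b'' => simp only [j_mul_j, mul_assoc]

theorem one_mul' (y : S) : D.mul (D.j 1) y = y := by
  have h : D.dB 1 = 0 := by
    have := D.dB_mul 1 1
    simpa using this
  induction y using D.ind with
  | hadd y y' hy hy' => rw [mul_add, hy, hy']
  | hV c => rw [j_mul_V, map_one, one_mul]
  | hdV c => rw [j_mul_dV, map_one, map_one, map_one, h, map_zero, one_mul, MulZeroClass.zero_mul,
      map_zero, sub_zero]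
  | hj b => rw [j_mul_j, one_mul]

theorem mul_one' (y : S) : D.mul y (D.j 1) = y := by
  have h : D.dB 1 = 0 := by
    have := D.dB_mul 1 1
    simpa using this
  induction y using D.ind with
  | hadd y y' hy hy' => rw [add_mul, hy, hy']
  | hV c => rw [Vγ_mul, D.F_j, map_one, mul_one]
  | hdV c => rw [dVγ_mul, D.d_j, D.F_j, D.F_j, h, map_one, map_zero, mul_one, MulZeroClass.mul_zero,
      map_zero, sub_zero]
  | hj b => rw [j_mul_j, mul_one]

/-- After the projection formulas and the Leibniz rule, the two orders differ by the order of two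
factors in `B` or in level `n`. The element `γ e` has degree one less than the whole, so it is odd
here. -/
theorem comm_even {b : B} {c e : M} (hb : ∀ b', b * b' = b' * b) (htb : D.tB b = b)
    (hFb : ∀ x, D.FB b * x = x * D.FB b) (hFdb : ∀ x, D.FB (D.dB b) * x = D.tQ x * D.FB (D.dB b))
    (hc : ∀ x, D.γ c * x = x * D.γ c) (he : ∀ x, D.γ e * x = D.tQ x * D.γ e)
    (hte : D.tQ (D.γ e) = - D.γ e) (y : S) :
    D.mul (D.j b + D.V (D.γ c) + D.d (D.V (D.γ e))) y =
      D.mul y (D.j b + D.V (D.γ c) + D.d (D.V (D.γ e))) := by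
  have h1 : D.mul (D.j b) y = D.mul y (D.j b) := by
    induction y using D.ind with
    | hadd y y' hy hy' => rw [mul_add, add_mul, hy, hy']
    | hj b' => rw [j_mul_j, j_mul_j, hb]
    | hV c => rw [mul_V, V_mul, D.F_j, hFb]
    | hdV c =>
      rw [D.d_mul_right (D.j b), D.d_mul_left (D.V _), D.t_j, htb, D.d_j, mul_V, mul_V, D.t_V, V_mul, V_mul, D.F_j,
        D.F_j, hFb, hFdb]
  rw [add_mul, add_mul, mul_add, mul_add, h1, V_mul, hc, mul_V, D.d_mul_left (D.V _), D.d_mul_right y, V_mul, he,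
    D.t_V, hte, V_mul, mul_V, mul_V, D.tQ_F, _root_.neg_mul, he, D.tQ_F, D.t_d, map_neg,
    map_neg, _root_.neg_mul, map_neg, neg_neg]

theorem comm_odd {b : B} {c e : M} (hb : ∀ b', b * b' = D.tB b' * b) (htb : D.tB b = - b)
    (hFb : ∀ x, D.FB b * x = D.tQ x * D.FB b) (hFdb : ∀ x, D.FB (D.dB b) * x = x * D.FB (D.dB b))
    (hc : ∀ x, D.γ c * x = D.tQ x * D.γ c) (he : ∀ x, D.γ e * x = x * D.γ e)
    (hte : D.tQ (D.γ e) = D.γ e) (y : S) :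
    D.mul (D.j b + D.V (D.γ c) + D.d (D.V (D.γ e))) y =
      D.mul (D.t y) (D.j b + D.V (D.γ c) + D.d (D.V (D.γ e))) := by
  have h1 : D.mul (D.j b) y = D.mul (D.t y) (D.j b) := by
    induction y using D.ind with
    | hadd y y' hy hy' => rw [mul_add, map_add, add_mul, hy, hy']
    | hj b' => rw [j_mul_j, D.t_j, j_mul_j, hb]
    | hV c => rw [mul_V, D.t_V, V_mul, D.F_j, hFb]
    | hdV c =>
      rw [D.d_mul_right (D.j b), D.t_d, neg_mul, D.d_mul_left (D.t (D.V (D.γ c)))]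
      simp only [D.t_j, htb, D.d_j, map_neg, neg_mul, _root_.neg_mul, mul_V, D.t_V, D.tQ_tQ, V_mul, D.F_j, hFb,
        hFdb]
      abel
  rw [add_mul, add_mul, mul_add, mul_add, h1, V_mul, hc, mul_V, D.tQ_F, D.d_mul_left (D.V _), D.d_mul_right (D.t y),
    V_mul, he, D.t_V, hte, V_mul, mul_V, mul_V, D.t_t, he]

end LevelStep

theorem map_inverse_natCast_mul {R S : Type*} [Ring R] [Ring S] (f : R →+ S) (k : ℕ)
    (hR : IsUnit (k : R)) (hS : IsUnit (k : S)) (x : R) :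
    f (Ring.inverse (k : R) * x) = Ring.inverse (k : S) * f x := by
  have h : (k : S) * f (Ring.inverse (k : R) * x) = f x := by
    rw [← nsmul_eq_mul, ← map_nsmul, nsmul_eq_mul, ← mul_assoc, Ring.mul_inverse_cancel _ hR, one_mul]
  rw [← h, ← mul_assoc, Ring.inverse_mul_cancel _ hS, one_mul]

/-! ### Formal sums of all four types and the additive operators on them. -/

namespace WittComplex

variable {A : Type u} [CommRing A] {E E' : WittComplex.{u, v} A} {n : ℕ}

section Inverse

variable [Algebra ZLocTwo A] {k : ℕ}

theorem inverse_eq_lam (hk : Odd k) : Ring.inverse (k : E.carrier n) =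
    E.lam (Ring.inverse (k : WittLen n A)) := by
  have h := WittLen.isUnit_natCast n k (isUnit_natCast_of_odd (A := A) hk)
  have h1 : (k : E.carrier n) * E.lam (Ring.inverse (k : WittLen n A)) = 1 := by
    rw [← map_natCast E.lam, ← map_mul, Ring.mul_inverse_cancel _ h, map_one]
  rw [← mul_one (Ring.inverse _), ← h1, ← mul_assoc, Ring.inverse_mul_cancel _ (E.isUnit_natCast hk),
    one_mul]

theorem inverse_mul_mem (hk : Odd k) {q : ℤ} {x : E.carrier n} (hx : x ∈ E.deg n q) :
    Ring.inverse (k : E.carrier n) * x ∈ E.deg n q := by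
  rw [inverse_eq_lam hk]
  have := E.mul_mem (E.lam_mem (Ring.inverse (k : WittLen n A))) hx
  rwa [zero_add] at this

theorem map_inverse_mul {m : ℕ} (f : E.carrier n →+ E'.carrier m) (hk : Odd k) (x : E.carrier n) :
    f (Ring.inverse (k : E.carrier n) * x) = Ring.inverse (k : E'.carrier m) * f x :=
  map_inverse_natCast_mul f k (E.isUnit_natCast hk) (E'.isUnit_natCast hk) x

theorem inverse_mul_cancel_left (hk : Odd k) (x : E.carrier n) :
    Ring.inverse (k : E.carrier n) * ((k : E.carrier n) * x) = x := by
  rw [← mul_assoc, Ring.inverse_mul_cancel _ (E.isUnit_natCast hk), one_mul]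

theorem mul_inverse_cancel_left (hk : Odd k) (x : E.carrier n) :
    (k : E.carrier n) * (Ring.inverse (k : E.carrier n) * x) = x := by
  rw [← mul_assoc, Ring.mul_inverse_cancel _ (E.isUnit_natCast hk), one_mul]

end Inverse

theorem odd_mul_eta_mul {k : ℕ} (hk : Odd k) (x : E.carrier n) :
    (k : E.carrier n) * (E.eta n * x) = E.eta n * x := by
  obtain ⟨m, rfl⟩ := hk
  rw [Nat.cast_add, add_mul, Nat.cast_one, one_mul, Nat.cast_mul, Nat.cast_comm, mul_assoc,
    Nat.cast_two, two_mul_eta_mul, mul_zero, zero_add]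

theorem eta_mul_add_eta_mul (x : E.carrier n) : E.eta n * x + E.eta n * x = 0 := by
  rw [← two_mul, two_mul_eta_mul]

theorem neg_eta_mul (x : E.carrier n) : - (E.eta n * x) = E.eta n * x :=
  neg_eq_of_add_eq_zero_left (E.eta_mul_add_eta_mul x)

/-- The formal sums of elements `V^r(c[X]^l)` of level `n`. -/
abbrev HigherPart (E : WittComplex.{u, v} A) (n : ℕ) : Type v :=
  ⨁ t : HigherIdx n, E.carrier t.1.1

namespace HigherPart

/-- The formal sum with the single term `V^r(c[X]^l)`. -/
def of {i : ℕ} (r l : ℕ) (h : i + r = n) (hr : 0 < r) (hl : Odd l) :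
    E.carrier i →+ HigherPart E n :=
  DirectSum.of (fun t : HigherIdx n => E.carrier t.1.1) ⟨(i, r, l), h, hr, hl⟩

/-- The additive map with given values at `V^r(c[X]^l)`. -/
def lift {G : Type*} [AddCommGroup G]
    (f : ∀ i r l : ℕ, i + r = n → 0 < r → Odd l → (E.carrier i →+ G)) : HigherPart E n →+ G :=
  DirectSum.toAddMonoid fun t => f t.1.1 t.1.2.1 t.1.2.2 t.2.1 t.2.2.1 t.2.2.2

@[simp] theorem lift_of {G : Type*} [AddCommGroup G]
    (f : ∀ i r l : ℕ, i + r = n → 0 < r → Odd l → (E.carrier i →+ G)) {i : ℕ} (r l : ℕ)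
    (h : i + r = n) (hr : 0 < r) (hl : Odd l) (c : E.carrier i) :
    lift f (of r l h hr hl c) = f i r l h hr hl c :=
  DirectSum.toAddMonoid_of _ _ _

theorem ind {P : HigherPart E n → Prop}
    (hof : ∀ i r l (h : i + r = n) hr hl (c : E.carrier i), P (of r l h hr hl c))
    (hadd : ∀ x y, P x → P y → P (x + y)) (h0 : P 0) (x : HigherPart E n) : P x := by
  induction x using DirectSum.induction_on with
  | zero => exact h0
  | of t c => exact hof _ _ _ t.2.1 t.2.2.1 t.2.2.2 c
  | add x y hx hy => exact hadd x y hx hy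

/-- The map that applies additive maps to the coefficients. -/
def map (f : ∀ i, E.carrier i →+ E'.carrier i) : HigherPart E n →+ HigherPart E' n :=
  lift fun i r l h hr hl => (of r l h hr hl).comp (f i)

@[simp] theorem map_of (f : ∀ i, E.carrier i →+ E'.carrier i) {i : ℕ} (r l : ℕ)
    (h : i + r = n) (hr : 0 < r) (hl : Odd l) (c : E.carrier i) :
    map f (of r l h hr hl c) = of r l h hr hl (f i c) :=
  lift_of _ _ _ _ _ _ _

/-- `V^r(c[X]^l) ↦ V^{r+1}(c[X]^l)` -/
def shift : HigherPart E n →+ HigherPart E (n + 1) :=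
  lift fun _ r l h _ hl => of (r + 1) l (by omega) (Nat.succ_pos r) hl

@[simp] theorem shift_of {i : ℕ} (r l : ℕ) (h : i + r = n) (hr : 0 < r) (hl : Odd l)
    (c : E.carrier i) :
    shift (of r l h hr hl c) = of (r + 1) l (by omega) (Nat.succ_pos r) hl c :=
  lift_of _ _ _ _ _ _ _

/-- The restriction. -/
def R : HigherPart E (n + 1) →+ HigherPart E n :=
  lift fun i r l h hr hl => match i, h with
    -- A coefficient of level 0 is zero and has no level below it, so the value here is immaterial.
    | 0, _ => 0
    | _ + 1, h => (of r l (by omega) hr hl).comp E.R.toAddMonoidHom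

@[simp] theorem R_of {i : ℕ} (r l : ℕ) (h : i + r = n) (hr : 0 < r) (hl : Odd l)
    (c : E.carrier (i + 1)) :
    R (of r l (by omega : i + 1 + r = n + 1) hr hl c) = of r l h hr hl (E.R c) :=
  lift_of _ _ _ _ _ _ _

theorem ind_succ {P : HigherPart E (n + 1) → Prop}
    (hof : ∀ i r l (h : i + r = n) hr hl (c : E.carrier (i + 1)),
      P (of r l (by omega : i + 1 + r = n + 1) hr hl c))
    (hadd : ∀ x y, P x → P y → P (x + y)) (h0 : P 0) (x : HigherPart E (n + 1)) : P x := by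
  refine ind ?_ hadd h0 x
  intro i r l h hr hl c
  rcases i with _ | i
  · have := E.level_zero
    rw [Subsingleton.elim c 0, map_zero]
    exact h0
  · exact hof i r l (by omega) hr hl c

/-- The elements of degree `q`. -/
def deg (n : ℕ) (q : ℤ) : AddSubgroup (HigherPart E n) where
  carrier := {x | ∀ t, x t ∈ E.deg t.1.1 q}
  zero_mem' _ := AddSubgroup.zero_mem _
  add_mem' hx hy t := AddSubgroup.add_mem _ (hx t) (hy t)
  neg_mem' hx t := AddSubgroup.neg_mem _ (hx t)

theorem of_mem {i r l : ℕ} {h : i + r = n} {hr : 0 < r} {hl : Odd l} {q : ℤ} {c : E.carrier i}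
    (hc : c ∈ E.deg i q) : of r l h hr hl c ∈ deg n q := by
  classical
  intro t
  by_cases ht : (⟨(i, r, l), h, hr, hl⟩ : HigherIdx n) = t
  · subst ht
    rw [of, DirectSum.of_eq_same]; exact hc
  · rw [of, DirectSum.of_eq_of_ne _ _ _ (Ne.symm ht)]; exact AddSubgroup.zero_mem _

theorem deg_ind {q : ℤ} {P : HigherPart E n → Prop}
    (hof : ∀ i r l (h : i + r = n) hr hl (c : E.carrier i), c ∈ E.deg i q → P (of r l h hr hl c))
    (hadd : ∀ x y, P x → P y → P (x + y)) (h0 : P 0) {x : HigherPart E n} (hx : x ∈ deg n q) :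
    P x := by
  classical
  rw [← DirectSum.sum_support_of x]
  exact Finset.sum_induction _ P hadd h0 fun t _ =>
    hof _ _ _ t.2.1 t.2.2.1 t.2.2.2 _ (hx t)

theorem lift_mem {G : Type*} [AddCommGroup G]
    {f : ∀ i r l : ℕ, i + r = n → 0 < r → Odd l → (E.carrier i →+ G)} {q : ℤ} {S : AddSubgroup G}
    (hf : ∀ i r l h hr hl (c : E.carrier i), c ∈ E.deg i q → f i r l h hr hl c ∈ S)
    {x : HigherPart E n} (hx : x ∈ deg n q) : lift f x ∈ S := by
  refine deg_ind (P := fun x => lift f x ∈ S) ?_ ?_ ?_ hx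
  · intro i r l h hr hl c hc; rw [lift_of]; exact hf i r l h hr hl c hc
  · intro x y hx hy; rw [map_add]; exact S.add_mem hx hy
  · rw [map_zero]; exact S.zero_mem

theorem map_mem {f : ∀ i, E.carrier i →+ E'.carrier i} {p q : ℤ}
    (hf : ∀ i (c : E.carrier i), c ∈ E.deg i p → f i c ∈ E'.deg i q)
    {x : HigherPart E n} (hx : x ∈ deg n p) : map f x ∈ deg n q :=
  lift_mem (S := deg n q) (fun i _ _ h hr hl c hc => of_mem (h := h) (hr := hr) (hl := hl)
    (c := f i c) (hf i c hc)) hx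

end HigherPart

/-- Level `n` of the functor `P`: formal sums of the four types of elements. -/
def PolyLevel (E : WittComplex.{u, v} A) (n : ℕ) : Type v :=
  IntPart E n × HigherPart E n × HigherPart E n

namespace PolyLevel

noncomputable instance : AddCommGroup (PolyLevel E n) :=
  inferInstanceAs (AddCommGroup (IntPart E n × HigherPart E n × HigherPart E n))

/-- The inclusion of the elements of type 1 and 2. -/
noncomputable def j : IntPart E n →+ PolyLevel E n := AddMonoidHom.inl _ _

/-- The inclusion of the elements of type 3. -/
noncomputable def v : HigherPart E n →+ PolyLevel E n :=
  (AddMonoidHom.inr (IntPart E n) (HigherPart E n × HigherPart E n)).comp (AddMonoidHom.inl _ _)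

/-- The inclusion of the elements of type 4. -/
noncomputable def w : HigherPart E n →+ PolyLevel E n :=
  (AddMonoidHom.inr (IntPart E n) (HigherPart E n × HigherPart E n)).comp (AddMonoidHom.inr _ _)

/-- The part of type 1 and 2. -/
noncomputable def pj : PolyLevel E n →+ IntPart E n :=
  AddMonoidHom.fst (IntPart E n) (HigherPart E n × HigherPart E n)

/-- The part of type 3. -/
noncomputable def pv : PolyLevel E n →+ HigherPart E n :=
  (AddMonoidHom.fst (HigherPart E n) (HigherPart E n)).comp
    (AddMonoidHom.snd (IntPart E n) (HigherPart E n × HigherPart E n))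

/-- The part of type 4. -/
noncomputable def pw : PolyLevel E n →+ HigherPart E n :=
  (AddMonoidHom.snd (HigherPart E n) (HigherPart E n)).comp
    (AddMonoidHom.snd (IntPart E n) (HigherPart E n × HigherPart E n))

theorem decomp (x : PolyLevel E n) : x = j (pj x) + v (pv x) + w (pw x) := by
  refine Prod.ext ?_ (Prod.ext ?_ ?_)
  · change x.1 = x.1 + 0 + 0
    rw [add_zero, add_zero]
  · change x.2.1 = 0 + x.2.1 + 0
    rw [zero_add, add_zero]
  · change x.2.2 = 0 + 0 + x.2.2
    rw [zero_add, zero_add]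

@[simp] theorem pj_j (b : IntPart E n) : pj (j b) = b := rfl
@[simp] theorem pv_j (b : IntPart E n) : pv (j b) = 0 := rfl
@[simp] theorem pw_j (b : IntPart E n) : pw (j b) = 0 := rfl
@[simp] theorem pj_v (c : HigherPart E n) : pj (v c) = 0 := rfl
@[simp] theorem pv_v (c : HigherPart E n) : pv (v c) = c := rfl
@[simp] theorem pw_v (c : HigherPart E n) : pw (v c) = 0 := rfl
@[simp] theorem pj_w (c : HigherPart E n) : pj (w c) = 0 := rfl
@[simp] theorem pv_w (c : HigherPart E n) : pv (w c) = 0 := rfl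
@[simp] theorem pw_w (c : HigherPart E n) : pw (w c) = c := rfl

/-- The additive map with given values on the three parts. -/
noncomputable def lift {G : Type*} [AddCommGroup G] (f : IntPart E n →+ G)
    (g h : HigherPart E n →+ G) : PolyLevel E n →+ G :=
  f.comp pj + g.comp pv + h.comp pw

section

variable {G : Type*} [AddCommGroup G] (f : IntPart E n →+ G) (g h : HigherPart E n →+ G)

theorem lift_j (b : IntPart E n) : lift f g h (j b) = f b := by
  change f b + g 0 + h 0 = f b
  rw [map_zero, map_zero, add_zero, add_zero]

theorem lift_v (c : HigherPart E n) : lift f g h (v c) = g c := by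
  change f 0 + g c + h 0 = g c
  rw [map_zero, map_zero, add_zero, zero_add]

theorem lift_w (c : HigherPart E n) : lift f g h (w c) = h c := by
  change f 0 + g 0 + h c = h c
  rw [map_zero, map_zero, zero_add, zero_add]

end

/-- The element `a[X]^k`. -/
noncomputable def z1 (k : ℕ) : E.carrier n →+ PolyLevel E n := j.comp (IntPart.y1 k)

/-- The element `b[X]^k d[X]`. -/
noncomputable def z2 (k : ℕ) : E.carrier n →+ PolyLevel E n := j.comp (IntPart.y2 k)

/-- The element `V^r(c[X]^l)`. -/
noncomputable def z3 {i : ℕ} (r l : ℕ) (h : i + r = n) (hr : 0 < r) (hl : Odd l) :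
    E.carrier i →+ PolyLevel E n := v.comp (HigherPart.of r l h hr hl)

/-- The element `dV^r(c[X]^l)`. -/
noncomputable def z4 {i : ℕ} (r l : ℕ) (h : i + r = n) (hr : 0 < r) (hl : Odd l) :
    E.carrier i →+ PolyLevel E n := w.comp (HigherPart.of r l h hr hl)

theorem ind_parts {P : PolyLevel E n → Prop} (hj : ∀ b, P (j b)) (hv : ∀ c, P (v c))
    (hw : ∀ c, P (w c)) (hadd : ∀ x y, P x → P y → P (x + y)) (x : PolyLevel E n) : P x := by
  rw [decomp x]; exact hadd _ _ (hadd _ _ (hj _) (hv _)) (hw _)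

theorem ind {P : PolyLevel E n → Prop} (h1 : ∀ k a, P (z1 k a)) (h2 : ∀ k a, P (z2 k a))
    (h3 : ∀ i r l (h : i + r = n) hr hl (c : E.carrier i), P (z3 r l h hr hl c))
    (h4 : ∀ i r l (h : i + r = n) hr hl (c : E.carrier i), P (z4 r l h hr hl c))
    (hadd : ∀ x y, P x → P y → P (x + y)) (x : PolyLevel E n) : P x := by
  have h0 : P 0 := by rw [← map_zero (z1 0)]; exact h1 0 0
  refine ind_parts ?_ ?_ ?_ hadd x
  · intro b
    induction b using IntPart.ind with
    | h1 k a => exact h1 k a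
    | h2 k a => exact h2 k a
    | hadd x y hx hy => rw [map_add]; exact hadd _ _ hx hy
  · intro c
    induction c using HigherPart.ind with
    | hof i r l h hr hl c => exact h3 i r l h hr hl c
    | hadd x y hx hy => rw [map_add]; exact hadd _ _ hx hy
    | h0 => rw [map_zero]; exact h0
  · intro c
    induction c using HigherPart.ind with
    | hof i r l h hr hl c => exact h4 i r l h hr hl c
    | hadd x y hx hy => rw [map_add]; exact hadd _ _ hx hy
    | h0 => rw [map_zero]; exact h0

/-- The element `V^r(c[X]^l)`, for `r ≥ 0`. -/
noncomputable def g3 : ∀ {i n : ℕ} (r l : ℕ), i + r = n → Odd l → (E.carrier i →+ PolyLevel E n)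
  | _, _, 0, l, h, _ => (z1 l).comp (E.Vpow 0 h)
  | _, _, r + 1, l, h, hl => z3 (r + 1) l h (Nat.succ_pos r) hl

theorem g3_pos {i : ℕ} (r l : ℕ) (h : i + r = n) (hr : 0 < r) (hl : Odd l) (c : E.carrier i) :
    g3 r l h hl c = z3 r l h hr hl c := by
  cases r with
  | zero => omega
  | succ r => rfl

/-- The map `V^{r+1}(c[X]^l) ↦ V^r(c[X]^l)`. -/
noncomputable def γ : HigherPart E (n + 1) →+ PolyLevel E n :=
  HigherPart.lift fun _ r l h _ hl => g3 (r - 1) l (by omega) hl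

theorem γ_of {i : ℕ} (r l : ℕ) (h : i + r = n) (hl : Odd l) (c : E.carrier i) :
    γ (HigherPart.of (r + 1) l (by omega : i + (r + 1) = n + 1) (Nat.succ_pos r) hl c) =
      g3 r l h hl c := HigherPart.lift_of _ _ _ _ _ _ _

theorem γ_of_one (l : ℕ) (hl : Odd l) (c : E.carrier n) :
    γ (HigherPart.of 1 l rfl Nat.one_pos hl c) = z1 l c := γ_of 0 l rfl hl c

/-- The operator `ι`. -/
noncomputable def io : PolyLevel E n →+ PolyLevel E n :=
  lift (j.comp (AddMonoidHom.mulLeft (IntPart.y1 0 (E.eta n))))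
    (v.comp (HigherPart.map fun i => AddMonoidHom.mulLeft (E.eta i)))
    (w.comp (HigherPart.map fun i => AddMonoidHom.mulLeft (E.eta i)))

theorem io_z1 (k : ℕ) (a : E.carrier n) : io (z1 k a) = z1 k (E.eta n * a) := by
  refine (lift_j _ _ _ _).trans ?_
  change j (IntPart.y1 0 (E.eta n) * IntPart.y1 k a) = _
  rw [IntPart.y1_mul_y1, zero_add]; rfl

theorem io_z2 (k : ℕ) (a : E.carrier n) : io (z2 k a) = z2 k (E.eta n * a) := by
  refine (lift_j _ _ _ _).trans ?_
  change j (IntPart.y1 0 (E.eta n) * IntPart.y2 k a) = _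
  rw [IntPart.y1_mul_y2, zero_add]; rfl

theorem io_z3 {i : ℕ} (r l : ℕ) (h : i + r = n) (hr : 0 < r) (hl : Odd l) (c : E.carrier i) :
    io (z3 r l h hr hl c) = z3 r l h hr hl (E.eta i * c) :=
  (lift_v _ _ _ _).trans (congrArg v (HigherPart.map_of _ _ _ _ _ _ _))

theorem io_z4 {i : ℕ} (r l : ℕ) (h : i + r = n) (hr : 0 < r) (hl : Odd l) (c : E.carrier i) :
    io (z4 r l h hr hl c) = z4 r l h hr hl (E.eta i * c) :=
  (lift_w _ _ _ _).trans (congrArg w (HigherPart.map_of _ _ _ _ _ _ _))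

theorem io_j (b : IntPart E n) : io (j b) = j (IntPart.y1 0 (E.eta n) * b) := lift_j _ _ _ _

/-- The involution that is `(-1)^q` in degree `q`. -/
noncomputable def t : PolyLevel E n →+ PolyLevel E n :=
  lift (j.comp IntPart.tau.toAddMonoidHom)
    (v.comp (HigherPart.map fun i => (E.tau i).toAddMonoidHom))
    (-w.comp (HigherPart.map fun i => (E.tau i).toAddMonoidHom))

theorem t_j (b : IntPart E n) : t (j b) = j (IntPart.tau b) := lift_j _ _ _ _

theorem t_z1 (k : ℕ) (a : E.carrier n) : t (z1 k a) = z1 k (E.tau n a) :=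
  (t_j _).trans (congrArg j (IntPart.tau_y1 k a))

theorem t_z2 (k : ℕ) (a : E.carrier n) : t (z2 k a) = - z2 k (E.tau n a) :=
  (t_j _).trans ((congrArg j (IntPart.tau_y2 k a)).trans (map_neg _ _))

theorem t_v (c : HigherPart E n) :
    t (v c) = v (HigherPart.map (fun i => (E.tau i).toAddMonoidHom) c) := lift_v _ _ _ _

theorem t_w (c : HigherPart E n) :
    t (w c) = - w (HigherPart.map (fun i => (E.tau i).toAddMonoidHom) c) := lift_w _ _ _ _

theorem t_z3 {i : ℕ} (r l : ℕ) (h : i + r = n) (hr : 0 < r) (hl : Odd l) (c : E.carrier i) :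
    t (z3 r l h hr hl c) = z3 r l h hr hl (E.tau i c) :=
  (t_v _).trans (congrArg v (HigherPart.map_of _ _ _ _ _ _ _))

theorem t_z4 {i : ℕ} (r l : ℕ) (h : i + r = n) (hr : 0 < r) (hl : Odd l) (c : E.carrier i) :
    t (z4 r l h hr hl c) = - z4 r l h hr hl (E.tau i c) :=
  (t_w _).trans (congrArg (fun x => - w x) (HigherPart.map_of _ _ _ _ _ _ _))

/-- The differential. -/
noncomputable def d : PolyLevel E n →+ PolyLevel E n :=
  lift (j.comp IntPart.d) w (w.comp (HigherPart.map fun i => AddMonoidHom.mulLeft (E.eta i)))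

theorem d_j (b : IntPart E n) : d (j b) = j (IntPart.d b) := lift_j _ _ _ _
theorem d_v (c : HigherPart E n) : d (v c) = w c := lift_v _ _ _ _

theorem d_z1 (k : ℕ) (a : E.carrier n) :
    d (z1 k a) = z1 k (E.d a) + z2 (k - 1) ((k : E.carrier n) * E.tau n a) :=
  (d_j _).trans ((congrArg j (IntPart.d_y1 k a)).trans (map_add _ _ _))

theorem d_z2 (k : ℕ) (b : E.carrier n) :
    d (z2 k b) = z2 k (E.d b) + z2 k (((k + 1 : ℕ) : E.carrier n) * (E.eta n * b)) :=
  (d_j _).trans ((congrArg j (IntPart.d_y2 k b)).trans (map_add _ _ _))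

theorem d_z3 {i : ℕ} (r l : ℕ) (h : i + r = n) (hr : 0 < r) (hl : Odd l) (c : E.carrier i) :
    d (z3 r l h hr hl c) = z4 r l h hr hl c := d_v _

theorem d_z4 {i : ℕ} (r l : ℕ) (h : i + r = n) (hr : 0 < r) (hl : Odd l) (c : E.carrier i) :
    d (z4 r l h hr hl c) = z4 r l h hr hl (E.eta i * c) :=
  (lift_w _ _ _ _).trans (congrArg w (HigherPart.map_of _ _ _ _ _ _ _))

/-- The restriction. -/
noncomputable def R : PolyLevel E (n + 1) →+ PolyLevel E n :=
  lift (j.comp IntPart.R.toAddMonoidHom) (v.comp HigherPart.R) (w.comp HigherPart.R)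

theorem R_j (b : IntPart E (n + 1)) : R (j b) = j (IntPart.R b) := lift_j _ _ _ _
theorem R_v (c : HigherPart E (n + 1)) : R (v c) = v (HigherPart.R c) := lift_v _ _ _ _
theorem R_w (c : HigherPart E (n + 1)) : R (w c) = w (HigherPart.R c) := lift_w _ _ _ _

theorem R_z1 (k : ℕ) (a : E.carrier (n + 1)) : R (z1 k a) = z1 k (E.R a) :=
  (R_j _).trans (congrArg j (IntPart.R_y1 k a))

theorem R_z2 (k : ℕ) (a : E.carrier (n + 1)) : R (z2 k a) = z2 k (E.R a) :=
  (R_j _).trans (congrArg j (IntPart.R_y2 k a))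

theorem R_z3 {i : ℕ} (r l : ℕ) (h : i + r = n) (hr : 0 < r) (hl : Odd l)
    (c : E.carrier (i + 1)) :
    R (z3 r l (by omega : i + 1 + r = n + 1) hr hl c) = z3 r l h hr hl (E.R c) :=
  (R_v _).trans (congrArg v (HigherPart.R_of _ _ _ _ _ _))

theorem R_z4 {i : ℕ} (r l : ℕ) (h : i + r = n) (hr : 0 < r) (hl : Odd l)
    (c : E.carrier (i + 1)) :
    R (z4 r l (by omega : i + 1 + r = n + 1) hr hl c) = z4 r l h hr hl (E.R c) :=
  (R_w _).trans (congrArg w (HigherPart.R_of _ _ _ _ _ _))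

theorem ind_succ {P : PolyLevel E (n + 1) → Prop} (h1 : ∀ k a, P (z1 k a))
    (h2 : ∀ k a, P (z2 k a))
    (h3 : ∀ i r l (h : i + r = n) hr hl (c : E.carrier (i + 1)),
      P (z3 r l (by omega : i + 1 + r = n + 1) hr hl c))
    (h4 : ∀ i r l (h : i + r = n) hr hl (c : E.carrier (i + 1)),
      P (z4 r l (by omega : i + 1 + r = n + 1) hr hl c))
    (hadd : ∀ x y, P x → P y → P (x + y)) (x : PolyLevel E (n + 1)) : P x := by
  have h0 : P 0 := by rw [← map_zero (z1 0)]; exact h1 0 0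
  have := E.level_zero
  refine ind h1 h2 ?_ ?_ hadd x
  · intro i r l h hr hl c
    rcases i with _ | i
    · rw [Subsingleton.elim c 0, map_zero]; exact h0
    · exact h3 i r l (by omega) hr hl c
  · intro i r l h hr hl c
    rcases i with _ | i
    · rw [Subsingleton.elim c 0, map_zero]; exact h0
    · exact h4 i r l (by omega) hr hl c

/-- The Frobenius. -/
noncomputable def F : PolyLevel E (n + 1) →+ PolyLevel E n :=
  lift (j.comp IntPart.F.toAddMonoidHom) (γ + γ) ((d + io).comp γ)

theorem F_j (b : IntPart E (n + 1)) : F (j b) = j (IntPart.F b) := lift_j _ _ _ _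
theorem F_v (c : HigherPart E (n + 1)) : F (v c) = γ c + γ c := lift_v _ _ _ _
theorem F_w (c : HigherPart E (n + 1)) : F (w c) = d (γ c) + io (γ c) := lift_w _ _ _ _

theorem F_z1 (k : ℕ) (a : E.carrier (n + 1)) : F (z1 k a) = z1 (2 * k) (E.F a) :=
  (F_j _).trans (congrArg j (IntPart.F_y1 k a))

theorem F_z2 (k : ℕ) (a : E.carrier (n + 1)) : F (z2 k a) = z2 (2 * k + 1) (E.F a) :=
  (F_j _).trans (congrArg j (IntPart.F_y2 k a))

theorem F_z3_one (l : ℕ) (hl : Odd l) (c : E.carrier n) :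
    F (z3 1 l rfl Nat.one_pos hl c) = z1 l c + z1 l c := by
  refine (F_v _).trans ?_; rw [γ_of_one]

theorem F_z3 {i : ℕ} (r l : ℕ) (h : i + r = n) (hr : 0 < r) (hl : Odd l) (c : E.carrier i) :
    F (z3 (r + 1) l (by omega : i + (r + 1) = n + 1) (Nat.succ_pos r) hl c) =
      z3 r l h hr hl c + z3 r l h hr hl c := by
  refine (F_v _).trans ?_; rw [γ_of r l h, g3_pos r l h hr]

theorem F_z4_one (l : ℕ) (hl : Odd l) (c : E.carrier n) :
    F (z4 1 l rfl Nat.one_pos hl c) = d (z1 l c) + z1 l (E.eta n * c) := by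
  refine (F_w _).trans ?_; rw [γ_of_one, io_z1]

theorem F_z4 {i : ℕ} (r l : ℕ) (h : i + r = n) (hr : 0 < r) (hl : Odd l) (c : E.carrier i) :
    F (z4 (r + 1) l (by omega : i + (r + 1) = n + 1) (Nat.succ_pos r) hl c) =
      z4 r l h hr hl c + z3 r l h hr hl (E.eta i * c) := by
  refine (F_w _).trans ?_; rw [γ_of r l h, g3_pos r l h hr, d_z3, io_z3]

/-- The value of `V` at `a[X]^k`. -/
noncomputable def V1 (k : ℕ) : E.carrier n →+ PolyLevel E (n + 1) :=
  if hk : Odd k then z3 1 k rfl Nat.one_pos hk else (z1 (k / 2)).comp E.V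

/-- The value of `V` at `b[X]^k d[X]`. -/
noncomputable def V2 (k : ℕ) : E.carrier n →+ PolyLevel E (n + 1) :=
  -- The index `k` stands for `b[X]^k d[X]`, so the number to be inverted is `k + 1`.
  if hk : Odd (k + 1) then
    let g := (AddMonoidHom.mulLeft (Ring.inverse ((k + 1 : ℕ) : E.carrier n))).comp
      (E.tau n).toAddMonoidHom
    (-(z3 1 (k + 1) rfl Nat.one_pos hk).comp (E.d.comp g) +
      ((z4 1 (k + 1) rfl Nat.one_pos hk).comp g + (z4 1 (k + 1) rfl Nat.one_pos hk).comp g))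
  else (z2 (k / 2)).comp E.V

/-- The Verschiebung. -/
noncomputable def V : PolyLevel E n →+ PolyLevel E (n + 1) :=
  lift (IntPart.lift V1 V2) (v.comp HigherPart.shift)
    ((w.comp HigherPart.shift) + (w.comp HigherPart.shift))

theorem V_z1_odd (k : ℕ) (hk : Odd k) (a : E.carrier n) :
    V (z1 k a) = z3 1 k rfl Nat.one_pos hk a := by
  refine (lift_j _ _ _ _).trans ((IntPart.lift_y1 _ _ _ _).trans ?_)
  rw [V1, dif_pos hk]

theorem V_z1_even (k : ℕ) (a : E.carrier n) : V (z1 (2 * k) a) = z1 k (E.V a) := by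
  refine (lift_j _ _ _ _).trans ((IntPart.lift_y1 _ _ _ _).trans ?_)
  rw [V1, dif_neg (by simp), Nat.mul_div_cancel_left k (by norm_num)]; rfl

/-- With `g = (k+1)⁻¹τ(b)` one has `d(g[X]^(k+1)) = (dg)[X]^(k+1) + b[X]^k d[X]`, so `Vd = 2dV`
leaves no other choice for this value. -/
theorem V_z2_even (k : ℕ) (hk : Odd (k + 1)) (b : E.carrier n) :
    V (z2 k b) = - z3 1 (k + 1) rfl Nat.one_pos hk
        (E.d (Ring.inverse ((k + 1 : ℕ) : E.carrier n) * E.tau n b))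
      + (z4 1 (k + 1) rfl Nat.one_pos hk (Ring.inverse ((k + 1 : ℕ) : E.carrier n) * E.tau n b)
        + z4 1 (k + 1) rfl Nat.one_pos hk
          (Ring.inverse ((k + 1 : ℕ) : E.carrier n) * E.tau n b)) := by
  refine (lift_j _ _ _ _).trans ((IntPart.lift_y2 _ _ _ _).trans ?_)
  rw [V2, dif_pos hk]; rfl

theorem V_z2_odd (k : ℕ) (b : E.carrier n) : V (z2 (2 * k + 1) b) = z2 k (E.V b) := by
  refine (lift_j _ _ _ _).trans ((IntPart.lift_y2 _ _ _ _).trans ?_)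
  rw [V2, dif_neg (by rw [Nat.not_odd_iff_even]; exact ⟨k + 1, by omega⟩),
    show (2 * k + 1) / 2 = k by omega]; rfl

theorem V_z3 {i : ℕ} (r l : ℕ) (h : i + r = n) (hr : 0 < r) (hl : Odd l) (c : E.carrier i) :
    V (z3 r l h hr hl c) = z3 (r + 1) l (by omega) (Nat.succ_pos r) hl c :=
  (lift_v _ _ _ _).trans (congrArg v (HigherPart.shift_of _ _ _ _ _ _))

theorem V_z4 {i : ℕ} (r l : ℕ) (h : i + r = n) (hr : 0 < r) (hl : Odd l) (c : E.carrier i) :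
    V (z4 r l h hr hl c) = z4 (r + 1) l (by omega) (Nat.succ_pos r) hl c +
      z4 (r + 1) l (by omega) (Nat.succ_pos r) hl c :=
  (lift_w _ _ _ _).trans (congrArg (fun x => w x + w x) (HigherPart.shift_of _ _ _ _ _ _))

theorem V_g3 {i : ℕ} (r l : ℕ) (h : i + r = n) (hl : Odd l) (c : E.carrier i) :
    V (g3 r l h hl c) = z3 (r + 1) l (by omega) (Nat.succ_pos r) hl c := by
  rcases r with _ | r
  · subst h; exact V_z1_odd l hl c
  · rw [g3_pos _ _ h (Nat.succ_pos r), V_z3]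

/-- Through `γ`, all elements of type 3 and 4 become `V(x)` and `dV(x)` with `x` one level lower,
which is the decomposition on which the recursion for the product rests. -/
theorem V_γ (c : HigherPart E (n + 1)) : V (γ c) = v c := by
  induction c using HigherPart.ind with
  | hadd x y hx hy => simp only [map_add, hx, hy]
  | h0 => simp only [map_zero]
  | hof i r l h hr hl c =>
    obtain ⟨r, rfl⟩ : ∃ s, r = s + 1 := ⟨r - 1, by omega⟩
    rw [γ_of r l (by omega : i + r = n) hl, V_g3]; rfl

theorem d_V_γ (c : HigherPart E (n + 1)) : d (V (γ c)) = w c := by rw [V_γ, d_v]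

end PolyLevel

end WittComplex

/-! ### Relations between the additive operators, checked on the four types. -/

namespace WittComplex

variable {A : Type u} [CommRing A] {E E' : WittComplex.{u, v} A} {n : ℕ}

namespace PolyLevel

theorem io_v (c : HigherPart E n) :
    io (v c) = v (HigherPart.map (fun i => AddMonoidHom.mulLeft (E.eta i)) c) := lift_v _ _ _ _

theorem io_w (c : HigherPart E n) :
    io (w c) = w (HigherPart.map (fun i => AddMonoidHom.mulLeft (E.eta i)) c) := lift_w _ _ _ _

theorem d_w (c : HigherPart E n) :
    d (w c) = w (HigherPart.map (fun i => AddMonoidHom.mulLeft (E.eta i)) c) := lift_w _ _ _ _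

theorem io_g3 {i : ℕ} (r l : ℕ) (h : i + r = n) (hl : Odd l) (c : E.carrier i) :
    io (g3 r l h hl c) = g3 r l h hl (E.eta i * c) := by
  rcases r with _ | r
  · subst h; exact io_z1 l c
  · rw [g3_pos _ _ h (Nat.succ_pos r), io_z3, g3_pos _ _ h (Nat.succ_pos r)]

theorem t_g3 {i : ℕ} (r l : ℕ) (h : i + r = n) (hl : Odd l) (c : E.carrier i) :
    t (g3 r l h hl c) = g3 r l h hl (E.tau i c) := by
  rcases r with _ | r
  · subst h; exact t_z1 l c
  · rw [g3_pos _ _ h (Nat.succ_pos r), t_z3, g3_pos _ _ h (Nat.succ_pos r)]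

theorem R_g3 {i : ℕ} (r l : ℕ) (h : i + r = n) (hl : Odd l) (c : E.carrier (i + 1)) :
    R (g3 r l (by omega : i + 1 + r = n + 1) hl c) = g3 r l h hl (E.R c) := by
  rcases r with _ | r
  · subst h; exact R_z1 l c
  · rw [g3_pos _ _ _ (Nat.succ_pos r), R_z3 _ _ h, g3_pos _ _ h (Nat.succ_pos r)]

theorem γ_map_tau (c : HigherPart E (n + 1)) :
    γ (HigherPart.map (fun i => (E.tau i).toAddMonoidHom) c) = t (γ c) := by
  induction c using HigherPart.ind with
  | hadd x y hx hy => simp only [map_add, hx, hy]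
  | h0 => simp only [map_zero]
  | hof i r l h hr hl c =>
    obtain ⟨r, rfl⟩ : ∃ s, r = s + 1 := ⟨r - 1, by omega⟩
    rw [HigherPart.map_of, γ_of r l (by omega : i + r = n) hl, γ_of r l (by omega : i + r = n) hl,
      t_g3]
    rfl

theorem γ_map_eta (c : HigherPart E (n + 1)) :
    γ (HigherPart.map (fun i => AddMonoidHom.mulLeft (E.eta i)) c) = io (γ c) := by
  induction c using HigherPart.ind with
  | hadd x y hx hy => simp only [map_add, hx, hy]
  | h0 => simp only [map_zero]
  | hof i r l h hr hl c =>
    obtain ⟨r, rfl⟩ : ∃ s, r = s + 1 := ⟨r - 1, by omega⟩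
    rw [HigherPart.map_of, γ_of r l (by omega : i + r = n) hl, γ_of r l (by omega : i + r = n) hl,
      io_g3]
    rfl

theorem γ_R (c : HigherPart E (n + 1 + 1)) : γ (HigherPart.R c) = R (γ c) := by
  induction c using HigherPart.ind_succ with
  | hadd x y hx hy => simp only [map_add, hx, hy]
  | h0 => simp only [map_zero]
  | hof i r l h hr hl c =>
    obtain ⟨r, rfl⟩ : ∃ s, r = s + 1 := ⟨r - 1, by omega⟩
    rw [HigherPart.R_of _ _ h, γ_of r l (by omega : i + r = n) hl,
      γ_of r l (by omega : i + 1 + r = n + 1) hl, R_g3]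

theorem io_add_io (x : PolyLevel E n) : io x + io x = 0 := by
  induction x using ind with
  | hadd x y hx hy => rw [map_add, add_add_add_comm, hx, hy, add_zero]
  | h1 k a => rw [io_z1, ← map_add, eta_mul_add_eta_mul, map_zero]
  | h2 k a => rw [io_z2, ← map_add, eta_mul_add_eta_mul, map_zero]
  | h3 i r l h hr hl c => rw [io_z3, ← map_add, eta_mul_add_eta_mul, map_zero]
  | h4 i r l h hr hl c => rw [io_z4, ← map_add, eta_mul_add_eta_mul, map_zero]

theorem io_t (x : PolyLevel E n) : io (t x) = io x := by
  induction x using ind with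
  | hadd x y hx hy => simp only [map_add, hx, hy]
  | h1 k a => rw [t_z1, io_z1, io_z1, E.eta_tau]
  | h2 k a => rw [t_z2, map_neg, io_z2, io_z2, E.eta_tau, ← map_neg, neg_eta_mul]
  | h3 i r l h hr hl c => rw [t_z3, io_z3, io_z3, E.eta_tau]
  | h4 i r l h hr hl c => rw [t_z4, map_neg, io_z4, io_z4, E.eta_tau, ← map_neg, neg_eta_mul]

theorem t_io (x : PolyLevel E n) : t (io x) = io x := by
  induction x using ind with
  | hadd x y hx hy => simp only [map_add, hx, hy]
  | h1 k a => rw [io_z1, t_z1, map_mul, tau_eta, E.eta_tau]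
  | h2 k a => rw [io_z2, t_z2, map_mul, tau_eta, E.eta_tau, ← map_neg, neg_eta_mul]
  | h3 i r l h hr hl c => rw [io_z3, t_z3, map_mul, tau_eta, E.eta_tau]
  | h4 i r l h hr hl c => rw [io_z4, t_z4, map_mul, tau_eta, E.eta_tau, ← map_neg, neg_eta_mul]

theorem t_t (x : PolyLevel E n) : t (t x) = x := by
  induction x using ind with
  | hadd x y hx hy => simp only [map_add, hx, hy]
  | h1 k a => rw [t_z1, t_z1, tau_tau]
  | h2 k a => rw [t_z2, map_neg, t_z2, tau_tau, neg_neg]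
  | h3 i r l h hr hl c => rw [t_z3, t_z3, tau_tau]
  | h4 i r l h hr hl c => rw [t_z4, map_neg, t_z4, tau_tau, neg_neg]

theorem t_d (x : PolyLevel E n) : t (d x) = - d (t x) := by
  induction x using ind_parts with
  | hadd x y hx hy => simp only [map_add, hx, hy, neg_add]
  | hj b => rw [d_j, t_j, t_j, d_j, IntPart.tau_d, map_neg]
  | hv c => rw [d_v, t_v, t_w, d_v]
  | hw c =>
    induction c using HigherPart.ind with
    | hadd x y hx hy => simp only [map_add, hx, hy, neg_add]
    | h0 => simp only [map_zero, neg_zero]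
    | hof i r l h hr hl c =>
      change t (d (z4 r l h hr hl c)) = - d (t (z4 r l h hr hl c))
      rw [d_z4, t_z4, t_z4, map_neg, d_z4, map_mul, tau_eta, neg_neg, E.eta_tau, ← map_neg,
        neg_eta_mul]

theorem io_d (x : PolyLevel E n) : io (d x) = d (io x) := by
  induction x using ind with
  | hadd x y hx hy => simp only [map_add, hx, hy]
  | h1 k a =>
    rw [io_z1, d_z1, d_z1, map_add, io_z1, io_z2, d_eta_mul, map_mul (E.tau n), tau_eta,
      ← mul_assoc (E.eta n), ← Nat.cast_comm, mul_assoc]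
  | h2 k a =>
    rw [io_z2, d_z2, d_z2, map_add, io_z2, io_z2, d_eta_mul, ← mul_assoc, ← Nat.cast_comm,
      mul_assoc]
  | h3 i r l h hr hl c => rw [io_z3, d_z3, d_z3, io_z4]
  | h4 i r l h hr hl c => rw [io_z4, d_z4, d_z4, io_z4]

theorem d_d (x : PolyLevel E n) : d (d x) = io (d x) := by
  induction x using ind_parts with
  | hadd x y hx hy => simp only [map_add, hx, hy]
  | hj b => rw [d_j, d_j, io_j, IntPart.d_d]
  | hv c => rw [d_v, d_w, io_w]
  | hw c =>
    induction c using HigherPart.ind with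
    | hadd x y hx hy => simp only [map_add, hx, hy]
    | h0 => simp only [map_zero]
    | hof i r l h hr hl c =>
      change d (d (z4 r l h hr hl c)) = io (d (z4 r l h hr hl c))
      rw [d_z4, d_z4, io_z4]

theorem F_io (x : PolyLevel E (n + 1)) : F (io x) = io (F x) := by
  induction x using ind_parts with
  | hadd x y hx hy => simp only [map_add, hx, hy]
  | hj b => rw [io_j, F_j, F_j, io_j, map_mul, IntPart.F_y1, mul_zero, F_eta]
  | hv c => rw [F_v, io_v, F_v, γ_map_eta,
      map_add]
  | hw c => rw [F_w, io_w, F_w, γ_map_eta,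
      map_add, io_d]

theorem t_F (x : PolyLevel E (n + 1)) : t (F x) = F (t x) := by
  induction x using ind_parts with
  | hadd x y hx hy => simp only [map_add, hx, hy]
  | hj b => rw [F_j, t_j, t_j, F_j, IntPart.tau_F]
  | hv c => rw [F_v, t_v, F_v, γ_map_tau, map_add]
  | hw c =>
    rw [F_w, t_w, map_neg, F_w, γ_map_tau, map_add, t_d, neg_add, t_io, io_t,
      neg_eq_of_add_eq_zero_left (io_add_io _)]

theorem d_F (x : PolyLevel E (n + 1)) : d (F x) = F (d x) + F (d x) := by
  induction x using ind_parts with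
  | hadd x y hx hy => simp only [map_add, hx, hy]; abel
  | hj b => rw [F_j, d_j, d_j, F_j, IntPart.d_F, map_add]
  | hv c =>
    rw [F_v, d_v, F_w, map_add, add_add_add_comm, io_add_io, add_zero]
  | hw c =>
    have h : d (w c) = io (w c) := by rw [← d_v, d_d]
    rw [h, F_io, io_add_io, F_w, map_add, d_d, ← io_d, io_add_io]

theorem R_t (x : PolyLevel E (n + 1)) : R (t x) = t (R x) := by
  induction x using ind_succ with
  | hadd x y hx hy => simp only [map_add, hx, hy]
  | h1 k a => rw [t_z1, R_z1, R_z1, t_z1, tau_R]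
  | h2 k a => rw [t_z2, map_neg, R_z2, R_z2, t_z2, tau_R]
  | h3 i r l h hr hl c => rw [t_z3, R_z3 _ _ h, R_z3 _ _ h, t_z3, tau_R]
  | h4 i r l h hr hl c => rw [t_z4, map_neg, R_z4 _ _ h, R_z4 _ _ h, t_z4, tau_R]

theorem R_io (x : PolyLevel E (n + 1)) : R (io x) = io (R x) := by
  induction x using ind_succ with
  | hadd x y hx hy => simp only [map_add, hx, hy]
  | h1 k a => rw [io_z1, R_z1, R_z1, io_z1, map_mul, R_eta]
  | h2 k a => rw [io_z2, R_z2, R_z2, io_z2, map_mul, R_eta]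
  | h3 i r l h hr hl c => rw [io_z3, R_z3 _ _ h, R_z3 _ _ h, io_z3, map_mul, R_eta]
  | h4 i r l h hr hl c => rw [io_z4, R_z4 _ _ h, R_z4 _ _ h, io_z4, map_mul, R_eta]

theorem R_d (x : PolyLevel E (n + 1)) : R (d x) = d (R x) := by
  induction x using ind_parts with
  | hadd x y hx hy => simp only [map_add, hx, hy]
  | hj b => rw [d_j, R_j, R_j, d_j, IntPart.R_d]
  | hv c => rw [d_v, R_v, R_w, d_v]
  | hw c =>
    have h : ∀ {m} (c : HigherPart E m), d (w c) = io (w c) := fun c => by rw [← d_v, d_d]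
    rw [h, R_io, R_w, h]

theorem R_F (x : PolyLevel E (n + 1 + 1)) : R (F x) = F (R x) := by
  induction x using ind_parts with
  | hadd x y hx hy => simp only [map_add, hx, hy]
  | hj b => rw [F_j, R_j, R_j, F_j, IntPart.R_F]
  | hv c => rw [F_v, R_v, F_v, γ_R, map_add]
  | hw c => rw [F_w, R_w, F_w, γ_R, map_add, R_d, R_io]

theorem V_io (x : PolyLevel E n) : V (io x) = io (V x) := by
  induction x using ind with
  | hadd x y hx hy => simp only [map_add, hx, hy]
  | h1 k a =>
    rcases Nat.even_or_odd' k with ⟨k, rfl | rfl⟩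
    · rw [io_z1, V_z1_even, V_z1_even, io_z1, V_eta_mul]
    · rw [io_z1, V_z1_odd _ (odd_two_mul_add_one k), V_z1_odd _ (odd_two_mul_add_one k), io_z3]
  | h2 k a =>
    rcases Nat.even_or_odd' k with ⟨k, rfl | rfl⟩
    · have hk := odd_two_mul_add_one k
      have h : ∀ y : E.carrier n, Ring.inverse ((2 * k + 1 : ℕ) : E.carrier n) * (E.eta n * y) =
          E.eta n * (Ring.inverse ((2 * k + 1 : ℕ) : E.carrier n) * y) := fun y => by
        rw [← mul_assoc, ← E.eta_comm, mul_assoc]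
      rw [io_z2, V_z2_even _ hk, V_z2_even _ hk, map_add, map_add, map_neg, io_z3, io_z4,
        map_mul (E.tau n), tau_eta, h, d_eta_mul]
    · rw [io_z2, V_z2_odd, V_z2_odd, io_z2, V_eta_mul]
  | h3 i r l h hr hl c => rw [io_z3, V_z3, V_z3, io_z3]
  | h4 i r l h hr hl c => rw [io_z4, V_z4, V_z4, map_add, io_z4]

variable [Algebra ZLocTwo A]

theorem natCast_mul_tau_inverse {k : ℕ} (hk : Odd k) (a : E.carrier n) :
    (k : E.carrier n) * E.tau n (Ring.inverse (k : E.carrier n) * E.tau n a) = a := by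
  have e := map_inverse_mul (E.tau n).toAddMonoidHom hk (E.tau n a)
  change E.tau n (_ * _) = _ * E.tau n (E.tau n a) at e
  rw [e, tau_tau, mul_inverse_cancel_left hk]

theorem t_V (x : PolyLevel E n) : t (V x) = V (t x) := by
  induction x using ind with
  | hadd x y hx hy => simp only [map_add, hx, hy]
  | h1 k a =>
    rcases Nat.even_or_odd' k with ⟨k, rfl | rfl⟩
    · rw [t_z1, V_z1_even, V_z1_even, t_z1, tau_V]
    · rw [t_z1, V_z1_odd _ (odd_two_mul_add_one k), V_z1_odd _ (odd_two_mul_add_one k), t_z3]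
  | h2 k a =>
    rcases Nat.even_or_odd' k with ⟨k, rfl | rfl⟩
    · have hk := odd_two_mul_add_one k
      have e := map_inverse_mul (E.tau n).toAddMonoidHom hk (E.tau n a)
      change E.tau n (_ * _) = _ * E.tau n (E.tau n a) at e
      rw [t_z2, map_neg V, V_z2_even _ hk, V_z2_even _ hk, map_add, map_add, map_neg, t_z3, t_z4,
        E.tau_d, e, tau_tau, map_neg]
      abel
    · rw [t_z2, map_neg, V_z2_odd, V_z2_odd, t_z2, tau_V]
  | h3 i r l h hr hl c => rw [t_z3, V_z3, V_z3, t_z3]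
  | h4 i r l h hr hl c => rw [t_z4, map_neg, V_z4, V_z4, map_add, t_z4, neg_add]

theorem R_V (x : PolyLevel E (n + 1)) : R (V x) = V (R x) := by
  induction x using ind_succ with
  | hadd x y hx hy => simp only [map_add, hx, hy]
  | h1 k a =>
    rcases Nat.even_or_odd' k with ⟨k, rfl | rfl⟩
    · rw [R_z1, V_z1_even, V_z1_even, R_z1, E.R_V]
    · rw [R_z1, V_z1_odd _ (odd_two_mul_add_one k), V_z1_odd _ (odd_two_mul_add_one k), R_z3 _ _ rfl]
  | h2 k a =>
    rcases Nat.even_or_odd' k with ⟨k, rfl | rfl⟩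
    · have hk := odd_two_mul_add_one k
      have e := map_inverse_mul E.R.toAddMonoidHom hk (E.tau _ a)
      change E.R (_ * _) = _ * E.R (E.tau _ a) at e
      rw [R_z2, V_z2_even _ hk, V_z2_even _ hk, map_add, map_add, map_neg, R_z3 _ _ rfl,
        R_z4 _ _ rfl, E.R_d, e, tau_R]
    · rw [R_z2, V_z2_odd, V_z2_odd, R_z2, E.R_V]
  | h3 i r l h hr hl c => rw [R_z3 _ _ h, V_z3, V_z3, R_z3 _ _ (by omega)]
  | h4 i r l h hr hl c => rw [R_z4 _ _ h, V_z4, V_z4, map_add, R_z4 _ _ (by omega)]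

theorem F_V (x : PolyLevel E n) : F (V x) = x + x := by
  induction x using ind with
  | hadd x y hx hy => simp only [map_add, hx, hy]; abel
  | h1 k a =>
    rcases Nat.even_or_odd' k with ⟨k, rfl | rfl⟩
    · rw [V_z1_even, F_z1, E.F_V, two_mul (a : E.carrier n), map_add]
    · rw [V_z1_odd _ (odd_two_mul_add_one k), F_z3_one]
  | h2 k a =>
    rcases Nat.even_or_odd' k with ⟨k, rfl | rfl⟩
    · have hk := odd_two_mul_add_one k
      set g := Ring.inverse ((2 * k + 1 : ℕ) : E.carrier n) * E.tau n a with hg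
      have e2 : ((2 * k + 1 : ℕ) : E.carrier n) * E.tau n g = a := by
        rw [hg, natCast_mul_tau_inverse hk]
      have e3 : z1 (2 * k + 1) (E.eta n * g) + z1 (2 * k + 1) (E.eta n * g) = 0 := by
        rw [← map_add, eta_mul_add_eta_mul, map_zero]
      rw [V_z2_even _ hk, map_add, map_add, map_neg, F_z3_one, F_z4_one, d_z1, ← hg, e2,
        Nat.add_sub_cancel]
      have : ∀ a b c : PolyLevel E n, -(a + a) + (a + b + c + (a + b + c)) = b + b + (c + c) :=
        fun a b c => by abel
      rw [this, e3, add_zero]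
    · rw [V_z2_odd, F_z2, E.F_V, two_mul (a : E.carrier n), map_add]
  | h3 i r l h hr hl c => rw [V_z3, F_z3 _ _ h]
  | h4 i r l h hr hl c =>
    rw [V_z4, map_add, F_z4 _ _ h, add_add_add_comm, ← map_add (z3 _ _ _ _ _), eta_mul_add_eta_mul,
      map_zero, add_zero]

/-- On `a[X]^k` with `k` odd this is built into the value of `V` on type 2; for `k` even it is the
same relation in `E`. -/
theorem V_d (x : PolyLevel E n) : V (d x) = d (V x) + d (V x) := by
  induction x using ind with
  | hadd x y hx hy => simp only [map_add, hx, hy]; abel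
  | h1 k a =>
    rcases Nat.even_or_odd' k with ⟨k, rfl | rfl⟩
    · rcases k with _ | k
      · have e := V_z1_even 0 (E.d a)
        have e' := V_z1_even 0 a
        rw [mul_zero] at e e' ⊢
        rw [d_z1, map_add, e', d_z1, e, E.V_d, two_mul (E.d _), map_add]
        simp
      · rw [V_z1_even, d_z1, d_z1, map_add, V_z1_even,
          show 2 * (k + 1) - 1 = 2 * k + 1 by omega, V_z2_odd, E.V_d, Nat.add_sub_cancel,
          two_mul (E.d _), map_add, Nat.cast_mul, mul_assoc, Nat.cast_two,
          two_mul ((_ : E.carrier n) * _), map_add E.V, map_add (z2 k), ← nsmul_eq_mul, map_nsmul,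
          nsmul_eq_mul, E.tau_V]
        abel
    · have hk := odd_two_mul_add_one k
      have e : E.tau n (((2 * k + 1 : ℕ) : E.carrier n) * E.tau n a) =
          ((2 * k + 1 : ℕ) : E.carrier n) * a := by
        rw [map_mul, map_natCast, tau_tau]
      rw [V_z1_odd _ hk, d_z1, d_z3, map_add, V_z1_odd _ hk, Nat.add_sub_cancel, V_z2_even _ hk, e,
        inverse_mul_cancel_left hk, add_neg_cancel_left]
  | h2 k a =>
    rcases Nat.even_or_odd' k with ⟨k, rfl | rfl⟩
    · have hk := odd_two_mul_add_one k
      set g := Ring.inverse ((2 * k + 1 : ℕ) : E.carrier n) * E.tau n a with hg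
      have e1 : Ring.inverse ((2 * k + 1 : ℕ) : E.carrier n) * E.tau n (E.d a) = - E.d g := by
        rw [E.tau_d, mul_neg, hg, ← map_inverse_mul E.d hk]
      have e2 : Ring.inverse ((2 * k + 1 : ℕ) : E.carrier n) *
          E.tau n (E.eta n * a) = E.eta n * g := by
        rw [map_mul, tau_eta, hg, ← mul_assoc, ← mul_assoc, E.eta_comm]
      have e3 : ∀ {i} (r : ℕ) (h : i + r = n + 1) hr (x : E.carrier i),
          z4 r (2 * k + 1) h hr hk (E.eta i * x) + z4 r (2 * k + 1) h hr hk (E.eta i * x) = 0 := by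
        intro i r h hr x
        rw [← map_add, eta_mul_add_eta_mul, map_zero]
      have e4 : -z3 1 (2 * k + 1) rfl Nat.one_pos hk (-(E.eta n * E.d g)) =
          z3 1 (2 * k + 1) rfl Nat.one_pos hk (E.eta n * E.d g) := by rw [map_neg, neg_neg]
      rw [d_z2, odd_mul_eta_mul hk, map_add, V_z2_even _ hk, V_z2_even _ hk, V_z2_even _ hk,
        map_add, map_add, map_neg, d_z3, d_z4, e1, e2, map_neg E.d, ← hg, d_d', d_eta_mul, e4, e3]
      simp only [map_neg, add_zero]
      abel
    · have h0 : ((2 * k + 1 + 1 : ℕ) : E.carrier n) * (E.eta n * a) = 0 := by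
        rw [show 2 * k + 1 + 1 = (k + 1) * 2 by ring, Nat.cast_mul, mul_assoc, Nat.cast_two,
          two_mul_eta_mul, mul_zero]
      have h1 : ((k + 1 : ℕ) : E.carrier (n + 1)) * (E.eta _ * E.V a)
          + ((k + 1 : ℕ) : E.carrier (n + 1)) * (E.eta _ * E.V a) = 0 := by
        rw [← mul_add, eta_mul_add_eta_mul, mul_zero]
      rw [d_z2, h0, map_zero, add_zero, V_z2_odd, V_z2_odd, d_z2, E.V_d, two_mul (E.d _), map_add,
        add_add_add_comm, ← map_add _ (_ * _), h1, map_zero, add_zero]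
  | h3 i r l h hr hl c => rw [V_z3, d_z3, d_z3, V_z4]
  | h4 i r l h hr hl c =>
    rw [V_z4, d_z4, map_add, d_z4, V_z4, ← map_add _ (_ * _), eta_mul_add_eta_mul, map_zero, add_zero]

theorem F_d_V (x : PolyLevel E n) : F (d (V x)) = d x + io x := by
  induction x using ind with
  | hadd x y hx hy => simp only [map_add, hx, hy]; abel
  | h1 k a =>
    rcases Nat.even_or_odd' k with ⟨k, rfl | rfl⟩
    · rw [V_z1_even, d_z1, map_add, F_z1, F_z2, E.F_dV, map_add, io_z1, d_z1]
      rcases k with _ | k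
      · simp
      · have h : ∀ x : E.carrier n, ((k + 1 : ℕ) : E.carrier n) * (2 * x) =
            ((2 * (k + 1) : ℕ) : E.carrier n) * x := fun x => by
          rw [← mul_assoc, _root_.mul_comm 2 (k + 1), Nat.cast_mul, Nat.cast_two]
        rw [show 2 * (k + 1) - 1 = 2 * (k + 1 - 1) + 1 by omega, map_mul E.F, map_natCast, E.tau_V,
          E.F_V, h]
        abel
    · rw [V_z1_odd _ (odd_two_mul_add_one k), d_z3, F_z4_one, io_z1]
  | h2 k a =>
    rcases Nat.even_or_odd' k with ⟨k, rfl | rfl⟩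
    · have hk := odd_two_mul_add_one k
      set g := Ring.inverse ((2 * k + 1 : ℕ) : E.carrier n) * E.tau n a with hg
      have e : ((2 * k + 1 : ℕ) : E.carrier n) * E.tau n (E.d g) = - E.d a := by
        rw [E.tau_d, mul_neg, ← d_natCast_mul, hg, natCast_mul_tau_inverse hk]
      have e3 : z4 1 (2 * k + 1) rfl Nat.one_pos hk (E.eta n * g) +
          z4 1 (2 * k + 1) rfl Nat.one_pos hk (E.eta n * g) = 0 := by
        rw [← map_add, eta_mul_add_eta_mul, map_zero]
      rw [V_z2_even _ hk, ← hg, map_add d, map_add d, map_neg d, d_z3, d_z4, e3, add_zero, map_neg,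
        F_z4_one, d_z1, e, d_z2, odd_mul_eta_mul hk, io_z2, add_assoc (z2 _ _), ← map_add _ (_ * _),
        eta_mul_add_eta_mul, map_zero, add_zero, d_d', Nat.add_sub_cancel, map_neg]
      have := io_add_io (z1 (2 * k + 1) (E.d g))
      rw [io_z1] at this
      rw [show ∀ a b : PolyLevel E n, -(a + -b + a) = b - (a + a) from fun a b => by abel, this,
        sub_zero]
    · have h0 : ((2 * k + 1 + 1 : ℕ) : E.carrier n) * (E.eta n * a) = 0 := by
        rw [show 2 * k + 1 + 1 = (k + 1) * 2 by ring, Nat.cast_mul, mul_assoc, Nat.cast_two,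
          two_mul_eta_mul, mul_zero]
      have h1 : ((k + 1 : ℕ) : E.carrier n) * (E.eta n * (2 * a)) = 0 := by
        rw [two_mul (a : E.carrier n), mul_add, eta_mul_add_eta_mul, mul_zero]
      rw [V_z2_odd, d_z2, map_add, F_z2, F_z2, E.F_dV, map_mul E.F, map_natCast, map_mul E.F,
        E.F_V, F_eta, h1, map_zero, add_zero, d_z2, h0, map_zero, add_zero, io_z2, map_add]
  | h3 i r l h hr hl c => rw [V_z3, d_z3, F_z4 _ _ h, d_z3, io_z3]
  | h4 i r l h hr hl c =>
    rw [V_z4, map_add, d_z4, ← map_add _ (_ * _), eta_mul_add_eta_mul, map_zero, map_zero, d_z4, io_z4,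
      ← map_add _ (_ * _), eta_mul_add_eta_mul, map_zero]

/-- Every element is, up to `γ c` and `dγ e`, a sum of elements of even weight, on which `V` is given
by `V` on the coefficients. -/
theorem split (x : PolyLevel E n) : ∃ y b c e, x = j y + γ c + d (γ e) ∧ V (j y) = j b ∧
    ∀ b' : IntPart E (n + 1), V (j (y * IntPart.F b')) = j (b * b') ∧
      V (j (IntPart.F b' * y)) = j (b' * b) := by
  have hγ : ∀ c : HigherPart E (n + 1), ∃ (y : IntPart E n) (b : IntPart E (n + 1)) (c' e : _),
      γ c = j y + γ c' + d (γ e) ∧ V (j y) = j b ∧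
        ∀ b' : IntPart E (n + 1), V (j (y * IntPart.F b')) = j (b * b') ∧
          V (j (IntPart.F b' * y)) = j (b' * b) := fun c =>
    ⟨0, 0, c, 0, by simp, by simp, fun b' => by simp⟩
  have hadd : ∀ x x' : PolyLevel E n, (∃ y b c e, x = j y + γ c + d (γ e) ∧ V (j y) = j b ∧
    ∀ b' : IntPart E (n + 1), V (j (y * IntPart.F b')) = j (b * b') ∧
      V (j (IntPart.F b' * y)) = j (b' * b)) → (∃ y b c e, x' = j y + γ c + d (γ e) ∧ V (j y) = j b ∧
    ∀ b' : IntPart E (n + 1), V (j (y * IntPart.F b')) = j (b * b') ∧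
      V (j (IntPart.F b' * y)) = j (b' * b)) → ∃ y b c e, x + x' = j y + γ c + d (γ e) ∧
      V (j y) = j b ∧ ∀ b' : IntPart E (n + 1), V (j (y * IntPart.F b')) = j (b * b') ∧
      V (j (IntPart.F b' * y)) = j (b' * b) := by
    rintro x x' ⟨y, b, c, e, h1, h2, h3⟩ ⟨y', b', c', e', h1', h2', h3'⟩
    refine ⟨y + y', b + b', c + c', e + e', ?_, ?_, fun z => ⟨?_, ?_⟩⟩
    · rw [h1, h1']; simp only [map_add]; abel
    · simp only [map_add, h2, h2']
    · simp only [map_add, add_mul, (h3 z).1, (h3' z).1]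
    · simp only [map_add, mul_add, (h3 z).2, (h3' z).2]
  induction x using ind with
  | hadd x y hx hy => exact hadd x y hx hy
  | h1 k a =>
    rcases Nat.even_or_odd' k with ⟨k, rfl | rfl⟩
    · refine ⟨IntPart.y1 (2 * k) a, IntPart.y1 k (E.V a), 0, 0, by simp; rfl, V_z1_even k a, ?_⟩
      -- `F` doubles weights, so the products of an element of even weight with `F b'` have even
      -- weight again; on them `V` acts through the coefficients, and the projection formula of `E`
      -- finishes.
      intro b'
      induction b' using IntPart.ind with
      | hadd x y hx hy => simp only [map_add, mul_add, add_mul, hx.1, hx.2, hy.1, hy.2, and_self]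
      | h1 l b =>
        rw [IntPart.F_y1, IntPart.y1_mul_y1, IntPart.y1_mul_y1, IntPart.y1_mul_y1,
          IntPart.y1_mul_y1, ← mul_add, ← mul_add, E.V_mul, E.mul_V]
        exact ⟨V_z1_even _ _, V_z1_even _ _⟩
      | h2 l b =>
        rw [IntPart.F_y2, IntPart.y1_mul_y2, IntPart.y2_mul_y1, IntPart.y1_mul_y2,
          IntPart.y2_mul_y1, E.V_mul, E.tau_V, E.mul_V]
        refine ⟨?_, ?_⟩
        · rw [IntPart.y2_congr (show 2 * k + (2 * l + 1) = 2 * (k + l) + 1 by ring)]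
          exact V_z2_odd _ _
        · rw [IntPart.y2_congr (show 2 * l + 1 + 2 * k = 2 * (l + k) + 1 by ring)]
          exact V_z2_odd _ _
    · have := hγ (HigherPart.of 1 (2 * k + 1) rfl Nat.one_pos (odd_two_mul_add_one k) a)
      rwa [γ_of_one] at this
  | h2 k a =>
    rcases Nat.even_or_odd' k with ⟨k, rfl | rfl⟩
    · have hk := odd_two_mul_add_one k
      -- `a[X]^(2k)d[X]` equals `d(g[X]^(2k+1)) - (dg)[X]^(2k+1)`, and elements of type 1 with odd
      -- exponent are values of `γ`.
      set g := Ring.inverse ((2 * k + 1 : ℕ) : E.carrier n) * E.tau n a with hg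
      have e : ((2 * k + 1 : ℕ) : E.carrier n) * E.tau n g = a := by
        rw [hg, natCast_mul_tau_inverse hk]
      refine ⟨0, 0, -HigherPart.of 1 (2 * k + 1) rfl Nat.one_pos hk (E.d g),
        HigherPart.of 1 (2 * k + 1) rfl Nat.one_pos hk g, ?_, by simp, fun b' => by simp⟩
      rw [map_neg, γ_of_one, γ_of_one, d_z1, e, Nat.add_sub_cancel, map_zero, zero_add,
        neg_add_cancel_left]
    · refine ⟨IntPart.y2 (2 * k + 1) a, IntPart.y2 k (E.V a), 0, 0, by simp; rfl, V_z2_odd k a, ?_⟩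
      intro b'
      induction b' using IntPart.ind with
      | hadd x y hx hy => simp only [map_add, mul_add, add_mul, hx.1, hx.2, hy.1, hy.2, and_self]
      | h1 l b =>
        rw [IntPart.F_y1, IntPart.y1_mul_y2, IntPart.y2_mul_y1, IntPart.y1_mul_y2,
          IntPart.y2_mul_y1, E.V_mul, E.tau_F, E.mul_V]
        refine ⟨?_, ?_⟩
        · rw [IntPart.y2_congr (show 2 * k + 1 + 2 * l = 2 * (k + l) + 1 by ring)]
          exact V_z2_odd _ _
        · rw [IntPart.y2_congr (show 2 * l + (2 * k + 1) = 2 * (l + k) + 1 by ring)]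
          exact V_z2_odd _ _
      | h2 l b =>
        rw [IntPart.F_y2, IntPart.y2_mul_y2, IntPart.y2_mul_y2, IntPart.y2_mul_y2,
          IntPart.y2_mul_y2, E.V_mul, ← V_eta_mul, E.mul_V b, ← V_eta_mul]
        refine ⟨?_, ?_⟩
        · rw [IntPart.y2_congr (show 2 * k + 1 + (2 * l + 1) + 1 = 2 * (k + l + 1) + 1 by ring)]
          exact V_z2_odd _ _
        · rw [IntPart.y2_congr (show 2 * l + 1 + (2 * k + 1) + 1 = 2 * (l + k + 1) + 1 by ring)]
          exact V_z2_odd _ _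
  | h3 i r l h hr hl c =>
    have := hγ (HigherPart.of (r + 1) l (by omega : i + (r + 1) = n + 1) (Nat.succ_pos r) hl c)
    rwa [γ_of r l h, g3_pos r l h hr] at this
  | h4 i r l h hr hl c =>
    refine ⟨0, 0, 0, HigherPart.of (r + 1) l (by omega : i + (r + 1) = n + 1) (Nat.succ_pos r) hl c,
      ?_, by simp, fun b' => by simp⟩
    rw [γ_of r l h, g3_pos r l h hr, d_z3]
    simp

end PolyLevel

end WittComplex

theorem DirectSum.isInternal_of_projections {M : Type*} [AddCommGroup M] (S : ℤ → AddSubgroup M)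
    (π : ℤ → M →+ M) (h1 : ∀ q x, x ∈ S q → π q x = x)
    (h2 : ∀ q q' x, x ∈ S q → q ≠ q' → π q' x = 0)
    (h3 : ∀ x, x ∈ (DirectSum.coeAddMonoidHom S).range) : DirectSum.IsInternal S := by
  refine ⟨?_, h3⟩
  have h : ∀ (z : ⨁ q, S q) (q : ℤ), π q (DirectSum.coeAddMonoidHom S z) = z q := by
    intro z q
    induction z using DirectSum.induction_on with
    | zero => simp
    | add x y hx hy => rw [map_add, map_add, hx, hy]; simp
    | of p x =>
      rw [DirectSum.coeAddMonoidHom_of]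
      by_cases hpq : p = q
      · subst hpq; rw [h1 _ _ x.2, DirectSum.of_eq_same]
      · rw [h2 _ _ _ x.2 hpq, DirectSum.of_eq_of_ne _ _ _ (Ne.symm hpq)]; rfl
  refine (injective_iff_map_eq_zero (DirectSum.coeAddMonoidHom S)).2 fun z hz => ?_
  refine DFinsupp.ext fun q => Subtype.ext ?_
  change ((z q : S q) : M) = 0
  rw [← h z q, hz, map_zero]

/-! ### The grading of the formal sums. -/

namespace WittComplex

variable {A : Type u} [CommRing A] {E E' : WittComplex.{u, v} A} {n : ℕ}

theorem HigherPart.R_mem {q : ℤ} {c : HigherPart E (n + 1)} (hc : c ∈ HigherPart.deg (n + 1) q) :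
    HigherPart.R c ∈ HigherPart.deg n q := by
  refine HigherPart.lift_mem (S := HigherPart.deg n q) (fun i r l h hr hl c hc => ?_) hc
  rcases i with _ | i
  · exact AddSubgroup.zero_mem _
  · exact HigherPart.of_mem (h := by omega) (hr := hr) (hl := hl) (c := E.R c) (E.R_mem hc)

namespace PolyLevel

/-- The elements of degree `q`. -/
noncomputable def deg (n : ℕ) (q : ℤ) : AddSubgroup (PolyLevel E n) :=
  (IntPart.deg n q).comap pj ⊓ ((HigherPart.deg n q).comap pv ⊓ (HigherPart.deg n (q - 1)).comap pw)

theorem mem_deg {q : ℤ} {x : PolyLevel E n} : x ∈ deg n q ↔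
    pj x ∈ IntPart.deg n q ∧ pv x ∈ HigherPart.deg n q ∧ pw x ∈ HigherPart.deg n (q - 1) := Iff.rfl

theorem j_mem {q : ℤ} {b : IntPart E n} (hb : b ∈ IntPart.deg n q) : j b ∈ deg n q :=
  mem_deg.2 ⟨hb, AddSubgroup.zero_mem _, AddSubgroup.zero_mem _⟩

theorem v_mem {q : ℤ} {c : HigherPart E n} (hc : c ∈ HigherPart.deg n q) : v c ∈ deg n q :=
  mem_deg.2 ⟨AddSubgroup.zero_mem _, hc, AddSubgroup.zero_mem _⟩

theorem w_mem {q : ℤ} {c : HigherPart E n} (hc : c ∈ HigherPart.deg n (q - 1)) : w c ∈ deg n q :=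
  mem_deg.2 ⟨AddSubgroup.zero_mem _, AddSubgroup.zero_mem _, hc⟩

theorem deg_ind_parts {q : ℤ} {P : PolyLevel E n → Prop} (hj : ∀ b ∈ IntPart.deg n q, P (j b))
    (hv : ∀ c ∈ HigherPart.deg n q, P (v c)) (hw : ∀ c ∈ HigherPart.deg n (q - 1), P (w c))
    (hadd : ∀ x y, P x → P y → P (x + y)) {x : PolyLevel E n} (hx : x ∈ deg n q) : P x := by
  rw [decomp x]
  exact hadd _ _ (hadd _ _ (hj _ hx.1) (hv _ hx.2.1)) (hw _ hx.2.2)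

theorem z1_mem {q : ℤ} {k : ℕ} {a : E.carrier n} (ha : a ∈ E.deg n q) : z1 k a ∈ deg n q :=
  j_mem (IntPart.y1_mem ha)

theorem z2_mem {q : ℤ} {k : ℕ} {a : E.carrier n} (ha : a ∈ E.deg n (q - 1)) : z2 k a ∈ deg n q :=
  j_mem (IntPart.y2_mem ha)

theorem z3_mem {q : ℤ} {i r l : ℕ} {h : i + r = n} {hr : 0 < r} {hl : Odd l} {c : E.carrier i}
    (hc : c ∈ E.deg i q) : z3 r l h hr hl c ∈ deg n q := v_mem (HigherPart.of_mem hc)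

theorem z4_mem {q : ℤ} {i r l : ℕ} {h : i + r = n} {hr : 0 < r} {hl : Odd l} {c : E.carrier i}
    (hc : c ∈ E.deg i (q - 1)) : z4 r l h hr hl c ∈ deg n q := w_mem (HigherPart.of_mem hc)

theorem deg_ind {q : ℤ} {P : PolyLevel E n → Prop} (h1 : ∀ k a, a ∈ E.deg n q → P (z1 k a))
    (h2 : ∀ k a, a ∈ E.deg n (q - 1) → P (z2 k a))
    (h3 : ∀ i r l (h : i + r = n) hr hl (c : E.carrier i), c ∈ E.deg i q → P (z3 r l h hr hl c))
    (h4 : ∀ i r l (h : i + r = n) hr hl (c : E.carrier i), c ∈ E.deg i (q - 1) →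
      P (z4 r l h hr hl c))
    (hadd : ∀ x y, P x → P y → P (x + y)) {x : PolyLevel E n} (hx : x ∈ deg n q) : P x := by
  have h0 : P 0 := by rw [← map_zero (z1 0)]; exact h1 0 0 (AddSubgroup.zero_mem _)
  refine deg_ind_parts (fun b hb => ?_) (fun c hc => ?_) (fun c hc => ?_) hadd hx
  · exact IntPart.deg_ind (P := fun b => P (j b)) h1 h2
      (fun x y hx hy => by rw [map_add]; exact hadd _ _ hx hy) hb
  · exact HigherPart.deg_ind (P := fun c => P (v c)) h3
      (fun x y hx hy => by rw [map_add]; exact hadd _ _ hx hy) (by rw [map_zero]; exact h0) hc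
  · exact HigherPart.deg_ind (P := fun c => P (w c)) h4
      (fun x y hx hy => by rw [map_add]; exact hadd _ _ hx hy) (by rw [map_zero]; exact h0) hc

theorem g3_mem {q : ℤ} {i r l : ℕ} {h : i + r = n} {hl : Odd l} {c : E.carrier i}
    (hc : c ∈ E.deg i q) : g3 r l h hl c ∈ deg n q := by
  rcases r with _ | r
  · subst h; exact z1_mem hc
  · rw [g3_pos _ _ h (Nat.succ_pos r)]; exact z3_mem hc

theorem γ_mem {q : ℤ} {c : HigherPart E (n + 1)} (hc : c ∈ HigherPart.deg (n + 1) q) :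
    γ c ∈ deg n q :=
  HigherPart.lift_mem (S := deg n q) (fun _ _ _ _ _ _ _ hc => g3_mem hc) hc

theorem d_mem {q : ℤ} {x : PolyLevel E n} (hx : x ∈ deg n q) : d x ∈ deg n (q + 1) := by
  refine deg_ind_parts (P := fun x => d x ∈ deg n (q + 1)) ?_ ?_ ?_ ?_ hx
  · intro b hb; rw [d_j]; exact j_mem (IntPart.d_mem hb)
  · intro c hc; rw [d_v]; exact w_mem (by rwa [add_sub_cancel_right])
  · intro c hc
    rw [d_w, add_comm]
    exact w_mem (HigherPart.map_mem (fun i c hc => by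
      have := E.mul_mem E.eta_mem hc
      rwa [← add_sub_assoc] at this) hc)
  · intro x y hx hy; rw [map_add]; exact AddSubgroup.add_mem _ hx hy

theorem io_mem {q : ℤ} {x : PolyLevel E n} (hx : x ∈ deg n q) : io x ∈ deg n (q + 1) := by
  have h : ∀ {q} {i} {a : E.carrier i}, a ∈ E.deg i q → E.eta i * a ∈ E.deg i (q + 1) := by
    intro q i a ha
    rw [add_comm]; exact E.mul_mem E.eta_mem ha
  have h' : ∀ {i} {a : E.carrier i}, a ∈ E.deg i (q - 1) → E.eta i * a ∈ E.deg i (q + 1 - 1) := by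
    intro i a ha
    have := h ha
    rwa [sub_add_eq_add_sub] at this
  refine deg_ind (P := fun x => io x ∈ deg n (q + 1)) ?_ ?_ ?_ ?_ ?_ hx
  · intro k a ha; rw [io_z1]; exact z1_mem (h ha)
  · intro k a ha; rw [io_z2]; exact z2_mem (h' ha)
  · intro i r l hi hr hl c hc; rw [io_z3]; exact z3_mem (h hc)
  · intro i r l hi hr hl c hc; rw [io_z4]; exact z4_mem (h' hc)
  · intro x y hx hy; rw [map_add]; exact AddSubgroup.add_mem _ hx hy

theorem t_of_mem {q : ℤ} {x : PolyLevel E n} (hx : x ∈ deg n q) : t x = q.negOnePow • x := by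
  have e : ∀ x : PolyLevel E n, -((q - 1).negOnePow • x) = q.negOnePow • x := fun x => by
    rw [Int.negOnePow_sub, Int.negOnePow_one, mul_neg, mul_one, Units.neg_smul, neg_neg]
  refine deg_ind (P := fun x => t x = q.negOnePow • x) ?_ ?_ ?_ ?_ ?_ hx
  · intro k a ha; rw [t_z1, E.tau_of_mem ha, map_negOnePow_smul]
  · intro k a ha; rw [t_z2, E.tau_of_mem ha, map_negOnePow_smul, e]
  · intro i r l hi hr hl c hc; rw [t_z3, E.tau_of_mem hc, map_negOnePow_smul]
  · intro i r l hi hr hl c hc; rw [t_z4, E.tau_of_mem hc, map_negOnePow_smul, e]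
  · intro x y hx hy; rw [map_add, smul_add, hx, hy]

theorem t_mem {q : ℤ} {x : PolyLevel E n} (hx : x ∈ deg n q) : t x ∈ deg n q := by
  rw [t_of_mem hx]; exact negOnePow_smul_mem _ _ hx

theorem R_mem {q : ℤ} {x : PolyLevel E (n + 1)} (hx : x ∈ deg (n + 1) q) : R x ∈ deg n q := by
  refine deg_ind_parts (P := fun x => R x ∈ deg n q) ?_ ?_ ?_ ?_ hx
  · intro b hb; rw [R_j]; exact j_mem (IntPart.R_mem hb)
  · intro c hc; rw [R_v]; exact v_mem (HigherPart.R_mem hc)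
  · intro c hc; rw [R_w]; exact w_mem (HigherPart.R_mem hc)
  · intro x y hx hy; rw [map_add]; exact AddSubgroup.add_mem _ hx hy

theorem F_mem {q : ℤ} {x : PolyLevel E (n + 1)} (hx : x ∈ deg (n + 1) q) : F x ∈ deg n q := by
  refine deg_ind_parts (P := fun x => F x ∈ deg n q) ?_ ?_ ?_ ?_ hx
  · intro b hb; rw [F_j]; exact j_mem (IntPart.F_mem hb)
  · intro c hc; rw [F_v]; exact AddSubgroup.add_mem _ (γ_mem hc) (γ_mem hc)
  · intro c hc
    have h1 := d_mem (γ_mem hc)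
    have h2 := io_mem (γ_mem hc)
    rw [sub_add_cancel] at h1 h2
    rw [F_w]; exact AddSubgroup.add_mem _ h1 h2
  · intro x y hx hy; rw [map_add]; exact AddSubgroup.add_mem _ hx hy

theorem V_mem [Algebra ZLocTwo A] {q : ℤ} {x : PolyLevel E n} (hx : x ∈ deg n q) :
    V x ∈ deg (n + 1) q := by
  refine deg_ind (P := fun x => V x ∈ deg (n + 1) q) ?_ ?_ ?_ ?_ ?_ hx
  · intro k a ha
    rcases Nat.even_or_odd' k with ⟨k, rfl | rfl⟩
    · rw [V_z1_even]; exact z1_mem (E.V_mem ha)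
    · rw [V_z1_odd _ (odd_two_mul_add_one k)]; exact z3_mem ha
  · intro k a ha
    rcases Nat.even_or_odd' k with ⟨k, rfl | rfl⟩
    · have hk := odd_two_mul_add_one k
      have h := inverse_mul_mem hk (E.tau_mem ha)
      have h' := E.d_mem h
      rw [sub_add_cancel] at h'
      rw [V_z2_even _ hk]
      exact AddSubgroup.add_mem _ (AddSubgroup.neg_mem _ (z3_mem h'))
        (AddSubgroup.add_mem _ (z4_mem h) (z4_mem h))
    · rw [V_z2_odd]; exact z2_mem (E.V_mem ha)
  · intro i r l hi hr hl c hc; rw [V_z3]; exact z3_mem hc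
  · intro i r l hi hr hl c hc; rw [V_z4]; exact AddSubgroup.add_mem _ (z4_mem hc) (z4_mem hc)
  · intro x y hx hy; rw [map_add]; exact AddSubgroup.add_mem _ hx hy

/-- The projection to the part of degree `q`. -/
noncomputable def homProj (n : ℕ) (q : ℤ) : PolyLevel E n →+ PolyLevel E n :=
  lift (j.comp (IntPart.lift (fun k => (IntPart.y1 k).comp (E.homPart n q))
      (fun k => (IntPart.y2 k).comp (E.homPart n (q - 1)))))
    (v.comp (HigherPart.map fun i => E.homPart i q))
    (w.comp (HigherPart.map fun i => E.homPart i (q - 1)))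

theorem homProj_z1 (q : ℤ) (k : ℕ) (a : E.carrier n) :
    homProj n q (z1 k a) = z1 k (E.homPart n q a) :=
  (lift_j _ _ _ _).trans (congrArg j (IntPart.lift_y1 _ _ _ _))

theorem homProj_z2 (q : ℤ) (k : ℕ) (a : E.carrier n) :
    homProj n q (z2 k a) = z2 k (E.homPart n (q - 1) a) :=
  (lift_j _ _ _ _).trans (congrArg j (IntPart.lift_y2 _ _ _ _))

theorem homProj_z3 (q : ℤ) {i : ℕ} (r l : ℕ) (h : i + r = n) (hr : 0 < r) (hl : Odd l)
    (c : E.carrier i) :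
    homProj n q (z3 r l h hr hl c) = z3 r l h hr hl (E.homPart i q c) :=
  (lift_v _ _ _ _).trans (congrArg v (HigherPart.map_of _ _ _ _ _ _ _))

theorem homProj_z4 (q : ℤ) {i : ℕ} (r l : ℕ) (h : i + r = n) (hr : 0 < r) (hl : Odd l)
    (c : E.carrier i) :
    homProj n q (z4 r l h hr hl c) = z4 r l h hr hl (E.homPart i (q - 1) c) :=
  (lift_w _ _ _ _).trans (congrArg w (HigherPart.map_of _ _ _ _ _ _ _))

theorem isInternal (n : ℕ) : DirectSum.IsInternal (deg (E := E) n) := by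
  refine DirectSum.isInternal_of_projections _ (homProj n) ?_ ?_ ?_
  · intro q x hx
    refine deg_ind (P := fun x => homProj n q x = x) ?_ ?_ ?_ ?_ ?_ hx
    · intro k a ha; rw [homProj_z1, E.homPart_of_mem ha]
    · intro k a ha; rw [homProj_z2, E.homPart_of_mem ha]
    · intro i r l hi hr hl c hc; rw [homProj_z3, E.homPart_of_mem hc]
    · intro i r l hi hr hl c hc; rw [homProj_z4, E.homPart_of_mem hc]
    · intro x y hx hy; rw [map_add, hx, hy]
  · intro q q' x hx hq
    have hq' : q - 1 ≠ q' - 1 := fun h => hq (by omega)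
    refine deg_ind (P := fun x => homProj n q' x = 0) ?_ ?_ ?_ ?_ ?_ hx
    · intro k a ha; rw [homProj_z1, E.homPart_of_mem_ne ha hq, map_zero]
    · intro k a ha; rw [homProj_z2, E.homPart_of_mem_ne ha hq', map_zero]
    · intro i r l hi hr hl c hc; rw [homProj_z3, E.homPart_of_mem_ne hc hq, map_zero]
    · intro i r l hi hr hl c hc; rw [homProj_z4, E.homPart_of_mem_ne hc hq', map_zero]
    · intro x y hx hy; rw [map_add, hx, hy, add_zero]
  · have key : ∀ {q} {x : PolyLevel E n}, x ∈ deg n q →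
        x ∈ (DirectSum.coeAddMonoidHom (deg (E := E) n)).range := fun {q x} hx =>
      ⟨DirectSum.of (fun q => deg (E := E) n q) q ⟨x, hx⟩, DirectSum.coeAddMonoidHom_of _ _ _⟩
    have gen : ∀ {i} (f : E.carrier i →+ PolyLevel E n) (m : ℤ),
        (∀ q a, a ∈ E.deg i q → f a ∈ deg n (q + m)) → ∀ a,
        f a ∈ (DirectSum.coeAddMonoidHom (deg (E := E) n)).range := by
      intro i f m hf a
      induction a using E.hom_ind with
      | add x y hx hy => rw [map_add]; exact AddSubgroup.add_mem _ hx hy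
      | hom q x hx => exact key (hf q x hx)
    intro x
    induction x using ind with
    | hadd x y hx hy => exact AddSubgroup.add_mem _ hx hy
    | h1 k a => exact gen (z1 k) 0 (fun q a ha => by rw [add_zero]; exact z1_mem ha) a
    | h2 k a => exact gen (z2 k) 1 (fun q a ha => z2_mem (by rwa [add_sub_cancel_right])) a
    | h3 i r l h hr hl c =>
      exact gen (z3 r l h hr hl) 0 (fun q a ha => by rw [add_zero]; exact z3_mem ha) c
    | h4 i r l h hr hl c =>
      exact gen (z4 r l h hr hl) 1 (fun q a ha => z4_mem (by rwa [add_sub_cancel_right])) c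

end PolyLevel

end WittComplex

/-! ### The multiplication, by recursion on the level. -/

namespace WittComplex

variable {A : Type u} [CommRing A] {E E' : WittComplex.{u, v} A} {n : ℕ}

instance : Subsingleton (IntPart E 0) := by
  have := E.level_zero
  refine ⟨fun x y => IntPart.ext ?_ ?_⟩ <;> exact Polynomial.ext fun _ => Subsingleton.elim _ _

instance : Subsingleton (HigherPart E 0) :=
  ⟨fun x y => DFinsupp.ext fun t => by have := t.2; omega⟩

namespace PolyLevel

instance : Subsingleton (PolyLevel E 0) :=
  inferInstanceAs (Subsingleton (IntPart E 0 × HigherPart E 0 × HigherPart E 0))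

/-- The multiplication. -/
noncomputable def mulP : ∀ n, PolyLevel E n → PolyLevel E n → PolyLevel E n
  | 0, _, _ => 0
  | n + 1, s, y =>
    -- The same expression as in `LevelStep.mul`, written with the bare function of level `n`: the
    -- ring structure there becomes available only once `IsGood` is known.
    j (pj s * pj y) + V (mulP n (j (IntPart.F (pj s))) (γ (pv y)))
      + (d (V (mulP n (t (j (IntPart.F (pj s)))) (γ (pw y))))
        - V (mulP n (j (IntPart.F (IntPart.d (IntPart.tau (pj s))))) (γ (pw y))))
      + V (mulP n (γ (pv s)) (F y))
      + (d (V (mulP n (γ (pw s)) (F y))) - V (mulP n (t (γ (pw s))) (F (d y))))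

/-- The properties of the multiplication of level `n` that are proved by induction on `n`. -/
structure IsGood (E : WittComplex.{u, v} A) (n : ℕ) : Prop where
  add_mul : ∀ x y z : PolyLevel E n, mulP n (x + y) z = mulP n x z + mulP n y z
  mul_add : ∀ x y z : PolyLevel E n, mulP n x (y + z) = mulP n x y + mulP n x z
  mul_assoc : ∀ x y z : PolyLevel E n, mulP n (mulP n x y) z = mulP n x (mulP n y z)
  one_mul : ∀ x : PolyLevel E n, mulP n (j 1) x = x
  mul_one : ∀ x : PolyLevel E n, mulP n x (j 1) = x
  j_mul : ∀ b b' : IntPart E n, j (b * b') = mulP n (j b) (j b')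
  t_mul : ∀ x y : PolyLevel E n, t (mulP n x y) = mulP n (t x) (t y)
  leibniz : ∀ x y : PolyLevel E n, d (mulP n x y) = mulP n (d x) y + mulP n (t x) (d y)
  io_eq : ∀ x : PolyLevel E n, io x = mulP n (z1 0 (E.eta n)) x
  io_eq' : ∀ x : PolyLevel E n, io x = mulP n x (z1 0 (E.eta n))
  comm_even : ∀ p, Even p → ∀ x ∈ deg n p, ∀ y : PolyLevel E n, mulP n x y = mulP n y x
  comm_odd : ∀ p, Odd p → ∀ x ∈ deg n p, ∀ y : PolyLevel E n, mulP n x y = mulP n (t y) x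

/-- The ring of level `n`. -/
noncomputable instance [hn : Fact (IsGood E n)] : Ring (PolyLevel E n) :=
  have h := hn.out
  have h0 : ∀ x : PolyLevel E n, mulP n 0 x = 0 := fun x => by
    have := h.add_mul 0 0 x
    rwa [add_zero, left_eq_add] at this
  have h0' : ∀ x : PolyLevel E n, mulP n x 0 = 0 := fun x => by
    have := h.mul_add x 0 0
    rwa [add_zero, left_eq_add] at this
  { (inferInstance : AddCommGroup (PolyLevel E n)) with
    mul := mulP n
    one := j 1
    left_distrib := h.mul_add
    right_distrib := h.add_mul
    zero_mul := h0
    mul_zero := h0'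
    mul_assoc := h.mul_assoc
    one_mul := h.one_mul
    mul_one := h.mul_one }

theorem isGood_zero : IsGood E 0 := by
  constructor <;> intros <;> exact Subsingleton.elim _ _

variable [Algebra ZLocTwo A]

/-- The data from which the multiplication of level `n + 1` is obtained. -/
noncomputable def levelStep (E : WittComplex.{u, v} A) (n : ℕ) [hn : Fact (IsGood E n)] :
    LevelStep (PolyLevel E n) (IntPart E (n + 1)) (PolyLevel E (n + 1)) (HigherPart E (n + 1)) :=
  have h := hn.out
  { tQ := { t with
      map_one' := (t_j 1).trans (congrArg j (map_one IntPart.tau))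
      map_mul' := h.t_mul }
    dQ := d
    eQ := z1 0 (E.eta n)
    tB := IntPart.tau
    dB := IntPart.d
    FB := { j.comp IntPart.F.toAddMonoidHom with
      map_one' := congrArg j (map_one IntPart.F)
      map_mul' := fun b b' => (congrArg j (map_mul IntPart.F b b')).trans (h.j_mul _ _) }
    γ := γ
    tM := HigherPart.map fun i => (E.tau i).toAddMonoidHom
    iM := HigherPart.map fun i => AddMonoidHom.mulLeft (E.eta i)
    j := j
    pB := pj
    pv := pv
    pw := pw
    F := F
    V := V
    d := d
    t := t
    tQ_tQ := t_t
    dQ_mul := h.leibniz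
    eQ_comm := fun x => (h.io_eq x).symm.trans (h.io_eq' x)
    eQ_tQ := fun x => (h.io_eq (t x)).symm.trans ((io_t x).trans (h.io_eq x))
    eQ_add := by
      rw [← map_add, eta_add_eta, map_zero]
    tB_tB := IntPart.tau_tau
    dB_mul := IntPart.d_mul
    tB_dB := IntPart.tau_d
    tQ_FB := fun b => (t_j _).trans (congrArg j (IntPart.tau_F b))
    dQ_FB := fun b => (d_j _).trans ((congrArg j (IntPart.d_F b)).trans (map_add j _ _))
    γ_tM := γ_map_tau
    γ_iM := fun c => (γ_map_eta c).trans (h.io_eq _)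
    F_j := F_j
    d_j := d_j
    t_j := t_j
    decomp := fun s => by
      have e := decomp s
      rwa [← V_γ, ← d_V_γ] at e
    pB_j := pj_j
    pv_j := pv_j
    pw_j := pw_j
    pB_V := fun c => (congrArg pj (V_γ c)).trans (pj_v c)
    pv_V := fun c => (congrArg pv (V_γ c)).trans (pv_v c)
    pw_V := fun c => (congrArg pw (V_γ c)).trans (pw_v c)
    pB_dV := fun c => (congrArg pj (d_V_γ c)).trans (pj_w c)
    pv_dV := fun c => (congrArg pv (d_V_γ c)).trans (pv_w c)
    pw_dV := fun c => (congrArg pw (d_V_γ c)).trans (pw_w c)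
    F_V := F_V
    F_dV := fun x => (F_d_V x).trans (congrArg (d x + ·) (h.io_eq x))
    V_d := V_d
    dQ_F := d_F
    F_dd := fun s => (congrArg F (d_d s)).trans ((F_io _).trans (h.io_eq _))
    d_dV := fun x => (d_d _).trans ((io_d _).trans
      ((congrArg d (V_io x)).symm.trans (congrArg (fun y => d (V y)) (h.io_eq x))))
    tQ_eQ := (t_z1 _ _).trans (congrArg _ E.tau_eta)
    tQ_F := t_F
    t_V := t_V
    t_d := t_d
    t_t := t_t
    split := fun x => by
      obtain ⟨y, b, c, e, h1, h2, h3⟩ := split x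
      exact ⟨j y, b, c, e, h1, h2, fun b' => ⟨(congrArg V (h.j_mul _ _)).symm.trans (h3 b').1,
        (congrArg V (h.j_mul _ _)).symm.trans (h3 b').2⟩⟩ }

theorem levelStep_mul [Fact (IsGood E n)] (x y : PolyLevel E (n + 1)) :
    (levelStep E n).mul x y = mulP (n + 1) x y := rfl

theorem levelStep_t [Fact (IsGood E n)] (x : PolyLevel E (n + 1)) :
    (levelStep E n).t x = t x := rfl

theorem levelStep_d [Fact (IsGood E n)] (x : PolyLevel E (n + 1)) :
    (levelStep E n).d x = d x := rfl

theorem levelStep_V [Fact (IsGood E n)] (x : PolyLevel E n) : (levelStep E n).V x = V x := rfl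

theorem levelStep_F [Fact (IsGood E n)] (x : PolyLevel E (n + 1)) :
    (levelStep E n).F x = F x := rfl

theorem levelStep_eq [Fact (IsGood E n)] (x : PolyLevel E (n + 1)) :
    (levelStep E n).j (pj x) + (levelStep E n).V ((levelStep E n).γ (pv x)) +
      (levelStep E n).d ((levelStep E n).V ((levelStep E n).γ (pw x))) = x :=
  ((levelStep E n).decomp x).symm

theorem comm_even_succ [hn : Fact (IsGood E n)] (p : ℤ) (hp : Even p)
    (x : PolyLevel E (n + 1)) (hx : x ∈ deg (n + 1) p) (y : PolyLevel E (n + 1)) :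
    mulP (n + 1) x y = mulP (n + 1) y x := by
  have hodd : Odd (p - 1) := hp.sub_odd odd_one
  have hodd' : Odd (p + 1) := hp.add_odd odd_one
  have hw := γ_mem hx.2.2
  have h := hn.out
  have := (levelStep E n).comm_even (b := pj x) (c := pv x) (e := pw x)
    (IntPart.comm_even hp hx.1)
    ((IntPart.tau_of_mem hx.1).trans (negOnePow_smul_even hp _))
    (fun z => h.comm_even p hp _ (j_mem (IntPart.F_mem hx.1)) z)
    (fun z => h.comm_odd _ hodd' _ (j_mem (IntPart.F_mem (IntPart.d_mem hx.1))) z)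
    (fun z => h.comm_even p hp _ (γ_mem hx.2.1) z)
    (fun z => h.comm_odd _ hodd _ hw z)
    ((t_of_mem hw).trans (negOnePow_smul_odd hodd _)) y
  rwa [levelStep_eq, levelStep_mul, levelStep_mul] at this

theorem comm_odd_succ [hn : Fact (IsGood E n)] (p : ℤ) (hp : Odd p)
    (x : PolyLevel E (n + 1)) (hx : x ∈ deg (n + 1) p) (y : PolyLevel E (n + 1)) :
    mulP (n + 1) x y = mulP (n + 1) (t y) x := by
  have heven : Even (p - 1) := hp.sub_odd odd_one
  have heven' : Even (p + 1) := hp.add_odd odd_one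
  have hw := γ_mem hx.2.2
  have h := hn.out
  have := (levelStep E n).comm_odd (b := pj x) (c := pv x) (e := pw x)
    (IntPart.comm_odd hp hx.1)
    ((IntPart.tau_of_mem hx.1).trans (negOnePow_smul_odd hp _))
    (fun z => h.comm_odd p hp _ (j_mem (IntPart.F_mem hx.1)) z)
    (fun z => h.comm_even _ heven' _ (j_mem (IntPart.F_mem (IntPart.d_mem hx.1))) z)
    (fun z => h.comm_odd p hp _ (γ_mem hx.2.1) z)
    (fun z => h.comm_even _ heven _ hw z)
    ((t_of_mem hw).trans (negOnePow_smul_even heven _)) y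
  rwa [levelStep_eq, levelStep_mul, levelStep_mul] at this

theorem mulP_j_j [Fact (IsGood E n)] (b b' : IntPart E (n + 1)) :
    mulP (n + 1) (j b) (j b') = j (b * b') := (levelStep E n).j_mul_j b b'

theorem mulP_j_v [Fact (IsGood E n)] (b : IntPart E (n + 1)) (c : HigherPart E (n + 1)) :
    mulP (n + 1) (j b) (v c) = V (mulP n (j (IntPart.F b)) (γ c)) := by
  have := (levelStep E n).j_mul_V b c
  rw [levelStep_mul] at this
  rw [← V_γ]
  exact this

theorem mulP_j_w [Fact (IsGood E n)] (b : IntPart E (n + 1)) (c : HigherPart E (n + 1)) :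
    mulP (n + 1) (j b) (w c) = d (V (mulP n (t (j (IntPart.F b))) (γ c)))
      - V (mulP n (j (IntPart.F (IntPart.d (IntPart.tau b)))) (γ c)) := by
  have := (levelStep E n).j_mul_dV b c
  rw [levelStep_mul] at this
  rw [← d_V_γ]
  exact this

/-- `ι` was defined on coefficients. It agrees with the product by `η[X]^0` because `F` fixes `η`,
because `dη = 0` removes the correction term in products with `dV`, and because this already holds
in level `n`. -/
theorem io_eq_succ [hn : Fact (IsGood E n)] (x : PolyLevel E (n + 1)) :
    io x = mulP (n + 1) (z1 0 (E.eta (n + 1))) x := by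
  have hF : IntPart.F (IntPart.y1 0 (E.eta (n + 1))) = IntPart.y1 0 (E.eta n) := by
    rw [IntPart.F_y1, mul_zero, F_eta]
  have ht : t (j (IntPart.y1 0 (E.eta n))) = j (IntPart.y1 0 (E.eta n)) := by
    rw [t_j, IntPart.tau_y1, tau_eta]
  have hd : IntPart.d (IntPart.tau (IntPart.y1 0 (E.eta (n + 1)))) = 0 := by
    rw [IntPart.tau_y1, tau_eta, IntPart.d_y1, d_eta, Nat.cast_zero, zero_mul, map_zero, map_zero,
      add_zero]
  have h0 : ∀ x : PolyLevel E n, mulP n 0 x = 0 := fun x => zero_mul x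
  have hio : ∀ x : PolyLevel E n, mulP n (j (IntPart.y1 0 (E.eta n))) x = io x :=
    fun x => (hn.out.io_eq x).symm
  change io x = mulP (n + 1) (j (IntPart.y1 0 (E.eta (n + 1)))) x
  induction x using ind_parts with
  | hadd x y hx hy => rw [map_add, hx, hy]; exact ((levelStep E n).mul_add _ _ _).symm
  | hj b => rw [io_j, mulP_j_j]
  | hv c => rw [mulP_j_v, hF, hio, io_v, ← V_γ, γ_map_eta]
  | hw c =>
    rw [mulP_j_w, hF, hd, map_zero, map_zero, h0, map_zero, sub_zero, ht, hio, io_w, ← d_V_γ,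
      γ_map_eta]

theorem mulP_add_left [Fact (IsGood E n)] (x y z : PolyLevel E (n + 1)) :
    mulP (n + 1) (x + y) z = mulP (n + 1) x z + mulP (n + 1) y z := by
  simpa only [levelStep_mul] using (levelStep E n).add_mul x y z

theorem mulP_add_right [Fact (IsGood E n)] (x y z : PolyLevel E (n + 1)) :
    mulP (n + 1) x (y + z) = mulP (n + 1) x y + mulP (n + 1) x z := by
  simpa only [levelStep_mul] using (levelStep E n).mul_add x y z

theorem mulP_assoc [Fact (IsGood E n)] (x y z : PolyLevel E (n + 1)) :
    mulP (n + 1) (mulP (n + 1) x y) z = mulP (n + 1) x (mulP (n + 1) y z) := by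
  simpa only [levelStep_mul] using (levelStep E n).mul_assoc' x y z

theorem t_mulP [Fact (IsGood E n)] (x y : PolyLevel E (n + 1)) :
    t (mulP (n + 1) x y) = mulP (n + 1) (t x) (t y) := by
  simpa only [levelStep_mul, levelStep_t] using (levelStep E n).t_mul x y

theorem leibniz_mulP [Fact (IsGood E n)] (x y : PolyLevel E (n + 1)) :
    d (mulP (n + 1) x y) = mulP (n + 1) (d x) y + mulP (n + 1) (t x) (d y) := by
  simpa only [levelStep_mul, levelStep_t, levelStep_d] using (levelStep E n).leibniz x y

theorem one_mulP [Fact (IsGood E n)] (x : PolyLevel E (n + 1)) : mulP (n + 1) (j 1) x = x :=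
  (levelStep_mul _ _).symm.trans ((levelStep E n).one_mul' x)

theorem mulP_one [Fact (IsGood E n)] (x : PolyLevel E (n + 1)) : mulP (n + 1) x (j 1) = x :=
  (levelStep_mul _ _).symm.trans ((levelStep E n).mul_one' x)

theorem isGood_succ [hn : Fact (IsGood E n)] : IsGood E (n + 1) where
  add_mul := mulP_add_left
  mul_add := mulP_add_right
  mul_assoc := mulP_assoc
  one_mul := one_mulP
  mul_one := mulP_one
  j_mul := fun b b' => (mulP_j_j b b').symm
  t_mul := t_mulP
  leibniz := leibniz_mulP
  io_eq := io_eq_succ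
  io_eq' := fun x => by
    have := comm_odd_succ 1 odd_one (z1 0 (E.eta (n + 1))) (z1_mem E.eta_mem) (t x)
    rwa [t_t, ← io_eq_succ, io_t] at this
  comm_even := comm_even_succ
  comm_odd := comm_odd_succ

theorem isGood (E : WittComplex.{u, v} A) : ∀ n, IsGood E n
  | 0 => isGood_zero
  -- The induction hypothesis is needed as an instance, since it supplies the ring of level `n`.
  | n + 1 => have : Fact (IsGood E n) := ⟨isGood E n⟩; isGood_succ

instance : Fact (IsGood E n) := ⟨isGood E n⟩

theorem one_eq : (1 : PolyLevel E n) = j 1 := rfl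

theorem one_eq_z1 : (1 : PolyLevel E n) = z1 0 1 := congrArg j IntPart.one_eq

theorem j_mul (b b' : IntPart E n) : j (b * b') = j b * j b' := (isGood E n).j_mul b b'

theorem t_mul (x y : PolyLevel E n) : t (x * y) = t x * t y := (isGood E n).t_mul x y

theorem leibniz (x y : PolyLevel E n) : d (x * y) = d x * y + t x * d y :=
  (isGood E n).leibniz x y

theorem io_eq (x : PolyLevel E n) : io x = z1 0 (E.eta n) * x := (isGood E n).io_eq x

theorem comm_even {p : ℤ} (hp : Even p) {x : PolyLevel E n} (hx : x ∈ deg n p)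
    (y : PolyLevel E n) : x * y = y * x := (isGood E n).comm_even p hp x hx y

theorem comm_odd {p : ℤ} (hp : Odd p) {x : PolyLevel E n} (hx : x ∈ deg n p)
    (y : PolyLevel E n) : x * y = t y * x := (isGood E n).comm_odd p hp x hx y

theorem levelStep_mul' (x y : PolyLevel E (n + 1)) : (levelStep E n).mul x y = x * y := rfl

theorem F_mul (x y : PolyLevel E (n + 1)) : F (x * y) = F x * F y := by
  simpa only [levelStep_mul', levelStep_F] using (levelStep E n).F_mul x y

theorem V_mul (x : PolyLevel E n) (y : PolyLevel E (n + 1)) : V x * y = V (x * F y) := by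
  simpa only [levelStep_mul', levelStep_F, levelStep_V] using (levelStep E n).V_mul x y

theorem mul_V (y : PolyLevel E (n + 1)) (x : PolyLevel E n) : y * V x = V (F y * x) := by
  simpa only [levelStep_mul', levelStep_F, levelStep_V] using (levelStep E n).mul_V y x

/-- Every element of level `n + 1` is a sum of elements of type 1 and 2, of elements `V x`, and of
elements `d V x`. -/
theorem ind_V {P : PolyLevel E (n + 1) → Prop} (hj : ∀ b, P (j b)) (hV : ∀ x, P (V x))
    (hdV : ∀ x, P (d (V x))) (hadd : ∀ x y, P x → P y → P (x + y)) (s : PolyLevel E (n + 1)) :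
    P s :=
  ind_parts hj (fun c => V_γ c ▸ hV _) (fun c => d_V_γ c ▸ hdV _) hadd s

theorem d_mul_left (x y : PolyLevel E n) : d x * y = d (x * y) - t x * d y := by
  rw [leibniz, add_sub_cancel_right]

theorem d_mul_right (x y : PolyLevel E n) : x * d y = d (t x * y) - d (t x) * y := by
  rw [leibniz, t_t, add_sub_cancel_left]

/-- `R` commutes with `V`, `F` and `d`, so the rules that determine the product reduce the claim to
integral factors and to a lower level. -/
theorem R_mul (x y : PolyLevel E (n + 1)) : R (x * y) = R x * R y := by
  induction n with
  | zero => exact Subsingleton.elim _ _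
  | succ n ih =>
    have hV : ∀ x (y : PolyLevel E (n + 1 + 1)), R (V x * y) = R (V x) * R y := fun x y => by
      rw [V_mul, R_V, R_V, V_mul, ih, R_F]
    have hV' : ∀ x (y : PolyLevel E (n + 1 + 1)), R (y * V x) = R y * R (V x) := fun x y => by
      rw [mul_V, R_V, R_V, mul_V, ih, R_F]
    induction x using ind_V with
    | hadd x x' hx hx' => rw [_root_.add_mul, map_add, map_add, _root_.add_mul, hx, hx']
    | hV x => exact hV x y
    | hdV x =>
      rw [d_mul_left, map_sub, R_d, hV, t_V, hV, R_d, R_d, d_mul_left (R (V x)), ← R_t, t_V]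
    | hj b =>
      induction y using ind_V with
      | hadd x x' hx hx' => rw [_root_.mul_add, map_add, map_add, _root_.mul_add, hx, hx']
      | hV x => exact hV' x _
      | hdV x =>
        rw [d_mul_right, map_sub, R_d, hV', hV', R_d, R_d, d_mul_right (R (j b)), R_t]
      | hj b' => rw [← j_mul, R_j, R_j, R_j, map_mul, j_mul]

theorem mul_mem {p q : ℤ} {x y : PolyLevel E n} (hx : x ∈ deg n p) (hy : y ∈ deg n q) :
    x * y ∈ deg n (p + q) := by
  induction n generalizing p q with
  | zero => rw [Subsingleton.elim (x * y) 0]; exact AddSubgroup.zero_mem _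
  | succ n ih =>
    have hV : ∀ {p q : ℤ} {x} {y : PolyLevel E (n + 1)}, x ∈ deg n p → y ∈ deg (n + 1) q →
        V x * y ∈ deg (n + 1) (p + q) := fun {p q x y} hx hy => by
      rw [V_mul]; exact V_mem (ih hx (F_mem hy))
    have hV' : ∀ {p q : ℤ} {x} {y : PolyLevel E (n + 1)}, x ∈ deg n p → y ∈ deg (n + 1) q →
        y * V x ∈ deg (n + 1) (q + p) := fun {p q x y} hx hy => by
      rw [mul_V]; exact V_mem (ih (F_mem hy) hx)
    refine deg_ind_parts (P := fun x => x * y ∈ deg (n + 1) (p + q)) ?_ ?_ ?_ ?_ hx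
    · intro b hb
      refine deg_ind_parts (P := fun y => j b * y ∈ deg (n + 1) (p + q)) ?_ ?_ ?_ ?_ hy
      · intro b' hb'; rw [← j_mul]; exact j_mem (IntPart.mul_mem hb hb')
      · intro c hc; rw [← V_γ]; exact hV' (γ_mem hc) (j_mem hb)
      · intro c hc
        have h := t_mem (j_mem hb)
        rw [← d_V_γ, d_mul_right]
        refine AddSubgroup.sub_mem _ ?_ ?_
        · have := d_mem (hV' (γ_mem hc) h)
          rwa [add_assoc, sub_add_cancel] at this
        · have := hV' (γ_mem hc) (d_mem h)
          rwa [add_assoc, add_sub_cancel] at this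
      · intro x y hx hy; rw [_root_.mul_add]; exact AddSubgroup.add_mem _ hx hy
    · intro c hc; rw [← V_γ]; exact hV (γ_mem hc) hy
    · intro c hc
      rw [← d_V_γ, d_mul_left, t_V]
      refine AddSubgroup.sub_mem _ ?_ ?_
      · have := d_mem (hV (γ_mem hc) hy)
        rwa [show p - 1 + q + 1 = p + q by ring] at this
      · have := hV (t_mem (γ_mem hc)) (d_mem hy)
        rwa [show p - 1 + (q + 1) = p + q by ring] at this
    · intro x y hx hy; rw [_root_.add_mul]; exact AddSubgroup.add_mem _ hx hy

end PolyLevel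

end WittComplex

/-! ### The decomposition of Witt vectors over a polynomial ring. -/

namespace WittVector

variable {A : Type u} [CommRing A]

theorem verschiebung_inj {x y : WittVector 2 A} (h : verschiebung x = verschiebung y) : x = y := by
  ext k
  rw [← verschiebung_coeff_succ, h, verschiebung_coeff_succ]

/-- The element `w[X]^j` of `W(A[X])`. -/
noncomputable def mono (j : ℕ) : WittVector 2 A →+ WittVector 2 A[X] :=
  (AddMonoidHom.mulRight (teichmuller 2 X ^ j)).comp (map C).toAddMonoidHom

theorem mono_apply (j : ℕ) (w : WittVector 2 A) : mono j w = map C w * teichmuller 2 X ^ j := rfl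

theorem mono_mul_mono (j k : ℕ) (w w' : WittVector 2 A) :
    mono j w * mono k w' = mono (j + k) (w * w') := by
  rw [mono_apply, mono_apply, mono_apply, map_mul]; ring

theorem frobenius_mono (j : ℕ) (w : WittVector 2 A) :
    frobenius (mono j w) = mono (2 * j) (frobenius w) := by
  rw [mono_apply, mono_apply, map_mul, map_pow, frobenius_teich, (frobenius_isPoly 2).map, map_pow,
    ← pow_mul]

/-- The projection formula with `F([X]^j) = [X]^(2j)`. -/
theorem mono_verschiebung (j : ℕ) (w : WittVector 2 A) :
    mono j (verschiebung w) = verschiebung (mono (2 * j) w) := by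
  have h := frobenius_teich (X : A[X])
  rw [map_pow] at h
  rw [mono_apply, mono_apply, map_verschiebung, pow_mul, ← h, ← map_pow frobenius,
    verschiebung_mul_frobenius]

theorem mono_zero_one : mono 0 (1 : WittVector 2 A) = 1 := by
  rw [mono_apply, map_one, pow_zero, one_mul]

/-- The element `∑ [a_j][X]^j`, for a polynomial `∑ a_j X^j`. -/
noncomputable def polyLift (p : A[X]) : WittVector 2 A[X] :=
  p.sum fun j a => mono j (teichmuller 2 a)

theorem polyLift_coeff_zero (p : A[X]) : (polyLift p).coeff 0 = p := by
  change constantCoeff (polyLift p) = p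
  rw [polyLift, Polynomial.sum_def, map_sum]
  conv_rhs => rw [← Polynomial.sum_C_mul_X_pow_eq p, Polynomial.sum_def]
  refine Finset.sum_congr rfl fun j _ => ?_
  rw [mono_apply, map_mul, map_pow, map_teichmuller]
  simp

theorem polyLift_monomial (j : ℕ) (a : A) :
    polyLift (monomial j a) = mono j (teichmuller 2 a) :=
  Polynomial.sum_monomial_index a _ (by rw [teichmuller_zero, map_zero])

/-- The element `y` with `x = ∑ [a_j][X]^j + V y`. -/
noncomputable def polyShift (x : WittVector 2 A[X]) : WittVector 2 A[X] :=
  shift (x - polyLift (x.coeff 0)) 1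

theorem polyLift_add_polyShift (x : WittVector 2 A[X]) :
    x = polyLift (x.coeff 0) + verschiebung (polyShift x) := by
  have h := eq_iterate_verschiebung (x := x - polyLift (x.coeff 0)) (n := 1) (by
    intro i hi
    obtain rfl : i = 0 := by omega
    have := map_sub constantCoeff x (polyLift (x.coeff 0))
    simpa only [constantCoeff_apply, polyLift_coeff_zero, sub_self] using this)
  exact eq_add_of_sub_eq' h

/-- The coefficient of index 0 determines `p`, and `V` is injective. This uniqueness lets `λ` be
evaluated on any decomposition, not only on the chosen one. -/
theorem polyShift_eq {x y : WittVector 2 A[X]} {p : A[X]} (h : x = polyLift p + verschiebung y) :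
    x.coeff 0 = p ∧ polyShift x = y := by
  have h1 : x.coeff 0 = p := by
    have := congrArg constantCoeff h
    rw [map_add, constantCoeff_apply, constantCoeff_apply, constantCoeff_apply, polyLift_coeff_zero,
      verschiebung_coeff_zero, add_zero] at this
    exact this
  refine ⟨h1, verschiebung_inj (add_left_cancel (a := polyLift p) ?_)⟩
  rw [← h]
  conv_rhs => rw [polyLift_add_polyShift x, h1]

theorem mono_ind {P : WittVector 2 A[X] → Prop} (hm : ∀ j w, P (mono j w))
    (hV : ∀ x, P (verschiebung x)) (hadd : ∀ x y, P x → P y → P (x + y))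
    (x : WittVector 2 A[X]) : P x := by
  rw [polyLift_add_polyShift x]
  refine hadd _ _ ?_ (hV _)
  rw [polyLift, Polynomial.sum_def]
  refine Finset.sum_induction _ P hadd ?_ fun j _ => hm j _
  rw [← map_zero (mono 0)]; exact hm 0 0

end WittVector

/-! ### The map `λ` on Witt vectors over `A[X]`. -/

namespace WittComplex

variable {A : Type u} [CommRing A] {E : WittComplex.{u, v} A} {n : ℕ}

/-- The composite of `W(A) → W_n(A)` and `λ`. -/
noncomputable def lamW (E : WittComplex.{u, v} A) (n : ℕ) : WittVector 2 A →+* E.carrier n :=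
  E.lam.comp (WittLen.proj n)

theorem lamW_apply (w : WittVector 2 A) : E.lamW n w = E.lam (WittLen.proj n w) := rfl

theorem lamW_verschiebung (w : WittVector 2 A) :
    E.lamW (n + 1) (WittVector.verschiebung w) = E.V (E.lamW n w) := by
  rw [lamW_apply, ← WittLen.V_proj, E.lam_V, lamW_apply]

theorem lamW_frobenius (w : WittVector 2 A) :
    E.lamW n (WittVector.frobenius w) = E.F (E.lamW (n + 1) w) := by
  rw [lamW_apply, ← WittLen.F_proj, E.lam_F, lamW_apply]

theorem R_lamW (w : WittVector 2 A) : E.R (E.lamW (n + 1) w) = E.lamW n w := by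
  rw [lamW_apply, E.R_lam, WittLen.R_proj, lamW_apply]

theorem lamW_mem (w : WittVector 2 A) : E.lamW n w ∈ E.deg n 0 := E.lam_mem _

namespace PolyLevel

open WittVector (mono polyLift polyShift verschiebung frobenius teichmuller)

/-- The element `∑ λ[a_j][X]^j`. -/
noncomputable def polySum (n : ℕ) (p : A[X]) : PolyLevel E n :=
  p.sum fun j a => z1 j (E.lamW n (teichmuller 2 a))

/-- The map `λ`, as a function on `W(A[X])`. -/
noncomputable def lamFun : ∀ n, WittVector 2 A[X] → PolyLevel E n
  | 0, _ => 0
  | n + 1, x => polySum (n + 1) (x.coeff 0) + V (lamFun n (polyShift x))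

theorem lamFun_eq {x y : WittVector 2 A[X]} {p : A[X]} (h : x = polyLift p + verschiebung y) :
    lamFun (n + 1) x = (polySum (n + 1) p : PolyLevel E (n + 1)) + V (lamFun n y) := by
  obtain ⟨h1, h2⟩ := WittVector.polyShift_eq h
  rw [lamFun, h1, h2]

/-- The definition gives this only for multiplicative representatives. In general `w = [w_0] +
V(y)`, and `V(y)[X]^j = V(y[X]^(2j))` is treated in the level below. -/
theorem lamFun_mono (j : ℕ) (w : WittVector 2 A) :
    (lamFun n (mono j w) : PolyLevel E n) = z1 j (E.lamW n w) := by
  induction n generalizing j w with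
  | zero => exact Subsingleton.elim _ _
  | succ n ih =>
    obtain ⟨y, hy⟩ := WittVector.exists_eq_teichmuller_add w
    have h : mono j w = polyLift (monomial j (w.coeff 0)) + verschiebung (mono (2 * j) y) := by
      rw [WittVector.polyLift_monomial, ← WittVector.mono_verschiebung, ← map_add, ← hy]
    have h' : (polySum (n + 1) (monomial j (w.coeff 0)) : PolyLevel E (n + 1)) =
        z1 j (E.lamW (n + 1) (teichmuller 2 (w.coeff 0))) :=
      Polynomial.sum_monomial_index _ _ (by rw [WittVector.teichmuller_zero, map_zero, map_zero])
    rw [lamFun_eq h, ih, V_z1_even, h', ← map_add, ← lamW_verschiebung, ← map_add, ← hy]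

/-- The sum `∑ [a_j][X]^j` fails to be additive in the polynomial. The failure is `V(δ)`, with `δ`
assembled from the failures `f j` for the single coefficients at exponents `2j`. Since `λ` of level
`n` sends `δ` to the same sum in `P(E)`, the failures on both sides correspond. -/
theorem exists_polySum_add (hadd : ∀ x y : WittVector 2 A[X],
    (lamFun n (x + y) : PolyLevel E n) = lamFun n x + lamFun n y) (p q : A[X]) :
    ∃ δ, polyLift (p + q) = polyLift p + polyLift q + verschiebung δ ∧
      (polySum (n + 1) (p + q) : PolyLevel E (n + 1)) =
        polySum (n + 1) p + polySum (n + 1) q + V (lamFun n δ) := by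
  choose f hf _ using fun j => WittVector.exists_teichmuller_add (p.coeff j) (q.coeff j)
  set N := max p.natDegree q.natDegree + 1
  have hp : p.natDegree < N := by omega
  have hq : q.natDegree < N := by omega
  have hpq : (p + q).natDegree < N := by have := natDegree_add_le p q; omega
  have h0 : ∀ j, mono j (teichmuller 2 (0 : A)) = 0 := fun j => by
    rw [WittVector.teichmuller_zero, map_zero]
  have h0' : ∀ j, (z1 j (E.lamW (n + 1) (teichmuller 2 (0 : A))) : PolyLevel E (n + 1)) = 0 :=
    fun j => by rw [WittVector.teichmuller_zero, map_zero, map_zero]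
  let L : WittVector 2 A[X] →+ PolyLevel E n := AddMonoidHom.mk' (lamFun n) hadd
  refine ⟨∑ j ∈ Finset.range N, mono (2 * j) (f j), ?_, ?_⟩
  · rw [polyLift, polyLift, polyLift, Polynomial.sum_over_range' _ h0 N hp,
      Polynomial.sum_over_range' _ h0 N hq, Polynomial.sum_over_range' _ h0 N hpq, map_sum,
      ← Finset.sum_add_distrib, ← Finset.sum_add_distrib]
    refine Finset.sum_congr rfl fun j _ => ?_
    rw [coeff_add, hf, map_add, map_add, WittVector.mono_verschiebung]
  · change _ = _ + V (L _)
    rw [polySum, polySum, polySum, Polynomial.sum_over_range' _ h0' N hp,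
      Polynomial.sum_over_range' _ h0' N hq, Polynomial.sum_over_range' _ h0' N hpq, map_sum, map_sum,
      ← Finset.sum_add_distrib, ← Finset.sum_add_distrib]
    refine Finset.sum_congr rfl fun j _ => ?_
    change _ = _ + V (lamFun n _)
    rw [coeff_add, hf, map_add, map_add, map_add, map_add, lamW_verschiebung, lamFun_mono, V_z1_even]

theorem lamFun_add (x y : WittVector 2 A[X]) :
    (lamFun n (x + y) : PolyLevel E n) = lamFun n x + lamFun n y := by
  induction n generalizing x y with
  | zero => exact Subsingleton.elim _ _
  | succ n ih =>
    let L : WittVector 2 A[X] →+ PolyLevel E n := AddMonoidHom.mk' (lamFun n) ih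
    obtain ⟨δ, h1, h2⟩ := exists_polySum_add ih (x.coeff 0) (y.coeff 0)
    have h : x + y = polyLift (x.coeff 0 + y.coeff 0) +
        verschiebung (polyShift x + polyShift y - δ) := by
      rw [map_sub, map_add, h1]
      conv_lhs => rw [WittVector.polyLift_add_polyShift x, WittVector.polyLift_add_polyShift y]
      abel
    have h3 : (lamFun n (polyShift x + polyShift y - δ) : PolyLevel E n) =
        lamFun n (polyShift x) + lamFun n (polyShift y) - lamFun n δ := by
      change L _ = L _ + L _ - L _
      rw [map_sub, map_add]
    rw [lamFun_eq h, h2, h3, lamFun, lamFun, map_sub, map_add]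
    abel

/-- The map `λ` on `W(A[X])`, as an additive map. -/
noncomputable def lamAdd (n : ℕ) : WittVector 2 A[X] →+ PolyLevel E n :=
  AddMonoidHom.mk' (lamFun n) lamFun_add

theorem lamAdd_mono (j : ℕ) (w : WittVector 2 A) :
    (lamAdd n (mono j w) : PolyLevel E n) = z1 j (E.lamW n w) := lamFun_mono j w

theorem lamAdd_verschiebung (x : WittVector 2 A[X]) :
    (lamAdd (n + 1) (verschiebung x) : PolyLevel E (n + 1)) = V (lamAdd n x) := by
  have h : verschiebung x = polyLift 0 + verschiebung x := by
    rw [polyLift, Polynomial.sum_zero_index, zero_add]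
  refine (lamFun_eq h).trans ?_
  rw [polySum, Polynomial.sum_zero_index, zero_add]; rfl

theorem lamAdd_frobenius [Algebra ZLocTwo A] (x : WittVector 2 A[X]) :
    (lamAdd n (frobenius x) : PolyLevel E n) = F (lamAdd (n + 1) x) := by
  induction x using WittVector.mono_ind with
  | hadd x y hx hy => simp only [map_add, hx, hy]
  | hm j w => rw [WittVector.frobenius_mono, lamAdd_mono, lamAdd_mono, F_z1, lamW_frobenius]
  | hV x =>
    rw [WittVector.frobenius_verschiebung_two, two_mul, map_add, lamAdd_verschiebung, F_V]

theorem R_lamAdd [Algebra ZLocTwo A] (x : WittVector 2 A[X]) :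
    R (lamAdd (n + 1) x) = (lamAdd n x : PolyLevel E n) := by
  induction n generalizing x with
  | zero => exact Subsingleton.elim _ _
  | succ n ih =>
    induction x using WittVector.mono_ind with
    | hadd x y hx hy => simp only [map_add, hx, hy]
    | hm j w => rw [lamAdd_mono, lamAdd_mono, R_z1, R_lamW]
    | hV x => rw [lamAdd_verschiebung, lamAdd_verschiebung, R_V, ih]

theorem lamAdd_mem [Algebra ZLocTwo A] (x : WittVector 2 A[X]) :
    (lamAdd n x : PolyLevel E n) ∈ deg n 0 := by
  induction n generalizing x with
  | zero => rw [Subsingleton.elim (lamAdd 0 x : PolyLevel E 0) 0]; exact AddSubgroup.zero_mem _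
  | succ n ih =>
    induction x using WittVector.mono_ind with
    | hadd x y hx hy => rw [map_add]; exact AddSubgroup.add_mem _ hx hy
    | hm j w => rw [lamAdd_mono]; exact z1_mem (E.lamW_mem w)
    | hV x => rw [lamAdd_verschiebung]; exact V_mem (ih x)

theorem z1_mul_z1 [Algebra ZLocTwo A] (j k : ℕ) (a b : E.carrier n) :
    z1 j a * z1 k b = z1 (j + k) (a * b) := by
  change PolyLevel.j (IntPart.y1 j a) * PolyLevel.j (IntPart.y1 k b) = _
  rw [← j_mul, IntPart.y1_mul_y1]; rfl

theorem lamAdd_mul [Algebra ZLocTwo A] (x y : WittVector 2 A[X]) :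
    (lamAdd n (x * y) : PolyLevel E n) = lamAdd n x * lamAdd n y := by
  induction n generalizing x y with
  | zero => exact Subsingleton.elim _ _
  | succ n ih =>
    induction x using WittVector.mono_ind with
    | hadd x x' hx hx' => rw [add_mul, map_add, map_add, add_mul, hx, hx']
    | hV x =>
      rw [← WittVector.verschiebung_mul_frobenius, lamAdd_verschiebung, lamAdd_verschiebung, V_mul,
        ih, lamAdd_frobenius]
    | hm j w =>
      induction y using WittVector.mono_ind with
      | hadd x x' hx hx' => rw [mul_add, map_add, map_add, mul_add, hx, hx']
      | hV x =>
        rw [_root_.mul_comm, ← WittVector.verschiebung_mul_frobenius, lamAdd_verschiebung,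
          lamAdd_verschiebung, mul_V, _root_.mul_comm x, ih, lamAdd_frobenius]
      | hm k w' => rw [WittVector.mono_mul_mono, lamAdd_mono, lamAdd_mono, lamAdd_mono, z1_mul_z1,
          map_mul]

/-- The map `λ` on `W(A[X])`. -/
noncomputable def lamRing [Algebra ZLocTwo A] (E : WittComplex.{u, v} A) (n : ℕ) :
    WittVector 2 A[X] →+* PolyLevel E n :=
  { lamAdd n with
    map_one' := by
      change lamAdd n 1 = 1
      rw [← WittVector.mono_zero_one, lamAdd_mono, map_one, one_eq_z1]
    map_mul' := lamAdd_mul }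

/-- Such an `x` is `V^n(y)`, and `λ` moves `V^n` out to reach level 0, which is zero. -/
theorem lamRing_eq_zero [Algebra ZLocTwo A] (x : WittVector 2 A[X])
    (hx : ∀ i < n, x.coeff i = 0) : lamRing E n x = 0 := by
  have h : ∀ y : WittVector 2 A[X], (lamAdd n (verschiebung^[n] y) : PolyLevel E n) = 0 := by
    induction n with
    | zero => exact fun _ => Subsingleton.elim _ _
    | succ n ih =>
      intro y
      rw [Function.iterate_succ_apply', lamAdd_verschiebung, ih fun i hi => hx i (by omega), map_zero]
  rw [WittVector.eq_iterate_verschiebung hx]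
  exact h _

/-- The map `λ : W_n(A[X]) → P(E)_n`. -/
noncomputable def lam [Algebra ZLocTwo A] (E : WittComplex.{u, v} A) (n : ℕ) :
    WittLen n A[X] →+* PolyLevel E n :=
  (WittLen.proj (A := A[X]) n).liftOfRightInverse TruncatedWittVector.out WittLen.proj_out
    ⟨lamRing E n, fun x hx => lamRing_eq_zero x ((WittVector.mem_ker_truncate n x).1 hx)⟩

theorem lam_proj [Algebra ZLocTwo A] (x : WittVector 2 A[X]) :
    lam E n (WittLen.proj n x) = lamAdd n x :=
  (WittLen.proj (A := A[X]) n).liftOfRightInverse_comp_apply _ _ _ x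

theorem lam_mono [Algebra ZLocTwo A] (j : ℕ) (w : WittVector 2 A) :
    lam E n (WittLen.proj n (mono j w)) = z1 j (E.lam (WittLen.proj n w)) :=
  (lam_proj _).trans (lamAdd_mono j w)

theorem lamAdd_iterate_verschiebung {i : ℕ} (r l : ℕ) (h : i + r = n) (hl : Odd l)
    (w : WittVector 2 A) :
    (lamAdd n (verschiebung^[r] (mono l w)) : PolyLevel E n) = g3 r l h hl (E.lamW i w) := by
  induction r generalizing n with
  | zero => subst h; exact lamAdd_mono l w
  | succ r ih =>
    obtain ⟨m, rfl⟩ : ∃ m, n = m + 1 := ⟨n - 1, by omega⟩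
    rw [Function.iterate_succ_apply', lamAdd_verschiebung, ih (by omega), V_g3]; rfl

end PolyLevel

end WittComplex

theorem WittVector.mono_teichmuller {A : Type u} [CommRing A] (j : ℕ) (c : A) :
    WittVector.mono j (WittVector.teichmuller 2 c) = WittVector.teichmuller 2 (monomial j c) := by
  rw [WittVector.mono_apply, WittVector.map_teichmuller, ← map_pow, ← map_mul,
    Polynomial.C_mul_X_pow_eq_monomial]

theorem WittVector.teichmuller_ind {A : Type u} [CommRing A] {P : WittVector 2 A[X] → Prop}
    (hm : ∀ j c, P (WittVector.teichmuller 2 (monomial j c)))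
    (hV : ∀ x, P (WittVector.verschiebung x)) (hadd : ∀ x y, P x → P y → P (x + y))
    (x : WittVector 2 A[X]) : P x := by
  rw [WittVector.polyLift_add_polyShift x]
  refine hadd _ _ ?_ (hV _)
  rw [WittVector.polyLift, Polynomial.sum_def]
  refine Finset.sum_induction _ P hadd ?_ fun j _ => by
    rw [WittVector.mono_teichmuller]; exact hm j _
  rw [← map_zero (WittVector.verschiebung (p := 2) (R := A[X]))]; exact hV 0

/-! ### The relation `Fdλ[a] = λ[a]dλ[a]`. -/

namespace WittComplex

theorem PolyLevel.z2_congr {A : Type u} [CommRing A] {E : WittComplex.{u, v} A} {n j k : ℕ}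
    (h : j = k) (a : E.carrier n) : (z2 j a : PolyLevel E n) = z2 k a := by
  rw [h]

variable {A : Type u} [CommRing A] [Algebra ZLocTwo A] {E : WittComplex.{u, v} A} {n : ℕ}

namespace PolyLevel

open WittVector (mono polyLift polyShift verschiebung frobenius teichmuller)

theorem io_mul (x y : PolyLevel E n) : io x * y = io (x * y) := by
  rw [io_eq, io_eq, mul_assoc]

theorem mul_io (x y : PolyLevel E n) : x * io y = io (x * y) := by
  have h := (isGood E n).io_eq'
  have h' : ∀ x : PolyLevel E n, io x = x * z1 0 (E.eta n) := h
  rw [h', h', mul_assoc]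

theorem d_one : d (1 : PolyLevel E n) = 0 := by
  rw [one_eq_z1, d_z1, WittComplex.d_one]; simp

theorem d_V_one : d (V (1 : PolyLevel E n)) = io 1 + io (V 1) := by
  have h := V_z1_even 0 (1 : E.carrier n)
  rw [mul_zero] at h
  rw [one_eq_z1, h, d_z1, E.d_V_one, one_eq_z1, io_z1, io_z1, map_add, mul_one]
  simp

theorem lamAdd_comm (x : WittVector 2 A[X]) (y : PolyLevel E n) :
    lamAdd n x * y = y * lamAdd n x := comm_even (by decide) (lamAdd_mem x) y

theorem t_lamAdd (x : WittVector 2 A[X]) : t (lamAdd n x : PolyLevel E n) = lamAdd n x :=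
  (t_of_mem (lamAdd_mem x)).trans (negOnePow_smul_even (by decide) _)

theorem d_lamAdd_mul (x : WittVector 2 A[X]) (y : PolyLevel E n) :
    d (lamAdd n x * y) = d (lamAdd n x) * y + lamAdd n x * d y := by
  rw [leibniz, t_lamAdd]

theorem z1_mul_z2 (j k : ℕ) (a b : E.carrier n) :
    z1 j a * z2 k b = z2 (j + k) (a * b) := by
  change PolyLevel.j (IntPart.y1 j a) * PolyLevel.j (IntPart.y2 k b) = _
  rw [← j_mul, IntPart.y1_mul_y2]; rfl

theorem F_d_lamAdd_monomial (j : ℕ) (c : A) :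
    F (d (lamAdd (n + 1) (teichmuller 2 (monomial j c)))) =
      (lamAdd n (teichmuller 2 (monomial j c)) : PolyLevel E n) *
        d (lamAdd n (teichmuller 2 (monomial j c))) := by
  have h1 : E.F (E.d (E.lamW (n + 1) (teichmuller 2 c))) =
      E.lamW n (teichmuller 2 c) * E.d (E.lamW n (teichmuller 2 c)) := E.F_d_lam c
  have h2 : E.F (E.lamW (n + 1) (teichmuller 2 c)) =
      E.lamW n (teichmuller 2 c) * E.lamW n (teichmuller 2 c) := by
    rw [← lamW_frobenius, WittVector.frobenius_teich, pow_two, map_mul, map_mul]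
  have h3 : ∀ n, E.tau n (E.lamW n (teichmuller 2 c)) = E.lamW n (teichmuller 2 c) :=
    fun n => E.tau_lam _
  rw [← WittVector.mono_teichmuller, lamAdd_mono, lamAdd_mono, d_z1, d_z1, map_add, F_z1, F_z2,
    mul_add, z1_mul_z1, z1_mul_z2, h1, h3, h3, map_mul E.F, map_natCast, h2, two_mul]
  congr 1
  rcases j with _ | j
  · simp
  · rw [z2_congr (show 2 * (j + 1 - 1) + 1 = j + 1 + (j + 1 - 1) by omega), ← mul_assoc,
      ← mul_assoc, Nat.cast_comm]

theorem lamAdd_teichmuller_sq (a : A[X]) : F (lamAdd (n + 1) (teichmuller 2 a)) =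
    (lamAdd n (teichmuller 2 a) * lamAdd n (teichmuller 2 a) : PolyLevel E n) := by
  rw [← lamAdd_frobenius, WittVector.frobenius_teich, pow_two, map_mul, lamAdd_mul]

theorem t_one : t (1 : PolyLevel E n) = 1 := (t_j 1).trans (congrArg j (map_one IntPart.tau))

/-- The identity is quadratic in `x`, but additive: the cross terms are `2dV(ab) - Vd(ab) = 0` on
the left and `2ιV(ab) = 0` on the right. So it suffices to know it for monomial representatives and,
as assumed, for the image of `V`. -/
theorem d_V_lamAdd_sq_aux
    (hV : ∀ x : WittVector 2 A[X],
      d (V (lamAdd n (verschiebung x) * lamAdd n (verschiebung x))) -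
        V (lamAdd n (verschiebung x) * d (lamAdd n (verschiebung x))) =
      (io (lamAdd (n + 1) (verschiebung x)) +
        io (V (lamAdd n (verschiebung x) * lamAdd n (verschiebung x))) : PolyLevel E (n + 1)))
    (x : WittVector 2 A[X]) :
    d (V (lamAdd n x * lamAdd n x)) - V (lamAdd n x * d (lamAdd n x)) =
      (io (lamAdd (n + 1) x) + io (V (lamAdd n x * lamAdd n x)) : PolyLevel E (n + 1)) := by
  induction x using WittVector.teichmuller_ind with
  | hV x => exact hV x
  | hm j c =>
    -- With `s = λ(x)` in level `n + 1`, the left side is `dV(F(s)) - V(F(ds)) = d(V(1)s) - V(1)ds =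
    -- dV(1)·s`.
    rw [← lamAdd_teichmuller_sq, ← F_d_lamAdd_monomial]
    set s : PolyLevel E (n + 1) := lamAdd (n + 1) (teichmuller 2 (monomial j c))
    have h1 : ∀ y : PolyLevel E (n + 1), V (F y) = V 1 * y := fun y => by rw [V_mul, one_mul]
    rw [h1, h1, leibniz, t_V, t_one, add_sub_cancel_right, d_V_one, add_mul, io_mul, io_mul, one_mul]
  | hadd x y hx hy =>
    have h3 : lamAdd n y * lamAdd n x = (lamAdd n x * lamAdd n y : PolyLevel E n) := lamAdd_comm _ _
    have h4 : d (lamAdd n x * lamAdd n y : PolyLevel E n) =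
        lamAdd n y * d (lamAdd n x) + lamAdd n x * d (lamAdd n y) := by
      rw [d_lamAdd_mul, lamAdd_comm y]
    rw [map_add (lamAdd n) x y, map_add (lamAdd (n + 1)) x y]
    generalize (lamAdd n x : PolyLevel E n) = a at *
    generalize (lamAdd n y : PolyLevel E n) = b at *
    generalize (lamAdd (n + 1) x : PolyLevel E (n + 1)) = a' at *
    generalize (lamAdd (n + 1) y : PolyLevel E (n + 1)) = b' at *
    have e2 : (a + b) * (a + b) = a * a + b * b + (a * b + a * b) := by
      rw [add_mul, mul_add, mul_add, h3]; abel
    have e3 : (a + b) * (d a + d b) = a * d a + b * d b + d (a * b) := by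
      rw [h4, add_mul, mul_add, mul_add]; abel
    have h1 : d (V (a * b)) + d (V (a * b)) = V (d (a * b)) := (V_d _).symm
    have h2 : io (V (a * b)) + io (V (a * b)) = 0 := io_add_io _
    rw [map_add d a b, e2, e3]
    simp only [map_add]
    rw [h1, h2, add_zero, show ∀ a b c p q : PolyLevel E (n + 1),
      a + b + c - (p + q + c) = a - p + (b - q) from fun a b c p q => by abel, hx, hy]
    exact add_add_add_comm _ _ _ _

/-- For an argument `V(x)` the identity follows by applying `V` to the identity for `x` one level
lower, with `FV = 2`, `FdV = d + ι` and `Vd = 2dV`. -/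
theorem d_V_lamAdd_sq (x : WittVector 2 A[X]) :
    d (V (lamAdd n x * lamAdd n x)) - V (lamAdd n x * d (lamAdd n x)) =
      (io (lamAdd (n + 1) x) + io (V (lamAdd n x * lamAdd n x)) : PolyLevel E (n + 1)) := by
  induction n generalizing x with
  | zero =>
    refine d_V_lamAdd_sq_aux (fun x => ?_) x
    rw [lamAdd_verschiebung, Subsingleton.elim (lamAdd 0 x : PolyLevel E 0) 0,
      Subsingleton.elim (lamAdd 0 (verschiebung x) : PolyLevel E 0) 0]
    simp
  | succ n ih =>
    refine d_V_lamAdd_sq_aux (fun x => ?_) x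
    have h := congrArg V (ih x)
    rw [lamAdd_verschiebung, lamAdd_verschiebung, V_mul, V_mul, F_V, F_d_V, mul_add, mul_add,
      mul_io, map_add V, map_add V, map_add V, map_add V, map_add io, io_add_io, add_zero, map_add d,
      ← V_d]
    rw [map_sub, map_add, sub_eq_iff_eq_add, V_io, V_io] at h
    rw [h, V_io, V_io]
    abel

/-- Bookkeeping for the next theorem: `α`, `β`, `v` are `λ[a]`, `λ[b]`, `λ(V(x))`, a prime denotes
the differential, `y'` is `dλ(x)`, and `w = ιλ(x)` occurs twice. -/
theorem mul_add_mul_add_eq {S : Type*} [Ring S] {α β v α' β' v' w q q' y' : S}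
    (h : y' = α' * β + α * β' + (α' * v + α * v') + (β' * v + β * v') + (w + q + q'))
    (h0 : v * v' = q' + q) (h1 : β * α' = α' * β) (h2 : v * α' = α' * v) (h3 : v * β' = β' * v)
    (h4 : w + w = 0) :
    α * α' + β * β' + (y' + w) = (α + β + v) * (α' + β' + v') := by
  rw [h, add_mul, add_mul, mul_add, mul_add, mul_add, mul_add, mul_add, mul_add, h0, h1, h2, h3,
    ← sub_eq_zero, ← h4]
  abel

/-- For a sum, `[a+b] = [a] + [b] + V(x)` and `FdV = d + ι` turn the left side into `[a]d[a] +
[b]d[b] + dx + ιx`, read after `λ`. The recursive equation for `x` expresses `dx`, and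
`d_V_lamAdd_sq` its only difficult term `dV(x²)`. -/
theorem F_d_lam (a : A[X]) :
    F (d (lamAdd (n + 1) (teichmuller 2 a))) =
      (lamAdd n (teichmuller 2 a) : PolyLevel E n) * d (lamAdd n (teichmuller 2 a)) := by
  -- Level 0 is zero. In level `n + 1` the element `λ(V(x))` is `V` of an element of level `n`, as
  -- the identity for squares requires.
  rcases n with _ | n
  · exact Subsingleton.elim _ _
  induction a using Polynomial.induction_on' with
  | monomial j c => exact F_d_lamAdd_monomial j c
  | add a b ha hb =>
    obtain ⟨x, h1, h2⟩ := WittVector.exists_teichmuller_add a b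
    have e1 : ∀ m, (lamAdd m (teichmuller 2 (a + b)) : PolyLevel E m) =
        lamAdd m (teichmuller 2 a) + lamAdd m (teichmuller 2 b) + lamAdd m (verschiebung x) :=
      fun m => by rw [h1, map_add, map_add]
    have h3 : (lamAdd (n + 1) x : PolyLevel E (n + 1)) =
        lamAdd (n + 1) (teichmuller 2 a) * lamAdd (n + 1) (teichmuller 2 b) +
        lamAdd (n + 1) (teichmuller 2 a) * V (lamAdd n x) +
          lamAdd (n + 1) (teichmuller 2 b) * V (lamAdd n x) + V (lamAdd n x * lamAdd n x) := by
      conv_lhs => rw [h2]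
      rw [map_add, map_add, lamAdd_mul, lamAdd_mul, map_add, add_mul, lamAdd_verschiebung,
        lamAdd_verschiebung, lamAdd_mul, ← add_assoc (lamAdd _ _ * lamAdd _ _)]
    have h4 := d_V_lamAdd_sq (E := E) (n := n) x
    have h5 : V (lamAdd n x) * d (V (lamAdd n x)) =
        (V (lamAdd n x * d (lamAdd n x)) + io (V (lamAdd n x * lamAdd n x)) :
          PolyLevel E (n + 1)) := by
      rw [V_mul, F_d_V, mul_add, mul_io, map_add, V_io]
    have c1 := lamAdd_comm (E := E) (n := n + 1) (teichmuller 2 b)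
    have c3 := lamAdd_comm (E := E) (n := n + 1) (verschiebung x)
    have d1 := d_lamAdd_mul (E := E) (n := n + 1) (teichmuller 2 a)
    have d2 := d_lamAdd_mul (E := E) (n := n + 1) (teichmuller 2 b)
    rw [lamAdd_verschiebung] at c3
    rw [e1, e1, map_add d, map_add d, map_add F, map_add F, ha, hb, map_add d, map_add d,
      lamAdd_verschiebung, lamAdd_verschiebung, F_d_V]
    refine mul_add_mul_add_eq ?_ h5 (c1 _) (c3 _) (c3 _) (io_add_io _)
    rw [sub_eq_iff_eq_add] at h4
    conv_lhs => rw [h3]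
    rw [map_add d, map_add d, map_add d, d1, d1, d2, h4]

end PolyLevel

end WittComplex

/-! ### The Witt complex `P(E)` and its identification with formal sums. -/

namespace WittComplex

variable {A : Type u} [CommRing A] [Algebra ZLocTwo A] {E : WittComplex.{u, v} A} {n : ℕ}

open PolyLevel in
/-- The Witt complex `P(E)` over `A[X]` without its laws. -/
noncomputable def polyPre (E : WittComplex.{u, v} A) : PreWittComplex.{u, v} A[X] where
  carrier := PolyLevel E
  deg := PolyLevel.deg
  R :=
    { R with
      map_one' := (R_j 1).trans (congrArg j (map_one IntPart.R))
      map_mul' := PolyLevel.R_mul }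
  lam := PolyLevel.lam E _
  F :=
    { F with
      map_one' := (F_j 1).trans (congrArg j (map_one IntPart.F))
      map_mul' := PolyLevel.F_mul }
  V := V
  d := d

namespace PolyLevel

theorem lam_teich_neg_one : PolyLevel.lam E n (WittLen.teich n (-1)) =
    z1 0 (E.lam (WittLen.teich n (-1))) := by
  have h := lam_mono (E := E) (n := n) 0 (WittVector.teichmuller 2 (-1))
  rwa [WittVector.mono_teichmuller, Polynomial.monomial_zero_left, map_neg, map_one] at h

theorem eta_polyPre (n : ℕ) : (polyPre E).eta n = z1 0 (E.eta n) := by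
  have h : PolyLevel.lam E n (WittLen.teich n (-1)) * PolyLevel.lam E n (WittLen.teich n (-1)) = 1 := by
    rw [← map_mul, ← WittLen.teich_mul, neg_mul_neg, one_mul, WittLen.teich_one, map_one]
  have h' : Ring.inverse (PolyLevel.lam E n (WittLen.teich n (-1))) =
      PolyLevel.lam E n (WittLen.teich n (-1)) :=
    Ring.inverse_unit ⟨_, _, h, h⟩
  change Ring.inverse (PolyLevel.lam E n (WittLen.teich n (-1))) *
    d (PolyLevel.lam E n (WittLen.teich n (-1))) = _
  rw [h', lam_teich_neg_one, d_z1, Nat.cast_zero, zero_mul, map_zero, add_zero, z1_mul_z1, E.eta_eq]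

theorem iota_polyPre (x : PolyLevel E n) : (polyPre E).iota (n := n) x = io x := by
  rw [io_eq, ← eta_polyPre]; rfl

theorem mul_comm_of_mem {p q : ℤ} {x y : PolyLevel E n} (hx : x ∈ deg n p) (hy : y ∈ deg n q) :
    x * y = (p * q).negOnePow • (y * x) := by
  rcases Int.even_or_odd p with hp | hp
  · rw [comm_even hp hx, negOnePow_smul_even (hp.mul_right q)]
  · rw [comm_odd hp hx, t_of_mem hy]
    rcases Int.even_or_odd q with hq | hq
    · rw [negOnePow_smul_even hq, negOnePow_smul_even (hq.mul_left p)]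
    · rw [negOnePow_smul_odd hq, negOnePow_smul_odd (hp.mul hq), neg_mul]

end PolyLevel

/-- The Witt complex `P(E)` over `A[X]`. -/
noncomputable def poly (E : WittComplex.{u, v} A) : WittComplex.{u, v} A[X] where
  toPreWittComplex := polyPre E
  level_zero := inferInstanceAs (Subsingleton (PolyLevel E 0))
  isInternal := PolyLevel.isInternal
  one_mem n := by
    change (1 : PolyLevel E n) ∈ PolyLevel.deg n 0
    rw [PolyLevel.one_eq_z1]; exact PolyLevel.z1_mem (E.one_mem n)
  mul_mem := PolyLevel.mul_mem
  mul_comm := PolyLevel.mul_comm_of_mem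
  R_mem := PolyLevel.R_mem
  lam_mem w := by
    obtain ⟨w, rfl⟩ := WittLen.proj_surjective _ w
    change PolyLevel.lam E _ _ ∈ PolyLevel.deg _ 0
    rw [PolyLevel.lam_proj]; exact PolyLevel.lamAdd_mem w
  R_lam w := by
    obtain ⟨w, rfl⟩ := WittLen.proj_surjective _ w
    change PolyLevel.R (PolyLevel.lam E _ _) = PolyLevel.lam E _ _
    rw [WittLen.R_proj, PolyLevel.lam_proj, PolyLevel.lam_proj, PolyLevel.R_lamAdd]
  F_mem := PolyLevel.F_mem
  R_F := PolyLevel.R_F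
  lam_F w := by
    obtain ⟨w, rfl⟩ := WittLen.proj_surjective _ w
    change PolyLevel.lam E _ _ = PolyLevel.F (PolyLevel.lam E _ _)
    rw [WittLen.F_proj, PolyLevel.lam_proj, PolyLevel.lam_proj, PolyLevel.lamAdd_frobenius]
  V_mem := PolyLevel.V_mem
  R_V := PolyLevel.R_V
  lam_V w := by
    obtain ⟨w, rfl⟩ := WittLen.proj_surjective _ w
    change PolyLevel.lam E _ _ = PolyLevel.V (PolyLevel.lam E _ _)
    rw [WittLen.V_proj, PolyLevel.lam_proj, PolyLevel.lam_proj, PolyLevel.lamAdd_verschiebung]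
  V_mul := PolyLevel.V_mul
  F_V x := (PolyLevel.F_V x).trans (two_mul x).symm
  d_mem := PolyLevel.d_mem
  R_d := PolyLevel.R_d
  d_mul y hx := by
    rw [← smul_mul_assoc]
    exact (PolyLevel.leibniz _ _).trans
      (congrArg (_ + · * PolyLevel.d (show PolyLevel E _ from y)) (PolyLevel.t_of_mem hx))
  F_d_V x := (PolyLevel.F_d_V x).trans
    (congrArg (fun z : PolyLevel E _ => PolyLevel.d x + z) (PolyLevel.iota_polyPre x).symm)
  d_d x := ((PolyLevel.d_d x).trans (PolyLevel.io_d x)).trans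
    (congrArg PolyLevel.d (PolyLevel.iota_polyPre x).symm)
  d_iota x := ((congrArg PolyLevel.d (PolyLevel.iota_polyPre x)).trans (PolyLevel.io_d x).symm).trans
    (PolyLevel.iota_polyPre _).symm
  F_d_lam a := by
    change PolyLevel.F (PolyLevel.d (PolyLevel.lam E _ (WittLen.proj _ _))) =
      PolyLevel.lam E _ (WittLen.proj _ _) * PolyLevel.d (PolyLevel.lam E _ (WittLen.proj _ _))
    rw [PolyLevel.lam_proj, PolyLevel.lam_proj]
    exact PolyLevel.F_d_lam a

/-- The identification of formal sums with the elements of `P(E)`. -/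
noncomputable def polyEquiv (E : WittComplex.{u, v} A) (n : ℕ) :
    FormalSum E n ≃+ E.poly.carrier n :=
  let e : (ℕ →₀ E.carrier n) ≃+ (E.carrier n)[X] :=
    { toFun := fun f => ⟨.ofCoeff f⟩
      invFun := fun p => p.toFinsupp.coeff
      left_inv := fun _ => rfl
      right_inv := fun _ => rfl
      map_add' := fun _ _ => rfl }
  { toFun := fun x => ((e x.1, e x.2.1), x.2.2)
    invFun := fun y => (e.symm y.1.1, e.symm y.1.2, y.2)
    left_inv := fun _ => rfl
    right_inv := fun _ => rfl
    map_add' := fun _ _ => rfl }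

theorem x3_eq {i : ℕ} (r l : ℕ) (h : i + r = n) (hr : 0 < r) (hl : Odd l) (c : E.carrier i) :
    x3 (polyEquiv E) r l h c = PolyLevel.z3 r l h hr hl c := by
  rw [x3, FormalSum.ty3, dif_pos ⟨hr, hl⟩]; rfl

theorem x4_eq {i : ℕ} (s m : ℕ) (h : i + s = n) (hs : 0 < s) (hm : Odd m) (e : E.carrier i) :
    x4 (polyEquiv E) s m h e = PolyLevel.z4 s m h hs hm e := by
  rw [x4, FormalSum.ty4, dif_pos ⟨hs, hm⟩]; rfl

theorem polyEquiv_mem (q : ℤ) (x : FormalSum E n) :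
    polyEquiv E n x ∈ E.poly.deg n q ↔ x.IsHomogeneous q := by
  constructor
  · rintro ⟨⟨h1, h2⟩, h3, h4⟩
    exact ⟨h1, h2, h3, h4⟩
  · rintro ⟨h1, h2, h3, h4⟩
    exact ⟨⟨h1, h2⟩, h3, h4⟩

end WittComplex

/-! ### Maps out of `P(E)` and the adjunction. -/

namespace WittComplex

section Variable

variable {A : Type u} [CommRing A] {Q : WittComplex.{u, v} A[X]} {n : ℕ}

/-- The image of `[X]_n`. -/
noncomputable def var (Q : WittComplex.{u, v} A[X]) (n : ℕ) : Q.carrier n :=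
  Q.lam (WittLen.teich n X)

theorem var_pow (j : ℕ) : Q.var n ^ j =
    Q.lam (WittLen.proj n (WittVector.teichmuller 2 X ^ j)) := by
  rw [map_pow, map_pow]; rfl

theorem F_var : Q.F (Q.var (n + 1)) = Q.var n ^ 2 := by
  rw [var, ← Q.lam_F, WittLen.F_teich, map_mul, ← pow_two]; rfl

theorem R_var : Q.R (Q.var (n + 1)) = Q.var n := by
  rw [var, Q.R_lam, WittLen.R_teich]; rfl

theorem F_d_var : Q.F (Q.d (Q.var (n + 1))) = Q.var n * Q.d (Q.var n) := Q.F_d_lam X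

theorem tau_var : Q.tau n (Q.var n) = Q.var n := Q.tau_lam _

theorem var_pow_mem (j : ℕ) : Q.var n ^ j ∈ Q.deg n 0 := by
  rw [var_pow]; exact Q.lam_mem _

theorem var_pow_comm (j : ℕ) (x : Q.carrier n) : Q.var n ^ j * x = x * Q.var n ^ j := by
  rw [var_pow, lam_comm]

theorem d_var_mem : Q.d (Q.var n) ∈ Q.deg n 1 := Q.d_mem (q := 0) (Q.lam_mem _)

theorem tau_d_var : Q.tau n (Q.d (Q.var n)) = - Q.d (Q.var n) := by
  rw [tau_d, tau_var]

theorem d_var_mul (x : Q.carrier n) : Q.d (Q.var n) * x = Q.tau n x * Q.d (Q.var n) :=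
  Q.comm_odd (by decide) d_var_mem x

theorem d_var_pow (j : ℕ) :
    Q.d (Q.var n ^ j) = (j : Q.carrier n) * (Q.var n ^ (j - 1) * Q.d (Q.var n)) := by
  induction j with
  | zero => simp
  | succ j ih =>
    rw [pow_succ, leibniz, ih, map_pow, tau_var, mul_assoc, mul_assoc, d_var_mul, tau_var]
    rcases j with _ | j
    · simp
    · rw [Nat.add_sub_cancel, Nat.add_sub_cancel, ← mul_assoc (Q.var n ^ j), ← pow_succ,
        Nat.cast_succ (j + 1), add_mul, one_mul]

/-- `F(d[X]) = [X]d[X]` in any Witt complex over `A[X]`. Its differential is `2F(dd[X]) = 2F(ηd[X])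
= 0`, and the Leibniz rule makes it `d[X]d[X] + η[X]d[X]`. So the twisted product of integral
elements was the only possible one. -/
theorem d_var_mul_d_var : Q.d (Q.var n) * Q.d (Q.var n) =
    Q.eta n * (Q.var n * Q.d (Q.var n)) := by
  have h : Q.d (Q.F (Q.d (Q.var (n + 1)))) = 0 := by
    rw [d_F, d_d', map_mul, ← mul_assoc, F_eta, mul_assoc, two_mul_eta_mul]
  rw [F_d_var, leibniz, tau_var, d_d', ← mul_assoc, ← eta_comm, mul_assoc] at h
  rw [eq_neg_of_add_eq_zero_left h, neg_eta_mul]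

theorem var_pow_left_comm (j : ℕ) (x y : Q.carrier n) :
    Q.var n ^ j * (x * y) = x * (Q.var n ^ j * y) := by
  rw [← mul_assoc, var_pow_comm, mul_assoc]

theorem d_var_left_comm (x y : Q.carrier n) :
    Q.d (Q.var n) * (x * y) = Q.tau n x * (Q.d (Q.var n) * y) := by
  rw [← mul_assoc, d_var_mul, mul_assoc]

theorem eta_left_comm {A : Type u} [CommRing A] {Q : WittComplex.{u, v} A} {n : ℕ}
    (x y : Q.carrier n) : x * (Q.eta n * y) = Q.eta n * (x * y) := by
  rw [← mul_assoc, ← eta_comm, mul_assoc]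

theorem natCast_left_comm {A : Type u} [CommRing A] {Q : WittComplex.{u, v} A} {n : ℕ} (N : ℕ)
    (x y : Q.carrier n) :
    x * ((N : Q.carrier n) * y) = N * (x * y) := by
  rw [← mul_assoc, ← Nat.cast_comm, mul_assoc]

theorem d_var_mul_var_pow (j : ℕ) :
    Q.d (Q.var n) * Q.var n ^ j = Q.var n ^ j * Q.d (Q.var n) := by
  rw [d_var_mul, map_pow, tau_var]

theorem d_var_pow_mul_d_var (k : ℕ) : Q.d (Q.var n ^ k * Q.d (Q.var n)) =
    ((k + 1 : ℕ) : Q.carrier n) * (Q.eta n * (Q.var n ^ k * Q.d (Q.var n))) := by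
  rw [leibniz, d_var_pow, d_d', map_pow, tau_var, mul_assoc, mul_assoc, d_var_mul_d_var,
    eta_left_comm (Q.var n ^ k), eta_left_comm (Q.var n ^ (k - 1)), Nat.cast_succ, add_mul, one_mul]
  rcases k with _ | k
  · simp
  · rw [Nat.add_sub_cancel, ← mul_assoc (Q.var n ^ k), ← pow_succ]

theorem F_var_pow (k : ℕ) : Q.F (Q.var (n + 1) ^ k) = Q.var n ^ (2 * k) := by
  rw [map_pow, F_var, ← pow_mul]

theorem F_var_pow_mul_d_var (k : ℕ) : Q.F (Q.var (n + 1) ^ k * Q.d (Q.var (n + 1))) =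
    Q.var n ^ (2 * k + 1) * Q.d (Q.var n) := by
  rw [map_mul, F_var_pow, F_d_var, ← mul_assoc, ← pow_succ]

end Variable

variable {A : Type u} [CommRing A] {E : WittComplex.{u, v} A} {Q : WittComplex.{u, v} A[X]} {n : ℕ}

/-- The ring homomorphism in level `n` of a map `E → U(Q)`. -/
noncomputable def coef (θ : E ⟶ (forgetPoly A).obj Q) (n : ℕ) : E.carrier n →+* Q.carrier n :=
  Hom.toFun θ n

variable (θ : E ⟶ (forgetPoly A).obj Q)

theorem coef_mem {q : ℤ} {x : E.carrier n} (hx : x ∈ E.deg n q) : coef θ n x ∈ Q.deg n q :=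
  Hom.map_deg θ hx

theorem coef_R (x : E.carrier (n + 1)) : coef θ n (E.R x) = Q.R (coef θ (n + 1) x) := Hom.map_R θ x

theorem coef_F (x : E.carrier (n + 1)) : coef θ n (E.F x) = Q.F (coef θ (n + 1) x) := Hom.map_F θ x

theorem coef_V (x : E.carrier n) : coef θ (n + 1) (E.V x) = Q.V (coef θ n x) := Hom.map_V θ x

theorem coef_d (x : E.carrier n) : coef θ n (E.d x) = Q.d (coef θ n x) := Hom.map_d θ x

theorem coef_lam (w : WittLen n A) : coef θ n (E.lam w) = Q.lam (WittLen.map C w) := Hom.map_lam θ w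

theorem coef_tau (x : E.carrier n) : coef θ n (E.tau n x) = Q.tau n (coef θ n x) :=
  E.map_tau (coef θ n).toAddMonoidHom (Q.tau n) (map_add _)
    (fun _ _ hx => Q.tau_of_mem (coef_mem θ hx)) x

theorem coef_eta : coef θ n (E.eta n) = Q.eta n := by
  rw [eta_eq, eta_eq, map_mul, coef_d, coef_lam, WittLen.map_teich, map_neg, map_one]

/-- The map `P(E) → Q` on elements of type 1 and 2. -/
noncomputable def intLift (n : ℕ) : IntPart E n →+ Q.carrier n :=
  IntPart.lift (fun j => (AddMonoidHom.mulRight (Q.var n ^ j)).comp (coef θ n).toAddMonoidHom)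
    (fun j => (AddMonoidHom.mulRight (Q.var n ^ j * Q.d (Q.var n))).comp (coef θ n).toAddMonoidHom)

theorem intLift_y1 (j : ℕ) (a : E.carrier n) :
    intLift θ n (IntPart.y1 j a) = coef θ n a * Q.var n ^ j := IntPart.lift_y1 _ _ _ _

theorem intLift_y2 (j : ℕ) (a : E.carrier n) :
    intLift θ n (IntPart.y2 j a) = coef θ n a * (Q.var n ^ j * Q.d (Q.var n)) :=
  IntPart.lift_y2 _ _ _ _

/-- The map `P(E) → Q` on elements of type 3. -/
noncomputable def higherLift (n : ℕ) : HigherPart E n →+ Q.carrier n :=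
  HigherPart.lift fun i r l h _ _ =>
    ((Q.Vpow r h).comp (AddMonoidHom.mulRight (Q.var i ^ l))).comp (coef θ i).toAddMonoidHom

theorem higherLift_of {i : ℕ} (r l : ℕ) (h : i + r = n) (hr : 0 < r) (hl : Odd l)
    (c : E.carrier i) : higherLift θ n (HigherPart.of r l h hr hl c) =
      Q.Vpow r h (coef θ i c * Q.var i ^ l) := HigherPart.lift_of _ _ _ _ _ _ _

/-- The additive map `P(E) → Q` in level `n` determined by a map `E → U(Q)`. -/
noncomputable def levelLift (n : ℕ) : PolyLevel E n →+ Q.carrier n :=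
  PolyLevel.lift (intLift θ n) (higherLift θ n) (Q.d.comp (higherLift θ n))

namespace PolyLevel

theorem levelLift_j (b : IntPart E n) : levelLift θ n (j b) = intLift θ n b := lift_j _ _ _ _

theorem levelLift_v (c : HigherPart E n) : levelLift θ n (v c) = higherLift θ n c := lift_v _ _ _ _

theorem levelLift_w (c : HigherPart E n) :
    levelLift θ n (w c) = Q.d (higherLift θ n c) := lift_w _ _ _ _

theorem levelLift_z1 (j : ℕ) (a : E.carrier n) :
    levelLift θ n (z1 j a) = coef θ n a * Q.var n ^ j :=
  (levelLift_j θ _).trans (intLift_y1 θ j a)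

theorem levelLift_z2 (j : ℕ) (a : E.carrier n) :
    levelLift θ n (z2 j a) = coef θ n a * (Q.var n ^ j * Q.d (Q.var n)) :=
  (levelLift_j θ _).trans (intLift_y2 θ j a)

theorem levelLift_z3 {i : ℕ} (r l : ℕ) (h : i + r = n) (hr : 0 < r) (hl : Odd l)
    (c : E.carrier i) : levelLift θ n (z3 r l h hr hl c) =
      Q.Vpow r h (coef θ i c * Q.var i ^ l) :=
  (levelLift_v θ _).trans (higherLift_of θ r l h hr hl c)

theorem levelLift_z4 {i : ℕ} (r l : ℕ) (h : i + r = n) (hr : 0 < r) (hl : Odd l)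
    (c : E.carrier i) : levelLift θ n (z4 r l h hr hl c) =
      Q.d (Q.Vpow r h (coef θ i c * Q.var i ^ l)) :=
  (levelLift_w θ _).trans (congrArg Q.d (higherLift_of θ r l h hr hl c))

theorem levelLift_mem {q : ℤ} {x : PolyLevel E n} (hx : x ∈ deg n q) :
    levelLift θ n x ∈ Q.deg n q := by
  have hp : ∀ {i : ℕ} {q : ℤ} {a : E.carrier i} (l : ℕ), a ∈ E.deg i q →
      coef θ i a * Q.var i ^ l ∈ Q.deg i q := fun l ha => by
    have := Q.mul_mem (coef_mem θ ha) (var_pow_mem l)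
    rwa [add_zero] at this
  refine deg_ind (P := fun x => levelLift θ n x ∈ Q.deg n q) ?_ ?_ ?_ ?_ ?_ hx
  · intro k a ha; rw [levelLift_z1]; exact hp k ha
  · intro k a ha
    have := Q.mul_mem (hp k ha) d_var_mem
    rw [levelLift_z2, ← mul_assoc]; rwa [sub_add_cancel] at this
  · intro i r l h hr hl c hc; rw [levelLift_z3]; exact Q.Vpow_mem h (hp l hc)
  · intro i r l h hr hl c hc
    have := Q.d_mem (Q.Vpow_mem h (hp l hc))
    rw [levelLift_z4]; rwa [sub_add_cancel] at this
  · intro x y hx hy; rw [map_add]; exact AddSubgroup.add_mem _ hx hy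

theorem levelLift_t (x : PolyLevel E n) : levelLift θ n (t x) = Q.tau n (levelLift θ n x) := by
  induction x using ind with
  | hadd x y hx hy => simp only [map_add, hx, hy]
  | h1 k a => rw [t_z1, levelLift_z1, levelLift_z1, map_mul, map_pow, tau_var, coef_tau]
  | h2 k a =>
    rw [t_z2, map_neg, levelLift_z2, levelLift_z2, map_mul, map_mul, map_pow, tau_var, coef_tau,
      tau_d_var, mul_neg, mul_neg]
  | h3 i r l h hr hl c =>
    rw [t_z3, levelLift_z3, levelLift_z3, tau_Vpow, map_mul (Q.tau _), map_pow, tau_var, coef_tau]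
  | h4 i r l h hr hl c =>
    rw [t_z4, map_neg, levelLift_z4, levelLift_z4, tau_d, tau_Vpow, map_mul (Q.tau _), map_pow, tau_var,
      coef_tau]

theorem levelLift_io (x : PolyLevel E n) : levelLift θ n (io x) = Q.eta n * levelLift θ n x := by
  induction x using ind with
  | hadd x y hx hy => simp only [map_add, hx, hy, mul_add]
  | h1 k a => rw [io_z1, levelLift_z1, levelLift_z1, map_mul, coef_eta, mul_assoc]
  | h2 k a => rw [io_z2, levelLift_z2, levelLift_z2, map_mul, coef_eta, mul_assoc]
  | h3 i r l h hr hl c =>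
    rw [io_z3, levelLift_z3, levelLift_z3, map_mul (coef θ _), coef_eta, mul_assoc, Vpow_eta_mul]
  | h4 i r l h hr hl c =>
    rw [io_z4, levelLift_z4, levelLift_z4, map_mul (coef θ _), coef_eta, mul_assoc, Vpow_eta_mul, d_eta_mul]

theorem levelLift_d (x : PolyLevel E n) : levelLift θ n (d x) = Q.d (levelLift θ n x) := by
  induction x using ind with
  | hadd x y hx hy => simp only [map_add, hx, hy]
  | h1 k a =>
    rw [d_z1, map_add, levelLift_z1, levelLift_z2, levelLift_z1, Q.leibniz, coef_d, d_var_pow, map_mul,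
      map_natCast, coef_tau, mul_assoc, natCast_left_comm]
  | h2 k b =>
    rw [d_z2, map_add, levelLift_z2, levelLift_z2, levelLift_z2, Q.leibniz, coef_d,
      d_var_pow_mul_d_var, map_mul, map_natCast, map_mul, coef_eta, natCast_left_comm,
      eta_left_comm (Q.tau n _), ← mul_assoc (Q.eta n) (Q.tau _ _), eta_tau, mul_assoc, mul_assoc]
  | h3 i r l h hr hl c => rw [d_z3, levelLift_z3, levelLift_z4]
  | h4 i r l h hr hl c =>
    rw [d_z4, levelLift_z4, levelLift_z4, map_mul (coef θ _), coef_eta, mul_assoc, Vpow_eta_mul, Q.d_d', d_eta_mul]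

theorem levelLift_R (x : PolyLevel E (n + 1)) :
    levelLift θ n (R x) = Q.R (levelLift θ (n + 1) x) := by
  induction x using ind_succ with
  | hadd x y hx hy => simp only [map_add, hx, hy]
  | h1 k a => rw [R_z1, levelLift_z1, levelLift_z1, map_mul, map_pow, R_var, coef_R]
  | h2 k a =>
    rw [R_z2, levelLift_z2, levelLift_z2, map_mul, map_mul, map_pow, R_var, coef_R, Q.R_d, R_var]
  | h3 i r l h hr hl c =>
    rw [R_z3, levelLift_z3, levelLift_z3, Q.R_Vpow h, map_mul Q.R, map_pow, R_var, coef_R]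
  | h4 i r l h hr hl c =>
    rw [R_z4, levelLift_z4, levelLift_z4, Q.R_d, Q.R_Vpow h, map_mul Q.R, map_pow, R_var, coef_R]

theorem intLift_F (b : IntPart E (n + 1)) :
    intLift θ n (IntPart.F b) = Q.F (intLift θ (n + 1) b) := by
  induction b using IntPart.ind with
  | hadd x y hx hy => simp only [map_add, hx, hy]
  | h1 k a => rw [IntPart.F_y1, intLift_y1, intLift_y1, map_mul, F_var_pow, coef_F]
  | h2 k a =>
    rw [IntPart.F_y2, intLift_y2, intLift_y2, map_mul, F_var_pow_mul_d_var, coef_F]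

theorem intLift_mul (b b' : IntPart E n) :
    intLift θ n (b * b') = intLift θ n b * intLift θ n b' := by
  induction b using IntPart.ind with
  | hadd x y hx hy => simp only [map_add, hx, hy, add_mul]
  | h1 k a =>
    induction b' using IntPart.ind with
    | hadd x y hx hy => simp only [map_add, hx, hy, mul_add]
    | h1 k' a' =>
      rw [IntPart.y1_mul_y1, intLift_y1, intLift_y1, intLift_y1, map_mul, pow_add, mul_assoc,
        mul_assoc, var_pow_left_comm]
    | h2 k' a' =>
      rw [IntPart.y1_mul_y2, intLift_y1, intLift_y2, intLift_y2, map_mul, pow_add, mul_assoc,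
        mul_assoc, mul_assoc, var_pow_left_comm k (coef θ n a')]
  | h2 k a =>
    induction b' using IntPart.ind with
    | hadd x y hx hy => simp only [map_add, hx, hy, mul_add]
    | h1 k' a' =>
      rw [IntPart.y2_mul_y1, intLift_y1, intLift_y2, intLift_y2, map_mul, coef_tau, pow_add,
        mul_assoc, mul_assoc, mul_assoc, mul_assoc, d_var_left_comm, d_var_mul_var_pow,
        var_pow_left_comm k (Q.tau n _)]
    | h2 k' a' =>
      rw [IntPart.y2_mul_y2, intLift_y2, intLift_y2, intLift_y2, map_mul, map_mul, coef_eta,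
        pow_succ, pow_add, mul_assoc, mul_assoc, mul_assoc, mul_assoc, mul_assoc, mul_assoc,
        d_var_left_comm, ← mul_assoc (Q.d _), d_var_mul_var_pow, mul_assoc, d_var_mul_d_var,
        eta_left_comm (Q.var n ^ k'), eta_left_comm (Q.tau n _), ← mul_assoc (Q.eta n) (Q.tau n _),
        eta_tau, mul_assoc, eta_left_comm (Q.var n ^ k), eta_left_comm (coef θ n a),
        var_pow_left_comm k (coef θ n a')]

theorem levelLift_V [Algebra ZLocTwo A] (x : PolyLevel E n) :
    levelLift θ (n + 1) (V x) = Q.V (levelLift θ n x) := by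
  have hz : ∀ k (hk : Odd k) (c : E.carrier n), levelLift θ (n + 1) (z3 1 k rfl Nat.one_pos hk c) =
      Q.V (coef θ n c * Q.var n ^ k) := fun k hk c => levelLift_z3 θ 1 k rfl Nat.one_pos hk c
  have hz' : ∀ k (hk : Odd k) (c : E.carrier n), levelLift θ (n + 1) (z4 1 k rfl Nat.one_pos hk c) =
      Q.d (Q.V (coef θ n c * Q.var n ^ k)) := fun k hk c => levelLift_z4 θ 1 k rfl Nat.one_pos hk c
  induction x using ind with
  | hadd x y hx hy => simp only [map_add, hx, hy]
  | h1 k a =>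
    rcases Nat.even_or_odd' k with ⟨k, rfl | rfl⟩
    · rw [V_z1_even, levelLift_z1, levelLift_z1, coef_V, Q.V_mul, F_var_pow]
    · rw [V_z1_odd _ (odd_two_mul_add_one k), hz, levelLift_z1]
  | h2 k b =>
    rcases Nat.even_or_odd' k with ⟨k, rfl | rfl⟩
    · have hk := odd_two_mul_add_one k
      -- The identity that dictated `V` on type 2 with odd `k`, now in `Q`; it is used with the same
      -- `g`.
      have h : ∀ g : E.carrier n, Q.V (Q.d (coef θ n g * Q.var n ^ (2 * k + 1))) =
          Q.V (coef θ n (E.d g) * Q.var n ^ (2 * k + 1)) +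
            Q.V (coef θ n (((2 * k + 1 : ℕ) : E.carrier n) * E.tau n g) *
              (Q.var n ^ (2 * k) * Q.d (Q.var n))) := fun g => by
        rw [Q.leibniz, d_var_pow, coef_d, map_add, map_mul (coef θ n), map_natCast, coef_tau,
          Nat.add_sub_cancel, natCast_left_comm, mul_assoc]
      have h' := h (Ring.inverse ((2 * k + 1 : ℕ) : E.carrier n) * E.tau n b)
      rw [show E.tau n (Ring.inverse ((2 * k + 1 : ℕ) : E.carrier n) * E.tau n b) =
        Ring.inverse ((2 * k + 1 : ℕ) : E.carrier n) * b from
          (map_inverse_mul (E.tau n).toAddMonoidHom hk _).trans (congrArg _ (E.tau_tau b)),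
        mul_inverse_cancel_left hk, Q.V_d, two_mul] at h'
      rw [V_z2_even _ hk, map_add, map_add, map_neg, hz, hz', levelLift_z2, h', neg_add_cancel_left]
    · rw [V_z2_odd, levelLift_z2, levelLift_z2, coef_V, Q.V_mul, F_var_pow_mul_d_var]
  | h3 i r l h hr hl c => rw [V_z3, levelLift_z3, levelLift_z3, Q.Vpow_succ h]
  | h4 i r l h hr hl c =>
    rw [V_z4, map_add, levelLift_z4, levelLift_z4, Q.Vpow_succ h, Q.V_d, two_mul]

theorem levelLift_V_γ [Algebra ZLocTwo A] (c : HigherPart E (n + 1)) :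
    Q.V (levelLift θ n (γ c)) = higherLift θ (n + 1) c := by
  rw [← levelLift_V, V_γ, levelLift_v]

theorem levelLift_F [Algebra ZLocTwo A] (x : PolyLevel E (n + 1)) :
    levelLift θ n (F x) = Q.F (levelLift θ (n + 1) x) := by
  induction x using ind_parts with
  | hadd x y hx hy => simp only [map_add, hx, hy]
  | hj b => rw [F_j, levelLift_j, levelLift_j, intLift_F]
  | hv c => rw [F_v, levelLift_v, ← levelLift_V_γ, Q.F_V, map_add, two_mul]
  | hw c =>
    rw [F_w, levelLift_w, ← levelLift_V_γ, Q.F_dV, map_add, levelLift_d, levelLift_io]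

/-- Both products obey the projection formula and the Leibniz rule, so the compatibility with `V`,
`F`, `d` and `tau` reduces the claim to a lower level and to integral elements. -/
theorem levelLift_mul [Algebra ZLocTwo A] (x y : PolyLevel E n) :
    levelLift θ n (x * y) = levelLift θ n x * levelLift θ n y := by
  induction n with
  | zero => exact (Q.level_zero).elim _ _
  | succ n ih =>
    have hV : ∀ (x : PolyLevel E n) (y : PolyLevel E (n + 1)),
        levelLift θ (n + 1) (V x * y) = levelLift θ (n + 1) (V x) * levelLift θ (n + 1) y :=
      fun x y => by rw [V_mul, levelLift_V, ih, levelLift_F, levelLift_V, Q.V_mul]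
    have hV' : ∀ (x : PolyLevel E n) (y : PolyLevel E (n + 1)),
        levelLift θ (n + 1) (y * V x) = levelLift θ (n + 1) y * levelLift θ (n + 1) (V x) :=
      fun x y => by rw [mul_V, levelLift_V, ih, levelLift_F, levelLift_V, Q.mul_V]
    have hdV : ∀ (x : PolyLevel E n) (y : PolyLevel E (n + 1)), levelLift θ (n + 1) (d (V x) * y) =
        levelLift θ (n + 1) (d (V x)) * levelLift θ (n + 1) y := fun x y => by
      rw [d_mul_left, map_sub, levelLift_d, hV, t_V, hV, levelLift_d, levelLift_d, Q.leibniz, ← t_V,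
        levelLift_t, add_sub_cancel_right]
    have hdV' : ∀ (x : PolyLevel E n) (y : PolyLevel E (n + 1)), levelLift θ (n + 1) (y * d (V x)) =
        levelLift θ (n + 1) y * levelLift θ (n + 1) (d (V x)) := fun x y => by
      rw [d_mul_right, map_sub, levelLift_d, hV', hV', levelLift_d, levelLift_d, Q.leibniz,
        levelLift_t, Q.tau_tau, add_sub_cancel_left]
    induction x using ind_V with
    | hadd x y hx hy => simp only [map_add, hx, hy, add_mul]
    | hV x => exact hV x y
    | hdV x => exact hdV x y
    | hj b =>
      induction y using ind_V with
      | hadd x y hx hy => simp only [map_add, hx, hy, mul_add]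
      | hV x => exact hV' x _
      | hdV x => exact hdV' x _
      | hj b' => rw [← j_mul, levelLift_j, levelLift_j, levelLift_j, intLift_mul]

theorem levelLift_one [Algebra ZLocTwo A] : levelLift θ n 1 = 1 := by
  rw [one_eq_z1, levelLift_z1, map_one, pow_zero, mul_one]

theorem levelLift_lamAdd [Algebra ZLocTwo A] (x : WittVector 2 A[X]) :
    levelLift θ n (lamAdd n x) = Q.lam (WittLen.proj n x) := by
  induction n generalizing x with
  | zero => exact (Q.level_zero).elim _ _
  | succ n ih =>
    induction x using WittVector.mono_ind with
    | hadd x y hx hy => simp only [map_add, hx, hy]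
    | hV x => rw [lamAdd_verschiebung, levelLift_V, ih, ← Q.lam_V, WittLen.V_proj]
    | hm j w =>
      rw [lamAdd_mono, levelLift_z1, WittVector.mono_apply, map_mul, map_mul, ← var_pow,
        ← WittLen.map_proj, ← coef_lam]; rfl

end PolyLevel

variable [Algebra ZLocTwo A]

/-- The map `P(E) → Q` of Witt complexes determined by a map `E → U(Q)`. -/
noncomputable def polyLift : E.poly ⟶ Q :=
  show Hom E.poly Q from
  { toFun := fun n =>
      { levelLift θ n with
        map_one' := PolyLevel.levelLift_one θ
        map_mul' := PolyLevel.levelLift_mul θ }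
    map_deg := PolyLevel.levelLift_mem θ
    map_R := PolyLevel.levelLift_R θ
    map_lam := fun {n} w => by
      obtain ⟨w, rfl⟩ := WittLen.proj_surjective _ w
      change levelLift θ n (PolyLevel.lam E n _) = _
      rw [PolyLevel.lam_proj, PolyLevel.levelLift_lamAdd]
    map_d := PolyLevel.levelLift_d θ
    map_F := PolyLevel.levelLift_F θ
    map_V := PolyLevel.levelLift_V θ }

/-- The map `E → U(P(E))` with `a ↦ a[X]^0`. -/
noncomputable def polyUnit (E : WittComplex.{u, v} A) : E ⟶ (forgetPoly A).obj E.poly :=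
  show Hom E ((forgetPoly A).obj E.poly) from
  { toFun := fun n =>
      { PolyLevel.z1 0 with
        map_one' := PolyLevel.one_eq_z1.symm
        map_mul' := fun a b => (PolyLevel.z1_mul_z1 0 0 a b).symm }
    map_deg := PolyLevel.z1_mem
    map_R := fun x => (PolyLevel.R_z1 0 x).symm
    map_lam := fun {n} w => by
      obtain ⟨w, rfl⟩ := WittLen.proj_surjective _ w
      change PolyLevel.z1 0 (E.lam (WittLen.proj n w)) = PolyLevel.lam E n (WittLen.map C _)
      rw [← PolyLevel.lam_mono, WittLen.map_proj, WittVector.mono_apply, pow_zero, mul_one]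
    map_d := fun {n} x => by
      have h := PolyLevel.d_z1 0 x
      rw [Nat.cast_zero, zero_mul, map_zero, add_zero] at h
      exact h.symm
    map_F := fun x => (PolyLevel.F_z1 0 x).symm
    map_V := fun x => (PolyLevel.V_z1_even 0 x).symm }

theorem polyUnit_polyLift : polyUnit E ≫ (forgetPoly A).map (polyLift θ) = θ := by
  refine Hom.ext (funext fun n => RingHom.ext fun a => ?_)
  change levelLift θ n (PolyLevel.z1 0 a) = coef θ n a
  rw [PolyLevel.levelLift_z1, pow_zero, mul_one]

theorem var_pow_poly (j : ℕ) : E.poly.var n ^ j = x1 (polyEquiv E) j (1 : E.carrier n) := by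
  have h := PolyLevel.lam_mono (E := E) (n := n) j 1
  rw [WittVector.mono_apply, map_one, one_mul, map_one, map_one] at h
  rw [var_pow]
  exact h

theorem x1_eq_mul (j : ℕ) (a : E.carrier n) :
    x1 (polyEquiv E) j a = x1 (polyEquiv E) 0 a * E.poly.var n ^ j := by
  rw [var_pow_poly]
  refine Eq.trans ?_ (PolyLevel.z1_mul_z1 0 j a 1).symm
  rw [zero_add, mul_one]; rfl

theorem d_var_poly : E.poly.d (E.poly.var n) = x2 (polyEquiv E) 1 (1 : E.carrier n) := by
  rw [← pow_one (E.poly.var n), var_pow_poly]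
  refine (PolyLevel.d_z1 1 1).trans ?_
  rw [WittComplex.d_one, map_zero, zero_add, Nat.cast_one, one_mul, map_one]; rfl

theorem x2_eq_mul (j : ℕ) (a : E.carrier n) : x2 (polyEquiv E) (j + 1) a =
    x1 (polyEquiv E) 0 a * (E.poly.var n ^ j * E.poly.d (E.poly.var n)) := by
  rw [← mul_assoc, ← x1_eq_mul, d_var_poly]
  refine Eq.trans ?_ (PolyLevel.z1_mul_z2 j 0 a 1).symm
  rw [mul_one, add_zero]; rfl

/-- A map over `A[X]` fixes the image of `[X]`. Together with the coefficients this determines all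
integral elements, and then, by induction on the level, everything of the form `V(x)` and `dV(x)`.
-/
theorem poly_hom_ext {Q : WittComplex.{u, v} A[X]} {f g : E.poly ⟶ Q}
    (h : polyUnit E ≫ (forgetPoly A).map f = polyUnit E ≫ (forgetPoly A).map g) : f = g := by
  have h0 : ∀ n (a : E.carrier n), app f n (x1 (polyEquiv E) 0 a) = app g n (x1 (polyEquiv E) 0 a) :=
    fun n a => congrArg (fun φ : E ⟶ (forgetPoly A).obj Q => app φ n a) h
  have hvar : ∀ (f : E.poly ⟶ Q) n, app f n (E.poly.var n) = Q.var n :=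
    fun f n => Hom.map_lam f _
  have hd : ∀ (f : E.poly ⟶ Q) n (x : E.poly.carrier n), app f n (E.poly.d x) = Q.d (app f n x) :=
    fun f n x => Hom.map_d f x
  have hV : ∀ (f : E.poly ⟶ Q) n (x : E.poly.carrier n),
      app f (n + 1) (E.poly.V x) = Q.V (app f n x) := fun f n x => Hom.map_V f x
  have hj : ∀ n (b : IntPart E n), app f n (PolyLevel.j b) = app g n (PolyLevel.j b) := by
    intro n b
    induction b using IntPart.ind with
    | hadd x y hx hy =>
      rw [map_add]
      exact (map_add (app f n) _ _).trans ((congrArg₂ _ hx hy).trans (map_add (app g n) _ _).symm)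
    | h1 j a =>
      change app f n (x1 (polyEquiv E) j a) = app g n (x1 (polyEquiv E) j a)
      rw [x1_eq_mul, map_mul, map_mul, h0, map_pow, map_pow, hvar, hvar]
    | h2 j a =>
      change app f n (x2 (polyEquiv E) (j + 1) a) = app g n (x2 (polyEquiv E) (j + 1) a)
      rw [x2_eq_mul, map_mul, map_mul, h0, map_mul, map_mul, map_pow, map_pow, hd, hd, hvar, hvar]
  refine Hom.ext (funext fun n => RingHom.ext fun x => ?_)
  change app f n x = app g n x
  induction n with
  | zero => exact Q.level_zero.elim _ _
  | succ n ih =>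
    refine PolyLevel.ind_V (P := fun x => app f (n + 1) x = app g (n + 1) x) (hj _) ?_ ?_ ?_ x
    · intro x
      exact (hV f n x).trans ((congrArg Q.V (ih x)).trans (hV g n x).symm)
    · intro x
      refine (hd f _ _).trans ((congrArg Q.d ?_).trans (hd g _ _).symm)
      exact (hV f n x).trans ((congrArg Q.V (ih x)).trans (hV g n x).symm)
    · intro x y hx hy
      exact (map_add (app f _) _ _).trans ((congrArg₂ _ hx hy).trans (map_add (app g _) _ _).symm)

/-- Maps `P(E) → Q` correspond to maps `E → U(Q)`. -/
noncomputable def polyHomEquiv (E : WittComplex.{u, v} A) (Q : WittComplex.{u, v} A[X]) :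
    (E.poly ⟶ Q) ≃ (E ⟶ (forgetPoly A).obj Q) where
  toFun f := polyUnit E ≫ (forgetPoly A).map f
  invFun θ := polyLift θ
  left_inv _ := poly_hom_ext (polyUnit_polyLift _)
  right_inv θ := polyUnit_polyLift θ

/-- The functor `P`. -/
noncomputable def polyFunctor (A : Type u) [CommRing A] [Algebra ZLocTwo A] :
    WittComplex.{u, v} A ⥤ WittComplex.{u, v} A[X] :=
  Adjunction.leftAdjointOfEquiv (G := forgetPoly A) polyHomEquiv fun X _ _ g h => by
    change polyUnit X ≫ (forgetPoly A).map (h ≫ g) = (polyUnit X ≫ (forgetPoly A).map h) ≫ _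
    rw [Functor.map_comp, Category.assoc]

/-- The functor `P` is left adjoint to the forgetful functor. -/
noncomputable def polyAdjunction (A : Type u) [CommRing A] [Algebra ZLocTwo A] :
    polyFunctor.{u, v} A ⊣ forgetPoly.{u, v} A :=
  Adjunction.adjunctionOfEquivLeft (G := forgetPoly A) polyHomEquiv fun X _ _ g h => by
    change polyUnit X ≫ (forgetPoly A).map (h ≫ g) = (polyUnit X ≫ (forgetPoly A).map h) ≫ _
    rw [Functor.map_comp, Category.assoc]

theorem polyAdjunction_unit (E : WittComplex.{u, v} A) :
    (polyAdjunction A).unit.app E = polyUnit E := by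
  change polyUnit E ≫ (forgetPoly A).map (𝟙 _) = _
  rw [CategoryTheory.Functor.map_id]; exact Category.comp_id _

theorem polyFunctor_map {E E' : WittComplex.{u, v} A} (θ : E ⟶ E') :
    (polyFunctor A).map θ = polyLift (θ ≫ polyUnit E') := by
  change polyLift (θ ≫ (polyUnit E' ≫ (forgetPoly A).map (𝟙 _))) = _
  rw [CategoryTheory.Functor.map_id]; rfl

end WittComplex

/-! ### The functor acts on coefficients. -/

namespace WittComplex

namespace FormalSum

variable {A : Type u} [CommRing A] {E E' : WittComplex.{u, v} A} {n : ℕ} (θ : E ⟶ E')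

theorem map_ty1 (j : ℕ) (a : E.carrier n) : map θ n (ty1 j a) = ty1 j (app θ n a) := by
  refine Prod.ext ?_ (Prod.ext ?_ (Prod.ext ?_ ?_))
  · exact Finsupp.mapRange_single (hf := map_zero _)
  · exact map_zero (Finsupp.mapRange.addMonoidHom (app θ n).toAddMonoidHom)
  · exact map_zero (DirectSum.map fun t : HigherIdx n => (app θ t.1.1).toAddMonoidHom)
  · exact map_zero (DirectSum.map fun t : HigherIdx n => (app θ t.1.1).toAddMonoidHom)

theorem map_ty2 (j : ℕ) (a : E.carrier n) : map θ n (ty2 j a) = ty2 j (app θ n a) := by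
  refine Prod.ext ?_ (Prod.ext ?_ (Prod.ext ?_ ?_))
  · exact map_zero (Finsupp.mapRange.addMonoidHom (app θ n).toAddMonoidHom)
  · exact Finsupp.mapRange_single (hf := map_zero _)
  · exact map_zero (DirectSum.map fun t : HigherIdx n => (app θ t.1.1).toAddMonoidHom)
  · exact map_zero (DirectSum.map fun t : HigherIdx n => (app θ t.1.1).toAddMonoidHom)

theorem map_ty3 {i : ℕ} (r l : ℕ) (h : i + r = n) (c : E.carrier i) :
    map θ n (ty3 r l h c) = ty3 r l h (app θ i c) := by
  rw [ty3, ty3]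
  split_ifs with hrl
  · refine Prod.ext ?_ (Prod.ext ?_ (Prod.ext ?_ ?_))
    · exact map_zero (Finsupp.mapRange.addMonoidHom (app θ n).toAddMonoidHom)
    · exact map_zero (Finsupp.mapRange.addMonoidHom (app θ n).toAddMonoidHom)
    · exact DirectSum.map_of _ _ _
    · exact map_zero (DirectSum.map fun t : HigherIdx n => (app θ t.1.1).toAddMonoidHom)
  · exact map_zero _

theorem map_ty4 {i : ℕ} (r l : ℕ) (h : i + r = n) (c : E.carrier i) :
    map θ n (ty4 r l h c) = ty4 r l h (app θ i c) := by
  rw [ty4, ty4]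
  split_ifs with hrl
  · refine Prod.ext ?_ (Prod.ext ?_ (Prod.ext ?_ ?_))
    · exact map_zero (Finsupp.mapRange.addMonoidHom (app θ n).toAddMonoidHom)
    · exact map_zero (Finsupp.mapRange.addMonoidHom (app θ n).toAddMonoidHom)
    · exact map_zero (DirectSum.map fun t : HigherIdx n => (app θ t.1.1).toAddMonoidHom)
    · exact DirectSum.map_of _ _ _
  · exact map_zero _

end FormalSum

variable {A : Type u} [CommRing A] [Algebra ZLocTwo A] {E E' : WittComplex.{u, v} A} {n : ℕ}

theorem Vpow_x1 {i : ℕ} (r l : ℕ) (h : i + r = n) (hr : 0 < r) (hl : Odd l) (c : E.carrier i) :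
    E.poly.Vpow r h (x1 (polyEquiv E) l c) = x3 (polyEquiv E) r l h c := by
  rw [x3_eq r l h hr hl]
  induction r generalizing n with
  | zero => exact absurd hr (lt_irrefl 0)
  | succ r ih =>
    obtain ⟨m, rfl⟩ : ∃ m, n = m + 1 := ⟨i + r, h.symm⟩
    have h' : i + r = m := Nat.succ_injective h
    rw [E.poly.Vpow_succ h']
    rcases r with _ | r
    · subst h'
      exact PolyLevel.V_z1_odd l hl c
    · rw [ih h' (Nat.succ_pos r)]
      exact PolyLevel.V_z3 (r + 1) l h' (Nat.succ_pos r) hl c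

theorem polyEquiv_ind {P : FormalSum E n → Prop} (h1 : ∀ j a, P (FormalSum.ty1 j a))
    (h2 : ∀ k b, 0 < k → P (FormalSum.ty2 k b))
    (h3 : ∀ i r l (h : i + r = n) (c : E.carrier i), 0 < r → Odd l → P (FormalSum.ty3 r l h c))
    (h4 : ∀ i s m (h : i + s = n) (e : E.carrier i), 0 < s → Odd m → P (FormalSum.ty4 s m h e))
    (hadd : ∀ x y, P x → P y → P (x + y)) (x : FormalSum E n) : P x := by
  rw [← (polyEquiv E n).symm_apply_apply x]
  refine PolyLevel.ind (P := fun y => P ((polyEquiv E n).symm y)) ?_ ?_ ?_ ?_ ?_ (polyEquiv E n x)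
  · intro j a; exact h1 j a
  · intro k a; exact h2 (k + 1) a (Nat.succ_pos k)
  · intro i r l h hr hl c
    have := h3 i r l h c hr hl
    rwa [← (polyEquiv E n).symm_apply_apply (FormalSum.ty3 r l h c),
      show polyEquiv E n (FormalSum.ty3 r l h c) = _ from x3_eq r l h hr hl c] at this
  · intro i r l h hr hl c
    have := h4 i r l h c hr hl
    rwa [← (polyEquiv E n).symm_apply_apply (FormalSum.ty4 r l h c),
      show polyEquiv E n (FormalSum.ty4 r l h c) = _ from x4_eq r l h hr hl c] at this
  · intro x y hx hy
    exact (map_add (polyEquiv E n).symm x y).symm ▸ hadd _ _ hx hy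

/-- On morphisms `P` is given by the adjunction, as the lift of `θ` followed by the unit. Such a
lift replaces each coefficient `a` by `θ(a)[X]^0` and keeps `[X]`, `V` and `d`. -/
theorem app_polyFunctor_map (θ : E ⟶ E') (x : FormalSum E n) :
    app ((polyFunctor A).map θ) n (polyEquiv E n x) =
      polyEquiv E' n (FormalSum.map θ n x) := by
  rw [polyFunctor_map]
  change levelLift _ n (polyEquiv E n x) = _
  have hc : ∀ m (a : E.carrier m), coef (θ ≫ polyUnit E') m a = x1 (polyEquiv E') 0 (app θ m a) :=
    fun _ _ => rfl
  induction x using polyEquiv_ind with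
  | hadd x y hx hy =>
    rw [map_add, map_add, map_add]
    exact (map_add (levelLift (θ ≫ polyUnit E') n) _ _).trans (congrArg₂ _ hx hy)
  | h1 j a =>
    rw [FormalSum.map_ty1]
    exact (PolyLevel.levelLift_z1 _ j a).trans (x1_eq_mul j _).symm
  | h2 k b hk =>
    obtain ⟨k, rfl⟩ : ∃ j, k = j + 1 := ⟨k - 1, by omega⟩
    rw [FormalSum.map_ty2]
    exact (PolyLevel.levelLift_z2 _ k b).trans (x2_eq_mul k _).symm
  | h3 i r l h c hr hl =>
    rw [FormalSum.map_ty3, show polyEquiv E n (FormalSum.ty3 r l h c) = _ from x3_eq r l h hr hl c]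
    refine (PolyLevel.levelLift_z3 _ r l h hr hl c).trans ?_
    rw [hc, ← x1_eq_mul]
    exact Vpow_x1 r l h hr hl _
  | h4 i r l h c hr hl =>
    rw [FormalSum.map_ty4, show polyEquiv E n (FormalSum.ty4 r l h c) = _ from x4_eq r l h hr hl c]
    refine (PolyLevel.levelLift_z4 _ r l h hr hl c).trans ?_
    rw [hc, ← x1_eq_mul, Vpow_x1 r l h hr hl, x3_eq r l h hr hl]
    exact (PolyLevel.d_z3 r l h hr hl _).trans (x4_eq r l h hr hl _).symm

end WittComplex

/-! ### Fractions with odd denominator, and `V^r` of elements of type 1 and 2. -/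

namespace WittComplex

theorem map_natCast_mul {R S : Type*} [Ring R] [Ring S] (f : R →+ S) (k : ℕ) (x : R) :
    f ((k : R) * x) = (k : S) * f x := by
  rw [← nsmul_eq_mul, ← nsmul_eq_mul, map_nsmul]

section Frac

section

variable {A : Type u} [CommRing A] {E : WittComplex.{u, v} A} {n M : ℕ}

theorem frac_mul (a : ℕ) (x : E.carrier n) :
    E.frac a M * x = (a : E.carrier n) * (Ring.inverse (M : E.carrier n) * x) := by
  rw [PreWittComplex.frac, mul_assoc]

theorem inverse_mul_natCast_mul (a : ℕ) (x : E.carrier n) :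
    Ring.inverse (M : E.carrier n) * ((a : E.carrier n) * x) = E.frac a M * x := by
  rw [natCast_left_comm, frac_mul]

theorem frac_add_mul (a b : ℕ) (x : E.carrier n) :
    E.frac (a + b) M * x = E.frac a M * x + E.frac b M * x := by
  rw [frac_mul, frac_mul, frac_mul, Nat.cast_add, add_mul]

theorem frac_mul_mul (a b : ℕ) (x : E.carrier n) :
    E.frac (a * b) M * x = (a : E.carrier n) * (E.frac b M * x) := by
  rw [frac_mul, frac_mul, Nat.cast_mul, mul_assoc]

theorem two_pow_mul_eta_mul {s : ℕ} (hs : 0 < s) (x : E.carrier n) :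
    ((2 ^ s : ℕ) : E.carrier n) * (E.eta n * x) = 0 := by
  obtain ⟨s, rfl⟩ : ∃ j, s = j + 1 := ⟨s - 1, by omega⟩
  rw [pow_succ, Nat.cast_mul, mul_assoc, Nat.cast_ofNat, two_mul_eta_mul, mul_zero]

/-- Translates the explicit signs of the formulas into `tau`, in terms of which the products are
computed below. -/
theorem negOnePow_cases {q : ℤ} {x : E.carrier n} (hx : x ∈ E.deg n q) :
    (E.tau n x = x ∧ ∀ {G : Type v} [AddCommGroup G] (y : G), q.negOnePow • y = y) ∨
      (E.tau n x = -x ∧ ∀ {G : Type v} [AddCommGroup G] (y : G), q.negOnePow • y = -y) := by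
  rcases Int.even_or_odd q with h | h
  · exact .inl ⟨E.tau_even h hx, negOnePow_smul_even h⟩
  · exact .inr ⟨E.tau_odd h hx, negOnePow_smul_odd h⟩

/-- The Leibniz rule for `τ(x)V^r(y)`, solved for the term with `dV^r(y)`. -/
theorem mul_d_Vpow {i r : ℕ} (h : i + r = n) (x : E.carrier n) (y : E.carrier i) :
    x * E.d (E.Vpow r h y) = E.d (E.Vpow r h (E.Fpow r h (E.tau n x) * y)) -
      E.Vpow r h (E.Fpow r h (E.d (E.tau n x)) * y) := by
  rw [← E.mul_Vpow, ← E.mul_Vpow, E.leibniz, E.tau_tau, add_sub_cancel_left]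

end

variable {A : Type u} [CommRing A] [Algebra ZLocTwo A] {E : WittComplex.{u, v} A} {n M : ℕ}

theorem map_frac_mul {B : Type u} [CommRing B] [Algebra ZLocTwo B] {Q : WittComplex.{u, v} B} {m : ℕ}
    (f : E.carrier n →+ Q.carrier m) (hM : Odd M) (a : ℕ) (x : E.carrier n) :
    f (E.frac a M * x) = Q.frac a M * f x := by
  rw [frac_mul, frac_mul, map_natCast_mul,
    map_inverse_natCast_mul f M (E.isUnit_natCast hM) (Q.isUnit_natCast hM)]

theorem frac_self_mul (hM : Odd M) (x : E.carrier n) : E.frac M M * x = x := by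
  rw [frac_mul, mul_inverse_cancel_left hM]

theorem frac_left_comm (hM : Odd M) (a : ℕ) (x y : E.carrier n) :
    x * (E.frac a M * y) = E.frac a M * (x * y) := map_frac_mul (AddMonoidHom.mulLeft x) hM a y

/-- As `2η = 0`, odd integers and their inverses act trivially on multiples of `η`. -/
theorem frac_mul_eta_mul {m : ℕ} (hm : Odd m) (hM : Odd M) (x : E.carrier n) :
    E.frac m M * (E.eta n * x) = E.eta n * x := by
  rw [frac_mul, show Ring.inverse (M : E.carrier n) * (E.eta n * x) = E.eta n * x by
    conv_lhs => rw [← odd_mul_eta_mul hM, inverse_mul_cancel_left hM], odd_mul_eta_mul hm]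

theorem frac_eq_sub (hM : Odd M) {a b : ℕ} (h : M = a + b) (x : E.carrier n) :
    E.frac b M * x = x - E.frac a M * x := by
  rw [eq_sub_iff_add_eq', ← frac_add_mul, ← h, frac_self_mul hM]

end Frac

variable {A : Type u} [CommRing A] [Algebra ZLocTwo A] {E : WittComplex.{u, v} A} {n : ℕ}

/-- `a ↦ a[X]^j`. -/
noncomputable def X1 (j : ℕ) : E.carrier n →+ E.poly.carrier n := PolyLevel.z1 j

/-- `b ↦ b[X]^{k-1}d[X]`. -/
noncomputable def X2 (k : ℕ) : E.carrier n →+ E.poly.carrier n := PolyLevel.z2 (k - 1)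

theorem x1_eq_X1 (j : ℕ) (a : E.carrier n) : x1 (polyEquiv E) j a = X1 j a := rfl
theorem x2_eq_X2 (j : ℕ) (a : E.carrier n) : x2 (polyEquiv E) j a = X2 j a := rfl

theorem x3_eq_Vpow {i : ℕ} (r l : ℕ) (h : i + r = n) (hr : 0 < r) (hl : Odd l) (c : E.carrier i) :
    x3 (polyEquiv E) r l h c = E.poly.Vpow r h (X1 l c) := (Vpow_x1 r l h hr hl c).symm

theorem x4_eq_d_Vpow {i : ℕ} (r l : ℕ) (h : i + r = n) (hr : 0 < r) (hl : Odd l) (c : E.carrier i) :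
    x4 (polyEquiv E) r l h c = E.poly.d (E.poly.Vpow r h (X1 l c)) := by
  rw [← x3_eq_Vpow r l h hr hl, x4_eq r l h hr hl, x3_eq r l h hr hl]
  exact (PolyLevel.d_z3 r l h hr hl c).symm

theorem X1_mul_X1 (j k : ℕ) (a b : E.carrier n) :
    (X1 j a * X1 k b : E.poly.carrier n) = X1 (j + k) (a * b) := PolyLevel.z1_mul_z1 j k a b

theorem X1_mul_X2 (j k : ℕ) (hk : 0 < k) (a b : E.carrier n) :
    (X1 j a * X2 k b : E.poly.carrier n) = X2 (j + k) (a * b) :=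
  (PolyLevel.z1_mul_z2 j (k - 1) a b).trans (PolyLevel.z2_congr (by omega) _)

theorem X2_mul_X1 (j k : ℕ) (hk : 0 < k) (a b : E.carrier n) :
    (X2 k b * X1 j a : E.poly.carrier n) = X2 (k + j) (b * E.tau n a) := by
  change PolyLevel.j (IntPart.y2 (k - 1) b) * PolyLevel.j (IntPart.y1 j a) = _
  rw [← PolyLevel.j_mul, IntPart.y2_mul_y1]
  exact PolyLevel.z2_congr (by omega) _

theorem X2_mul_X2 (j k : ℕ) (hj : 0 < j) (hk : 0 < k) (a b : E.carrier n) :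
    (X2 j a * X2 k b : E.poly.carrier n) = X2 (j + k) (E.eta n * (a * b)) := by
  change PolyLevel.j (IntPart.y2 (j - 1) a) * PolyLevel.j (IntPart.y2 (k - 1) b) = _
  rw [← PolyLevel.j_mul, IntPart.y2_mul_y2]
  exact PolyLevel.z2_congr (by omega) _

theorem eta_poly (n : ℕ) : E.poly.eta n = X1 0 (E.eta n) := PolyLevel.eta_polyPre n

theorem eta_mul_X1 (j : ℕ) (a : E.carrier n) : E.poly.eta n * X1 j a = X1 j (E.eta n * a) := by
  rw [eta_poly, X1_mul_X1, zero_add]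

theorem eta_mul_X2 (k : ℕ) (a : E.carrier n) : E.poly.eta n * X2 k a = X2 k (E.eta n * a) := by
  rw [eta_poly]
  exact (PolyLevel.z1_mul_z2 0 (k - 1) _ a).trans (PolyLevel.z2_congr (by omega) _)

theorem d_X1 (j : ℕ) (a : E.carrier n) : E.poly.d (X1 j a) =
    X1 j (E.d a) + X2 j ((j : E.carrier n) * E.tau n a) := PolyLevel.d_z1 j a

theorem d_X2 (k : ℕ) (hk : 0 < k) (b : E.carrier n) : E.poly.d (X2 k b) =
    X2 k (E.d b + (k : E.carrier n) * (E.eta n * b)) := by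
  obtain ⟨k, rfl⟩ : ∃ j, k = j + 1 := ⟨k - 1, by omega⟩
  rw [map_add]
  exact PolyLevel.d_z2 k b

theorem tau_X1 (j : ℕ) (a : E.carrier n) : E.poly.tau n (X1 j a) = X1 j (E.tau n a) :=
  (E.map_tau (X1 j) (E.poly.tau n) (map_add _)
    (fun _ _ hx => E.poly.tau_of_mem (PolyLevel.z1_mem hx)) a).symm

theorem tau_X2 (k : ℕ) (a : E.carrier n) : E.poly.tau n (X2 k a) = - X2 k (E.tau n a) := by
  refine eq_neg_of_add_eq_zero_left ?_
  have h := E.map_tau (X2 k) (fun x => - E.poly.tau n x) (fun x y => by rw [map_add, neg_add])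
    (fun q x hx => by
      have h : X2 k x ∈ E.poly.deg n (q + 1) :=
        PolyLevel.z2_mem (by rwa [add_sub_cancel_right])
      rw [E.poly.tau_of_mem h, Int.negOnePow_succ, Units.neg_smul, neg_neg]) a
  rw [h, add_neg_cancel]

theorem Fpow_X1 {i : ℕ} (r j : ℕ) (h : i + r = n) (a : E.carrier n) :
    E.poly.Fpow r h (X1 j a) = X1 (2 ^ r * j) (E.Fpow r h a) := by
  induction r generalizing n j with
  | zero => subst h; rw [pow_zero, one_mul]; rfl
  | succ r ih =>
    obtain ⟨m, rfl⟩ : ∃ m, n = m + 1 := ⟨i + r, h.symm⟩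
    have h' : i + r = m := Nat.succ_injective h
    rw [E.poly.Fpow_succ h', E.Fpow_succ h', show E.poly.F (X1 j a) = X1 (2 * j) (E.F a) from
      PolyLevel.F_z1 j a, ih _ h', pow_succ, mul_assoc]

theorem Fpow_X2 {i : ℕ} (r k : ℕ) (hk : 0 < k) (h : i + r = n) (a : E.carrier n) :
    E.poly.Fpow r h (X2 k a) = X2 (2 ^ r * k) (E.Fpow r h a) := by
  induction r generalizing n k with
  | zero => subst h; rw [pow_zero, one_mul]; rfl
  | succ r ih =>
    obtain ⟨m, rfl⟩ : ∃ m, n = m + 1 := ⟨i + r, h.symm⟩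
    have h' : i + r = m := Nat.succ_injective h
    rw [E.poly.Fpow_succ h', E.Fpow_succ h', show E.poly.F (X2 k a) = X2 (2 * k) (E.F a) from
      (PolyLevel.F_z2 (k - 1) a).trans (PolyLevel.z2_congr (by omega) _), ih _ (by omega) h',
      pow_succ, mul_assoc]

theorem Vpow_X1_of_dvd {i : ℕ} (r N : ℕ) (h : i + r = n) (c : E.carrier i) :
    E.poly.Vpow r h (X1 (2 ^ r * N) c) = X1 N (E.Vpow r h c) := by
  induction r generalizing n N with
  | zero => subst h; rw [pow_zero, one_mul]; rfl
  | succ r ih =>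
    obtain ⟨m, rfl⟩ : ∃ m, n = m + 1 := ⟨i + r, h.symm⟩
    have h' : i + r = m := Nat.succ_injective h
    rw [E.poly.Vpow_succ h', E.Vpow_succ h', pow_succ, mul_assoc, ih _ h']
    exact PolyLevel.V_z1_even N _

theorem Vpow_X2_of_dvd {i : ℕ} (r N : ℕ) (hN : 0 < N) (h : i + r = n) (c : E.carrier i) :
    E.poly.Vpow r h (X2 (2 ^ r * N) c) = X2 N (E.Vpow r h c) := by
  induction r generalizing n N with
  | zero => subst h; rw [pow_zero, one_mul]; rfl
  | succ r ih =>
    obtain ⟨m, rfl⟩ : ∃ m, n = m + 1 := ⟨i + r, h.symm⟩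
    have h' : i + r = m := Nat.succ_injective h
    rw [E.poly.Vpow_succ h', E.Vpow_succ h', pow_succ, mul_assoc, ih _ (by omega) h']
    exact (congrArg _ (PolyLevel.z2_congr (by omega) _)).trans (PolyLevel.V_z2_odd (N - 1) _)

/-- Solve the Leibniz rule for `d(g[X]^M)`, where `g = τ(b)/M`, for the term of type 2, and apply
`V^r d = 2^r dV^r`. -/
theorem Vpow_X2 {i : ℕ} (r M : ℕ) (hM : Odd M) (h : i + r = n) (b : E.carrier i) :
    E.poly.Vpow r h (X2 M b) =
      E.poly.d (E.poly.Vpow r h (X1 M (((2 ^ r : ℕ) : E.carrier i) *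
        (Ring.inverse (M : E.carrier i) * E.tau i b)))) -
      E.poly.Vpow r h (X1 M (E.d (Ring.inverse (M : E.carrier i) * E.tau i b))) := by
  have h1 := d_X1 M (Ring.inverse (M : E.carrier i) * E.tau i b)
  have h2 : E.tau i (Ring.inverse (M : E.carrier i) * E.tau i b) = Ring.inverse (M : E.carrier i) * b :=
    (map_inverse_mul (E.tau i).toAddMonoidHom hM _).trans (congrArg _ (E.tau_tau b))
  rw [h2, mul_inverse_cancel_left hM] at h1
  rw [eq_sub_of_add_eq' h1.symm, map_sub, E.poly.Vpow_d h, map_natCast_mul, map_natCast_mul,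
    map_natCast_mul, Nat.cast_pow, Nat.cast_ofNat]

/-- The part of the product formulas that comes from the elements of type 2. -/
theorem Vpow_X2_mul {i : ℕ} (r M N : ℕ) (hM : Odd M) (h : i + r = n) (b : E.carrier i) :
    E.poly.Vpow r h (X2 M ((N : E.carrier i) * E.tau i b)) =
      E.poly.d (E.poly.Vpow r h (X1 M (E.frac (2 ^ r * N) M * b))) -
      E.poly.Vpow r h (X1 M (E.frac N M * E.d b)) := by
  rw [Vpow_X2 r M hM, map_mul (E.tau i), map_natCast, E.tau_tau, inverse_mul_natCast_mul, ← frac_mul_mul,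
    map_frac_mul E.d hM]

theorem Fpow_d_X1 {i : ℕ} (r j : ℕ) (h : i + r = n) (a : E.carrier n) :
    E.poly.Fpow r h (E.poly.d (X1 j a)) = X1 (2 ^ r * j) (E.Fpow r h (E.d a)) +
      X2 (2 ^ r * j) ((j : E.carrier i) * E.tau i (E.Fpow r h a)) := by
  rw [d_X1, map_add, Fpow_X1, E.tau_Fpow]
  rcases Nat.eq_zero_or_pos j with rfl | hj
  · simp
  · rw [Fpow_X2 r j hj, map_mul, map_natCast]

/-- The sum in the first factor has the shape of `F^r d` of an element `a[X]^j`. The hypothesis `hk`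
covers `k = 0`, where truncated subtraction makes `X2 0` a meaningless value that must have
coefficient zero. -/
theorem Vpow_add_mul_X1 {i : ℕ} (r k m M N : ℕ) (hM : Odd M) (hkm : k + m = M)
    (hk : k = 0 → N = 0) (h : i + r = n) (a b e : E.carrier i) :
    E.poly.Vpow r h ((X1 k a + X2 k ((N : E.carrier i) * E.tau i b)) * X1 m e) =
      E.poly.Vpow r h (X1 M (a * e - E.frac N M * E.d (b * e))) +
      E.poly.d (E.poly.Vpow r h (X1 M (E.frac (2 ^ r * N) M * (b * e)))) := by
  have h2 : (X2 k ((N : E.carrier i) * E.tau i b) * X1 m e : E.poly.carrier i) =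
      X2 M ((N : E.carrier i) * E.tau i (b * e)) := by
    rcases Nat.eq_zero_or_pos k with rfl | hk'
    · rw [hk rfl, Nat.cast_zero, zero_mul, zero_mul, map_zero, map_zero, zero_mul]
    · rw [X2_mul_X1 m k hk', hkm, map_mul (E.tau i), mul_assoc]
  rw [add_mul, map_add, X1_mul_X1, h2, Vpow_X2_mul r M N hM, hkm, map_sub, map_sub]
  abel

theorem Vpow_X1_mul_add {i : ℕ} (r k l M N : ℕ) (hM : Odd M) (hkl : k + l = M) (hk : 0 < k)
    (h : i + r = n) (a b c : E.carrier i) :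
    E.poly.Vpow r h (X1 l c * (X1 k a + X2 k ((N : E.carrier i) * E.tau i b))) =
      E.poly.Vpow r h (X1 M (c * a - E.frac N M * E.d (E.tau i c * b))) +
      E.poly.d (E.poly.Vpow r h (X1 M (E.frac (2 ^ r * N) M * (E.tau i c * b)))) := by
  have h2 : (X1 l c * X2 k ((N : E.carrier i) * E.tau i b) : E.poly.carrier i) =
      X2 M ((N : E.carrier i) * E.tau i (E.tau i c * b)) := by
    rw [X1_mul_X2 l k hk, Nat.add_comm l, hkl, map_mul (E.tau i), E.tau_tau, natCast_left_comm]
  rw [mul_add, map_add, X1_mul_X1, h2, Vpow_X2_mul r M N hM, Nat.add_comm l, hkl, map_sub, map_sub]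
  abel

end WittComplex

/-! ### Products of two generators in `P(E)`, for arbitrary coefficients. -/

namespace WittComplex

theorem odd_two_pow_mul_add {r : ℕ} (hr : 0 < r) (j : ℕ) {l : ℕ} (hl : Odd l) :
    Odd (2 ^ r * j + l) :=
  (((Nat.even_pow.2 ⟨even_two, hr.ne'⟩).mul_right j)).add_odd hl

section

variable {A : Type u} [CommRing A] {E : WittComplex.{u, v} A} {n : ℕ}

theorem d_Fpow_mul {i : ℕ} (r : ℕ) (h : i + r = n) (x : E.carrier n) (y : E.carrier i) :
    E.d (E.Fpow r h x * y) =
      ((2 ^ r : ℕ) : E.carrier i) * (E.Fpow r h (E.d x) * y) + E.Fpow r h (E.tau n x) * E.d y := by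
  rw [E.leibniz, E.d_Fpow, E.tau_Fpow, mul_assoc, Nat.cast_pow, Nat.cast_ofNat]

theorem Fpow_eta_mul {i : ℕ} (r : ℕ) (h : i + r = n) (x : E.carrier n) :
    E.Fpow r h (E.eta n * x) = E.eta i * E.Fpow r h x := by
  rw [map_mul, Fpow_eta]

theorem frac_two_pow_mul {M : ℕ} (r : ℕ) (x : E.carrier n) :
    E.frac (2 ^ r) M * x = ((2 ^ r : ℕ) : E.carrier n) * (E.frac 1 M * x) := by
  rw [← frac_mul_mul, mul_one]

theorem Vpow_mul_Vpow {i i' : ℕ} (r t : ℕ) (h : i + (r + t) = n) (h' : i' + r = n) (ht : i + t = i')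
    (x : E.carrier i) (y : E.carrier i') :
    E.Vpow (r + t) h x * E.Vpow r h' y = 2 ^ r * E.Vpow (r + t) h (x * E.Fpow t ht y) := by
  rw [← E.Vpow_Vpow ht h', E.Vpow_mul, E.Fpow_Vpow, ← E.Vpow_Vpow ht h', ← E.Vpow_mul ht,
    ← Nat.cast_ofNat (R := E.carrier i'), ← Nat.cast_pow, natCast_left_comm, map_natCast_mul,
    Nat.cast_pow, Nat.cast_ofNat]

theorem Vpow_mul_Vpow_self {i : ℕ} (r : ℕ) (h : i + r = n) (x y : E.carrier i) :
    E.Vpow r h x * E.Vpow r h y = 2 ^ r * E.Vpow r h (x * y) := by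
  rw [E.Vpow_mul, E.Fpow_Vpow, ← Nat.cast_ofNat (R := E.carrier i), ← Nat.cast_pow,
    natCast_left_comm, map_natCast_mul, Nat.cast_pow, Nat.cast_ofNat]

end

variable {A : Type u} [CommRing A] [Algebra ZLocTwo A] {E : WittComplex.{u, v} A} {n : ℕ}

theorem eta_mul_Vpow_X1 {i : ℕ} (r M : ℕ) (h : i + r = n) (c : E.carrier i) :
    E.poly.eta n * E.poly.Vpow r h (X1 M c) = E.poly.Vpow r h (X1 M (E.eta i * c)) := by
  rw [← eta_mul_X1, E.poly.Vpow_eta_mul]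

theorem d_Vpow_X1_two_pow_mul {i : ℕ} (r M k : ℕ) (h : i + r = n) (c : E.carrier i) :
    E.poly.d (E.poly.Vpow r h (X1 M ((k : E.carrier i) * c))) =
      (k : E.poly.carrier n) * E.poly.d (E.poly.Vpow r h (X1 M c)) := by
  rw [map_natCast_mul, map_natCast_mul, map_natCast_mul]

/-- `mul_d_Vpow` moves the first factor under `V^s`. The type 2 part of `d(a[X]^j)` contributes
`-2^s j/M` to the coefficient of `dV^s`, and `1 - 2^s j/M = m/M`. -/
theorem X1_mul_d_Vpow_X1 {i : ℕ} (j s m : ℕ) (h : i + s = n) (hs : 0 < s) (hm : Odd m)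
    (a : E.carrier n) (e : E.carrier i) :
    X1 j a * E.poly.d (E.poly.Vpow s h (X1 m e)) =
      E.poly.d (E.poly.Vpow s h (X1 (2 ^ s * j + m)
        (E.frac m (2 ^ s * j + m) * (E.Fpow s h (E.tau n a) * e)))) -
      E.poly.Vpow s h (X1 (2 ^ s * j + m) (E.Fpow s h (E.d (E.tau n a)) * e -
        E.frac j (2 ^ s * j + m) * E.d (E.Fpow s h (E.tau n a) * e))) := by
  have hM := odd_two_pow_mul_add hs j hm
  rw [mul_d_Vpow, tau_X1, Fpow_X1, X1_mul_X1, Fpow_d_X1,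
    Vpow_add_mul_X1 s _ m _ j hM rfl (by rintro h; simpa using h), frac_eq_sub hM rfl]
  simp only [map_sub]
  abel

theorem X2_mul_Vpow_X1 {i : ℕ} (k r l : ℕ) (h : i + r = n) (hk : 0 < k) (hr : 0 < r) (hl : Odd l)
    (b : E.carrier n) (c : E.carrier i) :
    X2 k b * E.poly.Vpow r h (X1 l c) =
      E.poly.d (E.poly.Vpow r h (X1 (2 ^ r * k + l)
        (E.frac (2 ^ r) (2 ^ r * k + l) * (E.Fpow r h (E.tau n b) * c)))) -
      E.poly.Vpow r h (X1 (2 ^ r * k + l)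
        (E.frac 1 (2 ^ r * k + l) * E.d (E.Fpow r h (E.tau n b) * c))) := by
  have hM := odd_two_pow_mul_add hr k hl
  have h1 := Vpow_X2_mul r _ 1 hM h (E.Fpow r h (E.tau n b) * c)
  rw [Nat.cast_one, one_mul, mul_one, map_mul, E.tau_Fpow, E.tau_tau] at h1
  rw [E.poly.mul_Vpow, Fpow_X2 r k hk, X2_mul_X1 _ _ (by positivity), h1]

/-- The Leibniz rule for the product with `V^s(e[X]^m)` leaves two products of that kind, which
`X2_mul_Vpow_X1` evaluates. Terms with `2^s η` vanish. -/
theorem X2_mul_d_Vpow_X1 {i : ℕ} (k s m : ℕ) (h : i + s = n) (hk : 0 < k) (hs : 0 < s) (hm : Odd m)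
    (b : E.carrier n) (e : E.carrier i) :
    X2 k b * E.poly.d (E.poly.Vpow s h (X1 m e)) =
      E.poly.d (E.poly.Vpow s h (X1 (2 ^ s * k + m)
        (E.frac 1 (2 ^ s * k + m) * (E.Fpow s h (E.tau n b) * E.d e)))) -
      E.poly.Vpow s h (X1 (2 ^ s * k + m) (E.frac 1 (2 ^ s * k + m) *
        (E.Fpow s h (E.d (E.tau n b) + (k : E.carrier n) * (E.eta n * E.tau n b)) * E.d e))) := by
  have hM := odd_two_pow_mul_add hs k hm
  have h1 := E.poly.leibniz (X2 k (E.tau n b)) (E.poly.Vpow s h (X1 m e))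
  rw [tau_X2, E.tau_tau, neg_mul, ← sub_eq_add_neg, eq_sub_iff_add_eq', ← eq_sub_iff_add_eq,
    d_X2 k hk, X2_mul_Vpow_X1 k s m h hk hs hm, X2_mul_Vpow_X1 k s m h hk hs hm, E.tau_tau] at h1
  rw [h1]
  set β := E.d (E.tau n b) + (k : E.carrier n) * (E.eta n * E.tau n b) with hβ
  have hτ : E.tau n β = -E.d b + E.eta n * ((k : E.carrier n) * b) := by
    rw [hβ, map_add, map_mul, map_natCast, map_mul, tau_d, E.tau_tau, natCast_left_comm,
      E.tau_odd odd_one E.eta_mem, neg_eta]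
  have hd : E.d (E.tau n β) = E.eta n * (-E.d b + E.d ((k : E.carrier n) * b)) := by
    rw [hτ, map_add, map_neg, d_d', d_eta_mul, mul_add, mul_neg]
  have e1 : E.d (E.Fpow s h (E.tau n β) * e) = E.Fpow s h β * E.d e := by
    rw [d_Fpow_mul, hd, Fpow_eta_mul, mul_assoc, two_pow_mul_eta_mul hs, zero_add, E.tau_tau]
  have e2 : E.frac (2 ^ s) (2 ^ s * k + m) * (E.Fpow s h (E.tau n β) * e) =
      - (E.frac (2 ^ s) (2 ^ s * k + m) * (E.Fpow s h (E.d b) * e)) := by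
    rw [hτ, map_add, map_neg, Fpow_eta_mul, add_mul, neg_mul, mul_assoc, mul_add, mul_neg,
      frac_two_pow_mul s (E.eta i * _), ← frac_left_comm hM _ (E.eta i), two_pow_mul_eta_mul hs, add_zero]
  have e3 : E.poly.d (E.poly.d (E.poly.Vpow s h (X1 (2 ^ s * k + m)
      (E.frac (2 ^ s) (2 ^ s * k + m) * (E.Fpow s h b * e))))) = 0 := by
    rw [frac_two_pow_mul, d_Vpow_X1_two_pow_mul, map_natCast_mul, E.poly.d_d', two_pow_mul_eta_mul hs]
  rw [e1, e2, map_sub E.poly.d, e3, d_Fpow_mul, frac_two_pow_mul]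
  simp only [mul_add, map_add, map_neg, map_sub, natCast_left_comm]
  abel

/-- As `F^r dV^r = d + ι`, the product is `V^r` of `c[X]^l (d + ι)V^t(e[X]^m)`, which reduces to a
product of type 1 by type 4 and an `η`-term. -/
theorem Vpow_X1_mul_d_Vpow_X1_of_lt {i i' : ℕ} (r t l m : ℕ) (h : i + r = n)
    (h' : i' + (r + t) = n) (ht : i' + t = i) (hr : 0 < r) (ht0 : 0 < t) (hm : Odd m)
    (c : E.carrier i) (e : E.carrier i') :
    E.poly.Vpow r h (X1 l c) * E.poly.d (E.poly.Vpow (r + t) h' (X1 m e)) =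
      E.poly.d (E.poly.Vpow (r + t) h' (X1 (2 ^ t * l + m)
        (E.frac (2 ^ r * m) (2 ^ t * l + m) * (E.Fpow t ht (E.tau i c) * e)))) -
      E.poly.Vpow (r + t) h' (X1 (2 ^ t * l + m) (E.Fpow t ht (E.d (E.tau i c)) * e -
        E.frac l (2 ^ t * l + m) * E.d (E.Fpow t ht (E.tau i c) * e))) +
      E.poly.Vpow (r + t) h' (X1 (2 ^ t * l + m) (E.eta i' * (E.Fpow t ht c * e))) := by
  have hM := odd_two_pow_mul_add ht0 l hm
  have h3 : E.poly.Vpow r h (X1 l c * (E.poly.eta i * E.poly.Vpow t ht (X1 m e))) =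
      E.poly.Vpow (r + t) h' (X1 (2 ^ t * l + m) (E.eta i' * (E.Fpow t ht c * e))) := by
    rw [eta_left_comm, E.poly.mul_Vpow, Fpow_X1, X1_mul_X1, eta_mul_Vpow_X1, E.poly.Vpow_Vpow ht h]
  rw [← h3, ← E.poly.Vpow_Vpow ht h, ← E.poly.Vpow_Vpow ht h, ← E.poly.Vpow_Vpow ht h,
    E.poly.Vpow_mul h, E.poly.Fpow_d_Vpow h hr, mul_add, map_add (E.poly.Vpow r h),
    X1_mul_d_Vpow_X1 l t m ht ht0 hm, map_sub (E.poly.Vpow r h), E.poly.Vpow_d, frac_mul_mul,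
    map_natCast_mul (X1 _), map_natCast_mul (E.poly.Vpow _ _), map_natCast_mul (E.poly.Vpow _ _),
    map_natCast_mul E.poly.d, Nat.cast_pow, Nat.cast_ofNat]

/-- The common starting point for equal powers of `V`: only the 2-adic valuation of `l + m` decides
how the outer `V^r` is evaluated. -/
theorem Vpow_X1_mul_d_Vpow_X1_self {i : ℕ} (r l m : ℕ) (h : i + r = n) (hr : 0 < r) (hm : 0 < m)
    (c e : E.carrier i) :
    E.poly.Vpow r h (X1 l c) * E.poly.d (E.poly.Vpow r h (X1 m e)) =
      E.poly.Vpow r h (X1 (l + m) (c * (E.d e + E.eta i * e)) +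
        X2 (l + m) ((m : E.carrier i) * (c * E.tau i e))) := by
  rw [E.poly.Vpow_mul h, E.poly.Fpow_d_Vpow h hr, d_X1, eta_mul_X1, mul_add, mul_add, X1_mul_X1,
    X1_mul_X1, X1_mul_X2 _ _ hm, natCast_left_comm, mul_add c, map_add (X1 _), add_right_comm]

/-- Write the outer operator as `V^w V^v`. The inner `V^v` passes to the coefficients because `2^v`
divides the exponent; the exponent that remains is odd, so `Vpow_X2_mul` applies to `V^w`. -/
theorem Vpow_X1_mul_d_Vpow_X1_of_even {i : ℕ} (v w l m N : ℕ) (h : i + (v + w) = n)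
    (h' : i + v + w = n) (hw : 0 < w)
    (hm : 0 < m) (hN : Odd N) (hlm : l + m = 2 ^ v * N) (c e : E.carrier i) :
    E.poly.Vpow (v + w) h (X1 l c) * E.poly.d (E.poly.Vpow (v + w) h (X1 m e)) =
      E.poly.Vpow w h' (X1 N (E.Vpow v (rfl : i + v = i + v) (c * (E.d e + E.eta i * e)))) +
      E.poly.d (E.poly.Vpow w h' (X1 N (E.frac (2 ^ w * m) N *
        E.Vpow v (rfl : i + v = i + v) (E.tau i c * e)))) -
      E.poly.Vpow w h' (X1 N (E.frac m N *
        E.d (E.Vpow v (rfl : i + v = i + v) (E.tau i c * e)))) := by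
  have hv : ∀ x : E.poly.carrier i, E.poly.Vpow (v + w) h x =
      E.poly.Vpow w h' (E.poly.Vpow v (rfl : i + v = i + v) x) := fun x => by
    rw [E.poly.Vpow_Vpow rfl h']; exact E.poly.Vpow_congr _ (Nat.add_comm v w) x
  have h2 := Vpow_X2_mul w N m hN h' (E.Vpow v (rfl : i + v = i + v) (E.tau i c * e))
  rw [E.tau_Vpow, map_mul (E.tau i), E.tau_tau] at h2
  rw [Vpow_X1_mul_d_Vpow_X1_self (v + w) l m h (by omega) hm, hv, hlm, map_add (E.poly.Vpow v _),
    Vpow_X1_of_dvd, Vpow_X2_of_dvd v N hN.pos, map_natCast_mul, map_add (E.poly.Vpow w _), h2,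
    add_sub_assoc]

theorem Vpow_X1_mul_d_Vpow_X1_of_dvd {i : ℕ} (r l m N : ℕ) (h : i + r = n) (hr : 0 < r)
    (hm : 0 < m) (hlm : l + m = 2 ^ r * N) (c e : E.carrier i) :
    E.poly.Vpow r h (X1 l c) * E.poly.d (E.poly.Vpow r h (X1 m e)) =
      X1 N (E.Vpow r h (c * (E.d e + E.eta i * e))) +
        X2 N ((m : E.carrier n) * E.Vpow r h (c * E.tau i e)) := by
  have hN : 0 < N := Nat.pos_of_ne_zero fun h0 => by rw [h0, mul_zero] at hlm; omega
  rw [Vpow_X1_mul_d_Vpow_X1_self r l m h hr hm, hlm, map_add (E.poly.Vpow r _),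
    Vpow_X1_of_dvd, Vpow_X2_of_dvd r N hN, map_natCast_mul]

/-- Two projection formulas turn the product into `V^(s+t)` of `c[X]^l` times `F^t(d + ι)(e[X]^m)`.
-/
theorem Vpow_X1_mul_d_Vpow_X1_of_gt {i i' : ℕ} (s t l m : ℕ) (h : i + (s + t) = n)
    (h' : i' + s = n) (ht : i + t = i') (hs : 0 < s) (ht0 : 0 < t) (hl : Odd l) (hm : 0 < m)
    (c : E.carrier i) (e : E.carrier i') :
    E.poly.Vpow (s + t) h (X1 l c) * E.poly.d (E.poly.Vpow s h' (X1 m e)) =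
      E.poly.Vpow (s + t) h (X1 (2 ^ t * m + l) (c * E.Fpow t ht (E.d e + E.eta i' * e))) +
      E.poly.d (E.poly.Vpow (s + t) h (X1 (2 ^ t * m + l)
        (E.frac (2 ^ (s + t) * m) (2 ^ t * m + l) * (E.tau i c * E.Fpow t ht e)))) -
      E.poly.Vpow (s + t) h (X1 (2 ^ t * m + l)
        (E.frac m (2 ^ t * m + l) * E.d (E.tau i c * E.Fpow t ht e))) := by
  have hM := odd_two_pow_mul_add ht0 m hl
  rw [← E.poly.Vpow_Vpow ht h', E.poly.Vpow_mul h', E.poly.Fpow_d_Vpow h' hs, E.poly.Vpow_mul ht,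
    E.poly.Vpow_Vpow ht h', map_add (E.poly.Fpow t ht), Fpow_d_X1, Fpow_eta_mul, Fpow_X1, eta_mul_X1,
    mul_add, map_add (E.poly.Vpow _ _),
    Vpow_X1_mul_add (s + t) (2 ^ t * m) l _ m hM rfl (by positivity), X1_mul_X1, map_add (E.Fpow t ht),
    Fpow_eta_mul, Nat.add_comm l]
  simp only [mul_add, map_add, map_sub]
  abel

end WittComplex

/-! ### The product formulas with explicit signs. -/

namespace WittComplex

/-- Reduces products of two elements `dV` to the products of `V` by `dV` already computed: in the
Leibniz rule `ddy = ηdy`, and the sign of the `η`-term is irrelevant. -/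
theorem d_mul_d {A : Type u} [CommRing A] {E : WittComplex.{u, v} A} {n : ℕ} (x y : E.carrier n) :
    E.d x * E.d y = E.d (x * E.d y) + E.eta n * (x * E.d y) := by
  rw [E.leibniz, d_d', ← mul_assoc (E.tau n x), ← eta_comm, eta_tau, mul_assoc, add_assoc,
    eta_mul_add_eta_mul, add_zero]

section

variable {A : Type u} [CommRing A] {E : WittComplex.{u, v} A} {n : ℕ}

/-- The operator `d + ι` annihilates exact elements because `2η = 0`. After `d_mul_d` this discards
the `dV` part of a product of `V` by `dV`. -/
theorem d_add_eta_mul (x y : E.carrier n) :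
    E.d (E.d x + y) + E.eta n * (E.d x + y) = E.d y + E.eta n * y := by
  rw [map_add, mul_add, d_d', add_add_add_comm, eta_mul_add_eta_mul, zero_add]

theorem eta_mul_d_tau (x : E.carrier n) : E.eta n * E.d (E.tau n x) = E.eta n * E.d x := by
  rw [← neg_neg (E.d (E.tau n x)), ← tau_d, mul_neg, neg_eta_mul, eta_tau]

theorem eta_mul_eta_mul (x : E.carrier n) : E.eta n * (E.eta n * x) = 0 := by
  rw [← mul_assoc, eta_mul_eta, zero_mul]

end

variable {A : Type u} [CommRing A] [Algebra ZLocTwo A] {E : WittComplex.{u, v} A} {n : ℕ}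

theorem productFormulas (E : WittComplex.{u, v} A) : ProductFormulas (polyEquiv E) where
  p11 j j' a a' := X1_mul_X1 j j' a a'
  p12 j k a b hk := X1_mul_X2 j k hk a b
  p13 j r l h a c hr hl := by
    rw [x3_eq_Vpow r l h hr hl, x3_eq_Vpow r _ h hr (odd_two_pow_mul_add hr j hl), x1_eq_X1,
      E.poly.mul_Vpow, Fpow_X1, X1_mul_X1]
  p14 j s m h p a e hs hm ha := by
    have hM := odd_two_pow_mul_add hs j hm
    rw [x1_eq_X1, x4_eq_d_Vpow s m h hs hm, x4_eq_d_Vpow s _ h hs hM, x3_eq_Vpow s _ h hs hM,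
      X1_mul_d_Vpow_X1 j s m h hs hm]
    rcases negOnePow_cases ha with ⟨ht, hn⟩ | ⟨ht, hn⟩
    · rw [ht, hn, hn]
    · simp only [ht, hn, map_neg, neg_mul, mul_neg, map_sub]
      abel
  p22 k k' b b' hk hk' := X2_mul_X2 k k' hk hk' b b'
  p23 k r l h p b c hk hr hl hb := by
    have hM := odd_two_pow_mul_add hr k hl
    rw [x2_eq_X2, x3_eq_Vpow r l h hr hl, x4_eq_d_Vpow r _ h hr hM, x3_eq_Vpow r _ h hr hM,
      X2_mul_Vpow_X1 k r l h hk hr hl, Units.neg_smul]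
    rcases negOnePow_cases hb with ⟨ht, hn⟩ | ⟨ht, hn⟩
    · rw [ht, hn, hn]; abel
    · simp only [ht, hn, map_neg, neg_mul, mul_neg]
      abel
  p24 k s m h p b e hk hs hm hb := by
    have hM := odd_two_pow_mul_add hs k hm
    rw [x2_eq_X2, x4_eq_d_Vpow s m h hs hm, x4_eq_d_Vpow s _ h hs hM, x3_eq_Vpow s _ h hs hM,
      X2_mul_d_Vpow_X1 k s m h hk hs hm, Units.neg_smul, PreWittComplex.iota]
    rcases negOnePow_cases hb with ⟨ht, hn⟩ | ⟨ht, hn⟩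
    · rw [ht, hn, hn]; abel
    · simp only [ht, hn, map_neg, neg_mul, mul_neg, map_add, add_mul, mul_add]
      abel
  p33_gt r' t l l' h h' c c' hr' ht hl hl' := by
    rw [x3_eq_Vpow _ _ h (by omega) hl, x3_eq_Vpow _ _ h' hr' hl',
      x3_eq_Vpow _ _ h (by omega) (odd_two_pow_mul_add ht l' hl), Vpow_mul_Vpow r' t h h' (by omega),
      Fpow_X1, X1_mul_X1, Nat.add_comm l]
  p33_lt v w l l' N h c c' hw hl hl' hN hll := by
    have h' : _ + v + w = _ := (Nat.add_assoc _ v w).trans h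
    rw [x3_eq_Vpow _ _ h (by omega) hl, x3_eq_Vpow _ _ h (by omega) hl',
      x3_eq_Vpow _ _ h' hw hN, Vpow_mul_Vpow_self, X1_mul_X1, hll, ← Vpow_X1_of_dvd v N rfl,
      E.poly.Vpow_Vpow rfl h', E.poly.Vpow_congr _ (Nat.add_comm w v)]
  p33_ge r l l' N h c c' hr hl hl' hll := by
    rw [x3_eq_Vpow _ _ h hr hl, x3_eq_Vpow _ _ h hr hl', Vpow_mul_Vpow_self, X1_mul_X1, hll,
      Vpow_X1_of_dvd, x1_eq_X1]
  p34_lt r t l m h h' p c e hr ht hl hm hc := by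
    have hM := odd_two_pow_mul_add ht l hm
    rw [x3_eq_Vpow _ _ h hr hl, x4_eq_d_Vpow _ m h' (by omega) hm, x4_eq_d_Vpow _ _ h' (by omega) hM,
      x3_eq_Vpow _ _ h' (by omega) hM,
      Vpow_X1_mul_d_Vpow_X1_of_lt r t l m h h' (by omega) hr ht hm, PreWittComplex.iota,
      map_add (E.Fpow _ _), Fpow_eta_mul]
    rcases negOnePow_cases hc with ⟨ht, hn⟩ | ⟨ht, hn⟩
    · rw [ht, hn, hn, ← neg_eta_mul]
      simp only [mul_assoc, add_mul, map_sub, map_add, map_neg]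
      abel
    · simp only [ht, hn, map_neg, neg_mul, mul_neg, mul_assoc, add_mul, map_sub, map_add]
      abel
  p34_eq_lt v w l m N h p c e hw hl hm hN hlm hc := by
    have h' : _ + v + w = _ := (Nat.add_assoc _ v w).trans h
    rw [x3_eq_Vpow _ _ h (by omega) hl, x4_eq_d_Vpow _ _ h (by omega) hm, x3_eq_Vpow _ _ h' hw hN,
      x4_eq_d_Vpow _ _ h' hw hN, x3_eq_Vpow _ _ h' hw hN,
      Vpow_X1_mul_d_Vpow_X1_of_even v w l m N h h' hw hm.pos hN hlm, PreWittComplex.iota]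
    rcases negOnePow_cases hc with ⟨ht, hn⟩ | ⟨ht, hn⟩
    · rw [ht, hn, hn]
    · simp only [ht, hn, map_neg, neg_mul, mul_neg]
  p34_eq_ge r l m N h q c e hr hl hm hlm he := by
    rw [x3_eq_Vpow _ _ h hr hl, x4_eq_d_Vpow _ _ h hr hm, x1_eq_X1, x2_eq_X2,
      Vpow_X1_mul_d_Vpow_X1_of_dvd r l m N h hr hm.pos hlm, PreWittComplex.iota]
    rcases negOnePow_cases he with ⟨ht, hn⟩ | ⟨ht, hn⟩
    · rw [ht, hn]
    · simp only [ht, hn, map_neg, neg_mul, mul_neg]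
  p34_gt s t l m h h' p c e hs ht hl hm hc := by
    have hM := odd_two_pow_mul_add ht m hl
    rw [x3_eq_Vpow _ _ h (by omega) hl, x4_eq_d_Vpow _ m h' hs hm, x4_eq_d_Vpow _ _ h (by omega) hM,
      x3_eq_Vpow _ _ h (by omega) hM, x3_eq_Vpow _ _ h (by omega) hM,
      Vpow_X1_mul_d_Vpow_X1_of_gt s t l m h h' (by omega) hs ht hl hm.pos, PreWittComplex.iota]
    rcases negOnePow_cases hc with ⟨ht, hn⟩ | ⟨ht, hn⟩
    · rw [ht, hn, hn]
    · simp only [ht, hn, map_neg, neg_mul, mul_neg]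
  p44_lt s t m m' h h' p e e' hs ht hm hm' he := by
    have hM := odd_two_pow_mul_add ht m hm'
    rw [x4_eq_d_Vpow _ _ h hs hm, x4_eq_d_Vpow _ m' h' (by omega) hm',
      x4_eq_d_Vpow _ _ h' (by omega) hM, x3_eq_Vpow _ _ h' (by omega) hM, d_mul_d,
      Vpow_X1_mul_d_Vpow_X1_of_lt s t m m' h h' (by omega) hs ht hm', PreWittComplex.iota]
    -- Multiplication by `η` erases the odd fraction and the sign, and kills the part of `dF^t`
    -- divisible by `2^t`.
    have hη : E.eta _ * (E.frac m (2 ^ t * m + m') * E.d (E.Fpow t (by omega) (E.tau _ e) * e')) =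
        E.eta _ * (E.Fpow t (by omega) e * E.d e') := by
      rw [frac_left_comm hM, frac_mul_eta_mul hm hM, d_Fpow_mul, E.tau_tau, mul_add,
        natCast_left_comm, two_pow_mul_eta_mul ht, zero_add]
    have hη' : E.eta _ * (E.Fpow t (by omega) (E.d (E.tau _ e)) * e') =
        E.eta _ * (E.Fpow t (by omega) (E.d e) * e') := by
      rw [← mul_assoc, ← Fpow_eta_mul, eta_mul_d_tau, Fpow_eta_mul, mul_assoc]
    rw [sub_add, sub_eq_add_neg, d_add_eta_mul, ← map_sub, ← map_sub, ← map_neg, ← map_neg,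
      eta_mul_Vpow_X1, mul_neg, neg_eta_mul, mul_sub _ _ (E.eta _ * _), eta_mul_eta_mul, sub_zero,
      mul_sub, hη, hη', sub_eq_add_neg (E.eta _ * _), neg_eta_mul, ← mul_add]
    congr 1
    rw [map_add (E.Fpow _ _), Fpow_eta_mul, Units.neg_smul, add_mul, mul_assoc (E.eta _)]
    rcases negOnePow_cases he with ⟨ht, hn⟩ | ⟨ht, hn⟩
    · rw [ht, hn, sub_eq_add_neg _ (E.eta _ * _), neg_eta_mul]
      simp only [map_neg, map_sub, map_add]
      abel
    · rw [ht, hn]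
      simp only [map_neg, map_sub, map_add, mul_neg, neg_mul]
      abel
  p44_eq_lt v w m m' N h p e e' hw hm hm' hN hmm he := by
    have h' : _ + v + w = _ := (Nat.add_assoc _ v w).trans h
    rw [x4_eq_d_Vpow _ _ h (by omega) hm, x4_eq_d_Vpow _ _ h (by omega) hm', x3_eq_Vpow _ _ h' hw hN,
      x4_eq_d_Vpow _ _ h' hw hN, d_mul_d,
      Vpow_X1_mul_d_Vpow_X1_of_even v w m m' N h h' hw hm'.pos hN hmm]
    simp only [PreWittComplex.iota]
    have hη : E.eta _ * (E.frac m' N * E.d (E.Vpow v (rfl : _ + v = _ + v) (E.tau _ e * e'))) =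
        E.eta _ * E.d (E.Vpow v (rfl : _ + v = _ + v) (e * e')) := by
      rw [frac_left_comm hN, frac_mul_eta_mul hm' hN, ← d_eta_mul, ← E.Vpow_eta_mul, ← mul_assoc,
        eta_tau, mul_assoc, E.Vpow_eta_mul, d_eta_mul]
    have hη' : E.eta _ * E.Vpow v (rfl : _ + v = _ + v) (e * (E.d e' + E.eta _ * e')) =
        E.eta _ * E.Vpow v (rfl : _ + v = _ + v) (e * E.d e') := by
      rw [← E.Vpow_eta_mul, ← E.Vpow_eta_mul, ← eta_left_comm, mul_add, eta_mul_eta_mul, add_zero,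
        eta_left_comm]
    rw [add_sub_right_comm, add_comm (_ - _), d_add_eta_mul, ← map_sub, ← map_sub, eta_mul_Vpow_X1,
      mul_sub, hη, hη', sub_eq_add_neg (E.eta _ * _), neg_eta_mul, ← mul_add, add_comm]
    congr 1
    rcases negOnePow_cases he with ⟨ht, hn⟩ | ⟨ht, hn⟩
    · rw [ht, hn]
    · simp only [ht, hn, map_neg, neg_mul, mul_neg]
  p44_eq_ge s m m' N h p q e e' hs hm hm' hmm he he' := by
    have hN : 0 < N := Nat.pos_of_ne_zero fun h0 => by
      rw [h0, mul_zero] at hmm; have := hm.pos; omega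
    rw [x4_eq_d_Vpow _ _ h hs hm, x4_eq_d_Vpow _ _ h hs hm', x1_eq_X1, x2_eq_X2, d_mul_d,
      Vpow_X1_mul_d_Vpow_X1_of_dvd s m m' N h hs hm'.pos hmm,
      map_add E.poly.d, d_X1, d_X2 N hN, mul_add (E.poly.eta _), eta_mul_X1, eta_mul_X2]
    simp only [PreWittComplex.iota]
    have hη' : E.eta _ * E.Vpow s h (e * (E.d e' + E.eta _ * e')) =
        E.eta _ * E.Vpow s h (e * E.d e') := by
      rw [← E.Vpow_eta_mul, ← E.Vpow_eta_mul, ← eta_left_comm, mul_add, eta_mul_eta_mul, add_zero,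
        eta_left_comm]
    have h0 : E.eta _ * E.Vpow s h (e * E.tau _ e') = E.eta _ * E.Vpow s h (e * e') := by
      rw [← E.Vpow_eta_mul, ← E.Vpow_eta_mul, ← eta_left_comm, eta_tau, eta_left_comm]
    have h1 : E.tau _ (E.Vpow s h (e * (E.d e' + E.eta _ * e'))) =
        - (p + q).negOnePow • E.Vpow s h (e * E.d e') + E.eta _ * E.Vpow s h (e * e') := by
      rw [mul_add, map_add, map_add, eta_left_comm, E.Vpow_eta_mul, map_mul (E.tau _), tau_eta, eta_tau,
        E.tau_of_mem (E.Vpow_mem h (E.mul_mem he (E.d_mem he'))), ← add_assoc, Int.negOnePow_succ]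
    have h2 : E.d ((m' : E.carrier _) * E.Vpow s h (e * E.tau _ e')) =
        q.negOnePow • ((m' : E.carrier _) * E.d (E.Vpow s h (e * e'))) := by
      rw [map_natCast_mul, E.tau_of_mem he', mul_smul_comm, map_negOnePow_smul,
        map_negOnePow_smul, mul_smul_comm]
    rw [hη', h1, h2, natCast_left_comm m', odd_mul_eta_mul hm', h0, Units.neg_smul]
    simp only [map_add, map_sub, map_neg, mul_add, mul_neg, mul_smul_comm]
    -- The term `NηV^s(ee')` arises both from differentiating the type 1 part and from the factor
    -- `N` in the differential of type 2; the two copies cancel.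
    have h3 := E.eta_mul_add_eta_mul ((N : E.carrier _) * E.Vpow s h (e * e'))
    have h4 := congrArg (X2 N) h3
    rw [map_add, map_zero, natCast_left_comm] at h4
    rw [← sub_eq_zero, ← h4]
    abel

end WittComplex

/-! ### The operator formulas and the theorem. -/

namespace WittComplex

variable {A : Type u} [CommRing A] [Algebra ZLocTwo A]

open PolyLevel in
theorem operatorFormulas (E : WittComplex.{u, v} A) : OperatorFormulas (polyEquiv E) where
  lam1 {n} j w := by
    rw [← WittVector.mono_apply]; exact PolyLevel.lam_mono j w
  lam3 r l h w hr hl := by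
    rw [← WittVector.mono_apply, x3_eq r l h hr hl, ← g3_pos r l h hr]
    exact (PolyLevel.lam_proj _).trans (PolyLevel.lamAdd_iterate_verschiebung r l h hl w)
  r1 j a := R_z1 j a
  r2 k b _ := R_z2 (k - 1) b
  r3 r l h c hr hl := by rw [x3_eq r l _ hr hl, x3_eq r l _ hr hl]; exact R_z3 r l h hr hl c
  r4 r l h c hr hl := by rw [x4_eq r l _ hr hl, x4_eq r l _ hr hl]; exact R_z4 r l h hr hl c
  iota1 j a := (iota_polyPre _).trans (io_z1 j a)
  iota2 k b _ := (iota_polyPre _).trans (io_z2 (k - 1) b)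
  iota3 r l h c hr hl := by
    rw [x3_eq r l _ hr hl, x3_eq r l _ hr hl]; exact (iota_polyPre _).trans (io_z3 r l h hr hl c)
  iota4 r l h c hr hl := by
    rw [x4_eq r l _ hr hl, x4_eq r l _ hr hl]; exact (iota_polyPre _).trans (io_z4 r l h hr hl c)
  v1_odd j a hj := by rw [x3_eq 1 j rfl Nat.one_pos hj]; exact V_z1_odd j hj a
  v1_even j a := V_z1_even j a
  v2_odd {n} k p b hk hb := by
    -- The general formula for `V^r` on type 2 with `r = N = 1`; taking `τ(b)` as its coefficient
    -- makes the argument of `V` the element `b[X]^(k-1)d[X]`.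
    have h := Vpow_X2_mul 1 k 1 hk rfl (E.tau n b)
    rw [Nat.cast_one, one_mul, E.tau_tau, pow_one, mul_one] at h
    rw [x2_eq_X2, x3_eq_Vpow 1 k rfl Nat.one_pos hk, x4_eq_d_Vpow 1 k rfl Nat.one_pos hk, Units.neg_smul]
    refine h.trans ?_
    rcases negOnePow_cases hb with ⟨ht, hn⟩ | ⟨ht, hn⟩
    · rw [ht, hn, hn]; abel
    · simp only [ht, hn, map_neg, mul_neg]; abel
  v2_even k b hk := by
    obtain ⟨k, rfl⟩ : ∃ j, k = j + 1 := ⟨k - 1, by omega⟩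
    exact V_z2_odd k b
  v3 r l h c hr hl := by
    rw [x3_eq r l _ hr hl, x3_eq (r + 1) l _ (Nat.succ_pos r) hl]; exact V_z3 r l h hr hl c
  v4 r l h c hr hl := by
    rw [two_mul, x4_eq r l _ hr hl, x4_eq (r + 1) l _ (Nat.succ_pos r) hl]; exact V_z4 r l h hr hl c
  f1 j a := F_z1 j a
  f2 k b hk := by
    obtain ⟨k, rfl⟩ : ∃ j, k = j + 1 := ⟨k - 1, by omega⟩
    exact F_z2 k b
  f3_one l c hl := by
    rw [two_mul, x3_eq 1 l _ Nat.one_pos hl]; exact F_z3_one l hl c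
  f3 r l h c hr hl := by
    rw [two_mul, x3_eq r l _ hr hl, x3_eq (r + 1) l _ (Nat.succ_pos r) hl]; exact F_z3 r l h hr hl c
  f4_one m p e hm he := by
    rw [x4_eq 1 m _ Nat.one_pos hm]
    refine (F_z4_one m hm e).trans ?_
    rw [d_z1]
    rcases negOnePow_cases he with ⟨ht, hn⟩ | ⟨ht, hn⟩
    · rw [ht, hn]; rfl
    · simp only [ht, hn, map_neg, mul_neg]; rfl
  f4 r l h c hr hl := by
    rw [x4_eq r l _ hr hl, x3_eq r l _ hr hl, x4_eq (r + 1) l _ (Nat.succ_pos r) hl]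
    exact F_z4 r l h hr hl c
  d1 j p a ha := by
    refine (d_z1 j a).trans ?_
    rcases negOnePow_cases ha with ⟨ht, hn⟩ | ⟨ht, hn⟩
    · rw [ht, hn]; rfl
    · simp only [ht, hn, map_neg, mul_neg]; rfl
  d2 k b hk := by
    obtain ⟨k, rfl⟩ : ∃ j, k = j + 1 := ⟨k - 1, by omega⟩
    exact d_z2 k b
  d3 r l h c hr hl := by rw [x3_eq r l _ hr hl, x4_eq r l _ hr hl]; exact d_z3 r l h hr hl c
  d4 r l h c hr hl := by rw [x4_eq r l _ hr hl, x4_eq r l _ hr hl]; exact d_z4 r l h hr hl c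

end WittComplex

theorem mainTheorem3 (A : Type u) [CommRing A] [Algebra ZLocTwo A] :
    ∃ (P : WittComplex.{u, v} A ⥤ WittComplex.{u, v} A[X])
      (ε : ∀ (E : WittComplex.{u, v} A) (n : ℕ),
        WittComplex.FormalSum E n ≃+ (P.obj E).carrier n)
      (adj : P ⊣ WittComplex.forgetPoly.{u, v} A),
      (∀ (E : WittComplex.{u, v} A) (n : ℕ) (q : ℤ) (x : WittComplex.FormalSum E n),
        ε E n x ∈ (P.obj E).deg n q ↔ x.IsHomogeneous q) ∧
      (∀ E : WittComplex.{u, v} A, WittComplex.ProductFormulas (ε E)) ∧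
      (∀ E : WittComplex.{u, v} A, WittComplex.OperatorFormulas (ε E)) ∧
      (∀ (E E' : WittComplex.{u, v} A) (θ : E ⟶ E') (n : ℕ) (x : WittComplex.FormalSum E n),
        WittComplex.app (P.map θ) n (ε E n x) = ε E' n (WittComplex.FormalSum.map θ n x)) ∧
      (∀ (E : WittComplex.{u, v} A) (n : ℕ) (a : E.carrier n),
        WittComplex.app (adj.unit.app E) n a = WittComplex.x1 (ε E) 0 a) ∧
      (∀ E : WittComplex.{u, v} A,
        Nonempty (Limits.IsInitial E) → Nonempty (Limits.IsInitial (P.obj E))) := by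
  refine ⟨WittComplex.polyFunctor A, WittComplex.polyEquiv, WittComplex.polyAdjunction A,
    fun _ _ q x => WittComplex.polyEquiv_mem q x, WittComplex.productFormulas,
    WittComplex.operatorFormulas, fun _ _ θ _ x => WittComplex.app_polyFunctor_map θ x,
    fun E n a => by rw [WittComplex.polyAdjunction_unit]; rfl, ?_⟩
  rintro E ⟨h⟩
  have := (WittComplex.polyAdjunction A).leftAdjoint_preservesColimits
  exact ⟨h.isInitialObj (WittComplex.polyFunctor A) E⟩
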